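/- Let $\mathbb K$ be a field of arbitrary characteristic; everything is a $\mathbb Z$-graded cochain complex over $\mathbb K$ (differential of degree $+1$) and the Koszul sign rule is used. Let $\mathcal C$ be a non-symmetric dg cooperad and $\mathcal P$ a non-symmetric dg operad, both reduced ($\mathcal C(0)=\mathcal P(0)=0$, $\mathcal C(1)=\mathcal P(1)=\mathbb K$), let $\alpha\colon\mathcal C\to\mathcal P$ be an operadic twisting morphism (degree $+1$, $d_{\mathcal P}\alpha+\alpha d_{\mathcal C}+\alpha\star\alpha=0$), let $C$ be a conilpotent dg $\mathcal C$-coalgebra, with structure maps $\Delta^n_C\colon C\to\mathcal C(n)\otimes C^{\otimes n}$, and let $A$ be a dg $\mathcal P$-algebra with structure map $\gamma_A$. Let $B_\alpha A=(\mathcal C\circ A,d)$ and $\Omega_\alpha C=(\mathcal P\circ C,d)$ be the bar and cobar constructions relative to $\alpha$. Let $\mathrm{Hom}^\alpha(C,A)$ be the graded space of linear maps $C\to A$ with the shifted $A_\infty$-operations $$Q_0=0,\qquad Q_1(f)=d_A f-(-1)^{|f|}f d_C,\qquad Q_n(f_1,\dots,f_n)=\gamma_A\,(\alpha\otimes f_1\otimes\cdots\otimes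 f_n)\,\Delta_C^n\quad(n\ge2),$$ complete for the filtration $F^k=\{f: f|_{F_{k-1}C}=0\}$ $(k\ge1)$, where $F_kC=\{x:\Delta_C^n x=0\text{ for all }n>k\}$ is the coradical filtration. A Maurer–Cartan element is an element $\varphi$ of degree $0$ with $\sum_{n}Q_n(\varphi,\dots,\varphi)=0$ (the sum being taken in the topology of the filtration); $MC$ denotes the set of these. Two Maurer–Cartan elements are gauge equivalent if they lie in the same path component of the Maurer–Cartan simplicial set $MC_n=MC(\mathrm{Hom}^\alpha(C,A)\otimes N^\bullet(\Delta^n))$, i.e. if they are related by the equivalence relation generated by being the two vertices of a $1$-simplex. Then: 1. The maps $f\mapsto \pi f$, with $\pi\colon\mathcal C\circ A\to A$ the projection onto the cogenerators, and $g\mapsto g\iota$, with $\iota\colon C\to\mathcal P\circ C$ the inclusion of the generators, are bijections $$\mathrm{Hom}_{\mathcal C\text{-coalg}}(C,B_\alpha A)\;\cong\; MC(\mathrm{Hom}^\alpha(C,A))\;\cong\;\mathrm{Hom}_{\mathcal P\text{-alg}}(\Omega_\alpha C,A).$$ 2. Two morphisms of $\mathcal C$-coalgebras $f,g\colon C\to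 B_\alpha A$ are homotopic, i.e. there is a morphism of $\mathcal C$-coalgebras $H\colon C\otimes N_\bullet(\Delta^1)\to B_\alpha A$ that restricts to $f$ on $C\otimes[0]$ and to $g$ on $C\otimes[1]$, if and only if the corresponding Maurer–Cartan elements are gauge equivalent. 3. Two morphisms of $\mathcal P$-algebras $f,g\colon\Omega_\alpha C\to A$ are homotopic, i.e. there is a morphism of $\mathcal P$-algebras $H\colon\Omega_\alpha C\to A\otimes N^\bullet(\Delta^1)$ whose evaluations at the two vertices are $f$ and $g$, if and only if the corresponding Maurer–Cartan elements are gauge equivalent. -/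

import Mathlib

open scoped TensorProduct DirectSum

noncomputable section

namespace NSConv

universe u v w x y

/-! ## Tensor powers: shuffling, signs, deconcatenation -/

section Tensor

variable {K : Type u} [Field K]
variable {X : Type v} [AddCommGroup X] [Module K X]
variable {Y : Type w} [AddCommGroup Y] [Module K Y]

/-- `(x₁ ⊗ ⋯ ⊗ x_k) ⊗ (y₁ ⊗ ⋯ ⊗ y_k) ↦ (x₁ ⊗ y₁) ⊗ ⋯ ⊗ (x_k ⊗ y_k)`, without sign. -/
def zip (K : Type u) [Field K] (X : Type v) [AddCommGroup X] [Module K X]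
    (Y : Type w) [AddCommGroup Y] [Module K Y] (k : ℕ) :
    ((⨂[K]^k X) ⊗[K] (⨂[K]^k Y)) →ₗ[K] (⨂[K]^k (X ⊗[K] Y)) :=
  TensorProduct.lift (PiTensorProduct.map₂ (fun _ => TensorProduct.mk K X Y))

theorem zip_tprod (k : ℕ) (a : Fin k → X) (b : Fin k → Y) :
    zip K X Y k (PiTensorProduct.tprod K a ⊗ₜ PiTensorProduct.tprod K b) =
      PiTensorProduct.tprod K (fun i => a i ⊗ₜ[K] b i) := by
  simp [zip, PiTensorProduct.map₂_tprod_tprod]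

theorem zip_bijective (k : ℕ) : Function.Bijective (zip K X Y k) := by
  let bX := Module.Basis.ofVectorSpace K X
  let bY := Module.Basis.ofVectorSpace K Y
  let B₁ := (Basis.piTensorProduct (fun _ : Fin k => bX)).tensorProduct
    (Basis.piTensorProduct (fun _ : Fin k => bY))
  let B₂ := Basis.piTensorProduct (fun _ : Fin k => bX.tensorProduct bY)
  have h : zip K X Y k =
      (B₁.equiv B₂ (Equiv.arrowProdEquivProdArrow (Fin k) _ _).symm).toLinearMap := by
    refine B₁.ext fun p => ?_
    obtain ⟨p₁, p₂⟩ := p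
    rw [LinearEquiv.coe_coe, Module.Basis.equiv_apply]
    simp only [B₁, B₂, Module.Basis.tensorProduct_apply, Basis.piTensorProduct_apply, zip_tprod]
    simp [Equiv.arrowProdEquivProdArrow]
  rw [h]
  exact (B₁.equiv B₂ _).bijective

/-- `zip` as an isomorphism. -/
def zipEquiv (K : Type u) [Field K] (X : Type v) [AddCommGroup X] [Module K X]
    (Y : Type w) [AddCommGroup Y] [Module K Y] (k : ℕ) :
    ((⨂[K]^k X) ⊗[K] (⨂[K]^k Y)) ≃ₗ[K] (⨂[K]^k (X ⊗[K] Y)) :=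
  LinearEquiv.ofBijective (zip K X Y k) (zip_bijective k)

/-- The Koszul sign `(-1)^(∑_{i<j} |y_i| |x_j|)` acting on
`(x₁ ⊗ y₁) ⊗ ⋯ ⊗ (x_k ⊗ y_k)`.  Here `par ε` is the projection of `X` onto its part of
parity `ε`, and `s` is the operator `y ↦ (-1)^|y| y` on `Y`. -/
def koszulSign (par : ZMod 2 → X →ₗ[K] X) (s : Y →ₗ[K] Y) (k : ℕ) :
    (⨂[K]^k (X ⊗[K] Y)) →ₗ[K] (⨂[K]^k (X ⊗[K] Y)) :=
  ∑ ε : Fin k → ZMod 2, PiTensorProduct.map fun i =>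
    TensorProduct.map (par (ε i)) (s ^ (∑ j : Fin k, if i < j then (ε j).val else 0))

/-- `X^{⊗k} ⊗ Y^{⊗k} → (X ⊗ Y)^{⊗k}` with the Koszul sign. -/
def kzip (par : ZMod 2 → X →ₗ[K] X) (s : Y →ₗ[K] Y) (k : ℕ) :
    ((⨂[K]^k X) ⊗[K] (⨂[K]^k Y)) →ₗ[K] (⨂[K]^k (X ⊗[K] Y)) :=
  koszulSign par s k ∘ₗ zip K X Y k

/-- `(X ⊗ Y)^{⊗k} → X^{⊗k} ⊗ Y^{⊗k}` with the Koszul sign. -/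
def kunzip (par : ZMod 2 → X →ₗ[K] X) (s : Y →ₗ[K] Y) (k : ℕ) :
    (⨂[K]^k (X ⊗[K] Y)) →ₗ[K] ((⨂[K]^k X) ⊗[K] (⨂[K]^k Y)) :=
  (zipEquiv K X Y k).symm.toLinearMap ∘ₗ koszulSign par s k

/-- `∑ᵢ f ⊗ ⋯ ⊗ f ⊗ g ⊗ h ⊗ ⋯ ⊗ h`, with `g` in the `i`-th place. -/
def insertEach (k : ℕ) (f g h : X →ₗ[K] Y) : (⨂[K]^k X) →ₗ[K] (⨂[K]^k Y) :=
  ∑ i : Fin k, PiTensorProduct.map fun j => if j < i then f else if j = i then g else h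

/-- The words in `X`: `⨁ₙ X^{⊗n}`, an algebra under concatenation. -/
abbrev Words (K : Type u) [Field K] (X : Type v) [AddCommGroup X] [Module K X] :=
  ⨁ n : ℕ, (⨂[K]^n X)

/-- A letter as a word of length one. -/
def letter : X →ₗ[K] Words K X :=
  DirectSum.lof K ℕ (fun n : ℕ => (⨂[K]^n X)) 1 ∘ₗ
    (PiTensorProduct.subsingletonEquiv (R := K) (s := fun _ : Fin 1 => X) 0).symm.toLinearMap

/-- Concatenation of `k` words. -/
def concat (k : ℕ) : (⨂[K]^k (Words K X)) →ₗ[K] Words K X :=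
  PiTensorProduct.lift (MultilinearMap.mkPiAlgebraFin K k (Words K X))

/-- Deconcatenation of a word into `k` consecutive (possibly empty) words: sum over all weakly
increasing ways `g` of distributing the letters over `k` blocks, in each block the
letters being multiplied in their order. -/
def deconcat (k : ℕ) : Words K X →ₗ[K] (⨂[K]^k (Words K X)) :=
  DirectSum.toModule K ℕ _ fun n => 
    ∑ g : Fin n → Fin k with ∀ i j : Fin n, i ≤ j → g i ≤ g j,
      PiTensorProduct.lift
        ((MultilinearMap.mkPiAlgebraFin K n (⨂[K]^k (Words K X))).compLinearMap fun j =>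
          (PiTensorProduct.singleAlgHom (R := K) (A := fun _ : Fin k => Words K X)
            (g j)).toLinearMap ∘ₗ letter)

/-- An operator on letters, applied to every letter of a word. -/
def wordsMap (s : X →ₗ[K] X) : Words K X →ₗ[K] Words K X :=
  DirectSum.lmap fun _ => PiTensorProduct.map fun _ => s

end Tensor

/-! ## Cochain complexes of vector spaces -/

/-- A `ℤ`-graded vector space with a differential of degree `+1`. -/
structure DGMod (K : Type u) [Field K] where
  carrier : Type v
  [addCommGroup : AddCommGroup carrier]
  [module : Module K carrier]
  gr : ℤ → Submodule K carrier
  internal : DirectSum.IsInternal gr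
  d : carrier →ₗ[K] carrier
  d_mem : ∀ i : ℤ, ∀ a ∈ gr i, d a ∈ gr (i + 1)
  d_d : ∀ a, d (d a) = 0

attribute [instance] DGMod.addCommGroup DGMod.module

instance {K : Type u} [Field K] : CoeSort (DGMod.{u, v} K) (Type v) := ⟨DGMod.carrier⟩

theorem DGMod.coe_bijective {K : Type u} [Field K] (V : DGMod.{u, v} K) :
    Function.Bijective (DirectSum.coeLinearMap V.gr) := V.internal

/-- The projection onto the sum of the homogeneous parts whose degree has parity `ε`. -/
def DGMod.par {K : Type u} [Field K] (V : DGMod.{u, v} K) (ε : ZMod 2) : V →ₗ[K] V :=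
  DirectSum.coeLinearMap V.gr ∘ₗ
    (DirectSum.lmap fun i : ℤ => if ((i : ZMod 2) = ε) then LinearMap.id else 0) ∘ₗ
    (LinearEquiv.ofBijective (DirectSum.coeLinearMap V.gr) V.coe_bijective).symm.toLinearMap

theorem DGMod.par_of_mem {K : Type u} [Field K] (V : DGMod.{u, v} K) (ε : ZMod 2) {i : ℤ} {a : V}
    (ha : a ∈ V.gr i) : V.par ε a = if ((i : ZMod 2) = ε) then a else 0 := by
  have h : (LinearEquiv.ofBijective (DirectSum.coeLinearMap V.gr) V.coe_bijective).symm a =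
      DirectSum.lof K ℤ (fun i => V.gr i) i ⟨a, ha⟩ := by
    rw [LinearEquiv.symm_apply_eq]
    simp
  simp only [DGMod.par, LinearMap.comp_apply, LinearEquiv.coe_coe, h, DirectSum.lmap_lof]
  split_ifs <;> simp

/-- The sign operator `a ↦ (-1)^|a| a`. -/
def DGMod.sgn {K : Type u} [Field K] (V : DGMod.{u, v} K) : V →ₗ[K] V := V.par 0 - V.par 1

/-! ## Collections and their Schur functors

A collection is a sequence `P(n)` of complexes.  `Tot P = ⨁ₙ P(n)`, and
`Schur P V = P ∘ V = ⨁ₙ P(n) ⊗ V^{⊗n}`; in particular `Schur P (Tot Q)` is the composite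
product `P ∘ Q`. -/

section Schur

variable {K : Type u} [Field K]

abbrev Tot (P : ℕ → DGMod.{u, v} K) := ⨁ n : ℕ, (P n).carrier

def Tot.d (P : ℕ → DGMod.{u, v} K) : Tot P →ₗ[K] Tot P := DirectSum.lmap fun n => (P n).d

def Tot.sgn (P : ℕ → DGMod.{u, v} K) : Tot P →ₗ[K] Tot P := DirectSum.lmap fun n => (P n).sgn

def Tot.par (P : ℕ → DGMod.{u, v} K) (ε : ZMod 2) : Tot P →ₗ[K] Tot P :=
  DirectSum.lmap fun n => (P n).par ε

/-- The elements all of whose components have degree `i`. -/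
def Tot.gr (P : ℕ → DGMod.{u, v} K) (i : ℤ) : Submodule K (Tot P) :=
  ⨅ n : ℕ, ((P n).gr i).comap (DirectSum.component K ℕ (fun n => (P n).carrier) n)

/-- An element of arity `n`. -/
abbrev Tot.of (P : ℕ → DGMod.{u, v} K) (n : ℕ) : P n →ₗ[K] Tot P :=
  DirectSum.lof K ℕ (fun n => (P n).carrier) n

abbrev Schur (P : ℕ → DGMod.{u, v} K) (V : Type w) [AddCommGroup V] [Module K V] :=
  ⨁ n : ℕ, ((P n).carrier ⊗[K] (⨂[K]^n V))

variable (P : ℕ → DGMod.{u, v} K)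
variable {V : Type w} [AddCommGroup V] [Module K V]
variable {W : Type x} [AddCommGroup W] [Module K W]

abbrev Schur.of (n : ℕ) : ((P n).carrier ⊗[K] (⨂[K]^n V)) →ₗ[K] Schur P V :=
  DirectSum.lof K ℕ (fun n => (P n).carrier ⊗[K] (⨂[K]^n V)) n

/-- `P ∘ f`. -/
def Schur.map (f : V →ₗ[K] W) : Schur P V →ₗ[K] Schur P W :=
  DirectSum.lmap fun _ => TensorProduct.map LinearMap.id (PiTensorProduct.map fun _ => f)

/-- The differential of `P ∘ V`, induced by the differentials of `P` and of `V` (`s` is the sign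
operator of `V`). -/
def Schur.d (s dV : V →ₗ[K] V) : Schur P V →ₗ[K] Schur P V :=
  DirectSum.lmap fun n =>
    TensorProduct.map (P n).d LinearMap.id +
      TensorProduct.map (P n).sgn (insertEach n s dV LinearMap.id)

/-- The part of degree `i` of `P ∘ V`. -/
def Schur.gr (g : ℤ → Submodule K V) (i : ℤ) : Submodule K (Schur P V) :=
  Submodule.span K {z | ∃ (n : ℕ) (e : ℤ) (f : Fin n → ℤ) (p : P n) (a : Fin n → V),
    e + ∑ j, f j = i ∧ p ∈ (P n).gr e ∧ (∀ j, a j ∈ g (f j)) ∧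
      z = Schur.of P n (p ⊗ₜ PiTensorProduct.tprod K a)}

/-- The part of arity `n` of the composite product `P ∘ P`. -/
def Schur.arity (n : ℕ) : Submodule K (Schur P (Tot P)) :=
  Submodule.span K {z | ∃ (k : ℕ) (m : Fin k → ℕ) (p : P k) (q : ∀ j, P (m j)),
    ∑ j, m j = n ∧
      z = Schur.of P k (p ⊗ₜ PiTensorProduct.tprod K fun j => Tot.of P (m j) (q j))}

/-- The inclusion of `⨁ₙ P(n) ⊗ V^{⊗n}` into `(⨁ₙ P(n)) ⊗ (⨁ₙ V^{⊗n})`. -/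
def Schur.toTensor : Schur P V →ₗ[K] (Tot P ⊗[K] Words K V) :=
  DirectSum.toModule K ℕ _ fun n =>
    TensorProduct.map (Tot.of P n) (DirectSum.lof K ℕ (fun n : ℕ => (⨂[K]^n V)) n)

/-- The projection of `(⨁ₙ P(n)) ⊗ (⨁ₙ V^{⊗n})` onto `⨁ₙ P(n) ⊗ V^{⊗n}`. -/
def Schur.ofTensor : (Tot P ⊗[K] Words K V) →ₗ[K] Schur P V :=
  TensorProduct.lift (DirectSum.toModule K ℕ _ fun n =>
    TensorProduct.curry (Schur.of P n ∘ₗ TensorProduct.map LinearMap.id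
      (DirectSum.component K ℕ (fun n : ℕ => (⨂[K]^n V)) n)))

/-- The map `P ∘ (P ∘ V) = (P ∘ P) ∘ V → P ∘ V` induced by `γ : P ∘ P → P`:
`p ⊗ ⨂ᵢ (qᵢ ⊗ wᵢ) ↦ ± γ(p; q₁, …, q_k) ⊗ w₁ ⋯ w_k`. -/
def freeMul (γ : Schur P (Tot P) →ₗ[K] Tot P) (s : V →ₗ[K] V) :
    Schur P (Schur P V) →ₗ[K] Schur P V :=
  DirectSum.toModule K ℕ _ fun k =>
    Schur.ofTensor P ∘ₗ
    TensorProduct.map (γ ∘ₗ Schur.of P k) (concat k) ∘ₗ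
    (TensorProduct.assoc K (P k).carrier (⨂[K]^k (Tot P)) (⨂[K]^k (Words K V))).symm.toLinearMap ∘ₗ
    TensorProduct.map LinearMap.id
      (kunzip (Tot.par P) (wordsMap s) k ∘ₗ PiTensorProduct.map fun _ => Schur.toTensor P)

/-- The map `P ∘ V → (P ∘ P) ∘ V = P ∘ (P ∘ V)` induced by `Δ : P → P ∘ P`. -/
def cofreeComul (Δ : Tot P →ₗ[K] Schur P (Tot P)) (s : V →ₗ[K] V) :
    Schur P V →ₗ[K] Schur P (Schur P V) :=
  TensorProduct.lift (DirectSum.toModule K ℕ _ fun k => TensorProduct.curry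
    (Schur.of P k ∘ₗ
    TensorProduct.map LinearMap.id
      ((PiTensorProduct.map fun _ => Schur.ofTensor P) ∘ₗ
        kzip (Tot.par P) (wordsMap s) k) ∘ₗ
    (TensorProduct.assoc K (P k).carrier (⨂[K]^k (Tot P)) (⨂[K]^k (Words K V))).toLinearMap ∘ₗ
    TensorProduct.map LinearMap.id (deconcat k))) ∘ₗ
  TensorProduct.map Δ LinearMap.id ∘ₗ Schur.toTensor P

end Schur

/-! ## Reduced non-symmetric operads and cooperads, their algebras and coalgebras -/

/-- A reduced non-symmetric dg operad: a monoid `(P, γ, 1)` for the composite product,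
with `P(0) = 0` and `P(1) = K`. -/
structure NSOperad (K : Type u) [Field K] where
  obj : ℕ → DGMod.{u, v} K
  γ : Schur obj (Tot obj) →ₗ[K] Tot obj
  one : obj 1
  γ_degree : ∀ i : ℤ, ∀ z ∈ Schur.gr obj (Tot.gr obj) i, γ z ∈ Tot.gr obj i
  γ_arity : ∀ n : ℕ, ∀ z ∈ Schur.arity obj n, γ z ∈ LinearMap.range (Tot.of obj n)
  γ_d : γ ∘ₗ Schur.d obj (Tot.sgn obj) (Tot.d obj) = Tot.d obj ∘ₗ γ
  assoc : γ ∘ₗ Schur.map obj γ = γ ∘ₗ freeMul obj γ (Tot.sgn obj)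
  one_degree : one ∈ (obj 1).gr 0
  one_left : ∀ q : Tot obj, γ (Schur.of obj 1 (one ⊗ₜ PiTensorProduct.tprod K fun _ => q)) = q
  one_right : ∀ (n : ℕ) (p : obj n),
    γ (Schur.of obj n (p ⊗ₜ PiTensorProduct.tprod K fun _ => Tot.of obj 1 one)) = Tot.of obj n p
  reduced_zero : ∀ p : obj 0, p = 0
  reduced_one : ∀ p : obj 1, ∃ c : K, p = c • one
  one_ne_zero : one ≠ 0

section Counit

variable {K : Type u} [Field K] (P : ℕ → DGMod.{u, v} K) (ε : P 1 →ₗ[K] K)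

/-- The projection `P ∘ V → V` induced by a linear form `ε` on `P(1)`. -/
def counitProj {V : Type w} [AddCommGroup V] [Module K V] : Schur P V →ₗ[K] V :=
  (TensorProduct.lid K V).toLinearMap ∘ₗ
    TensorProduct.map ε
      (PiTensorProduct.subsingletonEquiv (R := K) (s := fun _ : Fin 1 => V) 0).toLinearMap ∘ₗ
    DirectSum.component K ℕ (fun n => (P n).carrier ⊗[K] (⨂[K]^n V)) 1

/-- A linear form on `P(1)`, extended by zero to all arities. -/
def counitTot : Tot P →ₗ[K] K := ε ∘ₗ DirectSum.component K ℕ (fun n => (P n).carrier) 1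

/-- The map `P ∘ P → P ∘ K → P` which applies `ε` to all factors of the right-hand `P`. -/
def counitRight : Schur P (Tot P) →ₗ[K] Tot P :=
  DirectSum.lmap fun k =>
    (TensorProduct.rid K (P k).carrier).toLinearMap ∘ₗ
      TensorProduct.map LinearMap.id
        (PiTensorProduct.lift
          ((MultilinearMap.mkPiAlgebraFin K k K).compLinearMap fun _ => counitTot P ε))

end Counit

/-- A reduced non-symmetric dg cooperad: a comonoid `(C, Δ, ε)` for the composite product,
with `C(0) = 0` and `C(1) = K`.  It is automatically conilpotent. -/
structure NSCooperad (K : Type u) [Field K] where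
  obj : ℕ → DGMod.{u, v} K
  Δ : Tot obj →ₗ[K] Schur obj (Tot obj)
  ε : obj 1 →ₗ[K] K
  Δ_degree : ∀ i : ℤ, ∀ c ∈ Tot.gr obj i, Δ c ∈ Schur.gr obj (Tot.gr obj) i
  Δ_arity : ∀ (n : ℕ) (c : obj n), Δ (Tot.of obj n c) ∈ Schur.arity obj n
  Δ_d : Schur.d obj (Tot.sgn obj) (Tot.d obj) ∘ₗ Δ = Δ ∘ₗ Tot.d obj
  coassoc : Schur.map obj Δ ∘ₗ Δ = cofreeComul obj Δ (Tot.sgn obj) ∘ₗ Δ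
  counit_left : counitProj obj ε ∘ₗ Δ = LinearMap.id
  counit_right : counitRight obj ε ∘ₗ Δ = LinearMap.id
  reduced_zero : ∀ c : obj 0, c = 0
  reduced_one : Function.Bijective ε
  reduced_one_degree : (obj 1).gr 0 = ⊤

/-- A dg algebra over the operad `P`. -/
structure NSAlg {K : Type u} [Field K] (P : NSOperad.{u, v} K) extends DGMod.{u, w} K where
  γ : Schur P.obj carrier →ₗ[K] carrier
  γ_degree : ∀ i : ℤ, ∀ z ∈ Schur.gr P.obj gr i, γ z ∈ gr i
  γ_d : γ ∘ₗ Schur.d P.obj toDGMod.sgn d = d ∘ₗ γ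
  assoc : γ ∘ₗ Schur.map P.obj γ = γ ∘ₗ freeMul P.obj P.γ toDGMod.sgn
  unit : ∀ a : carrier, γ (Schur.of P.obj 1 (P.one ⊗ₜ PiTensorProduct.tprod K fun _ => a)) = a

/-- A conilpotent dg coalgebra over the cooperad `C`: the structure map takes values in the
direct sum `C ∘ V = ⨁ₙ C(n) ⊗ V^{⊗n}`. -/
structure NSCoalg {K : Type u} [Field K] (C : NSCooperad.{u, v} K) extends DGMod.{u, w} K where
  Δ : carrier →ₗ[K] Schur C.obj carrier
  Δ_degree : ∀ i : ℤ, ∀ a ∈ gr i, Δ a ∈ Schur.gr C.obj gr i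
  Δ_d : Schur.d C.obj toDGMod.sgn d ∘ₗ Δ = Δ ∘ₗ d
  coassoc : Schur.map C.obj Δ ∘ₗ Δ = cofreeComul C.obj C.Δ toDGMod.sgn ∘ₗ Δ
  counit : counitProj C.obj C.ε ∘ₗ Δ = LinearMap.id

/-! ### Morphisms

A morphism only refers to the grading, the differential and the structure map.  These are
collected in the following two structures, so that the bar and cobar constructions,
cylinders and path objects can be given by explicit formulas. -/

structure NSAlgData {K : Type u} [Field K] (P : NSOperad.{u, v} K) where
  carrier : Type w
  [addCommGroup : AddCommGroup carrier]
  [module : Module K carrier]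
  gr : ℤ → Submodule K carrier
  d : carrier →ₗ[K] carrier
  γ : Schur P.obj carrier →ₗ[K] carrier

structure NSCoalgData {K : Type u} [Field K] (C : NSCooperad.{u, v} K) where
  carrier : Type w
  [addCommGroup : AddCommGroup carrier]
  [module : Module K carrier]
  gr : ℤ → Submodule K carrier
  d : carrier →ₗ[K] carrier
  Δ : carrier →ₗ[K] Schur C.obj carrier

attribute [instance] NSAlgData.addCommGroup NSAlgData.module NSCoalgData.addCommGroup NSCoalgData.module

def NSAlg.toData {K : Type u} [Field K] {P : NSOperad.{u, v} K} (A : NSAlg.{u, v, w} P) :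
    NSAlgData.{u, v, w} P where
  carrier := A.carrier
  gr := A.gr
  d := A.d
  γ := A.γ

def NSCoalg.toData {K : Type u} [Field K] {C : NSCooperad.{u, v} K} (V : NSCoalg.{u, v, w} C) :
    NSCoalgData.{u, v, w} C where
  carrier := V.carrier
  gr := V.gr
  d := V.d
  Δ := V.Δ

/-- Morphisms of dg `P`-algebras. -/
@[ext]
structure NSAlgHom {K : Type u} [Field K] {P : NSOperad.{u, v} K} (A : NSAlgData.{u, v, w} P)
    (B : NSAlgData.{u, v, x} P) where
  toLin : A.carrier →ₗ[K] B.carrier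
  degree : ∀ i : ℤ, ∀ a ∈ A.gr i, toLin a ∈ B.gr i
  comm_d : toLin ∘ₗ A.d = B.d ∘ₗ toLin
  comm_γ : toLin ∘ₗ A.γ = B.γ ∘ₗ Schur.map P.obj toLin

/-- Morphisms of dg `C`-coalgebras. -/
@[ext]
structure NSCoalgHom {K : Type u} [Field K] {C : NSCooperad.{u, v} K} (V : NSCoalgData.{u, v, w} C)
    (W : NSCoalgData.{u, v, x} C) where
  toLin : V.carrier →ₗ[K] W.carrier
  degree : ∀ i : ℤ, ∀ a ∈ V.gr i, toLin a ∈ W.gr i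
  comm_d : toLin ∘ₗ V.d = W.d ∘ₗ toLin
  comm_Δ : Schur.map C.obj toLin ∘ₗ V.Δ = W.Δ ∘ₗ toLin

/-! ## Twisting morphisms, bar and cobar constructions -/

section Twisting

variable {K : Type u} [Field K]

/-- The map `C → K → P` through `C(1) = K = P(1)`. -/
def unitCounit (C : NSCooperad.{u, v} K) (P : NSOperad.{u, w} K) : Tot C.obj →ₗ[K] Tot P.obj :=
  Tot.of P.obj 1 ∘ₗ LinearMap.toSpanSingleton K (P.obj 1).carrier P.one ∘ₗ counitTot C.obj C.ε

/-- The pre-Lie product `α ⋆ β` of the convolution operad, for `β` of degree one: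
decompose once, apply `α` to the lower and `β` to one upper factor, and compose. -/
def preLie (C : NSCooperad.{u, v} K) (P : NSOperad.{u, w} K)
    (α β : ∀ n, C.obj n →ₗ[K] P.obj n) : Tot C.obj →ₗ[K] Tot P.obj :=
  P.γ ∘ₗ
    (DirectSum.lmap fun k => TensorProduct.map (α k ∘ₗ (C.obj k).sgn)
      (insertEach k (unitCounit C P) (DirectSum.lmap β) (unitCounit C P))) ∘ₗ
    C.Δ

/-- An operadic twisting morphism: a map of collections of degree `+1` that satisfies the
Maurer-Cartan equation `d_P α + α d_C + α ⋆ α = 0`. -/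
structure TwistingMorphism (C : NSCooperad.{u, v} K) (P : NSOperad.{u, w} K) where
  toFun : ∀ n, C.obj n →ₗ[K] P.obj n
  degree : ∀ (n : ℕ) (i : ℤ), ∀ c ∈ (C.obj n).gr i, toFun n c ∈ (P.obj n).gr (i + 1)
  maurerCartan : Tot.d P.obj ∘ₗ DirectSum.lmap toFun + DirectSum.lmap toFun ∘ₗ Tot.d C.obj +
    preLie C P toFun toFun = 0

variable {C : NSCooperad.{u, v} K} {P : NSOperad.{u, w} K} (α : TwistingMorphism C P)

/-- `α ∘ V : C ∘ V → P ∘ V`. -/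
def TwistingMorphism.app (V : Type x) [AddCommGroup V] [Module K V] :
    Schur C.obj V →ₗ[K] Schur P.obj V :=
  DirectSum.lmap fun n => TensorProduct.map (α.toFun n) LinearMap.id

/-- The bar construction `B_α A`: the cofree coalgebra `C ∘ A`; its differential is the sum of
the internal one and of the coderivation with corestriction `C ∘ A → P ∘ A → A`. -/
def bar (A : NSAlg.{u, w, x} P) : NSCoalgData.{u, v, max u v x} C where
  carrier := Schur C.obj A.carrier
  gr := Schur.gr C.obj A.gr
  d := Schur.d C.obj A.sgn A.d +
    (DirectSum.lmap fun k => TensorProduct.map (C.obj k).sgn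
      (insertEach k (A.sgn ∘ₗ counitProj C.obj C.ε) (A.γ ∘ₗ α.app A.carrier)
        (counitProj C.obj C.ε))) ∘ₗ
      cofreeComul C.obj C.Δ A.sgn
  Δ := cofreeComul C.obj C.Δ A.sgn

/-- The inclusion `V → P ∘ V` of the generators of the free algebra. -/
def generator (P : NSOperad.{u, w} K) {V : Type x} [AddCommGroup V] [Module K V] :
    V →ₗ[K] Schur P.obj V :=
  Schur.of P.obj 1 ∘ₗ TensorProduct.mk K (P.obj 1).carrier (⨂[K]^1 V) P.one ∘ₗ
    (PiTensorProduct.subsingletonEquiv (R := K) (s := fun _ : Fin 1 => V) 0).symm.toLinearMap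

/-- The cobar construction `Ω_α V`: the free algebra `P ∘ V`; its differential is the internal
one minus the derivation with restriction `V → C ∘ V → P ∘ V`. -/
def cobar (V : NSCoalg.{u, v, x} C) : NSAlgData.{u, w, max u w x} P where
  carrier := Schur P.obj V.carrier
  gr := Schur.gr P.obj V.gr
  d := Schur.d P.obj V.sgn V.d -
    freeMul P.obj P.γ V.sgn ∘ₗ
      (DirectSum.lmap fun k => TensorProduct.map (P.obj k).sgn
        (insertEach k (generator P ∘ₗ V.sgn) (α.app V.carrier ∘ₗ V.Δ) (generator P)))
  γ := freeMul P.obj P.γ V.sgn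

end Twisting

/-! ## Normalized chains and cochains of the interval -/

/-- The nondegenerate simplices `[0]`, `[1]` and `[0,1]` of `Δ¹`. -/
inductive Simp : Type
  | v0
  | v1
  | edge
  deriving DecidableEq

instance : Fintype Simp := ⟨{Simp.v0, Simp.v1, Simp.edge}, fun s => by cases s <;> simp⟩

def Simp.dim : Simp → ℕ
  | .v0 => 0
  | .v1 => 0
  | .edge => 1

section Interval

variable (K : Type u) [Field K]

/-- The underlying space of the normalized chains `N_•(Δ¹)` (with basis
`a = [0]`, `b = [1]`, `c = [0,1]`) and of the normalized cochains `N^•(Δ¹)`. -/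
abbrev Interval := Simp → K

/-- `ν ↦ (-1)^|ν| ν`, on chains as well as on cochains. -/
def Interval.sgn : Interval K →ₗ[K] Interval K :=
  LinearMap.pi fun s => (-1 : K) ^ s.dim • (LinearMap.proj s : Interval K →ₗ[K] K)

/-- Cochains of degree `i`. -/
def Interval.cochainGr (i : ℤ) : Submodule K (Interval K) :=
  ⨅ s : Simp, ⨅ _ : (s.dim : ℤ) ≠ i, LinearMap.ker (LinearMap.proj s : Interval K →ₗ[K] K)

/-- Chains, graded cohomologically: a chain of dimension `n` has degree `-n`. -/
def Interval.chainGr (i : ℤ) : Submodule K (Interval K) :=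
  ⨅ s : Simp, ⨅ _ : -(s.dim : ℤ) ≠ i, LinearMap.ker (LinearMap.proj s : Interval K →ₗ[K] K)

/-- `(dφ)[0,1] = φ[1] - φ[0]`. -/
def Interval.cochainD : Interval K →ₗ[K] Interval K :=
  LinearMap.pi fun s => match s with
    | .edge =>
      (LinearMap.proj Simp.v1 : Interval K →ₗ[K] K) - (LinearMap.proj Simp.v0 : Interval K →ₗ[K] K)
    | _ => 0

/-- `d a = d b = 0` and `d c = b - a`. -/
def Interval.chainD : Interval K →ₗ[K] Interval K :=
  LinearMap.pi fun s => match s with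
    | .v0 => -LinearMap.proj Simp.edge
    | .v1 => LinearMap.proj Simp.edge
    | .edge => 0

/-- The `j`-th factor in the `i`-th term of the iterated coproduct
`c ↦ ∑ᵢ a ⊗ ⋯ ⊗ a ⊗ c ⊗ b ⊗ ⋯ ⊗ b`. -/
def Simp.factor {n : ℕ} (i j : Fin n) : Simp :=
  if j < i then .v0 else if j = i then .edge else .v1

/-- The iterated coproduct `N_•(Δ¹) → N_•(Δ¹)^{⊗n}` (`n ≥ 1`) of the coproduct
`Δa = a ⊗ a`, `Δb = b ⊗ b`, `Δc = a ⊗ c + c ⊗ b`. -/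
def Interval.coproduct (n : ℕ) : Interval K →ₗ[K] (⨂[K]^n (Interval K)) :=
  Fintype.linearCombination K fun s => match s with
    | .v0 => PiTensorProduct.tprod K fun _ => Pi.single Simp.v0 1
    | .v1 => PiTensorProduct.tprod K fun _ => Pi.single Simp.v1 1
    | .edge => ∑ i : Fin n, PiTensorProduct.tprod K fun j => Pi.single (Simp.factor i j) 1

/-- The iterated cup product `N^•(Δ¹)^{⊗n} → N^•(Δ¹)`; for `n = 0` it is the unit. -/
def Interval.cup (n : ℕ) : (⨂[K]^n (Interval K)) →ₗ[K] Interval K :=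
  LinearMap.pi fun s => match s with
    | .v0 => PiTensorProduct.lift ((MultilinearMap.mkPiAlgebraFin K n K).compLinearMap
        fun _ => LinearMap.proj Simp.v0)
    | .v1 => PiTensorProduct.lift ((MultilinearMap.mkPiAlgebraFin K n K).compLinearMap
        fun _ => LinearMap.proj Simp.v1)
    | .edge => ∑ i : Fin n, PiTensorProduct.lift
        ((MultilinearMap.mkPiAlgebraFin K n K).compLinearMap
          fun j => LinearMap.proj (Simp.factor i j))

end Interval

section Homotopy

variable {K : Type u} [Field K]

/-- The tensor product of two gradings. -/
def tensorGr {V : Type v} [AddCommGroup V] [Module K V] {W : Type w} [AddCommGroup W] [Module K W]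
    (g : ℤ → Submodule K V) (h : ℤ → Submodule K W) (i : ℤ) : Submodule K (V ⊗[K] W) :=
  Submodule.span K {z | ∃ (p q : ℤ) (a : V) (b : W),
    p + q = i ∧ a ∈ g p ∧ b ∈ h q ∧ z = a ⊗ₜ b}

/-- The cylinder `V ⊗ N_•(Δ¹)` of a `C`-coalgebra. -/
def cylinder {C : NSCooperad.{u, v} K} (V : NSCoalg.{u, v, w} C) : NSCoalgData.{u, v, max u w} C where
  carrier := V.carrier ⊗[K] Interval K
  gr := tensorGr V.gr (Interval.chainGr K)
  d := TensorProduct.map V.d LinearMap.id + TensorProduct.map V.sgn (Interval.chainD K)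
  Δ := TensorProduct.lift (DirectSum.toModule K ℕ _ fun n => TensorProduct.curry
      (Schur.of C.obj n ∘ₗ
      TensorProduct.map LinearMap.id (kzip V.par (Interval.sgn K) n) ∘ₗ
      (TensorProduct.assoc K (C.obj n).carrier (⨂[K]^n V.carrier)
        (⨂[K]^n (Interval K))).toLinearMap ∘ₗ
      TensorProduct.map LinearMap.id (Interval.coproduct K n))) ∘ₗ
    TensorProduct.map V.Δ LinearMap.id

/-- The path object `A ⊗ N^•(Δ¹)` of a `P`-algebra. -/
def pathObject {P : NSOperad.{u, v} K} (A : NSAlg.{u, v, w} P) : NSAlgData.{u, v, max u w} P where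
  carrier := A.carrier ⊗[K] Interval K
  gr := tensorGr A.gr (Interval.cochainGr K)
  d := TensorProduct.map A.d LinearMap.id + TensorProduct.map A.sgn (Interval.cochainD K)
  γ := DirectSum.toModule K ℕ _ fun n =>
    TensorProduct.map (A.γ ∘ₗ Schur.of P.obj n) (Interval.cup K n) ∘ₗ
    (TensorProduct.assoc K (P.obj n).carrier (⨂[K]^n A.carrier)
      (⨂[K]^n (Interval K))).symm.toLinearMap ∘ₗ
    TensorProduct.map LinearMap.id (kunzip A.par (Interval.sgn K) n)

/-- Evaluation of `V ⊗ N^•(Δ¹)` at a vertex. -/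
def evalAt (V : Type v) [AddCommGroup V] [Module K V] (s : Simp) : (V ⊗[K] Interval K) →ₗ[K] V :=
  (TensorProduct.rid K V).toLinearMap ∘ₗ TensorProduct.map LinearMap.id (LinearMap.proj s)

/-- Homotopy of morphisms `f, g : V → W` of `C`-coalgebras: a morphism `V ⊗ N_•(Δ¹) → W` that
restricts to `f` on `V ⊗ a` and to `g` on `V ⊗ b`. -/
def NSCoalgHom.Homotopic {C : NSCooperad.{u, v} K} {V : NSCoalg.{u, v, w} C}
    {W : NSCoalgData.{u, v, x} C} (f g : NSCoalgHom V.toData W) : Prop :=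
  ∃ H : NSCoalgHom (cylinder V) W, ∀ a : V.carrier,
    H.toLin (a ⊗ₜ[K] (Pi.single Simp.v0 1 : Interval K)) = f.toLin a ∧
    H.toLin (a ⊗ₜ[K] (Pi.single Simp.v1 1 : Interval K)) = g.toLin a

/-- Homotopy of morphisms `f, g : B → A` of `P`-algebras: a morphism `B → A ⊗ N^•(Δ¹)` whose
projections to the two vertices are `f` and `g`. -/
def NSAlgHom.Homotopic {P : NSOperad.{u, v} K} {B : NSAlgData.{u, v, x} P} {A : NSAlg.{u, v, w} P}
    (f g : NSAlgHom B A.toData) : Prop :=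
  ∃ H : NSAlgHom B (pathObject A), ∀ b : B.carrier,
    evalAt A.carrier Simp.v0 (H.toLin b) = f.toLin b ∧
    evalAt A.carrier Simp.v1 (H.toLin b) = g.toLin b

end Homotopy

/-! ## Filtered shifted `A_∞`-operations, Maurer-Cartan elements, gauge equivalence -/

/-- The data of a filtered shifted `A_∞`-algebra: a grading (with the projections `par ε` onto
the homogeneous elements of parity `ε`), a decreasing filtration and operations `Q n`. -/
structure AInfData (K : Type u) [Field K] where
  carrier : Type v
  [addCommGroup : AddCommGroup carrier]
  [module : Module K carrier]
  gr : ℤ → Submodule K carrier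
  par : ZMod 2 → carrier →ₗ[K] carrier
  F : ℕ → Submodule K carrier
  Q : ∀ n : ℕ, (⨂[K]^n carrier) →ₗ[K] carrier

attribute [instance] AInfData.addCommGroup AInfData.module

section MC

variable {K : Type u} [Field K]

/-- `a` has degree zero and `∑ₙ Qₙ(a, …, a) = 0`, the sum being taken in the topology
of the filtration. -/
def AInfData.IsMC (L : AInfData.{u, v} K) (a : L.carrier) : Prop :=
  a ∈ L.gr 0 ∧ ∀ k : ℕ, ∃ N : ℕ, ∀ n ≥ N,
    ∑ l ∈ Finset.range n, L.Q l (PiTensorProduct.tprod K fun _ => a) ∈ L.F k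

/-- The set of Maurer-Cartan elements. -/
def AInfData.MC (L : AInfData.{u, v} K) := {a : L.carrier // L.IsMC a}

/-- The operations of the extension of scalars `L ⊗ N^•(Δ¹)`: `Q₁ ⊗ id + id ⊗ d`, and
`Qₙ ⊗ ∪⁽ⁿ⁾` for `n ≠ 1`. -/
def AInfData.intervalQ (L : AInfData.{u, v} K) :
    ∀ n : ℕ, (⨂[K]^n (L.carrier ⊗[K] Interval K)) →ₗ[K] (L.carrier ⊗[K] Interval K)
  | 1 =>
    (TensorProduct.map (L.Q 1 ∘ₗ (PiTensorProduct.subsingletonEquiv (R := K)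
        (s := fun _ : Fin 1 => L.carrier) 0).symm.toLinearMap) LinearMap.id +
      TensorProduct.map (L.par 0 - L.par 1) (Interval.cochainD K)) ∘ₗ
    (PiTensorProduct.subsingletonEquiv (R := K)
      (s := fun _ : Fin 1 => L.carrier ⊗[K] Interval K) 0).toLinearMap
  | n => TensorProduct.map (L.Q n) (Interval.cup K n) ∘ₗ kunzip L.par (Interval.sgn K) n

/-- The part of parity `ε` of a cochain. -/
def Interval.par (K : Type u) [Field K] (ε : ZMod 2) : Interval K →ₗ[K] Interval K :=
  LinearMap.pi fun s => if (s.dim : ZMod 2) = ε then LinearMap.proj s else 0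

/-- The extension of scalars `L ⊗ N^•(Δ¹)`. -/
def AInfData.interval (L : AInfData.{u, v} K) : AInfData.{u, max u v} K where
  carrier := L.carrier ⊗[K] Interval K
  gr := tensorGr L.gr (Interval.cochainGr K)
  par := fun ε => ∑ δ : ZMod 2, TensorProduct.map (L.par (ε - δ)) (Interval.par K δ)
  F := fun k => LinearMap.range (TensorProduct.map (L.F k).subtype
    (LinearMap.id : Interval K →ₗ[K] Interval K))
  Q := L.intervalQ

/-- Gauge equivalence of Maurer-Cartan elements: they lie in the same path component of the
Maurer-Cartan simplicial set `MC_n = MC(L ⊗ N^•(Δⁿ))`, i.e. they are related by the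
equivalence relation generated by `a ~ b` whenever `a` and `b` are the two vertices of
a `1`-simplex, that is, of a Maurer-Cartan element of `L ⊗ N^•(Δ¹)`. -/
def AInfData.GaugeEquiv (L : AInfData.{u, v} K) : L.MC → L.MC → Prop :=
  Relation.EqvGen fun a b => ∃ c : L.interval.MC,
    evalAt L.carrier Simp.v0 c.1 = a.1 ∧ evalAt L.carrier Simp.v1 c.1 = b.1

end MC

/-! ## The convolution algebra -/

section Convolution

variable {K : Type u} [Field K]

/-- The part of parity `ε` of a linear map. -/
def homPar (V : DGMod.{u, v} K) (W : DGMod.{u, w} K) (ε : ZMod 2) :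
    (V.carrier →ₗ[K] W.carrier) →ₗ[K] (V.carrier →ₗ[K] W.carrier) :=
  ∑ δ : ZMod 2, (W.par (δ + ε)).compRight K ∘ₗ (V.par δ).lcomp K W.carrier

/-- The linear maps of degree `i`. -/
def homGr (V : DGMod.{u, v} K) (W : DGMod.{u, w} K) (i : ℤ) :
    Submodule K (V.carrier →ₗ[K] W.carrier) where
  carrier := {f | ∀ j : ℤ, ∀ a ∈ V.gr j, f a ∈ W.gr (j + i)}
  add_mem' hf hg j a ha := (W.gr (j + i)).add_mem (hf j a ha) (hg j a ha)
  zero_mem' j _ _ := (W.gr (j + i)).zero_mem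
  smul_mem' c _ hf j a ha := (W.gr (j + i)).smul_mem c (hf j a ha)

variable {C : NSCooperad.{u, v} K} {P : NSOperad.{u, w} K} (α : TwistingMorphism C P)
variable (V : NSCoalg.{u, v, x} C) (A : NSAlg.{u, w, y} P)

/-- The arity `n` part `V → C(n) ⊗ V^{⊗n}` of the coproduct. -/
def NSCoalg.comul (n : ℕ) : V.carrier →ₗ[K] ((C.obj n).carrier ⊗[K] (⨂[K]^n V.carrier)) :=
  DirectSum.component K ℕ (fun n => (C.obj n).carrier ⊗[K] (⨂[K]^n V.carrier)) n ∘ₗ V.Δ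

/-- The map `f₁ ⊗ ⋯ ⊗ fₙ ↦ α ⊗ f₁ ⊗ ⋯ ⊗ fₙ : C(n) ⊗ V^{⊗n} → P(n) ⊗ A^{⊗n}`, with the Koszul
sign: `fⱼ` moves past the element of `C(n)` and past the `i`-th element of `V` for `i < j`. -/
def convTensor (n : ℕ) : (⨂[K]^n (V.carrier →ₗ[K] A.carrier)) →ₗ[K]
    ((C.obj n).carrier ⊗[K] (⨂[K]^n V.carrier)) →ₗ[K]
      ((P.obj n).carrier ⊗[K] (⨂[K]^n A.carrier)) :=
  ∑ ε : Fin n → ZMod 2,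
    TensorProduct.mapBilinear (.id K) (C.obj n).carrier (⨂[K]^n V.carrier) (P.obj n).carrier
        (⨂[K]^n A.carrier) (α.toFun n ∘ₗ (C.obj n).sgn ^ (∑ j, (ε j).val)) ∘ₗ
      PiTensorProduct.piTensorHomMap ∘ₗ
      PiTensorProduct.map fun i =>
        (V.sgn ^ (∑ j : Fin n, if i < j then (ε j).val else 0)).lcomp K A.carrier ∘ₗ
          homPar V.toDGMod A.toDGMod (ε i)

/-- The differential `f ↦ d_A f - (-1)^|f| f d_V`. -/
def convD : (V.carrier →ₗ[K] A.carrier) →ₗ[K] (V.carrier →ₗ[K] A.carrier) :=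
  A.d.compRight K -
    V.d.lcomp K A.carrier ∘ₗ
      (homPar V.toDGMod A.toDGMod 0 - homPar V.toDGMod A.toDGMod 1)

/-- The operations of the convolution algebra: `Q₀ = 0`, `Q₁ = convD` and, for `n ≥ 2`,
`Qₙ(f₁, …, fₙ) = γ_A (α ⊗ f₁ ⊗ ⋯ ⊗ fₙ) Δⁿ`. -/
def convQ : ∀ n : ℕ, (⨂[K]^n (V.carrier →ₗ[K] A.carrier)) →ₗ[K] (V.carrier →ₗ[K] A.carrier)
  | 0 => 0
  | 1 => convD V A ∘ₗ (PiTensorProduct.subsingletonEquiv (R := K)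
      (s := fun _ : Fin 1 => (V.carrier →ₗ[K] A.carrier)) 0).toLinearMap
  | n + 2 =>
    (A.γ ∘ₗ Schur.of P.obj (n + 2)).compRight K ∘ₗ
      (V.comul (n + 2)).lcomp K ((P.obj (n + 2)).carrier ⊗[K] (⨂[K]^(n + 2) A.carrier)) ∘ₗ
      convTensor α V A (n + 2)

/-- The coradical filtration: `F_k V` consists of the `a` with `Δⁿ a = 0` for all `n > k`. -/
def NSCoalg.coradical (k : ℕ) : Submodule K V.carrier :=
  ⨅ n : ℕ, ⨅ _ : k < n, LinearMap.ker (V.comul n)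

/-- The maps that vanish on `F_{k-1} V` (no condition for `k = 0`). -/
def convF : ℕ → Submodule K (V.carrier →ₗ[K] A.carrier)
  | 0 => ⊤
  | k + 1 => LinearMap.ker ((V.coradical k).subtype.lcomp K A.carrier)

/-- The shifted `A_∞`-algebra `Hom^α(V, A)`, with the filtration dual to the coradical one. -/
def conv : AInfData.{u, max x y} K where
  carrier := V.carrier →ₗ[K] A.carrier
  gr := homGr V.toDGMod A.toDGMod
  par := homPar V.toDGMod A.toDGMod
  F := convF V A
  Q := convQ α V A

end Convolution

end NSConv

end

open NSConv

open scoped TensorProduct DirectSum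

noncomputable section

namespace NSConv

universe u v w x y z x'

/-! ## Words -/

section Words

variable {K : Type u} [Field K]
variable {X : Type v} [AddCommGroup X] [Module K X]
variable {Y : Type w} [AddCommGroup Y] [Module K Y]
variable {Z : Type x} [AddCommGroup Z] [Module K Z]

/-! Everything is compared with one notion: a twisting map, that is, a degree zero map `ψ : W → B`
from a coalgebra to an algebra whose curvature `d ψ - ψ d + γ (α ∘ ψ) Δ` vanishes (`IsTwisting`,
`curv`).

Bijections. As `C ∘ A` is cofree, a map to it that respects comultiplications is `(C ∘ ψ) Δ` for its
corestriction `ψ`. Its failure to commute with the differentials is the coderivation-like map with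
`curv ψ` inserted into one factor (`bar_d_comp`); projecting to the cogenerators returns `curv ψ`,
so the failure vanishes exactly if `ψ` is twisting. Free algebras behave dually (`cobar_d_comp`). On
the other side, `α` vanishes in arities 0 and 1, and on each step of the coradical filtration only
finitely many `Δⁿ` are nonzero, so the partial sums of the Maurer-Cartan series are eventually equal
to the curvature there (`isMC_conv_iff`).

Homotopies. All three kinds of one-step homotopy are twisting maps `V → A ⊗ N^•(Δ¹)` with prescribed
vertices (`PathRel`). For the path object this is the cobar bijection with target `A ⊗ N^•(Δ¹)`. For
the cylinder, the canonical element of chains tensor cochains gives a coaction `V → (V ⊗ N_•) ⊗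
N^•`, along which twisting maps on the cylinder become twisting maps to `A ⊗ N^•`
(`IsCoaction.curv_eq_zero_iff`); the same coaction transports the coalgebra laws from `V` to the
cylinder. For `1`-simplices of the Maurer-Cartan space, `homTensor` identifies `Hom(V, A) ⊗ N^•`
with `Hom(V, A ⊗ N^•)`, and the Koszul signs agree (`koszul_exponents`).

Gauge equivalence is only the equivalence relation generated by such steps, so `PathRel` has to be
an equivalence relation. Constant paths give reflexivity. The rest is filling the horn of `Δ²`
formed by the edges `01` and `02` (`PathRel.euclidean`). Put `0` on the 2-simplex; the top component
of the curvature equation then determines the edge `12` as the fixed point of an operator that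
contracts the coradical filtration. The only component of the curvature `F` left is the one on `12`.
It vanishes by the Bianchi identity `d F + F d + (terms with F inserted once) = 0`: by induction on
the coradical filtration the inserted terms vanish, and the top component of `d F` is, up to sign,
the component of `F` on `12`. The engine of both inductions is `phiIns_eq_zero`: an operation
without arity one part, with `g` inserted once, vanishes on `F_{k+1}` as soon as `g` vanishes on
`F_k`. -/

theorem letter_apply (a : X) : (letter a : Words K X) =
    DirectSum.lof K ℕ (fun n : ℕ => (⨂[K]^n X)) 1 (PiTensorProduct.tprod K fun _ => a) := by
  simp [letter]

/-- The word with the given letters. -/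
def word (K : Type u) [Field K] {X : Type v} [AddCommGroup X] [Module K X] (l : List X) :
    Words K X := (l.map letter).prod

@[simp] theorem word_nil : word K ([] : List X) = 1 := rfl

@[simp] theorem word_cons (a : X) (l : List X) : word K (a :: l) = letter a * word K l := by
  simp [word]

theorem word_append (l m : List X) : word K (l ++ m) = word K l * word K m := by
  simp [word]

theorem word_flatten (L : List (List X)) : word K L.flatten = (L.map (word K)).prod := by
  induction L with
  | nil => simp
  | cons a L ih => simp [word_append, ih]

/-- The isomorphism with the tensor algebra is multiplicative and knows products of generators.
Going through it avoids casts between tensor powers of propositionally equal length. -/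
theorem word_ofFn (n : ℕ) (a : Fin n → X) : word K (List.ofFn a) =
    DirectSum.lof K ℕ (fun n : ℕ => (⨂[K]^n X)) n (PiTensorProduct.tprod K a) := by
  rw [DirectSum.lof_eq_of, ← TensorAlgebra.toDirectSum_tensorPower_tprod, TensorAlgebra.tprod_apply,
    map_list_prod, List.map_ofFn, word, List.map_ofFn]
  congr 2
  funext i
  simp [letter_apply, DirectSum.lof_eq_of]

theorem word_eq (l : List X) : word K l =
    DirectSum.lof K ℕ (fun n : ℕ => (⨂[K]^n X)) l.length (PiTensorProduct.tprod K l.get) := by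
  rw [← word_ofFn, List.ofFn_get]

theorem concat_tprod (k : ℕ) (w : Fin k → Words K X) :
    concat k (PiTensorProduct.tprod K w) = (List.ofFn w).prod := by
  simp [concat]

/-- Reduces identities of operators on words to lists of letters, where they are proved by induction
on the list. -/
theorem words_hom_ext {Z : Type*} [AddCommMonoid Z] [Module K Z] {f g : Words K X →ₗ[K] Z}
    (h : ∀ l : List X, f (word K l) = g (word K l)) : f = g := by
  refine DirectSum.linearMap_ext _ fun n => PiTensorProduct.ext (MultilinearMap.ext fun a => ?_)
  simpa [word_ofFn] using h (List.ofFn a)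

/-- The map of words induced by a map of letters. -/
def wmap (f : X →ₗ[K] Y) : Words K X →ₗ[K] Words K Y :=
  DirectSum.lmap fun _ => PiTensorProduct.map fun _ => f

theorem wordsMap_eq (s : X →ₗ[K] X) : wordsMap s = wmap s := rfl

@[simp] theorem wmap_word (f : X →ₗ[K] Y) (l : List X) : wmap f (word K l) = word K (l.map f) := by
  rw [word_eq, wmap, DirectSum.lmap_lof, PiTensorProduct.map_tprod, ← word_ofFn]
  congr 1
  conv_rhs => rw [← List.ofFn_get l, List.map_ofFn]
  rfl

@[simp] theorem wmap_one (f : X →ₗ[K] Y) : wmap f (1 : Words K X) = 1 := by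
  simpa using wmap_word f []

theorem wmap_comp (g : Y →ₗ[K] Z) (f : X →ₗ[K] Y) : wmap (g ∘ₗ f) = wmap g ∘ₗ wmap f :=
  words_hom_ext fun l => by simp

theorem wmap_id : wmap (LinearMap.id : X →ₗ[K] X) = LinearMap.id :=
  words_hom_ext fun l => by simp

/-- `insertEach` on words of all lengths. -/
def winsert (f g h : X →ₗ[K] Y) : Words K X →ₗ[K] Words K Y :=
  DirectSum.lmap fun n => insertEach n f g h

theorem insertEach_tprod (n : ℕ) (f g h : X →ₗ[K] Y) (a : Fin n → X) :
    insertEach n f g h (PiTensorProduct.tprod K a) =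
      ∑ i : Fin n, PiTensorProduct.tprod K fun j =>
        if j < i then f (a j) else if j = i then g (a j) else h (a j) := by
  simp only [insertEach, LinearMap.sum_apply, PiTensorProduct.map_tprod]
  refine Finset.sum_congr rfl fun i _ => congrArg _ (funext fun j => ?_)
  split_ifs <;> rfl

@[simp] theorem winsert_nil (f g h : X →ₗ[K] Y) : winsert f g h (1 : Words K X) = 0 := by
  rw [← word_nil, word_eq, winsert, DirectSum.lmap_lof]
  simp [insertEach]

theorem winsert_word (f g h : X →ₗ[K] Y) (n : ℕ) (a : Fin n → X) :
    winsert f g h (word K (List.ofFn a)) = ∑ i : Fin n, word K (List.ofFn fun j =>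
      if j < i then f (a j) else if j = i then g (a j) else h (a j)) := by
  rw [word_ofFn, winsert, DirectSum.lmap_lof, insertEach_tprod, map_sum]
  simp_rw [word_ofFn]

-- The distinguished place is either the first letter, and then all later letters carry `h`, or a
-- later one, and then the first letter carries `f`.
@[simp] theorem winsert_cons (f g h : X →ₗ[K] Y) (a : X) (l : List X) :
    winsert f g h (letter a * word K l) =
      letter (g a) * word K (l.map h) + letter (f a) * winsert f g h (word K l) := by
  have hl : letter a * word K l = word K (List.ofFn (Fin.cons a l.get : Fin (l.length + 1) → X)) := by
    rw [List.ofFn_cons, List.ofFn_get, word_cons]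
  conv_rhs => rw [← List.ofFn_get l]
  rw [hl, winsert_word, winsert_word, Fin.sum_univ_succ, Finset.mul_sum]
  congr 1
  · rw [List.ofFn_succ, word_cons]
    simp
  · refine Finset.sum_congr rfl fun i _ => ?_
    rw [List.ofFn_succ, word_cons]
    simp

theorem winsert_letter_mul (f g h : X →ₗ[K] Y) (a : X) (w : Words K X) :
    winsert f g h (letter a * w) =
      letter (g a) * wmap h w + letter (f a) * winsert f g h w := by
  have : winsert f g h ∘ₗ LinearMap.mulLeft K (letter a) =
      LinearMap.mulLeft K (letter (g a)) ∘ₗ wmap h +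
        LinearMap.mulLeft K (letter (f a)) ∘ₗ winsert f g h :=
    words_hom_ext fun l => by simp
  simpa using LinearMap.congr_fun this w

theorem wmap_letter_mul (f : X →ₗ[K] Y) (a : X) (w : Words K X) :
    wmap f (letter a * w) = letter (f a) * wmap f w := by
  have : wmap f ∘ₗ LinearMap.mulLeft K (letter a) =
      LinearMap.mulLeft K (letter (f a)) ∘ₗ wmap f :=
    words_hom_ext fun l => by
      simp only [LinearMap.comp_apply, LinearMap.mulLeft_apply, wmap_word]
      rw [← word_cons, wmap_word]; simp
  simpa using LinearMap.congr_fun this w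

/-! ### Spanning sets of tensor powers -/

/-- Over a field every spanning set contains a basis, and multilinear maps are determined by bases.
-/
theorem MultilinearMap.ext_of_span {Z : Type*} [AddCommMonoid Z] [Module K Z]
    {ι : Type*} [Finite ι] {M : ι → Type*}
    [∀ i, AddCommGroup (M i)] [∀ i, Module K (M i)] {f g : MultilinearMap K M Z}
    {S : ∀ i, Set (M i)} (hS : ∀ i, Submodule.span K (S i) = ⊤)
    (h : ∀ a, (∀ i, a i ∈ S i) → f a = g a) : f = g := by
  refine Module.Basis.ext_multilinear (fun i => Module.Basis.ofSpan (hS i).ge) fun v => h _ fun i => ?_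
  exact Module.Basis.ofSpan_subset (hS i).ge ⟨_, rfl⟩

theorem tprod_hom_ext {Z : Type*} [AddCommMonoid Z] [Module K Z]
    {ι : Type*} [Finite ι] {M : ι → Type*}
    [∀ i, AddCommGroup (M i)] [∀ i, Module K (M i)] {f g : (⨂[K] i, M i) →ₗ[K] Z}
    {S : ∀ i, Set (M i)} (hS : ∀ i, Submodule.span K (S i) = ⊤)
    (h : ∀ a, (∀ i, a i ∈ S i) → f (PiTensorProduct.tprod K a) = g (PiTensorProduct.tprod K a)) :
    f = g :=
  PiTensorProduct.ext (MultilinearMap.ext_of_span hS h)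

/-- A multilinear map which maps tuples of elements of `S i` to a submodule `W` maps tuples of
elements of their spans to `W`. -/
theorem MultilinearMap.mem_of_span {ι : Type*} [Finite ι] {M : ι → Type*}
    [∀ i, AddCommGroup (M i)] [∀ i, Module K (M i)] (f : MultilinearMap K M Z)
    {S : ∀ i, Set (M i)} {W : Submodule K Z} (h : ∀ a, (∀ i, a i ∈ S i) → f a ∈ W)
    (a : ∀ i, M i) (ha : ∀ i, a i ∈ Submodule.span K (S i)) : f a ∈ W := by
  -- Restricting to the spans and passing to the quotient by `W` turns membership into an equality
  -- of multilinear maps.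
  have : (W.mkQ.compMultilinearMap f).compLinearMap (fun i => (Submodule.span K (S i)).subtype) = 0 := by
    refine MultilinearMap.ext_of_span (S := fun i => Subtype.val ⁻¹' (S i))
      (fun i => Submodule.span_span_coe_preimage) fun b hb => ?_
    simpa [Submodule.Quotient.mk_eq_zero] using h _ hb
  have h2 := congrArg (fun F => F fun i => ⟨a i, ha i⟩) this
  simpa [Submodule.Quotient.mk_eq_zero] using h2

end Words

/-! ## Sign operators -/

section Signs

variable {K : Type u} [Field K]
variable {X : Type v} [AddCommGroup X] [Module K X]
variable {Y : Type w} [AddCommGroup Y] [Module K Y]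
variable {Z : Type x} [AddCommGroup Z] [Module K Z]

/-- The power of an involution with an exponent modulo two. -/
def tw (s : X →ₗ[K] X) (e : ZMod 2) : X →ₗ[K] X := s ^ e.val

@[simp] theorem tw_zero (s : X →ₗ[K] X) : tw s 0 = LinearMap.id := by
  simp [tw]; rfl

@[simp] theorem tw_one (s : X →ₗ[K] X) : tw s 1 = s := by
  simp [tw, ZMod.val_one]

theorem zmod_two_cases (e : ZMod 2) : e = 0 ∨ e = 1 := by
  revert e; decide

theorem tw_add {s : X →ₗ[K] X} (hs : s ∘ₗ s = LinearMap.id) (e f : ZMod 2) :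
    tw s (e + f) = tw s e ∘ₗ tw s f := by
  rcases zmod_two_cases e with rfl | rfl <;> rcases zmod_two_cases f with rfl | rfl <;>
    simp [hs, show (1 + 1 : ZMod 2) = 0 from rfl]

theorem tw_natCast {s : X →ₗ[K] X} (hs : s ∘ₗ s = LinearMap.id) (n : ℕ) :
    tw s (n : ZMod 2) = s ^ n := by
  induction n with
  | zero => simp; rfl
  | succ n ih => rw [Nat.cast_succ, tw_add hs, ih, tw_one, pow_succ]; rfl

theorem pow_sum_val {s : X →ₗ[K] X} (hs : s ∘ₗ s = LinearMap.id) {ι : Type*} (t : Finset ι)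
    (e : ι → ZMod 2) : s ^ (∑ j ∈ t, (e j).val) = tw s (∑ j ∈ t, e j) := by
  rw [← tw_natCast hs]; simp

/-- The sum of the entries behind the `i`-th one. -/
def after {k : ℕ} (e : Fin k → ZMod 2) (i : Fin k) : ZMod 2 := ∑ j, if i < j then e j else 0

@[simp] theorem after_zero {k : ℕ} (e : Fin (k + 1) → ZMod 2) : after e 0 = ∑ j : Fin k, e j.succ := by
  simp [after, Fin.sum_univ_succ]

@[simp] theorem after_succ {k : ℕ} (e : Fin (k + 1) → ZMod 2) (i : Fin k) :
    after e i.succ = after (fun j => e j.succ) i := by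
  simp [after, Fin.sum_univ_succ]

theorem tw_comm {s : X →ₗ[K] X} {s' : Y →ₗ[K] Y} {f : X →ₗ[K] Y} (h : f ∘ₗ s = s' ∘ₗ f)
    (e : ZMod 2) (a : X) : f (tw s e a) = tw s' e (f a) := by
  rcases zmod_two_cases e with rfl | rfl
  · simp
  · simpa using LinearMap.congr_fun h a

theorem tw_wmap (s : X →ₗ[K] X) (e : ZMod 2) : tw (wmap s) e = wmap (tw s e) := by
  rcases zmod_two_cases e with rfl | rfl
  · simp [wmap_id]
  · simp

theorem tw_map (s : X →ₗ[K] X) (t : Y →ₗ[K] Y) (e : ZMod 2) :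
    tw (TensorProduct.map s t) e = TensorProduct.map (tw s e) (tw t e) := by
  rcases zmod_two_cases e with rfl | rfl <;> simp

/-- In the sum over parity vectors `ε` every summand other than `ε = e` contains a projection that
kills some `a i`. -/
theorem koszulSign_tprod (par : ZMod 2 → X →ₗ[K] X) {s : Y →ₗ[K] Y} (hs : s ∘ₗ s = LinearMap.id)
    (k : ℕ) (e : Fin k → ZMod 2) (a : Fin k → X) (b : Fin k → Y)
    (ha : ∀ i ε, par ε (a i) = if e i = ε then a i else 0) :
    koszulSign par s k (PiTensorProduct.tprod K fun i => a i ⊗ₜ b i) =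
      PiTensorProduct.tprod K fun i => a i ⊗ₜ tw s (after e i) (b i) := by
  simp only [koszulSign, LinearMap.sum_apply, PiTensorProduct.map_tprod, TensorProduct.map_tmul]
  rw [Finset.sum_eq_single e]
  · congr 1
    funext i
    rw [ha, if_pos rfl, after, ← pow_sum_val hs]
    congr 3
    refine Finset.sum_congr rfl fun j _ => ?_
    split_ifs <;> simp
  · intro ε _ hε
    obtain ⟨i, hi⟩ := Function.ne_iff.mp hε
    refine (PiTensorProduct.tprod K).map_coord_zero i ?_
    rw [ha, if_neg (Ne.symm hi), TensorProduct.zero_tmul]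
  · simp

theorem kunzip_tprod (par : ZMod 2 → X →ₗ[K] X) {s : Y →ₗ[K] Y} (hs : s ∘ₗ s = LinearMap.id)
    (k : ℕ) (e : Fin k → ZMod 2) (a : Fin k → X) (b : Fin k → Y)
    (ha : ∀ i ε, par ε (a i) = if e i = ε then a i else 0) :
    kunzip par s k (PiTensorProduct.tprod K fun i => a i ⊗ₜ b i) =
      PiTensorProduct.tprod K a ⊗ₜ PiTensorProduct.tprod K fun i => tw s (after e i) (b i) := by
  rw [kunzip, LinearMap.comp_apply, koszulSign_tprod par hs k e a b ha, LinearEquiv.coe_coe,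
    LinearEquiv.symm_apply_eq]
  exact (zip_tprod k _ _).symm

theorem kzip_tprod (par : ZMod 2 → X →ₗ[K] X) {s : Y →ₗ[K] Y} (hs : s ∘ₗ s = LinearMap.id)
    (k : ℕ) (e : Fin k → ZMod 2) (a : Fin k → X) (b : Fin k → Y)
    (ha : ∀ i ε, par ε (a i) = if e i = ε then a i else 0) :
    kzip par s k (PiTensorProduct.tprod K a ⊗ₜ PiTensorProduct.tprod K b) =
      PiTensorProduct.tprod K fun i => a i ⊗ₜ tw s (after e i) (b i) := by
  rw [kzip, LinearMap.comp_apply, zip_tprod, koszulSign_tprod par hs k e a b ha]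

end Signs

/-! ## Elements of Schur functors -/

section SchurElements

variable {K : Type u} [Field K] (P : ℕ → DGMod.{u, v} K)
variable {X : Type w} [AddCommGroup X] [Module K X]
variable {Y : Type x} [AddCommGroup Y] [Module K Y]
variable {Z : Type y} [AddCommGroup Z] [Module K Z]

/-- The component of `q ⊗ a₁ ⋯ aₙ` in `P ∘ X`. -/
def sch (q : Tot P) (l : List X) : Schur P X := Schur.ofTensor P (q ⊗ₜ word K l)

variable {P}

theorem ofTensor_of_tmul (n : ℕ) (p : P n) (w : Words K X) :
    Schur.ofTensor P (Tot.of P n p ⊗ₜ w) = Schur.of P n (p ⊗ₜ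
      DirectSum.component K ℕ (fun n : ℕ => (⨂[K]^n X)) n w) := by
  simp [Schur.ofTensor, Tot.of]

theorem sch_ofFn (n : ℕ) (p : P n) (a : Fin n → X) :
    sch P (Tot.of P n p) (List.ofFn a) = Schur.of P n (p ⊗ₜ PiTensorProduct.tprod K a) := by
  rw [sch, ofTensor_of_tmul, word_ofFn, DirectSum.component.lof_self]

/-- `sch` accepts lists of any length because `Schur.ofTensor` is a projection. A wrong length gives
zero, and this is how the wrong cuts of a word disappear later on. -/
theorem sch_of_length_ne {n : ℕ} (p : P n) {l : List X} (h : l.length ≠ n) :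
    sch P (Tot.of P n p) l = 0 := by
  rw [sch, ofTensor_of_tmul, word_eq, DirectSum.component.of, dif_neg h]
  simp

theorem toTensor_of (n : ℕ) (p : P n) (a : Fin n → X) :
    Schur.toTensor P (Schur.of P n (p ⊗ₜ PiTensorProduct.tprod K a)) =
      Tot.of P n p ⊗ₜ word K (List.ofFn a) := by
  simp [Schur.toTensor, word_ofFn]

theorem toTensor_sch {n : ℕ} (p : P n) {l : List X} (h : l.length = n) :
    Schur.toTensor P (sch P (Tot.of P n p) l) = Tot.of P n p ⊗ₜ word K l := by
  obtain ⟨a, rfl⟩ : ∃ a : Fin n → X, l = List.ofFn a := by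
    subst h; exact ⟨l.get, (List.ofFn_get l).symm⟩
  rw [sch_ofFn, toTensor_of]

theorem schur_hom_ext' {Z : Type*} [AddCommMonoid Z] [Module K Z] {f g : Schur P X →ₗ[K] Z}
    (h : ∀ n (p : P n) (a : Fin n → X), f (Schur.of P n (p ⊗ₜ PiTensorProduct.tprod K a)) =
      g (Schur.of P n (p ⊗ₜ PiTensorProduct.tprod K a))) : f = g := by
  refine DirectSum.linearMap_ext _ fun n => TensorProduct.ext (LinearMap.ext fun p => ?_)
  exact PiTensorProduct.ext (MultilinearMap.ext fun a => by simpa using h n p a)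

theorem DGMod.span_homogeneous (V : DGMod.{u, v} K) :
    Submodule.span K {a : V | ∃ i, a ∈ V.gr i} = ⊤ := by
  rw [eq_top_iff, ← V.internal.submodule_iSup_eq_top, iSup_le_iff]
  exact fun i a ha => Submodule.subset_span ⟨i, ha⟩

/-- Linear maps on `P ∘ X` agree if they agree on the elements `p ⊗ a₁ ⊗ ⋯ ⊗ aₙ` with `p`
homogeneous and the `aᵢ` in a spanning set. -/
theorem schur_hom_ext {Z : Type*} [AddCommMonoid Z] [Module K Z]
    {S : Set X} (hS : Submodule.span K S = ⊤) {f g : Schur P X →ₗ[K] Z}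
    (h : ∀ n (i : ℤ) (p : P n) (a : Fin n → X), p ∈ (P n).gr i → (∀ j, a j ∈ S) →
      f (Schur.of P n (p ⊗ₜ PiTensorProduct.tprod K a)) =
      g (Schur.of P n (p ⊗ₜ PiTensorProduct.tprod K a))) : f = g := by
  refine DirectSum.linearMap_ext _ fun n => TensorProduct.ext ?_
  refine LinearMap.ext_on (P n).span_homogeneous fun p ⟨i, hp⟩ => ?_
  exact tprod_hom_ext (fun _ => hS) fun a ha => by simpa using h n i p a hp ha

/-- The elements `q ⊗ a₁ ⊗ ⋯ ⊗ aₙ` with `q` homogeneous and the `aᵢ` in a given set. -/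
def pureSet (P : ℕ → DGMod.{u, v} K) (S : Set X) : Set (Schur P X) :=
  {z | ∃ (n : ℕ) (i : ℤ) (q : P n) (l : List X), q ∈ (P n).gr i ∧ (∀ a ∈ l, a ∈ S) ∧
    l.length = n ∧ z = sch P (Tot.of P n q) l}

/-- The quotient map by the span is linear and kills all generators, hence is zero. The same
argument serves for the other spanning statements. -/
theorem span_pureSet {S : Set X} (hS : Submodule.span K S = ⊤) :
    Submodule.span K (pureSet P S) = ⊤ := by
  have : (Submodule.span K (pureSet P S)).mkQ = 0 :=
    schur_hom_ext hS fun n i p a hp ha => by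
      rw [LinearMap.zero_apply, Submodule.mkQ_apply, Submodule.Quotient.mk_eq_zero]
      refine Submodule.subset_span ⟨n, i, p, List.ofFn a, hp, ?_, by simp, (sch_ofFn n p a).symm⟩
      simpa [List.mem_ofFn] using ha
  rw [← Submodule.ker_mkQ (Submodule.span K (pureSet P S)), this, LinearMap.ker_zero]

@[simp] theorem schur_map_of (f : X →ₗ[K] Y) (n : ℕ) (p : P n) (a : Fin n → X) :
    Schur.map P f (Schur.of P n (p ⊗ₜ PiTensorProduct.tprod K a)) =
      Schur.of P n (p ⊗ₜ PiTensorProduct.tprod K fun j => f (a j)) := by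
  simp [Schur.map]

theorem tmul_word_hom_ext {Z : Type*} [AddCommMonoid Z] [Module K Z]
    {f g : Tot P ⊗[K] Words K X →ₗ[K] Z}
    (h : ∀ n (p : P n) (l : List X), f (Tot.of P n p ⊗ₜ word K l) = g (Tot.of P n p ⊗ₜ word K l)) :
    f = g := by
  refine TensorProduct.ext (DirectSum.linearMap_ext _ fun n => LinearMap.ext fun p => ?_)
  exact words_hom_ext fun l => h n p l

theorem schur_map_ofTensor (f : X →ₗ[K] Y) (z : Tot P ⊗[K] Words K X) :
    Schur.map P f (Schur.ofTensor P z) =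
      Schur.ofTensor P (TensorProduct.map LinearMap.id (wmap f) z) := by
  have : Schur.map P f ∘ₗ Schur.ofTensor P =
      Schur.ofTensor P ∘ₗ TensorProduct.map LinearMap.id (wmap f) := by
    refine tmul_word_hom_ext fun n p l => ?_
    simp only [LinearMap.comp_apply, TensorProduct.map_tmul, LinearMap.id_apply, wmap_word]
    change Schur.map P f (sch P (Tot.of P n p) l) = sch P (Tot.of P n p) (l.map f)
    by_cases h : l.length = n
    · obtain ⟨a, rfl⟩ : ∃ a : Fin n → X, l = List.ofFn a := by
        subst h; exact ⟨l.get, (List.ofFn_get l).symm⟩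
      rw [List.map_ofFn, sch_ofFn, sch_ofFn, schur_map_of]
      rfl
    · rw [sch_of_length_ne p h, sch_of_length_ne p (by simpa using h), map_zero]
  exact LinearMap.congr_fun this z

@[simp] theorem schur_map_sch (f : X →ₗ[K] Y) (q : Tot P) (l : List X) :
    Schur.map P f (sch P q l) = sch P q (l.map f) := by
  simp [sch, schur_map_ofTensor]

theorem schur_map_comp (g : Y →ₗ[K] Z) (f : X →ₗ[K] Y) :
    Schur.map P (g ∘ₗ f) = Schur.map P g ∘ₗ Schur.map P f :=
  schur_hom_ext' fun n p a => by simp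

theorem Tot.par_of {n : ℕ} {i : ℤ} {q : P n} (hq : q ∈ (P n).gr i) (ε : ZMod 2) :
    Tot.par P ε (Tot.of P n q) = if (i : ZMod 2) = ε then Tot.of P n q else 0 := by
  rw [Tot.par, Tot.of, DirectSum.lmap_lof, DGMod.par_of_mem _ _ hq]
  split_ifs <;> simp

end SchurElements

/-! ## Multiplication in free algebras, comultiplication in cofree coalgebras -/

section Formulas

variable {K : Type u} [Field K] {P : ℕ → DGMod.{u, v} K}
variable {X : Type w} [AddCommGroup X] [Module K X]
variable {Y : Type x} [AddCommGroup Y] [Module K Y]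
variable {Z : Type y} [AddCommGroup Z] [Module K Z]

theorem wmap_involutive {s : X →ₗ[K] X} (hs : s ∘ₗ s = LinearMap.id) :
    wmap s ∘ₗ wmap s = LinearMap.id := by
  rw [← wmap_comp, hs, wmap_id]

/-- The `j`-th word moves past the operations `q` behind it, so the Koszul sign amounts to twisting
each of its letters by the total parity of those operations. -/
theorem freeMul_of (γ : Schur P (Tot P) →ₗ[K] Tot P) {s : X →ₗ[K] X} (hs : s ∘ₗ s = LinearMap.id)
    {k : ℕ} (p : P k) {m : Fin k → ℕ} {e : Fin k → ℤ} {q : ∀ j, P (m j)} {l : Fin k → List X}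
    (hq : ∀ j, q j ∈ (P (m j)).gr (e j)) (hl : ∀ j, (l j).length = m j) :
    freeMul P γ s (Schur.of P k (p ⊗ₜ PiTensorProduct.tprod K fun j =>
        sch P (Tot.of P (m j) (q j)) (l j))) =
      sch P (γ (Schur.of P k (p ⊗ₜ PiTensorProduct.tprod K fun j => Tot.of P (m j) (q j))))
        (List.ofFn fun j => (l j).map (tw s (after (fun j => (e j : ZMod 2)) j))).flatten := by
  simp only [freeMul, Schur.of, DirectSum.toModule_lof, LinearMap.comp_apply,
    TensorProduct.map_tmul, PiTensorProduct.map_tprod, LinearMap.id_apply, toTensor_sch _ (hl _)]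
  rw [wordsMap_eq, kunzip_tprod (Tot.par P) (wmap_involutive hs) k (fun j => (e j : ZMod 2)) _ _
    fun i ε => Tot.par_of (hq i) ε]
  simp only [LinearEquiv.coe_coe, TensorProduct.assoc_symm_tmul, TensorProduct.map_tmul,
    concat_tprod, LinearMap.comp_apply, tw_wmap, wmap_word]
  rw [sch, word_flatten, List.map_ofFn]
  rfl

/-! ### Deconcatenation -/

/-- Multiplication in the tensor power of algebras is factorwise, so a product of labelled letters
sorts them by label and keeps their order within each label. -/
theorem prod_singleAlgHom (k : ℕ) (L : List (Fin k × X)) :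
    (L.map fun z => PiTensorProduct.singleAlgHom (R := K) (A := fun _ : Fin k => Words K X) z.1
      (letter z.2)).prod =
      PiTensorProduct.tprod K fun b => word K ((L.filter fun z => z.1 = b).map Prod.snd) := by
  induction L with
  | nil => simp [PiTensorProduct.one_def]; rfl
  | cons z L ih =>
    rw [List.map_cons, List.prod_cons, ih]
    simp only [PiTensorProduct.singleAlgHom_apply, PiTensorProduct.tprod_mul_tprod]
    congr 1
    funext b
    by_cases h : z.1 = b
    · subst h; simp
    · simp [h, Ne.symm h]

theorem deconcat_word (k : ℕ) {n : ℕ} (a : Fin n → X) : deconcat k (word K (List.ofFn a)) =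
    ∑ g : Fin n → Fin k with ∀ i j : Fin n, i ≤ j → g i ≤ g j,
      PiTensorProduct.tprod K fun b => word K
        (((List.ofFn fun i => (g i, a i)).filter fun z => z.1 = b).map Prod.snd) := by
  rw [word_ofFn, deconcat, DirectSum.toModule_lof, LinearMap.sum_apply]
  refine Finset.sum_congr rfl fun g _ => ?_
  rw [← prod_singleAlgHom, PiTensorProduct.lift.tprod, List.map_ofFn]
  simp [Function.comp_def]

/-- The list `0, …, 0, 1, …, 1, …` with multiplicities `m`. -/
def blocks {k : ℕ} (m : Fin k → ℕ) : List (Fin k) :=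
  (List.ofFn fun j => List.replicate (m j) j).flatten

theorem count_blocks {k : ℕ} (m : Fin k → ℕ) (b : Fin k) : (blocks m).count b = m b := by
  simp [blocks, List.count_flatten, List.map_ofFn, Function.comp_def, List.sum_ofFn,
    List.count_replicate]

theorem pairwise_blocks {k : ℕ} (m : Fin k → ℕ) : (blocks m).Pairwise (· ≤ ·) := by
  rw [blocks, List.pairwise_flatten]
  constructor
  · intro l hl
    obtain ⟨j, rfl⟩ := (List.mem_ofFn' _ _).mp hl
    simp [List.pairwise_replicate]
  · rw [List.pairwise_ofFn]
    intro i j hij x hx y hy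
    rw [List.eq_of_mem_replicate hx, List.eq_of_mem_replicate hy]
    exact hij.le

/-- A sorted list is determined by its multiplicities. Weakly increasing labellings therefore
correspond to tuples of block lengths. -/
theorem eq_blocks {k : ℕ} {L : List (Fin k)} (h : L.Pairwise (· ≤ ·)) :
    L = blocks fun b => L.count b := by
  refine List.Perm.eq_of_pairwise (le := (· ≤ ·)) (fun a b _ _ => le_antisymm) h (pairwise_blocks _) ?_
  rw [List.perm_iff_count]
  intro b
  rw [count_blocks]

theorem filter_labelled {k : ℕ} (l : Fin k → List X) (b : Fin k) :
    (((List.ofFn fun j => (l j).map fun a => (j, a)).flatten.filter fun z => z.1 = b).map Prod.snd) =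
      l b := by
  rw [List.filter_flatten, List.map_flatten, List.map_ofFn, List.map_ofFn]
  induction k with
  | zero => exact b.elim0
  | succ k ih =>
    rw [List.ofFn_succ, List.flatten_cons]
    refine Fin.cases ?_ (fun b => ?_) b
    · rw [List.flatten_eq_nil_iff.mpr]
      · simp [List.filter_map, Function.comp_def]
      · intro l' hl'
        obtain ⟨j, rfl⟩ := (List.mem_ofFn' _ _).mp hl'
        simp [List.filter_map, Function.comp_def, Fin.succ_ne_zero]
    · have h0 : (0 : Fin (k + 1)) ≠ b.succ := (Fin.succ_ne_zero b).symm
      rw [← ih (fun j => l j.succ) b]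
      simp [List.filter_map, Function.comp_def, h0]

/-- A linear map that only sees the component of words of lengths `|l₁|, …, |l_k|` sends the
deconcatenation of `l₁ ⋯ l_k` to the value at `l₁ ⊗ ⋯ ⊗ l_k`. -/
theorem map_deconcat_flatten {k : ℕ} (l : Fin k → List X) (G : (⨂[K]^k (Words K X)) →ₗ[K] Z)
    (hG : ∀ l' : Fin k → List X, (∃ j, (l' j).length ≠ (l j).length) →
      G (PiTensorProduct.tprod K fun j => word K (l' j)) = 0) :
    G (deconcat k (word K (List.ofFn l).flatten)) =
      G (PiTensorProduct.tprod K fun j => word K (l j)) := by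
  -- Each letter is labelled by its block. The sequence of labels is the one weakly increasing map
  -- that cuts the word in the prescribed way.
  set LL : List (Fin k × X) := (List.ofFn fun j => (l j).map fun a => (j, a)).flatten with hLL
  have hsnd : (List.ofFn l).flatten = List.ofFn fun i => (LL.get i).2 := by
    have h : LL.map Prod.snd = List.ofFn fun i => (LL.get i).2 := by
      conv_lhs => rw [← List.ofFn_get LL, List.map_ofFn]
      rfl
    rw [← h, hLL, List.map_flatten, List.map_ofFn]
    simp [Function.comp_def]
  have hfst : blocks (fun j => (l j).length) = List.ofFn fun i => (LL.get i).1 := by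
    have h : LL.map Prod.fst = List.ofFn fun i => (LL.get i).1 := by
      conv_lhs => rw [← List.ofFn_get LL, List.map_ofFn]
      rfl
    rw [← h, hLL, List.map_flatten, List.map_ofFn, blocks]
    simp [Function.comp_def]
  rw [hsnd, deconcat_word, map_sum, Finset.sum_eq_single fun i => (LL.get i).1]
  · congr 2
    funext b
    rw [← filter_labelled l b]
    congr 3
    exact List.ofFn_get LL
  · intro g hg hne
    refine hG _ ?_
    by_contra! hcon
    -- A weakly increasing `g` with the prescribed block lengths has the same multiplicities as the
    -- chosen labelling, hence equals it.
    refine hne (List.ofFn_injective ?_)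
    rw [← hfst, eq_blocks (L := List.ofFn g)]
    · congr 1
      funext b
      rw [← hcon b, List.length_map, ← List.countP_eq_length_filter, List.count_eq_countP]
      simp_rw [List.countP_eq_length_filter]
      rw [← List.length_map (f := Prod.fst) (as := List.filter _ (List.ofFn fun i => (g i, _)))]
      have : List.ofFn g = (List.ofFn fun i => (g i, (LL.get i).2)).map Prod.fst := by
        rw [List.map_ofFn]; rfl
      rw [this, List.filter_map, List.length_map, List.length_map]
      congr 2
    · rw [List.pairwise_ofFn]
      intro i j hij
      exact (Finset.mem_filter.mp hg).2 i j hij.le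
  · intro h
    refine absurd (Finset.mem_filter.mpr ⟨Finset.mem_univ _, fun i j hij => ?_⟩) h
    have hp := pairwise_blocks fun j => (l j).length
    rw [hfst, List.pairwise_ofFn] at hp
    rcases hij.eq_or_lt with rfl | hlt
    · exact le_rfl
    · exact hp hlt

/-- The second step of the comultiplication `cofreeComul` of a cofree coalgebra. -/
def cut (P : ℕ → DGMod.{u, v} K) (s : X →ₗ[K] X) :
    Schur P (Tot P) ⊗[K] Words K X →ₗ[K] Schur P (Schur P X) :=
  TensorProduct.lift (DirectSum.toModule K ℕ _ fun k => TensorProduct.curry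
    (Schur.of P k ∘ₗ
    TensorProduct.map LinearMap.id
      ((PiTensorProduct.map fun _ => Schur.ofTensor P) ∘ₗ
        kzip (Tot.par P) (wordsMap s) k) ∘ₗ
    (TensorProduct.assoc K (P k).carrier (⨂[K]^k (Tot P)) (⨂[K]^k (Words K X))).toLinearMap ∘ₗ
    TensorProduct.map LinearMap.id (deconcat k)))

/-- Among all deconcatenations only the one into words of lengths `m j` survives the projections to
`P ∘ X`. The factor `q j` moves past the words in front of it, which gives the twists. -/
theorem cut_of {s : X →ₗ[K] X} (hs : s ∘ₗ s = LinearMap.id)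
    {k : ℕ} (p : P k) {m : Fin k → ℕ} {e : Fin k → ℤ} {q : ∀ j, P (m j)} {l : Fin k → List X}
    (hq : ∀ j, q j ∈ (P (m j)).gr (e j)) (hl : ∀ j, (l j).length = m j) :
    cut P s (Schur.of P k (p ⊗ₜ PiTensorProduct.tprod K fun j => Tot.of P (m j) (q j)) ⊗ₜ
        word K (List.ofFn l).flatten) =
      Schur.of P k (p ⊗ₜ PiTensorProduct.tprod K fun j => sch P (Tot.of P (m j) (q j))
        ((l j).map (tw s (after (fun j => (e j : ZMod 2)) j)))) := by
  let G : ((⨂[K]^k (Tot P)) ⊗[K] (⨂[K]^k (Words K X))) →ₗ[K] (⨂[K]^k (Schur P X)) :=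
    (PiTensorProduct.map fun _ => Schur.ofTensor P) ∘ₗ kzip (Tot.par P) (wordsMap s) k
  have key : ∀ l' : Fin k → List X,
      G ((PiTensorProduct.tprod K fun j => Tot.of P (m j) (q j)) ⊗ₜ
          PiTensorProduct.tprod K fun j => word K (l' j)) =
      PiTensorProduct.tprod K fun j => sch P (Tot.of P (m j) (q j))
        ((l' j).map (tw s (after (fun j => (e j : ZMod 2)) j))) := by
    intro l'
    rw [LinearMap.comp_apply, wordsMap_eq, kzip_tprod (Tot.par P) (wmap_involutive hs) k
      (fun j => (e j : ZMod 2)) _ _ fun i ε => Tot.par_of (hq i) ε, PiTensorProduct.map_tprod]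
    simp only [tw_wmap, wmap_word]
    rfl
  have key2 := map_deconcat_flatten (Z := ⨂[K]^k (Schur P X)) l
    (G ∘ₗ TensorProduct.mk K _ _ (PiTensorProduct.tprod K fun j => Tot.of P (m j) (q j))) ?_
  · rw [← key]
    refine Eq.trans ?_ (congrArg (fun z => Schur.of P k (p ⊗ₜ z)) key2)
    simp [cut, G]
  · rintro l' ⟨j, hj⟩
    rw [LinearMap.comp_apply, TensorProduct.mk_apply, key]
    refine (PiTensorProduct.tprod K).map_coord_zero j ?_
    exact sch_of_length_ne _ (by simpa [← hl j] using hj)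

theorem exists_flatten {k : ℕ} (m : Fin k → ℕ) (l : List X) (h : l.length = ∑ j, m j) :
    ∃ l' : Fin k → List X, (∀ j, (l' j).length = m j) ∧ (List.ofFn l').flatten = l := by
  induction k generalizing l with
  | zero => exact ⟨fun j => j.elim0, fun j => j.elim0, (List.eq_nil_of_length_eq_zero (by simpa using h)).symm⟩
  | succ k ih =>
    rw [Fin.sum_univ_succ] at h
    obtain ⟨l', h1, h2⟩ := ih (fun j => m j.succ) (l.drop (m 0)) (by simp [h])
    refine ⟨Fin.cons (l.take (m 0)) l', fun j => ?_, ?_⟩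
    · refine Fin.cases ?_ (fun j => ?_) j
      · simp [h]
      · simpa using h1 j
    · simp [List.ofFn_succ, h2]

/-- The part of arity `n` of `P ∘ P` is spanned by pure tensors of homogeneous elements. -/
theorem arity_le_span (n : ℕ) : Schur.arity P n ≤
    Submodule.span K {z | ∃ (k : ℕ) (p : P k) (m : Fin k → ℕ) (e : Fin k → ℤ) (q : ∀ j, P (m j)),
      (∀ j, q j ∈ (P (m j)).gr (e j)) ∧ ∑ j, m j = n ∧
      z = Schur.of P k (p ⊗ₜ PiTensorProduct.tprod K fun j => Tot.of P (m j) (q j))} := by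
  rw [Schur.arity, Submodule.span_le]
  rintro z ⟨k, m, p, q, hm, rfl⟩
  let F : MultilinearMap K (fun j => (P (m j)).carrier) (Schur P (Tot P)) :=
    ((Schur.of P k ∘ₗ TensorProduct.mk K _ _ p).compMultilinearMap
      (PiTensorProduct.tprod K)).compLinearMap fun j => Tot.of P (m j)
  refine MultilinearMap.mem_of_span F (S := fun j => {a | ∃ i, a ∈ (P (m j)).gr i}) ?_ q
    fun j => by rw [DGMod.span_homogeneous]; trivial
  intro q' hq'
  choose e he using hq'
  exact Submodule.subset_span ⟨k, p, m, e, q', he, hm, rfl⟩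

theorem cofreeComul_of (Δ : Tot P →ₗ[K] Schur P (Tot P)) (s : X →ₗ[K] X) (n : ℕ) (c : P n)
    (a : Fin n → X) : cofreeComul P Δ s (Schur.of P n (c ⊗ₜ PiTensorProduct.tprod K a)) =
      cut P s (Δ (Tot.of P n c) ⊗ₜ word K (List.ofFn a)) := by
  rw [cofreeComul, LinearMap.comp_apply, LinearMap.comp_apply, toTensor_of, TensorProduct.map_tmul]
  rfl

/-- A property of the values of a linear map on `z ⊗ a₁ ⋯ aₙ`, for `z` in the part of arity `n`
of `P ∘ P`, has to be checked only if `z` is a pure tensor of homogeneous elements. -/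
theorem arity_word_mem {n : ℕ} (F : Schur P (Tot P) ⊗[K] Words K X →ₗ[K] Z)
    {W : Submodule K Z} {S : Set X}
    (h : ∀ (k : ℕ) (p : P k) (m : Fin k → ℕ) (e : Fin k → ℤ) (q : ∀ j, P (m j))
      (l : Fin k → List X), ∑ j, m j = n → (∀ j, q j ∈ (P (m j)).gr (e j)) →
      (∀ j, (l j).length = m j) → (∀ j, ∀ x ∈ l j, x ∈ S) →
      F (Schur.of P k (p ⊗ₜ PiTensorProduct.tprod K fun j => Tot.of P (m j) (q j)) ⊗ₜ
        word K (List.ofFn l).flatten) ∈ W)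
    {z : Schur P (Tot P)} (hz : z ∈ Schur.arity P n) {a : Fin n → X} (ha : ∀ j, a j ∈ S) :
    F (z ⊗ₜ word K (List.ofFn a)) ∈ W := by
  replace hz := arity_le_span n hz
  induction hz using Submodule.span_induction with
  | zero => simp
  | add _ _ _ _ h1 h2 => rw [TensorProduct.add_tmul, map_add]; exact W.add_mem h1 h2
  | smul c _ _ h1 => rw [← TensorProduct.smul_tmul', map_smul]; exact W.smul_mem c h1
  | mem z hz =>
    obtain ⟨k, p, m, e, q, hq, hm, rfl⟩ := hz
    obtain ⟨l, hl, hla⟩ := exists_flatten m (List.ofFn a) (by simp [hm])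
    rw [← hla]
    refine h k p m e q l hm hq hl fun j x hx => ?_
    have : x ∈ List.ofFn a := by
      rw [← hla, List.mem_flatten]
      exact ⟨l j, (List.mem_ofFn' _ _).mpr ⟨j, rfl⟩, hx⟩
    obtain ⟨i, rfl⟩ := (List.mem_ofFn' _ _).mp this
    exact ha i

theorem arity_word_eq {n : ℕ} {F G : Schur P (Tot P) ⊗[K] Words K X →ₗ[K] Z} {S : Set X}
    (h : ∀ (k : ℕ) (p : P k) (m : Fin k → ℕ) (e : Fin k → ℤ) (q : ∀ j, P (m j))
      (l : Fin k → List X), ∑ j, m j = n → (∀ j, q j ∈ (P (m j)).gr (e j)) →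
      (∀ j, (l j).length = m j) → (∀ j, ∀ x ∈ l j, x ∈ S) →
      F (Schur.of P k (p ⊗ₜ PiTensorProduct.tprod K fun j => Tot.of P (m j) (q j)) ⊗ₜ
        word K (List.ofFn l).flatten) =
      G (Schur.of P k (p ⊗ₜ PiTensorProduct.tprod K fun j => Tot.of P (m j) (q j)) ⊗ₜ
        word K (List.ofFn l).flatten))
    {z : Schur P (Tot P)} (hz : z ∈ Schur.arity P n) {a : Fin n → X} (ha : ∀ j, a j ∈ S) :
    F (z ⊗ₜ word K (List.ofFn a)) = G (z ⊗ₜ word K (List.ofFn a)) := by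
  rw [← sub_eq_zero, ← LinearMap.sub_apply, ← Submodule.mem_bot (R := K)]
  refine arity_word_mem (F - G) (fun k p m e q l h1 h2 h3 h4 => ?_) hz ha
  rw [Submodule.mem_bot, LinearMap.sub_apply, sub_eq_zero]
  exact h k p m e q l h1 h2 h3 h4

theorem freeMul_natural (γ : Schur P (Tot P) →ₗ[K] Tot P) {s : X →ₗ[K] X} {s' : Y →ₗ[K] Y}
    (hs : s ∘ₗ s = LinearMap.id) (hs' : s' ∘ₗ s' = LinearMap.id) {f : X →ₗ[K] Y}
    (hf : f ∘ₗ s = s' ∘ₗ f) :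
    freeMul P γ s' ∘ₗ Schur.map P (Schur.map P f) = Schur.map P f ∘ₗ freeMul P γ s := by
  refine schur_hom_ext (span_pureSet (S := Set.univ) Submodule.span_univ) fun k _ p a _ ha => ?_
  choose n i q l hq _ hl ha using ha
  obtain rfl : a = fun j => sch P (Tot.of P (n j) (q j)) (l j) := funext ha
  simp only [LinearMap.comp_apply, schur_map_of, schur_map_sch]
  rw [freeMul_of γ hs p hq hl, freeMul_of γ hs' p hq (fun j => by simpa using hl j), schur_map_sch,
    List.map_flatten, List.map_ofFn]
  simp only [List.map_map, Function.comp_def, tw_comm hf]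

/-- Since `Δ` preserves arity, a word can be cut into blocks that fit the upper factors, and it
suffices to compare the two sides on such blocks. -/
theorem cofreeComul_natural {Δ : Tot P →ₗ[K] Schur P (Tot P)}
    (hΔ : ∀ (n : ℕ) (c : P n), Δ (Tot.of P n c) ∈ Schur.arity P n) {s : X →ₗ[K] X}
    {s' : Y →ₗ[K] Y} (hs : s ∘ₗ s = LinearMap.id) (hs' : s' ∘ₗ s' = LinearMap.id) {f : X →ₗ[K] Y}
    (hf : f ∘ₗ s = s' ∘ₗ f) :
    Schur.map P (Schur.map P f) ∘ₗ cofreeComul P Δ s = cofreeComul P Δ s' ∘ₗ Schur.map P f := by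
  refine schur_hom_ext' fun n c a => ?_
  rw [LinearMap.comp_apply, cofreeComul_of, LinearMap.comp_apply, schur_map_of, cofreeComul_of]
  have := arity_word_eq (F := Schur.map P (Schur.map P f) ∘ₗ cut P s)
    (G := cut P s' ∘ₗ TensorProduct.map LinearMap.id (wmap f)) (S := Set.univ)
    (fun k p m e q l _ hq hl _ => by
      simp only [LinearMap.comp_apply, TensorProduct.map_tmul, wmap_word, LinearMap.id_apply,
        List.map_flatten, List.map_ofFn]
      rw [cut_of hs p hq hl, Function.comp_def, cut_of hs' p hq (fun j => by simpa using hl j)]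
      simp [Function.comp_def, tw_comm hf]) (hΔ n c) (a := a) (by simp)
  simpa [List.map_ofFn, Function.comp_def] using this

end Formulas

/-! ## Inserting a map into one tensor factor -/

section Insert

variable {K : Type u} [Field K] {P : ℕ → DGMod.{u, v} K}
variable {X : Type w} [AddCommGroup X] [Module K X]
variable {Y : Type x} [AddCommGroup Y] [Module K Y]
variable {Z : Type y} [AddCommGroup Z] [Module K Z]

theorem map_comp_insertEach (k : ℕ) (u : Y →ₗ[K] Z) (f g h : X →ₗ[K] Y) :
    PiTensorProduct.map (fun _ => u) ∘ₗ insertEach k f g h =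
      insertEach k (u ∘ₗ f) (u ∘ₗ g) (u ∘ₗ h) := by
  refine PiTensorProduct.ext (MultilinearMap.ext fun a => ?_)
  simp only [LinearMap.compMultilinearMap_apply, LinearMap.comp_apply, insertEach_tprod, map_sum,
    PiTensorProduct.map_tprod, apply_ite u]

theorem insertEach_comp_map (k : ℕ) (u : X →ₗ[K] Y) (f g h : Y →ₗ[K] Z) :
    insertEach k f g h ∘ₗ PiTensorProduct.map (fun _ => u) =
      insertEach k (f ∘ₗ u) (g ∘ₗ u) (h ∘ₗ u) := by
  refine PiTensorProduct.ext (MultilinearMap.ext fun a => ?_)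
  simp only [LinearMap.compMultilinearMap_apply, LinearMap.comp_apply, insertEach_tprod,
    PiTensorProduct.map_tprod]

/-- In this form linearity in `g` is the multilinearity of `PiTensorProduct.map` in one place. -/
theorem insertEach_eq_update (k : ℕ) (f g h : X →ₗ[K] Y) : insertEach k f g h =
    ∑ i : Fin k, PiTensorProduct.map (Function.update (fun j => if j < i then f else h) i g) := by
  refine Finset.sum_congr rfl fun i _ => congrArg _ (funext fun j => ?_)
  by_cases h : j = i
  · subst h; simp
  · simp [h]

theorem insertEach_add (k : ℕ) (f g g' h : X →ₗ[K] Y) :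
    insertEach k f (g + g') h = insertEach k f g h + insertEach k f g' h := by
  simp only [insertEach_eq_update, PiTensorProduct.map_update_add, Finset.sum_add_distrib]

theorem insertEach_smul (k : ℕ) (c : K) (f g h : X →ₗ[K] Y) :
    insertEach k f (c • g) h = c • insertEach k f g h := by
  simp only [insertEach_eq_update, PiTensorProduct.map_update_smul, Finset.smul_sum]

variable (P) in
/-- `p ⊗ a₁ ⊗ ⋯ ⊗ aₙ ↦ ∑ᵢ (-1)^|p| p ⊗ f a₁ ⊗ ⋯ ⊗ g aᵢ ⊗ ⋯ ⊗ h aₙ`. -/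
def ins (f g h : X →ₗ[K] Y) : Schur P X →ₗ[K] Schur P Y :=
  DirectSum.lmap fun k => TensorProduct.map (P k).sgn (insertEach k f g h)

variable (P) in
/-- The part of the differential of `P ∘ X` that comes from the differential of `P`. -/
def opD (X : Type w) [AddCommGroup X] [Module K X] : Schur P X →ₗ[K] Schur P X :=
  DirectSum.lmap fun k => TensorProduct.map (P k).d LinearMap.id

theorem schur_d_eq (s d : X →ₗ[K] X) :
    Schur.d P s d = opD P X + ins P s d LinearMap.id := by
  refine DirectSum.linearMap_ext _ fun n => LinearMap.ext fun z => ?_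
  simp [Schur.d, opD, ins, DirectSum.lmap_lof]

theorem map_comp_ins (u : Y →ₗ[K] Z) (f g h : X →ₗ[K] Y) :
    Schur.map P u ∘ₗ ins P f g h = ins P (u ∘ₗ f) (u ∘ₗ g) (u ∘ₗ h) := by
  simp only [Schur.map, ins, ← DirectSum.lmap_comp, ← TensorProduct.map_comp, map_comp_insertEach]
  rfl

theorem ins_comp_map (u : X →ₗ[K] Y) (f g h : Y →ₗ[K] Z) :
    ins P f g h ∘ₗ Schur.map P u = ins P (f ∘ₗ u) (g ∘ₗ u) (h ∘ₗ u) := by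
  simp only [Schur.map, ins, ← DirectSum.lmap_comp, ← TensorProduct.map_comp, insertEach_comp_map]
  rfl

theorem ins_add (f g g' h : X →ₗ[K] Y) : ins P f (g + g') h = ins P f g h + ins P f g' h := by
  refine DirectSum.linearMap_ext _ fun n => LinearMap.ext fun z => ?_
  simp [ins, DirectSum.lmap_lof, insertEach_add, TensorProduct.map_add_right]

theorem ins_smul (c : K) (f g h : X →ₗ[K] Y) : ins P f (c • g) h = c • ins P f g h := by
  refine DirectSum.linearMap_ext _ fun n => LinearMap.ext fun z => ?_
  simp [ins, DirectSum.lmap_lof, insertEach_smul, TensorProduct.map_smul_right]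

theorem ins_zero (f h : X →ₗ[K] Y) : ins P f 0 h = 0 := by
  rw [← zero_smul K (0 : X →ₗ[K] Y), ins_smul, zero_smul]

theorem ins_sub (f g g' h : X →ₗ[K] Y) : ins P f (g - g') h = ins P f g h - ins P f g' h := by
  refine eq_sub_of_add_eq (G := Schur P X →ₗ[K] Schur P Y) ?_
  rw [← ins_add, sub_add_cancel]

theorem opD_natural (u : X →ₗ[K] Y) : Schur.map P u ∘ₗ opD P X = opD P Y ∘ₗ Schur.map P u := by
  simp only [Schur.map, opD, ← DirectSum.lmap_comp, ← TensorProduct.map_comp, LinearMap.id_comp,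
    LinearMap.comp_id]

end Insert

/-! ## Gradings and signs -/

section Graded

variable {K : Type u} [Field K] {P : ℕ → DGMod.{u, v} K}
variable {X : Type w} [AddCommGroup X] [Module K X]
variable {Y : Type x} [AddCommGroup Y] [Module K Y]
variable {Z : Type y} [AddCommGroup Z] [Module K Z]

/-- The scalar `(-1)^e`. -/
def zsign (K : Type u) [Field K] (e : ZMod 2) : K := if e = 0 then 1 else -1

@[simp] theorem zsign_zero : zsign K 0 = 1 := rfl

@[simp] theorem zsign_one : zsign K 1 = -1 := rfl

theorem zsign_add (e f : ZMod 2) : zsign K (e + f) = zsign K e * zsign K f := by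
  rcases zmod_two_cases e with rfl | rfl <;> rcases zmod_two_cases f with rfl | rfl <;>
    simp [show (1 + 1 : ZMod 2) = 0 from rfl]

theorem zsign_mul_self (e : ZMod 2) : zsign K e * zsign K e = 1 := by
  rcases zmod_two_cases e with rfl | rfl <;> simp

/-- The grading `gr` spans, and `s` is its sign operator. -/
structure IsGraded (gr : ℤ → Submodule K X) (s : X →ₗ[K] X) : Prop where
  sgn_of_mem : ∀ (i : ℤ) (a : X), a ∈ gr i → s a = zsign K i • a
  span : Submodule.span K {a | ∃ i, a ∈ gr i} = ⊤

theorem DGMod.sgn_of_mem (V : DGMod.{u, v} K) (i : ℤ) (a : V) (ha : a ∈ V.gr i) :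
    V.sgn a = zsign K i • a := by
  rw [DGMod.sgn, LinearMap.sub_apply, V.par_of_mem 0 ha, V.par_of_mem 1 ha]
  rcases zmod_two_cases (i : ZMod 2) with h | h <;> simp [h]

theorem DGMod.isGraded (V : DGMod.{u, v} K) : IsGraded V.gr V.sgn :=
  ⟨V.sgn_of_mem, V.span_homogeneous⟩

variable {gX : ℤ → Submodule K X} {sX : X →ₗ[K] X} {gY : ℤ → Submodule K Y} {sY : Y →ₗ[K] Y}

theorem IsGraded.involutive (h : IsGraded gX sX) : sX ∘ₗ sX = LinearMap.id := by
  refine LinearMap.ext_on h.span ?_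
  rintro a ⟨i, ha⟩
  rw [LinearMap.comp_apply, h.sgn_of_mem i a ha, map_smul, h.sgn_of_mem i a ha, smul_smul,
    zsign_mul_self, one_smul, LinearMap.id_apply]

theorem IsGraded.comm (hX : IsGraded gX sX) (hY : ∀ (i : ℤ) (a : Y), a ∈ gY i → sY a = zsign K i • a)
    {f : X →ₗ[K] Y} {j : ℤ} (hf : ∀ i, ∀ a ∈ gX i, f a ∈ gY (i + j)) :
    sY ∘ₗ f = zsign K j • (f ∘ₗ sX) := by
  refine LinearMap.ext_on hX.span ?_
  rintro a ⟨i, ha⟩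
  simp only [LinearMap.comp_apply, LinearMap.smul_apply]
  rw [hX.sgn_of_mem i a ha, hY _ _ (hf i a ha), map_smul, smul_smul, Int.cast_add, zsign_add,
    mul_comm]

theorem IsGraded.comm_zero (hX : IsGraded gX sX)
    (hY : ∀ (i : ℤ) (a : Y), a ∈ gY i → sY a = zsign K i • a)
    {f : X →ₗ[K] Y} (hf : ∀ i, ∀ a ∈ gX i, f a ∈ gY i) : f ∘ₗ sX = sY ∘ₗ f := by
  rw [hX.comm hY (j := 0) (by simpa using hf)]; simp

theorem IsGraded.anticomm (hX : IsGraded gX sX)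
    (hY : ∀ (i : ℤ) (a : Y), a ∈ gY i → sY a = zsign K i • a)
    {f : X →ₗ[K] Y} (hf : ∀ i, ∀ a ∈ gX i, f a ∈ gY (i + 1)) : sY ∘ₗ f = -(f ∘ₗ sX) := by
  rw [hX.comm hY hf]; simp

variable (P) in
/-- The sign operator of `P ∘ X`. -/
def schSgn (s : X →ₗ[K] X) : Schur P X →ₗ[K] Schur P X :=
  DirectSum.lmap fun n => TensorProduct.map (P n).sgn (PiTensorProduct.map fun _ => s)

theorem schur_gr_induction {gX : ℤ → Submodule K X} {i : ℤ} {z : Schur P X}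
    (hz : z ∈ Schur.gr P gX i) (W : Submodule K Z) (F : Schur P X →ₗ[K] Z)
    (h : ∀ (n : ℕ) (e : ℤ) (f : Fin n → ℤ) (p : P n) (a : Fin n → X), e + ∑ j, f j = i →
      p ∈ (P n).gr e → (∀ j, a j ∈ gX (f j)) →
      F (Schur.of P n (p ⊗ₜ PiTensorProduct.tprod K a)) ∈ W) : F z ∈ W := by
  suffices Schur.gr P gX i ≤ W.comap F from this hz
  rw [Schur.gr, Submodule.span_le]
  rintro _ ⟨n, e, f, p, a, h1, h2, h3, rfl⟩
  exact h n e f p a h1 h2 h3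

theorem zsign_sum {ι : Type*} (t : Finset ι) (f : ι → ZMod 2) :
    zsign K (∑ j ∈ t, f j) = ∏ j ∈ t, zsign K (f j) := by
  classical
  induction t using Finset.induction_on with
  | empty => simp
  | insert a t h ih => rw [Finset.sum_insert h, Finset.prod_insert h, zsign_add, ih]

theorem schSgn_of (h : ∀ (i : ℤ) (a : X), a ∈ gX i → sX a = zsign K i • a) {n : ℕ} {e : ℤ}
    {f : Fin n → ℤ} {p : P n} {a : Fin n → X} (hp : p ∈ (P n).gr e) (ha : ∀ j, a j ∈ gX (f j)) :
    schSgn P sX (Schur.of P n (p ⊗ₜ PiTensorProduct.tprod K a)) =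
      zsign K ((e + ∑ j, f j : ℤ) : ZMod 2) • Schur.of P n (p ⊗ₜ PiTensorProduct.tprod K a) := by
  rw [schSgn, Schur.of, DirectSum.lmap_lof, TensorProduct.map_tmul, PiTensorProduct.map_tprod,
    (P n).sgn_of_mem e p hp]
  simp_rw [h _ _ (ha _)]
  rw [MultilinearMap.map_smul_univ, TensorProduct.smul_tmul_smul, map_smul]
  congr 1
  rw [Int.cast_add, zsign_add, Int.cast_sum, zsign_sum]

theorem schSgn_of_mem (h : ∀ (i : ℤ) (a : X), a ∈ gX i → sX a = zsign K i • a) (i : ℤ)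
    (z : Schur P X) (hz : z ∈ Schur.gr P gX i) : schSgn P sX z = zsign K i • z := by
  have := schur_gr_induction hz ⊥ (schSgn P sX - zsign K i • LinearMap.id) ?_
  · simpa [sub_eq_zero] using this
  · intro n e f p a hi hp ha
    simp only [Submodule.mem_bot, LinearMap.sub_apply, LinearMap.smul_apply, LinearMap.id_apply]
    rw [schSgn_of h hp ha, hi, sub_self]

theorem schur_of_mem_gr {n : ℕ} {e i : ℤ}
    {f : Fin n → ℤ} {p : P n} {a : Fin n → X} (hp : p ∈ (P n).gr e) (ha : ∀ j, a j ∈ gX (f j))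
    (hi : e + ∑ j, f j = i) :
    Schur.of P n (p ⊗ₜ PiTensorProduct.tprod K a) ∈ Schur.gr P gX i :=
  Submodule.subset_span ⟨n, e, f, p, a, hi, hp, ha, rfl⟩

/-- `IsGraded` asks only that the homogeneous elements span, not that the degrees are independent.
This passes to Schur functors at once and is all the sign arguments need. -/
theorem IsGraded.schur (h : IsGraded gX sX) : IsGraded (Schur.gr P gX) (schSgn P sX) := by
  refine ⟨fun i z => schSgn_of_mem h.sgn_of_mem i z, ?_⟩
  have : (Submodule.span K {z : Schur P X | ∃ i, z ∈ Schur.gr P gX i}).mkQ = 0 :=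
    schur_hom_ext h.span fun n i p a hp ha => by
      choose f hf using ha
      rw [LinearMap.zero_apply, Submodule.mkQ_apply, Submodule.Quotient.mk_eq_zero]
      exact Submodule.subset_span ⟨_, schur_of_mem_gr hp hf rfl⟩
  rw [← Submodule.ker_mkQ (Submodule.span K _), this, LinearMap.ker_zero]

theorem schur_map_mem_gr {f : X →ₗ[K] Y} (hf : ∀ i, ∀ a ∈ gX i, f a ∈ gY i) {i : ℤ}
    {z : Schur P X} (hz : z ∈ Schur.gr P gX i) : Schur.map P f z ∈ Schur.gr P gY i :=
  schur_gr_induction hz _ _ fun n e g p a hi hp ha => by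
    rw [schur_map_of]
    exact schur_of_mem_gr hp (fun j => hf _ _ (ha j)) hi

end Graded

/-! ## Unit and counit -/

section Units

variable {K : Type u} [Field K]
variable {X : Type w} [AddCommGroup X] [Module K X]
variable {Y : Type x} [AddCommGroup Y] [Module K Y]
variable (P : NSOperad.{u, v} K) (C : NSCooperad.{u, v} K)

theorem generator_eq (a : X) : generator P a = sch P.obj (Tot.of P.obj 1 P.one) [a] := by
  have := sch_ofFn (P := P.obj) 1 P.one (fun _ => a)
  rw [List.ofFn_succ, List.ofFn_zero] at this
  rw [this]
  simp [generator]

theorem schur_map_generator (f : X →ₗ[K] Y) : Schur.map P.obj f ∘ₗ generator P = generator P ∘ₗ f :=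
  LinearMap.ext fun a => by simp [generator_eq]

variable {C} in
theorem counitProj_sch_one (c : C.obj 1) (a : X) :
    counitProj C.obj C.ε (sch C.obj (Tot.of C.obj 1 c) [a]) = C.ε c • a := by
  have := sch_ofFn (P := C.obj) 1 c (fun _ => a)
  rw [List.ofFn_succ, List.ofFn_zero] at this
  rw [this]
  simp [counitProj]

variable {C} in
theorem counitProj_of_ne {n : ℕ} (h : n ≠ 1) (z : (C.obj n).carrier ⊗[K] (⨂[K]^n X)) :
    counitProj C.obj C.ε (Schur.of C.obj n z) = 0 := by
  simp [counitProj, DirectSum.component.of, h]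

variable {C} in
theorem counitProj_sch_of_ne {n : ℕ} (h : n ≠ 1) (c : C.obj n) (l : List X) :
    counitProj C.obj C.ε (sch C.obj (Tot.of C.obj n c) l) = 0 := by
  rw [sch, ofTensor_of_tmul, counitProj_of_ne h]

theorem counitProj_natural (f : X →ₗ[K] Y) :
    counitProj C.obj C.ε ∘ₗ Schur.map C.obj f = f ∘ₗ counitProj C.obj C.ε := by
  refine schur_hom_ext' fun n c a => ?_
  simp only [LinearMap.comp_apply, schur_map_of]
  by_cases h : n = 1
  · subst h
    simp [counitProj]
  · rw [counitProj_of_ne h, counitProj_of_ne h, map_zero]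

theorem sgn_one (c : C.obj 1) : (C.obj 1).sgn c = c := by
  rw [(C.obj 1).sgn_of_mem 0 c (by rw [C.reduced_one_degree]; trivial)]; simp

theorem insertEach_one (f g h : X →ₗ[K] Y) (a : Fin 1 → X) :
    insertEach 1 f g h (PiTensorProduct.tprod K a) = PiTensorProduct.tprod K fun j => g (a j) := by
  rw [insertEach_tprod, Fin.sum_univ_one]
  congr 1
  funext j
  rw [Subsingleton.elim j 0, if_neg (lt_irrefl _), if_pos rfl]

/-- The projection sees arity one only. There `g` is inserted into the single factor, without a sign
because `C(1)` has degree zero. Thus the inserted map is recovered from its coderivation. -/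
theorem counitProj_ins (f g h : X →ₗ[K] Y) :
    counitProj C.obj C.ε ∘ₗ ins C.obj f g h = g ∘ₗ counitProj C.obj C.ε := by
  refine schur_hom_ext' fun n c a => ?_
  simp only [LinearMap.comp_apply, ins, Schur.of, DirectSum.lmap_lof, TensorProduct.map_tmul]
  by_cases hn : n = 1
  · subst hn
    rw [insertEach_one, sgn_one]
    simp [counitProj]
  · rw [← Schur.of, ← Schur.of, counitProj_of_ne hn, counitProj_of_ne hn, map_zero]

theorem ins_generator (f g h : X →ₗ[K] Y) :
    ins P.obj f g h ∘ₗ generator P = generator P ∘ₗ g := by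
  refine LinearMap.ext fun a => ?_
  have h1 := sch_ofFn (P := P.obj) 1 P.one (fun _ => a)
  have h2 := sch_ofFn (P := P.obj) 1 P.one (fun _ => g a)
  rw [List.ofFn_succ, List.ofFn_zero] at h1 h2
  rw [LinearMap.comp_apply, LinearMap.comp_apply, generator_eq, generator_eq, h1, h2, ins, Schur.of,
    DirectSum.lmap_lof, TensorProduct.map_tmul, insertEach_one,
    (P.obj 1).sgn_of_mem 0 _ P.one_degree]
  simp

theorem flatten_ofFn_singleton {k : ℕ} (a : Fin k → X) :
    (List.ofFn fun j => [a j]).flatten = List.ofFn a := by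
  induction k with
  | zero => simp
  | succ k ih => rw [List.ofFn_succ, List.ofFn_succ, List.flatten_cons, ih]; rfl

theorem tw_zero_exponent (s : X →ₗ[K] X) {k : ℕ} (j : Fin k) :
    tw s (after (fun _ => ((0 : ℤ) : ZMod 2)) j) = LinearMap.id := by
  simp [after]

/-- The right unit law of the operad. No signs appear, as the unit has degree zero. -/
theorem freeMul_map_generator {s : X →ₗ[K] X} (hs : s ∘ₗ s = LinearMap.id) :
    freeMul P.obj P.γ s ∘ₗ Schur.map P.obj (generator P) = LinearMap.id := by
  refine schur_hom_ext' fun n p a => ?_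
  simp only [LinearMap.comp_apply, schur_map_of, generator_eq]
  rw [freeMul_of P.γ hs p (m := fun _ => 1) (e := fun _ => 0) (q := fun _ => P.one)
    (fun _ => P.one_degree) (fun _ => rfl), P.one_right]
  simp only [tw_zero_exponent]
  simp only [List.map_cons, List.map_nil, LinearMap.id_apply]
  rw [flatten_ofFn_singleton, sch_ofFn]

theorem counitRight_of {k : ℕ} (p : C.obj k) (q : Fin k → Tot C.obj) :
    counitRight C.obj C.ε (Schur.of C.obj k (p ⊗ₜ PiTensorProduct.tprod K q)) =
      (∏ j, counitTot C.obj C.ε (q j)) • Tot.of C.obj k p := by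
  simp [counitRight, List.prod_ofFn]

theorem exists_eq_zero_or_degree {k : ℕ} {e : Fin k → ℤ} {q : ∀ _ : Fin k, C.obj 1}
    (hq : ∀ j, q j ∈ (C.obj 1).gr (e j)) : (∃ j, q j = 0) ∨ e = fun _ => 0 := by
  by_contra! h
  obtain ⟨j, hj⟩ := Function.ne_iff.mp h.2
  have hd := (C.obj 1).internal.submodule_iSupIndep.pairwiseDisjoint hj
  refine h.1 j ?_
  have := (Submodule.disjoint_def.mp hd) (q j) (hq j) (by rw [C.reduced_one_degree]; trivial)
  exact this

/-- The right counit law of the cooperad. Upper factors of arity different from one are killed on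
both sides, and nonzero ones of arity one have degree zero, so that the Koszul twists are trivial.
-/
theorem map_counitProj_cofreeComul {s : X →ₗ[K] X} (hs : s ∘ₗ s = LinearMap.id) :
    Schur.map C.obj (counitProj C.obj C.ε) ∘ₗ cofreeComul C.obj C.Δ s = LinearMap.id := by
  refine schur_hom_ext' fun n c a => ?_
  rw [LinearMap.comp_apply, cofreeComul_of, LinearMap.id_apply, ← sch_ofFn]
  -- The right-hand `c` is replaced by its image under the counit law, after which both sides are
  -- linear in `Δ c` and can be compared on pure tensors.
  have hc := LinearMap.congr_fun C.counit_right (Tot.of C.obj n c)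
  rw [LinearMap.comp_apply, LinearMap.id_apply] at hc
  conv_rhs => rw [← hc]
  refine arity_word_eq (F := Schur.map C.obj (counitProj C.obj C.ε) ∘ₗ cut C.obj s)
    (G := Schur.ofTensor C.obj ∘ₗ TensorProduct.map (counitRight C.obj C.ε) LinearMap.id)
    (S := Set.univ) (fun k p m e q l _ hq hl _ => ?_) (C.Δ_arity n c) (by simp)
  simp only [LinearMap.comp_apply, TensorProduct.map_tmul, LinearMap.id_apply]
  rw [cut_of hs p hq hl, schur_map_of, counitRight_of]
  by_cases hm : ∃ j, m j ≠ 1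
  · obtain ⟨j, hj⟩ := hm
    rw [(PiTensorProduct.tprod K).map_coord_zero j (counitProj_sch_of_ne hj _ _),
      Finset.prod_eq_zero (Finset.mem_univ j)]
    · simp
    · simp [counitTot, DirectSum.component.of, hj]
  · push Not at hm
    obtain rfl : m = fun _ => 1 := funext hm
    rcases exists_eq_zero_or_degree C hq with ⟨j, hj⟩ | rfl
    · rw [(PiTensorProduct.tprod K).map_coord_zero j (by rw [hj]; simp [sch]),
        Finset.prod_eq_zero (Finset.mem_univ j)]
      · simp
      · simp [counitTot, hj]
    · have hx : ∀ j, ∃ x, l j = [x] := fun j => List.length_eq_one_iff.mp (hl j)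
      choose x hx using hx
      obtain rfl : l = fun j => [x j] := funext hx
      simp only [tw_zero_exponent]
      simp only [List.map_cons, List.map_nil, LinearMap.id_apply, counitProj_sch_one]
      rw [MultilinearMap.map_smul_univ, flatten_ofFn_singleton, TensorProduct.tmul_smul, map_smul,
        ← TensorProduct.smul_tmul', map_smul, ← sch_ofFn]
      simp [counitTot, sch]

end Units

/-! ## Algebras and coalgebras with an explicit sign operator -/

section Laws

variable {K : Type u} [Field K]

/-- `B` is a dg algebra with sign operator `s`. -/
structure NSAlgData.IsAlg {P : NSOperad.{u, v} K} (B : NSAlgData.{u, v, w} P)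
    (s : B.carrier →ₗ[K] B.carrier) : Prop where
  graded : IsGraded B.gr s
  d_mem : ∀ i : ℤ, ∀ a ∈ B.gr i, B.d a ∈ B.gr (i + 1)
  d_d : B.d ∘ₗ B.d = 0
  γ_degree : ∀ i : ℤ, ∀ z ∈ Schur.gr P.obj B.gr i, B.γ z ∈ B.gr i
  γ_d : B.γ ∘ₗ Schur.d P.obj s B.d = B.d ∘ₗ B.γ
  assoc : B.γ ∘ₗ Schur.map P.obj B.γ = B.γ ∘ₗ freeMul P.obj P.γ s
  unit : B.γ ∘ₗ generator P = LinearMap.id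

/-- `W` is a conilpotent dg coalgebra with sign operator `s`. -/
structure NSCoalgData.IsCoalg {C : NSCooperad.{u, v} K} (W : NSCoalgData.{u, v, w} C)
    (s : W.carrier →ₗ[K] W.carrier) : Prop where
  graded : IsGraded W.gr s
  d_mem : ∀ i : ℤ, ∀ a ∈ W.gr i, W.d a ∈ W.gr (i + 1)
  d_d : W.d ∘ₗ W.d = 0
  Δ_degree : ∀ i : ℤ, ∀ a ∈ W.gr i, W.Δ a ∈ Schur.gr C.obj W.gr i
  Δ_d : Schur.d C.obj s W.d ∘ₗ W.Δ = W.Δ ∘ₗ W.d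
  coassoc : Schur.map C.obj W.Δ ∘ₗ W.Δ = cofreeComul C.obj C.Δ s ∘ₗ W.Δ
  counit : counitProj C.obj C.ε ∘ₗ W.Δ = LinearMap.id

theorem NSAlg.isAlg {P : NSOperad.{u, v} K} (A : NSAlg.{u, v, w} P) : A.toData.IsAlg A.sgn where
  graded := A.isGraded
  d_mem := A.d_mem
  d_d := LinearMap.ext A.d_d
  γ_degree := A.γ_degree
  γ_d := A.γ_d
  assoc := A.assoc
  unit := LinearMap.ext fun a => by
    have h1 := sch_ofFn (P := P.obj) 1 P.one (fun _ => a)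
    rw [List.ofFn_succ, List.ofFn_zero] at h1
    rw [LinearMap.comp_apply, generator_eq, h1]
    exact A.unit a

theorem NSCoalg.isCoalg {C : NSCooperad.{u, v} K} (V : NSCoalg.{u, v, w} C) :
    V.toData.IsCoalg V.sgn where
  graded := V.isGraded
  d_mem := V.d_mem
  d_d := LinearMap.ext V.d_d
  Δ_degree := V.Δ_degree
  Δ_d := V.Δ_d
  coassoc := V.coassoc
  counit := V.counit

end Laws

/-! ## Morphisms to the bar and from the cobar construction -/

section Morphisms

variable {K : Type u} [Field K] {C : NSCooperad.{u, v} K} {P : NSOperad.{u, w} K}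
variable (α : TwistingMorphism C P)

theorem app_natural {X : Type x} [AddCommGroup X] [Module K X] {Y : Type y} [AddCommGroup Y]
    [Module K Y] (f : X →ₗ[K] Y) :
    α.app Y ∘ₗ Schur.map C.obj f = Schur.map P.obj f ∘ₗ α.app X := by
  simp only [Schur.map, TwistingMorphism.app, ← DirectSum.lmap_comp, ← TensorProduct.map_comp,
    LinearMap.id_comp, LinearMap.comp_id]

/-- The curvature `d_B ψ - ψ d_W + γ_B (α ∘ ψ) Δ_W` of a linear map `ψ` of degree zero. -/
def curv (W : NSCoalgData.{u, v, x} C) (B : NSAlgData.{u, w, y} P)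
    (ψ : W.carrier →ₗ[K] B.carrier) : W.carrier →ₗ[K] B.carrier :=
  B.d ∘ₗ ψ - ψ ∘ₗ W.d + B.γ ∘ₗ α.app B.carrier ∘ₗ Schur.map C.obj ψ ∘ₗ W.Δ

/-- Linear maps of degree zero with vanishing curvature. -/
structure IsTwisting (W : NSCoalgData.{u, v, x} C) (B : NSAlgData.{u, w, y} P)
    (ψ : W.carrier →ₗ[K] B.carrier) : Prop where
  degree : ∀ i, ∀ a ∈ W.gr i, ψ a ∈ B.gr i
  curv_eq_zero : curv α W B ψ = 0

/-- The differential of the bar construction. -/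
def barD (B : NSAlgData.{u, w, y} P) (s : B.carrier →ₗ[K] B.carrier) :
    Schur C.obj B.carrier →ₗ[K] Schur C.obj B.carrier :=
  opD C.obj B.carrier + ins C.obj s B.d LinearMap.id +
    ins C.obj (s ∘ₗ counitProj C.obj C.ε) (B.γ ∘ₗ α.app B.carrier) (counitProj C.obj C.ε) ∘ₗ
      cofreeComul C.obj C.Δ s

theorem bar_d (A : NSAlg.{u, w, y} P) : (bar α A).d = barD α A.toData A.sgn :=
  congrArg (fun f : Schur C.obj A.carrier →ₗ[K] Schur C.obj A.carrier => f +
    ins C.obj (A.sgn ∘ₗ counitProj C.obj C.ε) (A.γ ∘ₗ α.app A.carrier) (counitProj C.obj C.ε) ∘ₗ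
      cofreeComul C.obj C.Δ A.sgn) (schur_d_eq A.sgn A.d)

/-- The differential of the cobar construction. -/
def cobarD (W : NSCoalgData.{u, v, x} C) (s : W.carrier →ₗ[K] W.carrier) :
    Schur P.obj W.carrier →ₗ[K] Schur P.obj W.carrier :=
  opD P.obj W.carrier + ins P.obj s W.d LinearMap.id -
    freeMul P.obj P.γ s ∘ₗ ins P.obj (generator P ∘ₗ s) (α.app W.carrier ∘ₗ W.Δ) (generator P)

theorem cobar_d (V : NSCoalg.{u, v, x} C) : (cobar α V).d = cobarD α V.toData V.sgn :=
  congrArg (fun f : Schur P.obj V.carrier →ₗ[K] Schur P.obj V.carrier => f -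
    freeMul P.obj P.γ V.sgn ∘ₗ ins P.obj (generator P ∘ₗ V.sgn) (α.app V.carrier ∘ₗ V.Δ)
      (generator P)) (schur_d_eq V.sgn V.d)

variable {α}
variable {W : NSCoalgData.{u, v, x} C} {sW : W.carrier →ₗ[K] W.carrier}
variable {B : NSAlgData.{u, w, y} P} {sB : B.carrier →ₗ[K] B.carrier}

/-- Uniqueness in the cofree property: apply `C ∘ counitProj` to the compatibility with the
comultiplications. -/
theorem eq_map_comp_Δ (hs : sB ∘ₗ sB = LinearMap.id) {f : W.carrier →ₗ[K] Schur C.obj B.carrier}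
    (hΔ : Schur.map C.obj f ∘ₗ W.Δ = cofreeComul C.obj C.Δ sB ∘ₗ f) :
    f = Schur.map C.obj (counitProj C.obj C.ε ∘ₗ f) ∘ₗ W.Δ := by
  rw [schur_map_comp, LinearMap.comp_assoc, hΔ, ← LinearMap.comp_assoc,
    map_counitProj_cofreeComul C hs, LinearMap.id_comp]

/-- Existence in the cofree property: coassociativity of `W` together with naturality of the cofree
comultiplication. -/
theorem map_comp_Δ (hW : W.IsCoalg sW) {X : Type y} [AddCommGroup X] [Module K X] {sX : X →ₗ[K] X}
    (hX : sX ∘ₗ sX = LinearMap.id) {ψ : W.carrier →ₗ[K] X} (hψ : ψ ∘ₗ sW = sX ∘ₗ ψ) :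
    Schur.map C.obj (Schur.map C.obj ψ ∘ₗ W.Δ) ∘ₗ W.Δ =
      cofreeComul C.obj C.Δ sX ∘ₗ Schur.map C.obj ψ ∘ₗ W.Δ := by
  rw [schur_map_comp, LinearMap.comp_assoc, hW.coassoc, ← LinearMap.comp_assoc,
    ← LinearMap.comp_assoc, cofreeComul_natural C.Δ_arity hW.graded.involutive hX hψ]

theorem counitProj_map_Δ (hW : W.IsCoalg sW) {X : Type y} [AddCommGroup X] [Module K X] (ψ : W.carrier →ₗ[K] X) :
    counitProj C.obj C.ε ∘ₗ Schur.map C.obj ψ ∘ₗ W.Δ = ψ := by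
  rw [← LinearMap.comp_assoc, counitProj_natural, LinearMap.comp_assoc, hW.counit,
    LinearMap.comp_id]

/-- The failure of `(C ∘ ψ) Δ` to commute with the differentials. -/
theorem bar_d_comp (hW : W.IsCoalg sW) (hs : sB ∘ₗ sB = LinearMap.id) {ψ : W.carrier →ₗ[K] B.carrier}
    (hψ : ψ ∘ₗ sW = sB ∘ₗ ψ) :
    barD α B sB ∘ₗ (Schur.map C.obj ψ ∘ₗ W.Δ) - (Schur.map C.obj ψ ∘ₗ W.Δ) ∘ₗ W.d =
      ins C.obj (sB ∘ₗ ψ) (curv α W B ψ) ψ ∘ₗ W.Δ := by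
  have h1 : (Schur.map C.obj ψ ∘ₗ W.Δ) ∘ₗ W.d =
      (opD C.obj B.carrier ∘ₗ Schur.map C.obj ψ + ins C.obj (sB ∘ₗ ψ) (ψ ∘ₗ W.d) ψ) ∘ₗ W.Δ := by
    rw [LinearMap.comp_assoc, ← hW.Δ_d, schur_d_eq, ← LinearMap.comp_assoc, LinearMap.comp_add,
      opD_natural, map_comp_ins, hψ, LinearMap.comp_id]
  -- As `(C ∘ ψ) Δ` is compatible with the comultiplications, the insertion is precomposed with `C ∘
  -- ((C ∘ ψ) Δ)`, and there each counit projection becomes `ψ`.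
  have h2 : ins C.obj (sB ∘ₗ counitProj C.obj C.ε) (B.γ ∘ₗ α.app B.carrier)
      (counitProj C.obj C.ε) ∘ₗ cofreeComul C.obj C.Δ sB ∘ₗ Schur.map C.obj ψ ∘ₗ W.Δ =
      ins C.obj (sB ∘ₗ ψ) (B.γ ∘ₗ α.app B.carrier ∘ₗ Schur.map C.obj ψ ∘ₗ W.Δ) ψ ∘ₗ W.Δ := by
    rw [← map_comp_Δ hW hs hψ, ← LinearMap.comp_assoc, ins_comp_map,
      LinearMap.comp_assoc, counitProj_map_Δ hW, LinearMap.comp_assoc]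
  rw [h1, curv, barD, LinearMap.add_comp, LinearMap.comp_assoc, h2, ← LinearMap.comp_assoc,
    LinearMap.add_comp, ins_comp_map, ins_add, ins_sub]
  simp only [LinearMap.add_comp, LinearMap.sub_comp, LinearMap.id_comp]
  abel

theorem counitProj_mem_gr {X : Type y} [AddCommGroup X] [Module K X] {gX : ℤ → Submodule K X}
    (i : ℤ) (z : Schur C.obj X) (hz : z ∈ Schur.gr C.obj gX i) :
    counitProj C.obj C.ε z ∈ gX i := by
  refine schur_gr_induction hz _ _ fun n e g c a hi hc ha => ?_
  by_cases hn : n = 1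
  · subst hn
    by_cases hc0 : c = 0
    · simp [hc0]
    · have he : e = 0 := by
        by_contra hne
        have hd := (C.obj 1).internal.submodule_iSupIndep.pairwiseDisjoint hne
        exact hc0 ((Submodule.disjoint_def.mp hd) c hc (by rw [C.reduced_one_degree]; trivial))
      subst he
      have : g 0 = i := by simpa using hi
      have := this ▸ ha 0
      simpa [counitProj] using (gX i).smul_mem _ this
  · rw [counitProj_of_ne hn]; exact zero_mem _

/-- For a chain map the defect in `bar_d_comp` is zero; its projection to the cogenerators is the
curvature. That the bar differential squares to zero plays no role. -/
theorem isTwisting_of_bar (hW : W.IsCoalg sW) (hB : IsGraded B.gr sB) {f : W.carrier →ₗ[K] Schur C.obj B.carrier}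
    (hdeg : ∀ i, ∀ a ∈ W.gr i, f a ∈ Schur.gr C.obj B.gr i)
    (hd : f ∘ₗ W.d = barD α B sB ∘ₗ f)
    (hΔ : Schur.map C.obj f ∘ₗ W.Δ = cofreeComul C.obj C.Δ sB ∘ₗ f) :
    IsTwisting α W B (counitProj C.obj C.ε ∘ₗ f) := by
  have h0 : ∀ i, ∀ a ∈ W.gr i, (counitProj C.obj C.ε ∘ₗ f) a ∈ B.gr i :=
    fun i a ha => counitProj_mem_gr i _ (hdeg i a ha)
  refine ⟨h0, ?_⟩
  have h := bar_d_comp (α := α) hW hB.involutive (hW.graded.comm_zero hB.sgn_of_mem h0)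
  rw [← eq_map_comp_Δ hB.involutive hΔ, ← hd] at h
  replace h := (sub_self (G := W.carrier →ₗ[K] Schur C.obj B.carrier) _).symm.trans h
  have h' := congrArg (fun g => counitProj C.obj C.ε ∘ₗ g) h
  simp only [LinearMap.comp_zero] at h'
  rw [← LinearMap.comp_assoc, counitProj_ins, LinearMap.comp_assoc, hW.counit,
    LinearMap.comp_id] at h'
  exact h'.symm

theorem IsTwisting.bar_comm_d (hW : W.IsCoalg sW) (hB : IsGraded B.gr sB) {ψ : W.carrier →ₗ[K] B.carrier}
    (h : IsTwisting α W B ψ) :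
    (Schur.map C.obj ψ ∘ₗ W.Δ) ∘ₗ W.d = barD α B sB ∘ₗ Schur.map C.obj ψ ∘ₗ W.Δ := by
  have h1 := bar_d_comp (α := α) hW hB.involutive (hW.graded.comm_zero hB.sgn_of_mem h.degree)
  rw [h.curv_eq_zero, ins_zero, LinearMap.zero_comp] at h1
  exact ((sub_eq_zero (G := W.carrier →ₗ[K] Schur C.obj B.carrier)).mp h1).symm

/-- Uniqueness in the free property: a word of generators is multiplied back to itself, and `g`
commutes with that multiplication. -/
theorem eq_γ_comp_map (hs : sW ∘ₗ sW = LinearMap.id) {g : Schur P.obj W.carrier →ₗ[K] B.carrier}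
    (hγ : g ∘ₗ freeMul P.obj P.γ sW = B.γ ∘ₗ Schur.map P.obj g) :
    g = B.γ ∘ₗ Schur.map P.obj (g ∘ₗ generator P) := by
  rw [schur_map_comp, ← LinearMap.comp_assoc, ← hγ, LinearMap.comp_assoc,
    freeMul_map_generator P hs, LinearMap.comp_id]

/-- Existence in the free property, from associativity of `B` and naturality of the free
multiplication. -/
theorem γ_comp_map (hB : B.IsAlg sB) {X : Type x} [AddCommGroup X] [Module K X] {sX : X →ₗ[K] X}
    (hX : sX ∘ₗ sX = LinearMap.id) {φ : X →ₗ[K] B.carrier} (hφ : φ ∘ₗ sX = sB ∘ₗ φ) :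
    (B.γ ∘ₗ Schur.map P.obj φ) ∘ₗ freeMul P.obj P.γ sX =
      B.γ ∘ₗ Schur.map P.obj (B.γ ∘ₗ Schur.map P.obj φ) := by
  rw [schur_map_comp, ← LinearMap.comp_assoc, hB.assoc, LinearMap.comp_assoc, LinearMap.comp_assoc,
    freeMul_natural P.γ hX hB.graded.involutive hφ]

theorem γ_map_comp_generator (hB : B.IsAlg sB) {X : Type x} [AddCommGroup X] [Module K X] (φ : X →ₗ[K] B.carrier) :
    (B.γ ∘ₗ Schur.map P.obj φ) ∘ₗ generator P = φ := by
  rw [LinearMap.comp_assoc, schur_map_generator, ← LinearMap.comp_assoc, hB.unit, LinearMap.id_comp]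

/-- The failure of `γ_B (P ∘ φ)` to commute with the differentials. -/
theorem cobar_d_comp (hB : B.IsAlg sB) (hs : sW ∘ₗ sW = LinearMap.id) {φ : W.carrier →ₗ[K] B.carrier}
    (hφ : φ ∘ₗ sW = sB ∘ₗ φ) :
    B.d ∘ₗ (B.γ ∘ₗ Schur.map P.obj φ) - (B.γ ∘ₗ Schur.map P.obj φ) ∘ₗ cobarD α W sW =
      B.γ ∘ₗ ins P.obj (sB ∘ₗ φ) (curv α W B φ) φ := by
  have h1 : B.d ∘ₗ (B.γ ∘ₗ Schur.map P.obj φ) =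
      B.γ ∘ₗ (Schur.map P.obj φ ∘ₗ opD P.obj W.carrier + ins P.obj (sB ∘ₗ φ) (B.d ∘ₗ φ) φ) := by
    rw [← LinearMap.comp_assoc, ← hB.γ_d, schur_d_eq, LinearMap.comp_assoc, LinearMap.add_comp,
      opD_natural, ins_comp_map, LinearMap.id_comp]
  have h2 : (B.γ ∘ₗ Schur.map P.obj φ) ∘ₗ (freeMul P.obj P.γ sW ∘ₗ
      ins P.obj (generator P ∘ₗ sW) (α.app W.carrier ∘ₗ W.Δ) (generator P)) =
      B.γ ∘ₗ ins P.obj (sB ∘ₗ φ) (B.γ ∘ₗ α.app B.carrier ∘ₗ Schur.map C.obj φ ∘ₗ W.Δ) φ := by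
    have h3 : (B.γ ∘ₗ Schur.map P.obj φ) ∘ₗ (α.app W.carrier ∘ₗ W.Δ) =
        B.γ ∘ₗ α.app B.carrier ∘ₗ Schur.map C.obj φ ∘ₗ W.Δ := by
      rw [LinearMap.comp_assoc, ← LinearMap.comp_assoc (h := Schur.map P.obj φ), ← app_natural,
        LinearMap.comp_assoc]
    rw [← LinearMap.comp_assoc, γ_comp_map hB hs hφ, LinearMap.comp_assoc, map_comp_ins,
      ← LinearMap.comp_assoc (g := generator P), γ_map_comp_generator hB, h3, hφ]
  have h5 : (B.γ ∘ₗ Schur.map P.obj φ) ∘ₗ ins P.obj sW W.d LinearMap.id =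
      B.γ ∘ₗ ins P.obj (sB ∘ₗ φ) (φ ∘ₗ W.d) φ := by
    rw [LinearMap.comp_assoc, map_comp_ins, hφ, LinearMap.comp_id]
  rw [h1, cobarD, LinearMap.comp_sub, LinearMap.comp_add, LinearMap.comp_add, h2, curv, h5, ins_add,
    ins_sub]
  simp only [LinearMap.comp_add, LinearMap.comp_sub, LinearMap.comp_assoc]
  abel

theorem generator_mem_gr {X : Type x} [AddCommGroup X] [Module K X] {gX : ℤ → Submodule K X}
    (i : ℤ) (a : X) (ha : a ∈ gX i) : generator P a ∈ Schur.gr P.obj gX i := by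
  have h1 := sch_ofFn (P := P.obj) 1 P.one (fun _ => a)
  rw [List.ofFn_succ, List.ofFn_zero] at h1
  rw [generator_eq, h1]
  exact schur_of_mem_gr (f := fun _ => i) P.one_degree (fun _ => ha) (by simp)

theorem isTwisting_of_cobar (hB : B.IsAlg sB) (hW : IsGraded W.gr sW) {g : Schur P.obj W.carrier →ₗ[K] B.carrier}
    (hdeg : ∀ i, ∀ z ∈ Schur.gr P.obj W.gr i, g z ∈ B.gr i)
    (hd : g ∘ₗ cobarD α W sW = B.d ∘ₗ g)
    (hγ : g ∘ₗ freeMul P.obj P.γ sW = B.γ ∘ₗ Schur.map P.obj g) :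
    IsTwisting α W B (g ∘ₗ generator P) := by
  have h0 : ∀ i, ∀ a ∈ W.gr i, (g ∘ₗ generator P) a ∈ B.gr i :=
    fun i a ha => hdeg i _ (generator_mem_gr i a ha)
  refine ⟨h0, ?_⟩
  have h := cobar_d_comp (α := α) hB hW.involutive (hW.comm_zero hB.graded.sgn_of_mem h0)
  rw [← eq_γ_comp_map hW.involutive hγ, ← hd, sub_self] at h
  have h' := congrArg (fun f => f ∘ₗ generator P) h
  simp only [LinearMap.zero_comp] at h'
  rw [LinearMap.comp_assoc, ins_generator, ← LinearMap.comp_assoc, hB.unit,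
    LinearMap.id_comp] at h'
  exact h'.symm

theorem IsTwisting.cobar_comm_d (hB : B.IsAlg sB) (hW : IsGraded W.gr sW) {φ : W.carrier →ₗ[K] B.carrier}
    (h : IsTwisting α W B φ) :
    (B.γ ∘ₗ Schur.map P.obj φ) ∘ₗ cobarD α W sW = B.d ∘ₗ B.γ ∘ₗ Schur.map P.obj φ := by
  have h1 := cobar_d_comp (α := α) hB hW.involutive (hW.comm_zero hB.graded.sgn_of_mem h.degree)
  rw [h.curv_eq_zero, ins_zero, LinearMap.comp_zero, sub_eq_zero] at h1
  exact h1.symm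

/-- Morphisms of coalgebras to the bar construction. -/
def barHomEquiv (hW : W.IsCoalg sW) (A : NSAlg.{u, w, y} P) :
    NSCoalgHom W (bar α A) ≃ {ψ : W.carrier →ₗ[K] A.toData.carrier // IsTwisting α W A.toData ψ} where
  toFun f := ⟨counitProj C.obj C.ε ∘ₗ (f.toLin : W.carrier →ₗ[K] Schur C.obj A.toData.carrier),
    isTwisting_of_bar hW A.isAlg.graded f.degree (bar_d α A ▸ f.comm_d) f.comm_Δ⟩
  invFun ψ :=
    { toLin := (Schur.map C.obj ψ.1 ∘ₗ W.Δ : W.carrier →ₗ[K] Schur C.obj A.toData.carrier)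
      degree := fun i a ha => schur_map_mem_gr ψ.2.degree (hW.Δ_degree i a ha)
      comm_d := (ψ.2.bar_comm_d hW A.isAlg.graded).trans (by rw [bar_d]; rfl)
      comm_Δ := map_comp_Δ hW A.isAlg.graded.involutive
        (hW.graded.comm_zero A.isAlg.graded.sgn_of_mem ψ.2.degree) }
  left_inv f := NSCoalgHom.ext
    (eq_map_comp_Δ (B := A.toData) A.isAlg.graded.involutive f.comm_Δ).symm
  right_inv ψ := Subtype.ext (counitProj_map_Δ hW ψ.1)

/-- Morphisms of algebras from the cobar construction. -/
def cobarHomEquiv (hB : B.IsAlg sB) (V : NSCoalg.{u, v, x} C) :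
    NSAlgHom (cobar α V) B ≃ {φ : V.toData.carrier →ₗ[K] B.carrier // IsTwisting α V.toData B φ} where
  toFun g := ⟨(g.toLin : Schur P.obj V.toData.carrier →ₗ[K] B.carrier) ∘ₗ generator P,
    isTwisting_of_cobar hB V.isCoalg.graded g.degree (cobar_d α V ▸ g.comm_d) g.comm_γ⟩
  invFun φ :=
    { toLin := (B.γ ∘ₗ Schur.map P.obj φ.1 : Schur P.obj V.toData.carrier →ₗ[K] B.carrier)
      degree := fun i z hz => hB.γ_degree i _ (schur_map_mem_gr φ.2.degree hz)
      comm_d := by rw [cobar_d]; exact φ.2.cobar_comm_d hB V.isCoalg.graded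
      comm_γ := γ_comp_map hB V.isCoalg.graded.involutive
        (V.isCoalg.graded.comm_zero hB.graded.sgn_of_mem φ.2.degree) }
  left_inv g := NSAlgHom.ext
    (eq_γ_comp_map (W := V.toData) V.isCoalg.graded.involutive g.comm_γ).symm
  right_inv φ := Subtype.ext (γ_map_comp_generator hB φ.1)

end Morphisms

/-! ## Tensor products with a dg algebra -/

section LMap

variable {K : Type u} [Field K] {P : ℕ → DGMod.{u, v} K} {Q : ℕ → DGMod.{u, w} K}
variable {X : Type x} [AddCommGroup X] [Module K X]
variable {Y : Type y} [AddCommGroup Y] [Module K Y]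

/-- Aritywise operators on `P ∘ X` are computed in `Tot P ⊗ Words X`, where operations and words are
independent factors and words can be treated by induction. -/
theorem lmap_ofTensor (φ : ∀ n, P n →ₗ[K] Q n) (ψ : ∀ n, (⨂[K]^n X) →ₗ[K] (⨂[K]^n Y))
    (z : Tot P ⊗[K] Words K X) :
    DirectSum.lmap (fun n => TensorProduct.map (φ n) (ψ n)) (Schur.ofTensor P z) =
      Schur.ofTensor Q (TensorProduct.map (DirectSum.lmap φ) (DirectSum.lmap ψ) z) := by
  have : DirectSum.lmap (fun n => TensorProduct.map (φ n) (ψ n)) ∘ₗ Schur.ofTensor P =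
      Schur.ofTensor Q ∘ₗ TensorProduct.map (DirectSum.lmap φ) (DirectSum.lmap ψ) := by
    refine tmul_word_hom_ext fun n p l => ?_
    simp only [LinearMap.comp_apply, TensorProduct.map_tmul, ofTensor_of_tmul]
    have h : DirectSum.lmap φ (Tot.of P n p) = Tot.of Q n (φ n p) := DirectSum.lmap_lof _ _ _
    rw [h, ofTensor_of_tmul, Schur.of, DirectSum.lmap_lof, TensorProduct.map_tmul]
    rfl
  exact LinearMap.congr_fun this z

theorem toTensor_lmap (φ : ∀ n, P n →ₗ[K] Q n) (ψ : ∀ n, (⨂[K]^n X) →ₗ[K] (⨂[K]^n Y))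
    (z : Schur P X) :
    Schur.toTensor Q (DirectSum.lmap (fun n => TensorProduct.map (φ n) (ψ n)) z) =
      TensorProduct.map (DirectSum.lmap φ) (DirectSum.lmap ψ) (Schur.toTensor P z) := by
  have : Schur.toTensor Q ∘ₗ DirectSum.lmap (fun n => TensorProduct.map (φ n) (ψ n)) =
      TensorProduct.map (DirectSum.lmap φ) (DirectSum.lmap ψ) ∘ₗ Schur.toTensor P := by
    refine DirectSum.linearMap_ext _ fun n => ?_
    refine TensorProduct.ext' fun p t => ?_
    simp [Schur.toTensor, DirectSum.lmap_lof]
  exact LinearMap.congr_fun this z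

theorem ins_ofTensor (f g h : X →ₗ[K] Y) (q : Tot P) (w : Words K X) :
    ins P f g h (Schur.ofTensor P (q ⊗ₜ w)) =
      Schur.ofTensor P (Tot.sgn P q ⊗ₜ winsert f g h w) := lmap_ofTensor _ _ _

theorem schSgn_ofTensor (s : X →ₗ[K] X) (q : Tot P) (w : Words K X) :
    schSgn P s (Schur.ofTensor P (q ⊗ₜ w)) = Schur.ofTensor P (Tot.sgn P q ⊗ₜ wmap s w) :=
  lmap_ofTensor _ _ _

theorem opD_ofTensor (q : Tot P) (w : Words K X) :
    opD P X (Schur.ofTensor P (q ⊗ₜ w)) = Schur.ofTensor P (Tot.d P q ⊗ₜ w) := by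
  rw [opD, lmap_ofTensor, DirectSum.lmap_id]
  rfl

theorem toTensor_ins (f g h : X →ₗ[K] Y) (z : Schur P X) :
    Schur.toTensor P (ins P f g h z) =
      TensorProduct.map (Tot.sgn P) (winsert f g h) (Schur.toTensor P z) := toTensor_lmap _ _ _

theorem toTensor_opD (z : Schur P X) :
    Schur.toTensor P (opD P X z) =
      TensorProduct.map (Tot.d P) LinearMap.id (Schur.toTensor P z) := by
  rw [opD, toTensor_lmap, DirectSum.lmap_id]
  rfl

theorem toTensor_map (f : X →ₗ[K] Y) (z : Schur P X) :
    Schur.toTensor P (Schur.map P f z) =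
      TensorProduct.map LinearMap.id (wmap f) (Schur.toTensor P z) := by
  rw [Schur.map, toTensor_lmap, DirectSum.lmap_id]
  rfl

theorem winsert_comp_wmap {Z : Type*} [AddCommGroup Z] [Module K Z] (u : X →ₗ[K] Y)
    (f g h : Y →ₗ[K] Z) :
    winsert f g h ∘ₗ wmap u = winsert (f ∘ₗ u) (g ∘ₗ u) (h ∘ₗ u) := by
  simp only [winsert, wmap, ← DirectSum.lmap_comp, insertEach_comp_map]

theorem wmap_comp_winsert {Z : Type*} [AddCommGroup Z] [Module K Z] (u : Y →ₗ[K] Z)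
    (f g h : X →ₗ[K] Y) :
    wmap u ∘ₗ winsert f g h = winsert (u ∘ₗ f) (u ∘ₗ g) (u ∘ₗ h) := by
  simp only [winsert, wmap, ← DirectSum.lmap_comp, map_comp_insertEach]

theorem winsert_smul (c : K) (f g h : X →ₗ[K] Y) : winsert f (c • g) h = c • winsert f g h := by
  refine DirectSum.linearMap_ext _ fun n => LinearMap.ext fun z => ?_
  simp [winsert, DirectSum.lmap_lof, insertEach_smul]

end LMap

/-- The structure of a dg algebra on `R`. -/
structure DGAlg (K : Type u) [Field K] (R : Type z) [AddCommGroup R] [Module K R] where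
  gr : ℤ → Submodule K R
  par : ZMod 2 → R →ₗ[K] R
  sgn : R →ₗ[K] R
  d : R →ₗ[K] R
  mul : R →ₗ[K] R →ₗ[K] R
  one : R
  graded : IsGraded gr sgn
  par_of_mem : ∀ (ε : ZMod 2) (i : ℤ) (a : R), a ∈ gr i →
    par ε a = if (i : ZMod 2) = ε then a else 0
  mul_assoc : ∀ a b c, mul (mul a b) c = mul a (mul b c)
  one_mul : ∀ a, mul one a = a
  mul_one : ∀ a, mul a one = a
  one_mem : one ∈ gr 0
  mul_mem : ∀ i j a b, a ∈ gr i → b ∈ gr j → mul a b ∈ gr (i + j)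
  d_mem : ∀ i, ∀ a ∈ gr i, d a ∈ gr (i + 1)
  d_d : ∀ a, d (d a) = 0
  d_one : d one = 0
  d_mul : ∀ a b, d (mul a b) = mul (d a) b + mul (sgn a) (d b)

section TensorDG

variable {K : Type u} [Field K] {P : ℕ → DGMod.{u, v} K}
variable {X : Type x} [AddCommGroup X] [Module K X]
variable {Y : Type y} [AddCommGroup Y] [Module K Y]
variable {R : Type z} [AddCommGroup R] [Module K R] (D : DGAlg K R)

theorem DGAlg.par_add (ν : R) : D.par 0 ν + D.par 1 ν = ν := by
  have : D.par 0 + D.par 1 = LinearMap.id := by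
    refine LinearMap.ext_on D.graded.span ?_
    rintro a ⟨i, ha⟩
    rw [LinearMap.add_apply, D.par_of_mem _ i a ha, D.par_of_mem _ i a ha]
    rcases zmod_two_cases (i : ZMod 2) with h | h <;> simp [h]
  exact LinearMap.congr_fun this ν

theorem DGAlg.par_sub (ν : R) : D.par 0 ν - D.par 1 ν = D.sgn ν := by
  have : D.par 0 - D.par 1 = D.sgn := by
    refine LinearMap.ext_on D.graded.span ?_
    rintro a ⟨i, ha⟩
    rw [LinearMap.sub_apply, D.par_of_mem _ i a ha, D.par_of_mem _ i a ha,
      D.graded.sgn_of_mem i a ha]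
    rcases zmod_two_cases (i : ZMod 2) with h | h <;> simp [h]
  exact LinearMap.congr_fun this ν

theorem DGAlg.sgn_one : D.sgn D.one = D.one := by
  rw [D.graded.sgn_of_mem 0 _ D.one_mem]; simp

theorem DGAlg.sgn_mul (a b : R) : D.sgn (D.mul a b) = D.mul (D.sgn a) (D.sgn b) := by
  have : D.mul.compr₂ D.sgn = D.mul.compl₁₂ D.sgn D.sgn := by
    refine LinearMap.ext_on D.graded.span ?_
    rintro a ⟨i, ha⟩
    refine LinearMap.ext_on D.graded.span ?_
    rintro b ⟨j, hb⟩
    simp only [LinearMap.compr₂_apply, LinearMap.compl₁₂_apply]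
    rw [D.graded.sgn_of_mem _ _ (D.mul_mem i j a b ha hb), D.graded.sgn_of_mem i a ha,
      D.graded.sgn_of_mem j b hb, Int.cast_add, zsign_add]
    simp [smul_smul, mul_comm]
  exact LinearMap.congr_fun₂ this a b

theorem DGAlg.tw_mul (e : ZMod 2) (a b : R) :
    tw D.sgn e (D.mul a b) = D.mul (tw D.sgn e a) (tw D.sgn e b) := by
  rcases zmod_two_cases e with rfl | rfl <;> simp [D.sgn_mul]

theorem DGAlg.tw_one (e : ZMod 2) : tw D.sgn e D.one = D.one := by
  rcases zmod_two_cases e with rfl | rfl <;> simp [D.sgn_one]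

theorem tensor_hom_ext {Z : Type*} [AddCommMonoid Z] [Module K Z] {f g : X ⊗[K] R →ₗ[K] Z}
    (h : ∀ (x : X) (i : ℤ) (ν : R), ν ∈ D.gr i → f (x ⊗ₜ ν) = g (x ⊗ₜ ν)) : f = g := by
  refine TensorProduct.ext (LinearMap.ext fun x => LinearMap.ext_on D.graded.span ?_)
  rintro ν ⟨i, hν⟩
  exact h x i ν hν

/-- Left multiplication by the letter `x ⊗ ν` on `Words X ⊗ R`, with the Koszul sign. -/
def act (s : X →ₗ[K] X) : X ⊗[K] R →ₗ[K] Module.End K (Words K X ⊗[K] R) :=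
  TensorProduct.lift
    ((TensorProduct.mapBilinear (.id K) (Words K X) R (Words K X) R).compl₁₂
        (LinearMap.mul K (Words K X) ∘ₗ letter) (D.mul ∘ₗ D.par 0) +
      (TensorProduct.mapBilinear (.id K) (Words K X) R (Words K X) R).compl₁₂
        ((wmap s).lcomp K (Words K X) ∘ₗ LinearMap.mul K (Words K X) ∘ₗ letter)
        (D.mul ∘ₗ D.par 1))

theorem act_tmul (s : X →ₗ[K] X) (a : X) (ν : R) (w : Words K X) (ν' : R) :
    act D s (a ⊗ₜ ν) (w ⊗ₜ ν') = (letter a * w) ⊗ₜ D.mul (D.par 0 ν) ν' +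
      (letter a * wmap s w) ⊗ₜ D.mul (D.par 1 ν) ν' := by
  simp [act]

theorem act_of_mem (s : X →ₗ[K] X) (a : X) {i : ℤ} {ν : R} (h : ν ∈ D.gr i) (w : Words K X)
    (ν' : R) :
    act D s (a ⊗ₜ ν) (w ⊗ₜ ν') = (letter a * wmap (tw s i) w) ⊗ₜ D.mul ν ν' := by
  rw [act_tmul, D.par_of_mem _ i _ h, D.par_of_mem _ i _ h]
  rcases zmod_two_cases (i : ZMod 2) with h | h <;> simp [h, wmap_id]

/-- `Words (X ⊗ R) → Words X ⊗ R`: sort the letters and multiply those of `R`. -/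
def collectWords (s : X →ₗ[K] X) : Words K (X ⊗[K] R) →ₗ[K] Words K X ⊗[K] R :=
  DirectSum.toModule K ℕ _ fun n => LinearMap.applyₗ (1 ⊗ₜ D.one) ∘ₗ
    PiTensorProduct.lift ((MultilinearMap.mkPiAlgebraFin K n
      (Module.End K (Words K X ⊗[K] R))).compLinearMap fun _ => act D s)

theorem collectWords_word (s : X →ₗ[K] X) (l : List (X ⊗[K] R)) :
    collectWords D s (word K l) = (l.map (act D s)).prod (1 ⊗ₜ D.one) := by
  obtain ⟨n, a, rfl⟩ : ∃ (n : ℕ) (a : Fin n → X ⊗[K] R), l = List.ofFn a :=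
    ⟨_, l.get, (List.ofFn_get l).symm⟩
  rw [word_ofFn, collectWords, DirectSum.toModule_lof]
  simp [List.map_ofFn, Function.comp_def]

@[simp] theorem collectWords_one (s : X →ₗ[K] X) :
    collectWords D s (1 : Words K (X ⊗[K] R)) = 1 ⊗ₜ D.one := by
  simpa using collectWords_word D s ([] : List (X ⊗[K] R))

theorem collectWords_letter_mul (s : X →ₗ[K] X) (z : X ⊗[K] R) (w : Words K (X ⊗[K] R)) :
    collectWords D s (letter z * w) = act D s z (collectWords D s w) := by
  have : collectWords D s ∘ₗ LinearMap.mulLeft K (letter z) = act D s z ∘ₗ collectWords D s :=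
    words_hom_ext fun l => by
      simp only [LinearMap.comp_apply, LinearMap.mulLeft_apply]
      rw [← word_cons, collectWords_word, collectWords_word]
      simp
  exact LinearMap.congr_fun this w

theorem act_natural {s : X →ₗ[K] X} {s' : Y →ₗ[K] Y} {f : X →ₗ[K] Y} (hf : f ∘ₗ s = s' ∘ₗ f)
    (z : X ⊗[K] R) (y : Words K X ⊗[K] R) :
    act D s' (TensorProduct.map f LinearMap.id z) (TensorProduct.map (wmap f) LinearMap.id y) =
      TensorProduct.map (wmap f) LinearMap.id (act D s z y) := by
  induction z with
  | zero => simp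
  | add z z' h h' => simp only [map_add, LinearMap.add_apply, h, h']
  | tmul a ν =>
    induction y with
    | zero => simp
    | add y y' h h' => simp only [map_add, h, h']
    | tmul w ν' =>
      have hw : wmap s' (wmap f w) = wmap f (wmap s w) := by
        rw [← LinearMap.comp_apply, ← wmap_comp, ← hf, wmap_comp, LinearMap.comp_apply]
      simp only [TensorProduct.map_tmul, LinearMap.id_apply, act_tmul, map_add, wmap_letter_mul, hw]

theorem collectWords_natural {s : X →ₗ[K] X} {s' : Y →ₗ[K] Y} {f : X →ₗ[K] Y}
    (hf : f ∘ₗ s = s' ∘ₗ f) (w : Words K (X ⊗[K] R)) :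
    collectWords D s' (wmap (TensorProduct.map f LinearMap.id) w) =
      TensorProduct.map (wmap f) LinearMap.id (collectWords D s w) := by
  have : collectWords D s' ∘ₗ wmap (TensorProduct.map f LinearMap.id) =
      TensorProduct.map (wmap f) LinearMap.id ∘ₗ collectWords D s := by
    refine words_hom_ext fun l => ?_
    induction l with
    | nil => simp
    | cons z l ih =>
      simp only [LinearMap.comp_apply] at ih ⊢
      rw [word_cons, wmap_letter_mul, collectWords_letter_mul, ih, act_natural D hf,
        collectWords_letter_mul]
  exact LinearMap.congr_fun this w

/-- The differential of `X ⊗ R`. -/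
def tensorD (s d : X →ₗ[K] X) : X ⊗[K] R →ₗ[K] X ⊗[K] R :=
  TensorProduct.map d LinearMap.id + TensorProduct.map s D.d

theorem winsert_anticomm {s d : X →ₗ[K] X} (hd : s ∘ₗ d = -(d ∘ₗ s))
    (w : Words K X) : winsert s d LinearMap.id (wmap s w) = -wmap s (winsert s d LinearMap.id w) := by
  rw [← LinearMap.comp_apply, ← LinearMap.comp_apply (wmap s), winsert_comp_wmap, wmap_comp_winsert,
    hd, ← neg_one_smul K (d ∘ₗ s), winsert_smul, LinearMap.smul_apply, neg_one_smul, neg_neg,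
    LinearMap.id_comp, LinearMap.comp_id]

/-- The Leibniz rule for adding one letter; the rule for words follows by induction, `collectWords`
being the composite of these actions. -/
theorem act_leibniz {s d : X →ₗ[K] X} (hs : s ∘ₗ s = LinearMap.id) (hd : s ∘ₗ d = -(d ∘ₗ s))
    (z : X ⊗[K] R) (y : Words K X ⊗[K] R) :
    tensorD D (wmap s) (winsert s d LinearMap.id) (act D s z y) =
      act D s (tensorD D s d z) y +
        act D s (TensorProduct.map s D.sgn z) (tensorD D (wmap s) (winsert s d LinearMap.id) y) := by
  have hz : ∀ y, tensorD D (wmap s) (winsert s d LinearMap.id) ∘ₗ (act D s).flip y =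
      (act D s).flip y ∘ₗ tensorD D s d + (act D s).flip
        (tensorD D (wmap s) (winsert s d LinearMap.id) y) ∘ₗ TensorProduct.map s D.sgn := by
    intro y
    refine tensor_hom_ext D fun a i ν hν => ?_
    simp only [LinearMap.comp_apply, LinearMap.add_apply, LinearMap.flip_apply]
    induction y with
    | zero => simp
    | add y y' h h' => simp only [map_add, h, h']; abel
    | tmul w ν' =>
      have h2 : ((i + 1 : ℤ) : ZMod 2) = (i : ZMod 2) + 1 := by push_cast; rfl
      have hneg (u v : Words K X) : u * -v = -(u * v) := (LinearMap.mulLeft K u).map_neg v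
      have hsmul (u : Words K X ⊗[K] R) : (-1 : K) • u = -u := neg_one_smul K u
      have hww : wmap s (wmap s w) = w := LinearMap.congr_fun (wmap_involutive hs) w
      simp only [tensorD, LinearMap.add_apply, TensorProduct.map_tmul, LinearMap.id_apply, map_add,
        act_of_mem D s _ hν, act_of_mem D s _ (D.d_mem i ν hν), D.graded.sgn_of_mem i ν hν,
        TensorProduct.tmul_smul, map_smul, LinearMap.smul_apply, winsert_letter_mul,
        wmap_letter_mul, D.d_mul, wmap_id, h2]
      -- For odd `ν` the word `w` picks up `wmap s`, which anticommutes with the differential of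
      -- words. This sign matches the one that `D.sgn` puts on `ν`.
      rcases zmod_two_cases (i : ZMod 2) with h | h
      · simp only [h, tw_zero, wmap_id, LinearMap.id_apply, zsign_zero, one_smul, zero_add, tw_one,
          TensorProduct.tmul_add, TensorProduct.add_tmul]
        abel
      · simp only [h, tw_one, zsign_one, show (1 + 1 : ZMod 2) = 0 from rfl, tw_zero, wmap_id,
          LinearMap.id_apply, winsert_anticomm hd, hww, TensorProduct.tmul_add,
          TensorProduct.add_tmul, neg_smul, one_smul, map_neg, LinearMap.neg_apply,
          TensorProduct.tmul_neg, hneg, hsmul, TensorProduct.neg_tmul]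
        abel
  exact LinearMap.congr_fun (hz y) z

theorem collectWords_leibniz {s d : X →ₗ[K] X} (hs : s ∘ₗ s = LinearMap.id)
    (hd : s ∘ₗ d = -(d ∘ₗ s)) (w : Words K (X ⊗[K] R)) :
    collectWords D s (winsert (TensorProduct.map s D.sgn) (tensorD D s d) LinearMap.id w) =
      tensorD D (wmap s) (winsert s d LinearMap.id) (collectWords D s w) := by
  have : collectWords D s ∘ₗ winsert (TensorProduct.map s D.sgn) (tensorD D s d) LinearMap.id =
      tensorD D (wmap s) (winsert s d LinearMap.id) ∘ₗ collectWords D s := by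
    refine words_hom_ext fun l => ?_
    induction l with
    | nil => simp [tensorD, D.d_one]
    | cons z l ih =>
      simp only [LinearMap.comp_apply] at ih ⊢
      rw [word_cons, winsert_letter_mul, map_add, collectWords_letter_mul, collectWords_letter_mul,
        collectWords_letter_mul, ih, act_leibniz D hs hd, wmap_id, LinearMap.id_apply]
  exact LinearMap.congr_fun this w

/-! ### The map `P ∘ (X ⊗ R) → (P ∘ X) ⊗ R` -/

/-- `Tot P ⊗ (Words X ⊗ R) → (P ∘ X) ⊗ R`. -/
def ofTensorR (P : ℕ → DGMod.{u, v} K) (X : Type x) [AddCommGroup X] [Module K X] (R : Type z)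
    [AddCommGroup R] [Module K R] : Tot P ⊗[K] (Words K X ⊗[K] R) →ₗ[K] Schur P X ⊗[K] R :=
  TensorProduct.map (Schur.ofTensor P) LinearMap.id ∘ₗ
    (TensorProduct.assoc K (Tot P) (Words K X) R).symm.toLinearMap

@[simp] theorem ofTensorR_tmul (q : Tot P) (w : Words K X) (ν : R) :
    ofTensorR P X R (q ⊗ₜ (w ⊗ₜ ν)) = Schur.ofTensor P (q ⊗ₜ w) ⊗ₜ ν := by
  simp [ofTensorR]

/-- `P ∘ (X ⊗ R) → (P ∘ X) ⊗ R`. -/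
def collect (P : ℕ → DGMod.{u, v} K) (s : X →ₗ[K] X) :
    Schur P (X ⊗[K] R) →ₗ[K] Schur P X ⊗[K] R :=
  ofTensorR P X R ∘ₗ TensorProduct.map LinearMap.id (collectWords D s) ∘ₗ Schur.toTensor P

theorem collect_of (s : X →ₗ[K] X) (n : ℕ) (p : P n) (z : Fin n → X ⊗[K] R) :
    collect D P s (Schur.of P n (p ⊗ₜ PiTensorProduct.tprod K z)) =
      ofTensorR P X R (Tot.of P n p ⊗ₜ collectWords D s (word K (List.ofFn z))) := by
  simp [collect, toTensor_of]

theorem collect_natural {s : X →ₗ[K] X} {s' : Y →ₗ[K] Y} {f : X →ₗ[K] Y} (hf : f ∘ₗ s = s' ∘ₗ f) :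
    collect D P s' ∘ₗ Schur.map P (TensorProduct.map f LinearMap.id) =
      TensorProduct.map (Schur.map P f) LinearMap.id ∘ₗ collect D P s := by
  refine schur_hom_ext' fun n p z => ?_
  simp only [LinearMap.comp_apply, collect, toTensor_map]
  rw [toTensor_of]
  simp only [TensorProduct.map_tmul, LinearMap.id_apply, collectWords_natural D hf]
  induction collectWords D s (word K (List.ofFn z)) with
  | zero => simp
  | add y y' h h' => simp only [map_add, TensorProduct.tmul_add, h, h']
  | tmul w ν => simp [schur_map_ofTensor]

/-- The collecting map is a chain map: the differential of the operation is not affected by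
collecting, and the rest is the Leibniz rule for words. -/
theorem collect_leibniz {s d : X →ₗ[K] X} (hs : s ∘ₗ s = LinearMap.id) (hd : s ∘ₗ d = -(d ∘ₗ s)) :
    collect D P s ∘ₗ Schur.d P (TensorProduct.map s D.sgn) (tensorD D s d) =
      tensorD D (schSgn P s) (Schur.d P s d) ∘ₗ collect D P s := by
  refine schur_hom_ext' fun n p z => ?_
  simp only [LinearMap.comp_apply, schur_d_eq, collect, LinearMap.add_apply, map_add, toTensor_ins,
    toTensor_opD]
  rw [toTensor_of]
  simp only [TensorProduct.map_tmul, LinearMap.id_apply, collectWords_leibniz D hs hd]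
  induction collectWords D s (word K (List.ofFn z)) with
  | zero => simp
  | add y y' h h' =>
    simp only [map_add, TensorProduct.tmul_add] at h h' ⊢
    rw [← h, ← h']
    abel
  | tmul w ν =>
    simp only [tensorD, LinearMap.add_apply, TensorProduct.map_tmul, LinearMap.id_apply, map_add,
      TensorProduct.tmul_add, ofTensorR_tmul, opD_ofTensor, ins_ofTensor, schSgn_ofTensor,
      TensorProduct.add_tmul]
    abel

end TensorDG

/-! ## Tensor products of algebras with a dg algebra -/

section Triples

variable {K : Type u} [Field K] {P : ℕ → DGMod.{u, v} K}
variable {X : Type x} [AddCommGroup X] [Module K X]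
variable {Y : Type y} [AddCommGroup Y] [Module K Y]
variable {R : Type z} [AddCommGroup R] [Module K R] (D : DGAlg K R)

/-- The sum of the parities in a list of triples (parity of `a`, `a`, `ν`). -/
def psum (T : List (ZMod 2 × X × R)) : ZMod 2 := (T.map fun t => t.1).sum

/-- The product of the entries `ν`, with the Koszul sign that they acquire by moving past the
entries `a` behind them. -/
def nuProd : List (ZMod 2 × X × R) → R
  | [] => D.one
  | t :: T => D.mul (tw D.sgn (psum T) t.2.2) (nuProd T)

/-- The letters `a ⊗ ν`. -/
def tens (K : Type u) [Field K] {X : Type x} [AddCommGroup X] [Module K X] {R : Type z}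
    [AddCommGroup R] [Module K R] (T : List (ZMod 2 × X × R)) : List (X ⊗[K] R) :=
  T.map fun t => t.2.1 ⊗ₜ t.2.2

/-- The letters `a`. -/
def letters (T : List (ZMod 2 × X × R)) : List X := T.map fun t => t.2.1

/-- The first entry of each triple is the parity of the second. -/
def HasParity (s : X →ₗ[K] X) (T : List (ZMod 2 × X × R)) : Prop :=
  ∀ t ∈ T, s t.2.1 = zsign K t.1 • t.2.1

/-- The sign operators applied to a list of triples. -/
def twist (s : X →ₗ[K] X) (e : ZMod 2) (T : List (ZMod 2 × X × R)) : List (ZMod 2 × X × R) :=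
  T.map fun t => (t.1, tw s e t.2.1, tw D.sgn e t.2.2)

theorem psum_append (T T' : List (ZMod 2 × X × R)) : psum (T ++ T') = psum T + psum T' := by
  simp [psum]

theorem psum_twist (s : X →ₗ[K] X) (e : ZMod 2) (T : List (ZMod 2 × X × R)) :
    psum (twist D s e T) = psum T := by
  simp [psum, twist, Function.comp_def]

theorem psum_ofFn {k : ℕ} (t : Fin k → ZMod 2 × X × R) :
    psum (List.ofFn t) = ∑ j, (t j).1 := by
  simp [psum, List.map_ofFn, List.sum_ofFn]

theorem psum_flatten {k : ℕ} (L : Fin k → List (ZMod 2 × X × R)) :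
    psum (List.ofFn L).flatten = ∑ j, psum (L j) := by
  simp [psum, List.map_flatten, List.map_ofFn, List.sum_flatten, List.sum_ofFn]

theorem letters_twist (s : X →ₗ[K] X) (e : ZMod 2) (T : List (ZMod 2 × X × R)) :
    letters (twist D s e T) = (letters T).map (tw s e) := by
  simp [letters, twist]

theorem tens_twist (s : X →ₗ[K] X) (e : ZMod 2) (T : List (ZMod 2 × X × R)) :
    tens K (twist D s e T) = (tens K T).map (tw (TensorProduct.map s D.sgn) e) := by
  simp [tens, twist, tw_map]

theorem tw_apply_self (s : X →ₗ[K] X) (e : ZMod 2) (a : X) : s (tw s e a) = tw s e (s a) := by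
  rcases zmod_two_cases e with rfl | rfl <;> simp

theorem HasParity.twist {s : X →ₗ[K] X} {T : List (ZMod 2 × X × R)} (h : HasParity s T)
    (e : ZMod 2) : HasParity s (twist D s e T) := by
  intro t ht
  obtain ⟨t', ht', rfl⟩ := List.mem_map.mp ht
  simp only
  rw [tw_apply_self, h t' ht', map_smul]

theorem HasParity.flatten {s : X →ₗ[K] X} {k : ℕ} {L : Fin k → List (ZMod 2 × X × R)}
    (h : ∀ j, HasParity s (L j)) : HasParity s (List.ofFn L).flatten := by
  intro t ht
  obtain ⟨l, hl, ht⟩ := List.mem_flatten.mp ht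
  obtain ⟨j, rfl⟩ := (List.mem_ofFn' _ _).mp hl
  exact h j t ht

theorem letters_ofFn {k : ℕ} (t : Fin k → ZMod 2 × X × R) :
    letters (List.ofFn t) = List.ofFn fun j => (t j).2.1 := by
  simp [letters, List.map_ofFn, Function.comp_def]

theorem tens_ofFn {k : ℕ} (t : Fin k → ZMod 2 × X × R) :
    tens K (List.ofFn t) = List.ofFn fun j => (t j).2.1 ⊗ₜ (t j).2.2 := by
  simp [tens, List.map_ofFn, Function.comp_def]

theorem letters_flatten {k : ℕ} (L : Fin k → List (ZMod 2 × X × R)) :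
    letters (List.ofFn L).flatten = (List.ofFn fun j => letters (L j)).flatten := by
  simp [letters, List.map_flatten, List.map_ofFn, Function.comp_def]

theorem tens_flatten {k : ℕ} (L : Fin k → List (ZMod 2 × X × R)) :
    tens K (List.ofFn L).flatten = (List.ofFn fun j => tens K (L j)).flatten := by
  simp [tens, List.map_flatten, List.map_ofFn, Function.comp_def]

theorem wmap_letters {s : X →ₗ[K] X} {T : List (ZMod 2 × X × R)} (h : HasParity s T) :
    wmap s (word K (letters T)) = zsign K (psum T) • word K (letters T) := by
  induction T with
  | nil => simp [psum, letters]
  | cons t T ih =>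
    have h1 : letters (t :: T) = t.2.1 :: letters T := rfl
    have h2 : psum (t :: T) = t.1 + psum T := by simp [psum]
    rw [h1, word_cons, wmap_letter_mul, ih fun t' ht' => h t' (List.mem_cons_of_mem _ ht'),
      h t List.mem_cons_self, h2, zsign_add, map_smul, smul_mul_smul_comm]

/-- The sign of moving `ν` past the later letters can be read from the parity of `ν`, as in `act`,
or from the parity of the letters, as in `nuProd`. The second reading leaves `ν` arbitrary. -/
theorem collectWords_tens {s : X →ₗ[K] X} {T : List (ZMod 2 × X × R)} (h : HasParity s T) :
    collectWords D s (word K (tens K T)) = word K (letters T) ⊗ₜ nuProd D T := by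
  induction T with
  | nil => simp [tens, letters, nuProd]
  | cons t T ih =>
    have hT : HasParity s T := fun t' ht' => h t' (List.mem_cons_of_mem _ ht')
    have h1 : letters (t :: T) = t.2.1 :: letters T := rfl
    have h2 : tens K (t :: T) = (t.2.1 ⊗ₜ t.2.2) :: tens K T := rfl
    rw [h2, word_cons, collectWords_letter_mul, ih hT, act_tmul, wmap_letters hT, h1, word_cons,
      nuProd, mul_smul_comm, TensorProduct.smul_tmul, ← TensorProduct.tmul_add, ← LinearMap.smul_apply,
      ← LinearMap.add_apply, ← map_smul, ← map_add]
    congr 3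
    -- `ν` is the sum of its even and odd parts, and the sign operator is their difference.
    rcases zmod_two_cases (psum T) with h | h
    · simp [h, D.par_add]
    · rw [h, tw_one, zsign_one, neg_one_smul, ← sub_eq_add_neg, D.par_sub]

theorem nuProd_append (T T' : List (ZMod 2 × X × R)) :
    nuProd D (T ++ T') = D.mul (tw D.sgn (psum T') (nuProd D T)) (nuProd D T') := by
  induction T with
  | nil => simp [nuProd, D.tw_one, D.one_mul]
  | cons t T ih =>
    rw [List.cons_append, nuProd, ih, nuProd, D.tw_mul, D.mul_assoc, psum_append, add_comm,
      tw_add D.graded.involutive, LinearMap.comp_apply]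

theorem nuProd_twist (s : X →ₗ[K] X) (e : ZMod 2) (T : List (ZMod 2 × X × R)) :
    nuProd D (twist D s e T) = tw D.sgn e (nuProd D T) := by
  induction T with
  | nil => simp [twist, nuProd, D.tw_one]
  | cons t T ih =>
    have : twist D s e (t :: T) = (t.1, tw s e t.2.1, tw D.sgn e t.2.2) :: twist D s e T := rfl
    rw [this, nuProd, ih, nuProd, D.tw_mul, psum_twist]
    congr 2
    rw [← LinearMap.comp_apply, ← LinearMap.comp_apply, ← tw_add D.graded.involutive,
      ← tw_add D.graded.involutive, add_comm]

/-- The `ν` can be multiplied first within blocks and then across them. The parities `f` of the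
operations heading the blocks enter twice, once in the outer product and once in the explicit twist,
and cancel. -/
theorem nuProd_flatten {k : ℕ} (f : Fin k → ZMod 2) (L : Fin k → List (ZMod 2 × X × R))
    (y : Fin k → Y) :
    nuProd D (List.ofFn L).flatten = nuProd D (List.ofFn fun j =>
      (f j + psum (L j), y j, tw D.sgn (after f j) (nuProd D (L j)))) := by
  induction k with
  | zero => simp [nuProd]
  | succ k ih =>
    rw [List.ofFn_succ, List.ofFn_succ, List.flatten_cons, nuProd_append, nuProd,
      ih (fun j => f j.succ) _ fun j => y j.succ]
    simp only [after_succ, after_zero, psum_ofFn, psum_flatten, Finset.sum_add_distrib]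
    congr 2
    rw [← LinearMap.comp_apply, ← tw_add D.graded.involutive]
    congr 2
    -- The two contributions of the `f j` behind the first block cancel modulo two.
    rw [add_right_comm, CharTwo.add_self_eq_zero, zero_add]

theorem nuProd_flatten_twist (s : X →ₗ[K] X) {k : ℕ} (f : Fin k → ZMod 2)
    (L : Fin k → List (ZMod 2 × X × R)) (y : Fin k → Y) :
    nuProd D (List.ofFn fun j => twist D s (after f j) (L j)).flatten =
      nuProd D (List.ofFn fun j => (f j + psum (L j), y j, nuProd D (L j))) := by
  rw [nuProd_flatten D f _ y]
  congr 2
  funext j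
  rw [psum_twist, nuProd_twist, ← LinearMap.comp_apply, ← tw_add D.graded.involutive,
    CharTwo.add_self_eq_zero, tw_zero, LinearMap.id_apply]

theorem collect_sch {s : X →ₗ[K] X} {T : List (ZMod 2 × X × R)} (h : HasParity s T) (q : Tot P) :
    collect D P s (sch P q (tens K T)) = sch P q (letters T) ⊗ₜ nuProd D T := by
  have : collect D P s ∘ₗ Schur.ofTensor P ∘ₗ (TensorProduct.mk K (Tot P) _).flip (word K (tens K T)) =
      (TensorProduct.mk K _ R).flip (nuProd D T) ∘ₗ Schur.ofTensor P ∘ₗ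
        (TensorProduct.mk K (Tot P) _).flip (word K (letters T)) := by
    refine DirectSum.linearMap_ext _ fun n => LinearMap.ext fun p => ?_
    change collect D P s (sch P (Tot.of P n p) (tens K T)) =
      sch P (Tot.of P n p) (letters T) ⊗ₜ nuProd D T
    by_cases hn : T.length = n
    · rw [collect, LinearMap.comp_apply, LinearMap.comp_apply, toTensor_sch p (by simpa [tens] using hn),
        TensorProduct.map_tmul, collectWords_tens D h, LinearMap.id_apply, ofTensorR_tmul, sch]
    · rw [sch_of_length_ne p (by simpa [tens] using hn),
        sch_of_length_ne p (by simpa [letters] using hn), map_zero, TensorProduct.zero_tmul]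
  exact LinearMap.congr_fun this q

theorem schSgn_sch {s : X →ₗ[K] X} {T : List (ZMod 2 × X × R)} (h : HasParity s T) {n : ℕ}
    {q : P n} {e : ℤ} (hq : q ∈ (P n).gr e) :
    schSgn P s (sch P (Tot.of P n q) (letters T)) =
      zsign K (e + psum T) • sch P (Tot.of P n q) (letters T) := by
  have h1 : Tot.sgn P (Tot.of P n q) = zsign K e • Tot.of P n q := by
    rw [Tot.sgn, Tot.of, DirectSum.lmap_lof, (P n).sgn_of_mem e q hq, map_smul]
  rw [sch, schSgn_ofTensor, h1, wmap_letters h, TensorProduct.smul_tmul_smul, map_smul, zsign_add]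

/-- The elements `a ⊗ ν` with `a` homogeneous. -/
def tensSet (R : Type z) [AddCommGroup R] [Module K R] (gX : ℤ → Submodule K X) :
    Set (X ⊗[K] R) :=
  {z | ∃ (i : ℤ) (a : X) (ν : R), a ∈ gX i ∧ z = a ⊗ₜ ν}

variable {gX : ℤ → Submodule K X} {s : X →ₗ[K] X}

theorem IsGraded.span_tensSet (hX : IsGraded gX s) :
    Submodule.span K (tensSet R gX) = ⊤ := by
  rw [← Submodule.ker_mkQ (Submodule.span K (tensSet R gX)), LinearMap.ker_eq_top]
  refine TensorProduct.ext (LinearMap.ext_on hX.span ?_)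
  rintro a ⟨i, ha⟩
  refine LinearMap.ext fun ν => ?_
  simp only [LinearMap.compr₂ₛₗ_apply, TensorProduct.mk_apply, LinearMap.zero_apply,
    Submodule.mkQ_apply, Submodule.Quotient.mk_eq_zero]
  exact Submodule.subset_span ⟨i, a, ν, ha, rfl⟩

theorem IsGraded.exists_triples (hX : IsGraded gX s) (l : List (X ⊗[K] R))
    (hl : ∀ z ∈ l, z ∈ tensSet R gX) : ∃ T, HasParity s T ∧ tens K T = l := by
  induction l with
  | nil => exact ⟨[], by simp [HasParity], rfl⟩
  | cons z l ih =>
    obtain ⟨T, hT, rfl⟩ := ih fun z' hz' => hl z' (List.mem_cons_of_mem _ hz')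
    obtain ⟨i, a, ν, ha, rfl⟩ := hl z List.mem_cons_self
    refine ⟨((i : ZMod 2), a, ν) :: T, fun t ht => ?_, rfl⟩
    rcases List.mem_cons.mp ht with rfl | ht
    · exact hX.sgn_of_mem i a ha
    · exact hT t ht

theorem IsGraded.tensor_involutive (hX : IsGraded gX s) :
    TensorProduct.map s D.sgn ∘ₗ TensorProduct.map s D.sgn = LinearMap.id := by
  rw [← TensorProduct.map_comp, hX.involutive, D.graded.involutive, TensorProduct.map_id]

theorem collect_collect {k : ℕ} (p : P k) {m : Fin k → ℕ} {e : Fin k → ℤ} {q : ∀ j, P (m j)}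
    (hq : ∀ j, q j ∈ (P (m j)).gr (e j)) {T : Fin k → List (ZMod 2 × X × R)}
    (hT : ∀ j, HasParity s (T j)) :
    collect D P (schSgn P s) (Schur.of P k (p ⊗ₜ PiTensorProduct.tprod K fun j =>
        collect D P s (sch P (Tot.of P (m j) (q j)) (tens K (T j))))) =
      Schur.of P k (p ⊗ₜ PiTensorProduct.tprod K fun j =>
          sch P (Tot.of P (m j) (q j)) (letters (T j))) ⊗ₜ
        nuProd D (List.ofFn fun j => ((e j : ZMod 2) + psum (T j),
          sch P (Tot.of P (m j) (q j)) (letters (T j)), nuProd D (T j))) := by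
  have h := collect_sch D (P := P) (s := schSgn P s) (T := List.ofFn fun j => ((e j : ZMod 2) +
    psum (T j), sch P (Tot.of P (m j) (q j)) (letters (T j)), nuProd D (T j))) (fun t ht => by
      obtain ⟨j, rfl⟩ := (List.mem_ofFn' _ _).mp ht
      exact schSgn_sch (hT j) (hq j)) (Tot.of P k p)
  rw [letters_ofFn, tens_ofFn, sch_ofFn, sch_ofFn] at h
  simp only [collect_sch D (hT _)]
  exact h

/-- Collecting the coefficients at once or in two stages gives the same signs, by
`nuProd_flatten_twist`. Associativity of `B ⊗ R` rests on this. -/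
theorem collect_freeMul (hX : IsGraded gX s) (γ : Schur P (Tot P) →ₗ[K] Tot P) :
    collect D P s ∘ₗ freeMul P γ (TensorProduct.map s D.sgn) =
      TensorProduct.map (freeMul P γ s) LinearMap.id ∘ₗ collect D P (schSgn P s) ∘ₗ
        Schur.map P (collect D P s) := by
  have hs := hX.tensor_involutive D
  refine schur_hom_ext (span_pureSet hX.span_tensSet) fun k _ p a _ ha => ?_
  choose n i q l hq hl hn ha using ha
  obtain rfl : a = fun j => sch P (Tot.of P (n j) (q j)) (l j) := funext ha
  choose T hT hTl using fun j => hX.exists_triples (l j) (hl j)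
  obtain rfl : (fun j => tens K (T j)) = l := funext hTl
  simp only [LinearMap.comp_apply, schur_map_of]
  rw [collect_collect D p hq hT, TensorProduct.map_tmul, freeMul_of γ hs p hq hn,
    freeMul_of γ hX.involutive p hq fun j => by simpa [tens, letters] using hn j]
  simp only [← tens_twist]
  rw [← tens_flatten, collect_sch D (HasParity.flatten fun j => (hT j).twist D _), letters_flatten,
    nuProd_flatten_twist D s _ _ fun j => sch P (Tot.of P (n j) (q j)) (letters (T j))]
  simp only [letters_twist, LinearMap.id_apply]

/-- `cut` with coefficients in `R`. -/
def cutR (s : X →ₗ[K] X) :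
    Schur P (Tot P) ⊗[K] Words K (X ⊗[K] R) →ₗ[K] Schur P (Schur P X) ⊗[K] R :=
  TensorProduct.map (cut P s) LinearMap.id ∘ₗ
    (TensorProduct.assoc K (Schur P (Tot P)) (Words K X) R).symm.toLinearMap ∘ₗ
    TensorProduct.map LinearMap.id (collectWords D s)

theorem cutR_tens (z : Schur P (Tot P)) {T : List (ZMod 2 × X × R)} (hT : HasParity s T) :
    cutR D s (z ⊗ₜ word K (tens K T)) = cut P s (z ⊗ₜ word K (letters T)) ⊗ₜ nuProd D T := by
  simp [cutR, collectWords_tens D hT]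

theorem collect_cut (hX : IsGraded gX s) {k : ℕ} (p : P k) {m : Fin k → ℕ} {e : Fin k → ℤ}
    {q : ∀ j, P (m j)} (hq : ∀ j, q j ∈ (P (m j)).gr (e j)) {T : Fin k → List (ZMod 2 × X × R)}
    (hT : ∀ j, HasParity s (T j)) (hl : ∀ j, (T j).length = m j) :
    collect D P (schSgn P s) (Schur.map P (collect D P s) (cut P (TensorProduct.map s D.sgn)
      (Schur.of P k (p ⊗ₜ PiTensorProduct.tprod K fun j => Tot.of P (m j) (q j)) ⊗ₜ
        word K (List.ofFn fun j => tens K (T j)).flatten))) =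
    cutR D s (Schur.of P k (p ⊗ₜ PiTensorProduct.tprod K fun j => Tot.of P (m j) (q j)) ⊗ₜ
        word K (List.ofFn fun j => tens K (T j)).flatten) := by
  have h1 := cut_of (hX.tensor_involutive D) p hq (l := fun j => tens K (T j))
    fun j => by simpa [tens] using hl j
  have h2 := cut_of hX.involutive p hq (l := fun j => letters (T j))
    fun j => by simpa [letters] using hl j
  have h3 := collect_collect D p hq fun j => (hT j).twist D (after (fun j => (e j : ZMod 2)) j)
  have h4 := cutR_tens D (Schur.of P k (p ⊗ₜ PiTensorProduct.tprod K fun j => Tot.of P (m j) (q j)))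
    (HasParity.flatten hT)
  have h5 := nuProd_flatten D (fun j => (e j : ZMod 2)) T fun j => sch P (Tot.of P (m j) (q j))
    ((letters (T j)).map (tw s (after (fun j => (e j : ZMod 2)) j)))
  simp only [letters_twist, nuProd_twist, psum_twist, tens_twist] at h3
  rw [letters_flatten, tens_flatten, h2, h5] at h4
  rw [h4, h1, schur_map_of]
  exact h3

theorem cutR_Δ (hX : IsGraded gX s) (Δ : Tot P →ₗ[K] Schur P (Tot P)) (n : ℕ) (c : P n)
    (a : Fin n → X ⊗[K] R) (ha : ∀ j, a j ∈ tensSet R gX) :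
    cutR D s (Δ (Tot.of P n c) ⊗ₜ word K (List.ofFn a)) =
      TensorProduct.map (cofreeComul P Δ s) LinearMap.id
        (collect D P s (Schur.of P n (c ⊗ₜ PiTensorProduct.tprod K a))) := by
  obtain ⟨T, hT, hTa⟩ := hX.exists_triples (List.ofFn a) fun z hz => by
    obtain ⟨j, rfl⟩ := (List.mem_ofFn' _ _).mp hz
    exact ha j
  have hlen : (letters T).length = n := by
    have := congrArg List.length hTa
    simpa [tens, letters] using this
  obtain ⟨b, hb⟩ : ∃ b : Fin n → X, letters T = List.ofFn b := by
    subst hlen; exact ⟨_, (List.ofFn_get _).symm⟩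
  rw [← sch_ofFn, ← hTa, cutR_tens D _ hT, collect_sch D hT, TensorProduct.map_tmul,
    LinearMap.id_apply, hb, sch_ofFn, cofreeComul_of]

/-- The dual of `collect_freeMul`: coefficients may be collected before or after cutting a word. It
is used to transport coassociativity to the cylinder. -/
theorem collect_cofreeComul (hX : IsGraded gX s) {Δ : Tot P →ₗ[K] Schur P (Tot P)}
    (hΔ : ∀ (n : ℕ) (c : P n), Δ (Tot.of P n c) ∈ Schur.arity P n) :
    collect D P (schSgn P s) ∘ₗ Schur.map P (collect D P s) ∘ₗ
        cofreeComul P Δ (TensorProduct.map s D.sgn) =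
      TensorProduct.map (cofreeComul P Δ s) LinearMap.id ∘ₗ collect D P s := by
  refine schur_hom_ext hX.span_tensSet fun n _ c a _ ha => ?_
  have key := arity_word_eq (Z := Schur P (Schur P X) ⊗[K] R)
    (F := collect D P (schSgn P s) ∘ₗ Schur.map P (collect D P s) ∘ₗ
      cut P (TensorProduct.map s D.sgn)) (G := cutR D s) (S := tensSet R gX)
    (fun k p m e q l _ hq hl hS => by
      choose T hT hTl using fun j => hX.exists_triples (l j) (hS j)
      obtain rfl : (fun j => tens K (T j)) = l := funext hTl
      rw [LinearMap.comp_apply, LinearMap.comp_apply]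
      exact collect_cut D hX p hq hT fun j => by simpa [tens] using hl j) (hΔ n c) ha
  rw [LinearMap.comp_apply, LinearMap.comp_apply, cutR_Δ D hX Δ n c a ha] at key
  rw [LinearMap.comp_apply, LinearMap.comp_apply, LinearMap.comp_apply, cofreeComul_of, key]

end Triples

/-! ### The algebra laws of `B ⊗ R` -/

section TensorAlg

variable {K : Type u} [Field K] {X : Type x} [AddCommGroup X] [Module K X]
variable {R : Type z} [AddCommGroup R] [Module K R] (D : DGAlg K R)
variable {gX : ℤ → Submodule K X} {s d : X →ₗ[K] X}

theorem tmul_mem_tensorGr {gR : ℤ → Submodule K R} {i j k : ℤ} {a : X} {ν : R} (ha : a ∈ gX i)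
    (hν : ν ∈ gR j) (h : i + j = k) : a ⊗ₜ ν ∈ tensorGr gX gR k :=
  Submodule.subset_span ⟨i, j, a, ν, h, ha, hν, rfl⟩

theorem tensorGr_induction {gR : ℤ → Submodule K R} {i : ℤ} {y : X ⊗[K] R}
    (hy : y ∈ tensorGr gX gR i) {Y : Type*} [AddCommGroup Y] [Module K Y] (W : Submodule K Y)
    (F : X ⊗[K] R →ₗ[K] Y)
    (h : ∀ (p q : ℤ) (a : X) (ν : R), p + q = i → a ∈ gX p → ν ∈ gR q → F (a ⊗ₜ ν) ∈ W) :
    F y ∈ W := by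
  suffices tensorGr gX gR i ≤ W.comap F from this hy
  rw [tensorGr, Submodule.span_le]
  rintro _ ⟨p, q, a, ν, h1, h2, h3, rfl⟩
  exact h p q a ν h1 h2 h3

theorem IsGraded.tensor (hX : IsGraded gX s) {gR : ℤ → Submodule K R} {t : R →ₗ[K] R}
    (hR : IsGraded gR t) : IsGraded (tensorGr gX gR) (TensorProduct.map s t) where
  sgn_of_mem i y hy := by
    have := tensorGr_induction hy ⊥ (TensorProduct.map s t - zsign K i • LinearMap.id)
      fun p q a ν hi ha hν => by
        rw [Submodule.mem_bot, LinearMap.sub_apply, LinearMap.smul_apply, LinearMap.id_apply,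
          TensorProduct.map_tmul, hX.sgn_of_mem p a ha, hR.sgn_of_mem q ν hν,
          TensorProduct.smul_tmul_smul, ← zsign_add, ← hi, Int.cast_add, sub_self]
    simpa [sub_eq_zero] using this
  span := by
    rw [← Submodule.ker_mkQ (Submodule.span K _), LinearMap.ker_eq_top]
    refine TensorProduct.ext (LinearMap.ext_on hX.span ?_)
    rintro a ⟨i, ha⟩
    refine LinearMap.ext_on hR.span ?_
    rintro ν ⟨j, hν⟩
    simp only [LinearMap.compr₂ₛₗ_apply, TensorProduct.mk_apply, LinearMap.zero_apply,
      Submodule.mkQ_apply, Submodule.Quotient.mk_eq_zero]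
    exact Submodule.subset_span ⟨_, tmul_mem_tensorGr ha hν rfl⟩

theorem tensorD_mem (hX : IsGraded gX s) (hd : ∀ i, ∀ a ∈ gX i, d a ∈ gX (i + 1)) (i : ℤ)
    (y : X ⊗[K] R) (hy : y ∈ tensorGr gX D.gr i) : tensorD D s d y ∈ tensorGr gX D.gr (i + 1) := by
  refine tensorGr_induction hy _ _ fun p q a ν hi ha hν => ?_
  rw [tensorD, LinearMap.add_apply, TensorProduct.map_tmul, TensorProduct.map_tmul,
    hX.sgn_of_mem p a ha, ← TensorProduct.smul_tmul']
  refine Submodule.add_mem _ (tmul_mem_tensorGr (hd p a ha) hν (by omega))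
    (Submodule.smul_mem _ _ (tmul_mem_tensorGr ha (D.d_mem q ν hν) (by omega)))

theorem tensorD_tensorD (hd : s ∘ₗ d = -(d ∘ₗ s))
    (hdd : d ∘ₗ d = 0) : tensorD D s d ∘ₗ tensorD D s d = 0 := by
  refine TensorProduct.ext' fun a ν => ?_
  have h1 : s (d a) = -d (s a) := LinearMap.congr_fun hd a
  have h2 : d (d a) = 0 := LinearMap.congr_fun hdd a
  simp [tensorD, h1, h2, D.d_d, TensorProduct.neg_tmul]

variable {P : NSOperad.{u, v} K}

/-- The algebra `B ⊗ R` over `P`. -/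
def tensorAlg (B : NSAlgData.{u, v, x} P) (s : B.carrier →ₗ[K] B.carrier) :
    NSAlgData.{u, v, max x z} P where
  carrier := B.carrier ⊗[K] R
  gr := tensorGr B.gr D.gr
  d := tensorD D s B.d
  γ := TensorProduct.map B.γ LinearMap.id ∘ₗ collect D P.obj s

theorem IsGraded.tw_mem {gR : ℤ → Submodule K R} {t : R →ₗ[K] R} (h : IsGraded gR t) {i : ℤ}
    {ν : R} (hν : ν ∈ gR i) (e : ZMod 2) : tw t e ν ∈ gR i := by
  rcases zmod_two_cases e with rfl | rfl
  · simpa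
  · rw [tw_one, h.sgn_of_mem i ν hν]; exact Submodule.smul_mem _ _ hν

theorem nuProd_mem {k : ℕ} (t : Fin k → ZMod 2 × X × R) (q : Fin k → ℤ)
    (h : ∀ j, (t j).2.2 ∈ D.gr (q j)) : nuProd D (List.ofFn t) ∈ D.gr (∑ j, q j) := by
  induction k with
  | zero => simpa [nuProd] using D.one_mem
  | succ k ih =>
    rw [List.ofFn_succ, nuProd, Fin.sum_univ_succ]
    exact D.mul_mem _ _ _ _ (D.graded.tw_mem (h 0) _) (ih _ _ fun j => h j.succ)

theorem collect_mem_gr (hX : IsGraded gX s) {P : ℕ → DGMod.{u, v} K} {i : ℤ}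
    {y : Schur P (X ⊗[K] R)} (hy : y ∈ Schur.gr P (tensorGr gX D.gr) i) :
    collect D P s y ∈ tensorGr (Schur.gr P gX) D.gr i := by
  refine schur_gr_induction hy (tensorGr (Schur.gr P gX) D.gr i) (collect D P s) fun n e f p a hi hp ha => ?_
  -- The entries `a j` are only sums of homogeneous pure tensors. Multilinearity reduces the claim
  -- to pure entries, where `collect_sch` is explicit.
  let F : MultilinearMap K (fun _ : Fin n => X ⊗[K] R) (Schur P X ⊗[K] R) :=
    (collect D P s ∘ₗ Schur.of P n ∘ₗ TensorProduct.mk K _ _ p).compMultilinearMap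
      (PiTensorProduct.tprod K)
  refine MultilinearMap.mem_of_span (Z := Schur P X ⊗[K] R) F (S := fun j => {y | ∃ (p q : ℤ) (a : X) (b : R),
    p + q = f j ∧ a ∈ gX p ∧ b ∈ D.gr q ∧ y = a ⊗ₜ b}) ?_ a ha
  intro b hb
  choose p' q' b' ν hpq hb' hν hb using hb
  obtain rfl : b = fun j => b' j ⊗ₜ ν j := funext hb
  change collect D P s (Schur.of P n (p ⊗ₜ PiTensorProduct.tprod K fun j => b' j ⊗ₜ ν j)) ∈ _
  have h := collect_sch D (P := P) (s := s) (T := List.ofFn fun j => ((p' j : ZMod 2), b' j, ν j))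
    (fun t ht => by
      obtain ⟨j, rfl⟩ := (List.mem_ofFn' _ _).mp ht
      exact hX.sgn_of_mem _ _ (hb' j)) (Tot.of P n p)
  rw [letters_ofFn, tens_ofFn, sch_ofFn, sch_ofFn] at h
  simp only at h
  rw [h]
  refine tmul_mem_tensorGr (schur_of_mem_gr hp hb' rfl) (nuProd_mem D _ q' hν) ?_
  rw [← hi, add_assoc, ← Finset.sum_add_distrib]
  simp_rw [hpq]

theorem collect_generator (hX : IsGraded gX s) :
    collect D P.obj s ∘ₗ generator P = TensorProduct.map (generator P) LinearMap.id := by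
  refine LinearMap.ext_on hX.span_tensSet ?_
  rintro _ ⟨i, a, ν, ha, rfl⟩
  have h := collect_sch D (P := P.obj) (s := s) (T := [((i : ZMod 2), a, ν)])
    (fun t ht => by rw [List.mem_singleton.mp ht]; exact hX.sgn_of_mem _ _ ha)
    (Tot.of P.obj 1 P.one)
  rw [LinearMap.comp_apply, generator_eq]
  refine h.trans ?_
  simp [nuProd, psum, D.mul_one, generator_eq, letters]

variable {D} in
theorem NSAlgData.IsAlg.γ_comp_schSgn {B : NSAlgData.{u, v, x} P} {s : B.carrier →ₗ[K] B.carrier}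
    (hB : B.IsAlg s) : B.γ ∘ₗ schSgn P.obj s = s ∘ₗ B.γ :=
  hB.graded.schur.comm_zero hB.graded.sgn_of_mem hB.γ_degree

theorem NSAlgData.IsAlg.anticomm {B : NSAlgData.{u, v, x} P} {s : B.carrier →ₗ[K] B.carrier}
    (hB : B.IsAlg s) : s ∘ₗ B.d = -(B.d ∘ₗ s) :=
  hB.graded.anticomm hB.graded.sgn_of_mem hB.d_mem

theorem map_tensorD {Y : Type y} [AddCommGroup Y] [Module K Y] {s' d' : Y →ₗ[K] Y} {f : X →ₗ[K] Y}
    (hs : f ∘ₗ s = s' ∘ₗ f) (hd : f ∘ₗ d = d' ∘ₗ f) :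
    TensorProduct.map f LinearMap.id ∘ₗ tensorD D s d =
      tensorD D s' d' ∘ₗ TensorProduct.map f LinearMap.id := by
  simp only [tensorD, LinearMap.comp_add, LinearMap.add_comp, ← TensorProduct.map_comp, hs, hd,
    LinearMap.id_comp, LinearMap.comp_id]

/-- Naturality of the collecting map moves the inner `γ` outwards, associativity of `B` exchanges it
for the free multiplication, and `collect_freeMul` moves that one back inside. -/
theorem tensorAlg_assoc {B : NSAlgData.{u, v, x} P} {s : B.carrier →ₗ[K] B.carrier}
    (hB : B.IsAlg s) (y : Schur P.obj (Schur P.obj (B.carrier ⊗[K] R))) :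
    TensorProduct.map B.γ LinearMap.id (collect D P.obj s (Schur.map P.obj
      (TensorProduct.map B.γ LinearMap.id)
        (Schur.map P.obj (W := Schur P.obj B.carrier ⊗[K] R) (collect D P.obj s) y))) =
    TensorProduct.map B.γ LinearMap.id (collect D P.obj s
      (freeMul P.obj P.γ (TensorProduct.map s D.sgn) y)) := by
  have h1 := LinearMap.congr_fun (collect_natural D (P := P.obj) hB.γ_comp_schSgn)
    (Schur.map P.obj (W := Schur P.obj B.carrier ⊗[K] R) (collect D P.obj s) y)
  have h2 := LinearMap.congr_fun (collect_freeMul D hB.graded P.γ) y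
  have h3 : TensorProduct.map B.γ LinearMap.id ∘ₗ TensorProduct.map (Schur.map P.obj B.γ)
      (LinearMap.id : R →ₗ[K] R) = TensorProduct.map B.γ LinearMap.id ∘ₗ
        TensorProduct.map (freeMul P.obj P.γ s) LinearMap.id := by
    rw [← TensorProduct.map_comp, ← TensorProduct.map_comp, hB.assoc]
  refine (congrArg (TensorProduct.map B.γ LinearMap.id) h1).trans
    (Eq.trans ?_ (congrArg (TensorProduct.map B.γ LinearMap.id) h2).symm)
  exact LinearMap.congr_fun h3 _

theorem tensorAlg_γ_d {B : NSAlgData.{u, v, x} P} {s : B.carrier →ₗ[K] B.carrier}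
    (hB : B.IsAlg s) : (TensorProduct.map B.γ LinearMap.id ∘ₗ collect D P.obj s) ∘ₗ
        Schur.d P.obj (TensorProduct.map s D.sgn) (tensorD D s B.d) =
      tensorD D s B.d ∘ₗ TensorProduct.map B.γ LinearMap.id ∘ₗ collect D P.obj s := by
  rw [LinearMap.comp_assoc, collect_leibniz D hB.graded.involutive hB.anticomm,
    ← LinearMap.comp_assoc, map_tensorD D hB.γ_comp_schSgn hB.γ_d, LinearMap.comp_assoc]

theorem tensorAlg_γ_degree {B : NSAlgData.{u, v, x} P} {s : B.carrier →ₗ[K] B.carrier}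
    (hB : B.IsAlg s) (i : ℤ) (y : Schur P.obj (B.carrier ⊗[K] R))
    (hy : y ∈ Schur.gr P.obj (tensorGr B.gr D.gr) i) :
    (TensorProduct.map B.γ LinearMap.id ∘ₗ collect D P.obj s) y ∈ tensorGr B.gr D.gr i := by
  refine tensorGr_induction (collect_mem_gr D hB.graded hy) (tensorGr B.gr D.gr i)
    (TensorProduct.map B.γ LinearMap.id) fun p q a ν hi ha hν => ?_
  rw [TensorProduct.map_tmul]
  exact tmul_mem_tensorGr (hB.γ_degree p a ha) hν hi

theorem tensorAlg_unit {B : NSAlgData.{u, v, x} P} {s : B.carrier →ₗ[K] B.carrier}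
    (hB : B.IsAlg s) : (TensorProduct.map B.γ LinearMap.id ∘ₗ collect D P.obj s) ∘ₗ generator P =
      LinearMap.id := by
  rw [LinearMap.comp_assoc, collect_generator D hB.graded, ← TensorProduct.map_comp, hB.unit,
    LinearMap.id_comp, TensorProduct.map_id]

theorem schur_map_comp_apply {P : ℕ → DGMod.{u, v} K} {X Y Z : Type*} [AddCommGroup X] [Module K X]
    [AddCommGroup Y] [Module K Y] [AddCommGroup Z] [Module K Z] (f : X →ₗ[K] Y) (g : Y →ₗ[K] Z)
    (y : Schur P X) : Schur.map P (g ∘ₗ f) y = Schur.map P g (Schur.map P f y) := by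
  rw [schur_map_comp]; rfl

theorem schur_map_tensorAlg_γ {B : NSAlgData.{u, v, x} P} {s : B.carrier →ₗ[K] B.carrier}
    (y : Schur P.obj (Schur P.obj (B.carrier ⊗[K] R))) :
    Schur.map P.obj (TensorProduct.map B.γ LinearMap.id ∘ₗ collect D P.obj s) y =
      Schur.map P.obj (TensorProduct.map B.γ LinearMap.id)
        (Schur.map P.obj (W := Schur P.obj B.carrier ⊗[K] R) (collect D P.obj s) y) :=
  schur_map_comp_apply (Y := Schur P.obj B.carrier ⊗[K] R) _ _ _

theorem tensorAlg_assoc_apply {B : NSAlgData.{u, v, x} P} {s : B.carrier →ₗ[K] B.carrier}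
    (hB : B.IsAlg s) (y : Schur P.obj (Schur P.obj (B.carrier ⊗[K] R))) :
    TensorProduct.map B.γ LinearMap.id (collect D P.obj s
      (Schur.map P.obj (TensorProduct.map B.γ LinearMap.id ∘ₗ collect D P.obj s) y)) =
      TensorProduct.map B.γ LinearMap.id (collect D P.obj s
        (freeMul P.obj P.γ (TensorProduct.map s D.sgn) y)) := by
  rw [schur_map_tensorAlg_γ, tensorAlg_assoc D hB y]

theorem NSAlgData.IsAlg.tensor {B : NSAlgData.{u, v, x} P} {s : B.carrier →ₗ[K] B.carrier}
    (hB : B.IsAlg s) : (tensorAlg D B s).IsAlg (TensorProduct.map s D.sgn) where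
  graded := hB.graded.tensor D.graded
  d_mem := tensorD_mem D hB.graded hB.d_mem
  d_d := tensorD_tensorD D hB.anticomm hB.d_d
  γ_degree := tensorAlg_γ_degree D hB
  γ_d := tensorAlg_γ_d D hB
  assoc := LinearMap.ext fun y => tensorAlg_assoc_apply D hB y
  unit := tensorAlg_unit D hB

end TensorAlg

/-! ## Cochains on the interval and on the triangle -/

section Cochains

variable (K : Type u) [Field K]

/-- A cochain algebra with a basis indexed by a finite set of simplices. -/
theorem pi_graded {ι : Type} [Fintype ι] [DecidableEq ι] (dim : ι → ℤ) :
    IsGraded (fun i : ℤ => ⨅ s : ι, ⨅ _ : dim s ≠ i, LinearMap.ker (LinearMap.proj s : (ι → K) →ₗ[K] K))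
      (LinearMap.pi fun s => zsign K (dim s) • (LinearMap.proj s : (ι → K) →ₗ[K] K)) where
  sgn_of_mem i a ha := by
    simp only [Submodule.mem_iInf, LinearMap.mem_ker, LinearMap.proj_apply] at ha
    funext s
    by_cases h : dim s = i
    · simp [h]
    · simp [ha s h]
  span := by
    rw [eq_top_iff]
    intro a _
    rw [← Finset.univ_sum_single a]
    refine Submodule.sum_mem _ fun s _ => Submodule.subset_span ⟨dim s, ?_⟩
    simp only [Submodule.mem_iInf, LinearMap.mem_ker, LinearMap.proj_apply]
    intro s' hs'
    rw [Pi.single_eq_of_ne]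
    rintro rfl
    exact hs' rfl

theorem mem_pi_gr {ι : Type} (dim : ι → ℤ) {i : ℤ} {a : ι → K} :
    a ∈ (⨅ s : ι, ⨅ _ : dim s ≠ i, LinearMap.ker (LinearMap.proj s : (ι → K) →ₗ[K] K)) ↔
      ∀ s, dim s ≠ i → a s = 0 := by
  simp [Submodule.mem_iInf]

theorem Interval.mem_cochainGr {i : ℤ} {a : Interval K} :
    a ∈ Interval.cochainGr K i ↔ ∀ s : Simp, (s.dim : ℤ) ≠ i → a s = 0 :=
  mem_pi_gr K fun s : Simp => (s.dim : ℤ)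

theorem Interval.sgn_eq : Interval.sgn K =
    LinearMap.pi fun s => zsign K ((s.dim : ℤ) : ZMod 2) • (LinearMap.proj s : Interval K →ₗ[K] K) := by
  refine LinearMap.ext fun a => funext fun s => ?_
  cases s <;> simp [Interval.sgn, Simp.dim]

theorem Interval.cochain_graded : IsGraded (Interval.cochainGr K) (Interval.sgn K) := by
  rw [Interval.sgn_eq]
  exact pi_graded K fun s : Simp => (s.dim : ℤ)

/-- The cup product of cochains on the interval. -/
def Interval.mul : Interval K →ₗ[K] Interval K →ₗ[K] Interval K :=
  LinearMap.mk₂ K (fun a b s => match s with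
      | .v0 => a .v0 * b .v0
      | .v1 => a .v1 * b .v1
      | .edge => a .v0 * b .edge + a .edge * b .v1)
    (fun a a' b => by funext s; cases s <;> simp <;> ring)
    (fun c a b => by funext s; cases s <;> simp <;> ring)
    (fun a b b' => by funext s; cases s <;> simp <;> ring)
    (fun c a b => by funext s; cases s <;> simp <;> ring)

@[simp] theorem Interval.mul_v0 (a b : Interval K) : Interval.mul K a b .v0 = a .v0 * b .v0 := rfl
@[simp] theorem Interval.mul_v1 (a b : Interval K) : Interval.mul K a b .v1 = a .v1 * b .v1 := rfl
@[simp] theorem Interval.mul_edge (a b : Interval K) :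
    Interval.mul K a b .edge = a .v0 * b .edge + a .edge * b .v1 := rfl

@[simp] theorem Interval.cochainD_v0 (a : Interval K) : Interval.cochainD K a .v0 = 0 := rfl
@[simp] theorem Interval.cochainD_v1 (a : Interval K) : Interval.cochainD K a .v1 = 0 := rfl
@[simp] theorem Interval.cochainD_edge (a : Interval K) :
    Interval.cochainD K a .edge = a .v1 - a .v0 := rfl

@[simp] theorem Interval.sgn_v0 (a : Interval K) : Interval.sgn K a .v0 = a .v0 := by
  simp [Interval.sgn, Simp.dim]
@[simp] theorem Interval.sgn_v1 (a : Interval K) : Interval.sgn K a .v1 = a .v1 := by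
  simp [Interval.sgn, Simp.dim]
@[simp] theorem Interval.sgn_edge (a : Interval K) : Interval.sgn K a .edge = -a .edge := by
  simp [Interval.sgn, Simp.dim]

/-- The normalized cochain algebra of the interval. -/
def intervalAlg : DGAlg K (Interval K) where
  gr := Interval.cochainGr K
  par := Interval.par K
  sgn := Interval.sgn K
  d := Interval.cochainD K
  mul := Interval.mul K
  one := fun s => match s with
    | .edge => 0
    | _ => 1
  graded := Interval.cochain_graded K
  par_of_mem ε i a ha := by
    rw [Interval.mem_cochainGr] at ha
    funext s
    by_cases h : (s.dim : ℤ) = i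
    · subst h; simp [Interval.par]; split_ifs <;> simp
    · have := ha s h
      by_cases h1 : (i : ZMod 2) = ε <;> by_cases h2 : (s.dim : ZMod 2) = ε <;>
        simp [Interval.par, h1, h2, this]
  mul_assoc a b c := by funext s; cases s <;> simp <;> ring
  one_mul a := by funext s; cases s <;> simp
  mul_one a := by funext s; cases s <;> simp
  one_mem := by
    rw [Interval.mem_cochainGr]; intro s hs; cases s <;> simp_all [Simp.dim]
  mul_mem i j a b ha hb := by
    rw [Interval.mem_cochainGr] at ha hb ⊢
    intro s hs
    have a0 := ha .v0; have a1 := ha .v1; have a2 := ha .edge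
    have b0 := hb .v0; have b1 := hb .v1; have b2 := hb .edge
    simp only [Simp.dim] at *
    cases s
    · by_cases h : i = 0
      · simp [b0 (by push_cast at *; omega)]
      · simp [a0 (by push_cast at *; omega)]
    · by_cases h : i = 0
      · simp [b1 (by push_cast at *; omega)]
      · simp [a1 (by push_cast at *; omega)]
    · rw [Interval.mul_edge]
      by_cases h : i = 0
      · simp [b2 (by push_cast at *; omega), a2 (by push_cast at *; omega)]
      · by_cases h' : i = 1
        · simp [a0 (by push_cast at *; omega), b1 (by push_cast at *; omega)]
        · simp [a0 (by push_cast at *; omega), a2 (by push_cast at *; omega)]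
  d_mem i a ha := by
    rw [Interval.mem_cochainGr] at ha ⊢
    intro s hs
    cases s
    · rfl
    · rfl
    · have a0 := ha .v0; have a1 := ha .v1
      simp only [Simp.dim] at *
      rw [Interval.cochainD_edge, a0 (by push_cast at *; omega), a1 (by push_cast at *; omega), sub_self]
  d_d a := by funext s; cases s <;> simp
  d_one := by funext s; cases s <;> simp
  d_mul a b := by funext s; cases s <;> simp; ring

/-- The nondegenerate simplices of `Δ²`. -/
inductive Tri : Type
  | v0
  | v1
  | v2
  | e01
  | e02
  | e12
  | top
  deriving DecidableEq

instance : Fintype Tri :=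
  ⟨{Tri.v0, Tri.v1, Tri.v2, Tri.e01, Tri.e02, Tri.e12, Tri.top}, fun s => by cases s <;> simp⟩

/-- The dimension of a simplex of `Δ²`. -/
def Tri.dim : Tri → ℤ
  | .v0 => 0
  | .v1 => 0
  | .v2 => 0
  | .e01 => 1
  | .e02 => 1
  | .e12 => 1
  | .top => 2

/-- The cup product of cochains on the triangle. -/
def Tri.mul : (Tri → K) →ₗ[K] (Tri → K) →ₗ[K] (Tri → K) :=
  LinearMap.mk₂ K (fun a b s => match s with
      | .v0 => a .v0 * b .v0
      | .v1 => a .v1 * b .v1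
      | .v2 => a .v2 * b .v2
      | .e01 => a .v0 * b .e01 + a .e01 * b .v1
      | .e02 => a .v0 * b .e02 + a .e02 * b .v2
      | .e12 => a .v1 * b .e12 + a .e12 * b .v2
      | .top => a .v0 * b .top + a .e01 * b .e12 + a .top * b .v2)
    (fun a a' b => by funext s; cases s <;> simp <;> ring)
    (fun c a b => by funext s; cases s <;> simp <;> ring)
    (fun a b b' => by funext s; cases s <;> simp <;> ring)
    (fun c a b => by funext s; cases s <;> simp <;> ring)

/-- The differential of cochains on the triangle. -/
def Tri.d : (Tri → K) →ₗ[K] (Tri → K) :=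
  LinearMap.pi fun s => match s with
    | .e01 => (LinearMap.proj .v1 : (Tri → K) →ₗ[K] K) - LinearMap.proj .v0
    | .e02 => (LinearMap.proj .v2 : (Tri → K) →ₗ[K] K) - LinearMap.proj .v0
    | .e12 => (LinearMap.proj .v2 : (Tri → K) →ₗ[K] K) - LinearMap.proj .v1
    | .top => (LinearMap.proj .e12 : (Tri → K) →ₗ[K] K) - LinearMap.proj .e02 + LinearMap.proj .e01
    | _ => 0

@[simp] theorem Tri.mul_v0 (a b : Tri → K) : Tri.mul K a b .v0 = a .v0 * b .v0 := rfl
@[simp] theorem Tri.mul_v1 (a b : Tri → K) : Tri.mul K a b .v1 = a .v1 * b .v1 := rfl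
@[simp] theorem Tri.mul_v2 (a b : Tri → K) : Tri.mul K a b .v2 = a .v2 * b .v2 := rfl
@[simp] theorem Tri.mul_e01 (a b : Tri → K) :
    Tri.mul K a b .e01 = a .v0 * b .e01 + a .e01 * b .v1 := rfl
@[simp] theorem Tri.mul_e02 (a b : Tri → K) :
    Tri.mul K a b .e02 = a .v0 * b .e02 + a .e02 * b .v2 := rfl
@[simp] theorem Tri.mul_e12 (a b : Tri → K) :
    Tri.mul K a b .e12 = a .v1 * b .e12 + a .e12 * b .v2 := rfl
@[simp] theorem Tri.mul_top (a b : Tri → K) :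
    Tri.mul K a b .top = a .v0 * b .top + a .e01 * b .e12 + a .top * b .v2 := rfl

@[simp] theorem Tri.d_v0 (a : Tri → K) : Tri.d K a .v0 = 0 := rfl
@[simp] theorem Tri.d_v1 (a : Tri → K) : Tri.d K a .v1 = 0 := rfl
@[simp] theorem Tri.d_v2 (a : Tri → K) : Tri.d K a .v2 = 0 := rfl
@[simp] theorem Tri.d_e01 (a : Tri → K) : Tri.d K a .e01 = a .v1 - a .v0 := rfl
@[simp] theorem Tri.d_e02 (a : Tri → K) : Tri.d K a .e02 = a .v2 - a .v0 := rfl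
@[simp] theorem Tri.d_e12 (a : Tri → K) : Tri.d K a .e12 = a .v2 - a .v1 := rfl
@[simp] theorem Tri.d_top (a : Tri → K) : Tri.d K a .top = a .e12 - a .e02 + a .e01 := rfl

/-- Cochains of degree `i` on the triangle. -/
def Tri.gr (i : ℤ) : Submodule K (Tri → K) :=
  ⨅ s : Tri, ⨅ _ : s.dim ≠ i, LinearMap.ker (LinearMap.proj s : (Tri → K) →ₗ[K] K)

theorem Tri.mem_gr {i : ℤ} {a : Tri → K} : a ∈ Tri.gr K i ↔ ∀ s : Tri, s.dim ≠ i → a s = 0 :=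
  mem_pi_gr K Tri.dim

/-- The normalized cochain algebra of the triangle. -/
def triAlg : DGAlg K (Tri → K) where
  gr := Tri.gr K
  par ε := LinearMap.pi fun s =>
    if (s.dim : ZMod 2) = ε then (LinearMap.proj s : (Tri → K) →ₗ[K] K) else 0
  sgn := LinearMap.pi fun s => zsign K (s.dim : ZMod 2) • (LinearMap.proj s : (Tri → K) →ₗ[K] K)
  d := Tri.d K
  mul := Tri.mul K
  one := fun s => if s.dim = 0 then 1 else 0
  graded := pi_graded K Tri.dim
  par_of_mem ε i a ha := by
    rw [Tri.mem_gr] at ha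
    funext s
    by_cases h : s.dim = i
    · subst h; simp; split_ifs <;> simp
    · have := ha s h
      by_cases h1 : (i : ZMod 2) = ε <;> by_cases h2 : (s.dim : ZMod 2) = ε <;>
        simp [h1, h2, this]
  mul_assoc a b c := by funext s; cases s <;> simp <;> ring
  one_mul a := by funext s; cases s <;> simp [Tri.dim]
  mul_one a := by funext s; cases s <;> simp [Tri.dim]
  one_mem := by
    rw [Tri.mem_gr]; intro s hs; simp [hs]
  mul_mem i j a b ha hb := by
    rw [Tri.mem_gr] at ha hb ⊢
    have h (s s' : Tri) (hs : s.dim + s'.dim ≠ i + j) : a s * b s' = 0 := by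
      by_cases h : s.dim = i
      · rw [hb s' (by omega), mul_zero]
      · rw [ha s h, zero_mul]
    intro s hs
    cases s <;> simp only [Tri.mul_v0, Tri.mul_v1, Tri.mul_v2, Tri.mul_e01, Tri.mul_e02, Tri.mul_e12,
      Tri.mul_top] <;> simp only [Tri.dim] at hs <;> repeat rw [h _ _ (by simp only [Tri.dim]; omega)]
    all_goals simp
  d_mem i a ha := by
    rw [Tri.mem_gr] at ha ⊢
    intro s hs
    cases s <;> simp only [Tri.d_v0, Tri.d_v1, Tri.d_v2, Tri.d_e01, Tri.d_e02, Tri.d_e12,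
      Tri.d_top] <;> simp only [Tri.dim] at hs <;> repeat rw [ha _ (by simp only [Tri.dim]; omega)]
    all_goals simp
  d_d a := by funext s; cases s <;> simp
  d_one := by funext s; cases s <;> simp [Tri.dim]
  d_mul a b := by funext s; cases s <;> simp [Tri.dim] <;> ring

/-- A morphism of dg algebras. -/
structure DGAlg.IsHom {R : Type y} [AddCommGroup R] [Module K R] {R' : Type z} [AddCommGroup R']
    [Module K R'] (D : DGAlg K R) (D' : DGAlg K R') (r : R →ₗ[K] R') : Prop where
  map_mem : ∀ i, ∀ a ∈ D.gr i, r a ∈ D'.gr i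
  map_d : ∀ a, r (D.d a) = D'.d (r a)
  map_mul : ∀ a b, r (D.mul a b) = D'.mul (r a) (r b)
  map_one : r D.one = D'.one

/-- The three edges of `Δ²`. -/
def Tri.face : Fin 3 → Simp → Tri
  | 0, .v0 => .v1
  | 0, .v1 => .v2
  | 0, .edge => .e12
  | 1, .v0 => .v0
  | 1, .v1 => .v2
  | 1, .edge => .e02
  | 2, .v0 => .v0
  | 2, .v1 => .v1
  | 2, .edge => .e01

/-- The restriction of cochains to an edge. -/
def Tri.res (i : Fin 3) : (Tri → K) →ₗ[K] Interval K := LinearMap.funLeft K K (Tri.face i)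

theorem Tri.res_apply (i : Fin 3) (a : Tri → K) (s : Simp) : Tri.res K i a s = a (Tri.face i s) := rfl

theorem Tri.res_isHom (i : Fin 3) : (triAlg K).IsHom K (intervalAlg K) (Tri.res K i) where
  map_mem j a ha := by
    change a ∈ Tri.gr K j at ha
    change Tri.res K i a ∈ Interval.cochainGr K j
    rw [Tri.mem_gr] at ha
    rw [Interval.mem_cochainGr]
    intro s hs
    rw [Tri.res_apply]
    refine ha _ fun h => hs ?_
    rw [← h]
    fin_cases i <;> cases s <;> rfl
  map_d a := by
    change Tri.res K i (Tri.d K a) = Interval.cochainD K (Tri.res K i a)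
    funext s
    fin_cases i <;> cases s <;> simp [Tri.res_apply, Tri.face]
  map_mul a b := by
    change Tri.res K i (Tri.mul K a b) = Interval.mul K (Tri.res K i a) (Tri.res K i b)
    funext s
    fin_cases i <;> cases s <;> simp [Tri.res_apply, Tri.face]
  map_one := by
    funext s
    fin_cases i <;> cases s <;> simp [Tri.res_apply, Tri.face, triAlg, intervalAlg, Tri.dim]

/-- The ground field as a dg algebra. -/
def groundAlg : DGAlg K K where
  gr i := if i = 0 then ⊤ else ⊥
  par ε := if ε = 0 then LinearMap.id else 0
  sgn := LinearMap.id
  d := 0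
  mul := LinearMap.mul K K
  one := 1
  graded := by
    refine ⟨fun i a ha => ?_, ?_⟩
    · by_cases h : i = 0
      · simp [h]
      · simp_all
    · rw [eq_top_iff]
      exact fun a _ => Submodule.subset_span ⟨0, by simp⟩
  par_of_mem ε i a ha := by
    by_cases h : i = 0
    · subst h; by_cases h : ε = 0
      · simp [h]
      · simp [h, Ne.symm h]
    · have : a = 0 := by simpa [h] using ha
      simp [this]
  mul_assoc := mul_assoc
  one_mul := one_mul
  mul_one := mul_one
  one_mem := by simp
  mul_mem i j a b ha hb := by
    by_cases h : i = 0
    · by_cases h' : j = 0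
      · simp [h, h']
      · have : b = 0 := by simpa [h'] using hb
        simp [this]
    · have : a = 0 := by simpa [h] using ha
      simp [this]
  d_mem i a _ := by simp
  d_d a := by simp
  d_one := by simp
  d_mul a b := by simp

/-- Evaluation of cochains on the interval at a vertex. -/
theorem Interval.proj_isHom {s : Simp} (hs : s ≠ .edge) :
    (intervalAlg K).IsHom K (groundAlg K) (LinearMap.proj s) where
  map_mem i a ha := by
    change a ∈ Interval.cochainGr K i at ha
    rw [Interval.mem_cochainGr] at ha
    by_cases h : i = 0
    · simp [groundAlg, h]
    · rw [LinearMap.proj_apply, ha s (by cases s <;> simp_all [Simp.dim] <;> omega)]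
      exact Submodule.zero_mem _
  map_d a := by cases s <;> simp_all [intervalAlg, groundAlg]
  map_mul a b := by cases s <;> simp_all [intervalAlg, groundAlg]
  map_one := by cases s <;> simp_all [intervalAlg, groundAlg]

end Cochains

/-! ## Maps of algebras and curvature -/

section CollectHom

variable {K : Type u} [Field K] {P : ℕ → DGMod.{u, v} K}
variable {X : Type x} [AddCommGroup X] [Module K X]
variable {R : Type y} [AddCommGroup R] [Module K R] {D : DGAlg K R}
variable {R' : Type z} [AddCommGroup R'] [Module K R'] {D' : DGAlg K R'}

theorem DGAlg.IsHom.map_par {r : R →ₗ[K] R'} (h : D.IsHom K D' r) (ε : ZMod 2) (a : R) :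
    r (D.par ε a) = D'.par ε (r a) := by
  have : r ∘ₗ D.par ε = D'.par ε ∘ₗ r := by
    refine LinearMap.ext_on D.graded.span ?_
    rintro a ⟨i, ha⟩
    rw [LinearMap.comp_apply, LinearMap.comp_apply, D.par_of_mem ε i a ha,
      D'.par_of_mem ε i _ (h.map_mem i a ha)]
    split_ifs <;> simp
  exact LinearMap.congr_fun this a

theorem act_map_right {r : R →ₗ[K] R'} (h : D.IsHom K D' r) (s : X →ₗ[K] X) (z : X ⊗[K] R)
    (y : Words K X ⊗[K] R) :
    act D' s (TensorProduct.map LinearMap.id r z) (TensorProduct.map LinearMap.id r y) =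
      TensorProduct.map LinearMap.id r (act D s z y) := by
  induction z with
  | zero => simp
  | add z z' h h' => simp only [map_add, LinearMap.add_apply, h, h']
  | tmul a ν =>
    induction y with
    | zero => simp
    | add y y' h h' => simp only [map_add, h, h']
    | tmul w ν' =>
      simp only [TensorProduct.map_tmul, LinearMap.id_apply, act_tmul, map_add, h.map_mul, h.map_par]

theorem collectWords_map_right {r : R →ₗ[K] R'} (h : D.IsHom K D' r) (s : X →ₗ[K] X)
    (w : Words K (X ⊗[K] R)) :
    collectWords D' s (wmap (TensorProduct.map LinearMap.id r) w) =
      TensorProduct.map LinearMap.id r (collectWords D s w) := by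
  have : collectWords D' s ∘ₗ wmap (TensorProduct.map LinearMap.id r) =
      TensorProduct.map LinearMap.id r ∘ₗ collectWords D s := by
    refine words_hom_ext fun l => ?_
    induction l with
    | nil => simp [h.map_one]
    | cons z l ih =>
      simp only [LinearMap.comp_apply] at ih ⊢
      rw [word_cons, wmap_letter_mul, collectWords_letter_mul, ih, act_map_right h,
        collectWords_letter_mul]
  exact LinearMap.congr_fun this w

theorem collect_map_right {r : R →ₗ[K] R'} (h : D.IsHom K D' r) (s : X →ₗ[K] X)
    (y : Schur P (X ⊗[K] R)) :
    collect D' P s (Schur.map P (TensorProduct.map LinearMap.id r) y) =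
      TensorProduct.map LinearMap.id r (collect D P s y) := by
  have : collect D' P s ∘ₗ Schur.map P (TensorProduct.map LinearMap.id r) =
      TensorProduct.map LinearMap.id r ∘ₗ collect D P s := by
    refine schur_hom_ext' fun n p z => ?_
    simp only [LinearMap.comp_apply, collect, toTensor_map]
    rw [toTensor_of]
    simp only [TensorProduct.map_tmul, LinearMap.id_apply, collectWords_map_right h]
    induction collectWords D s (word K (List.ofFn z)) with
    | zero => simp
    | add y y' h h' => simp only [map_add, TensorProduct.tmul_add, h, h']
    | tmul w ν => simp
  exact LinearMap.congr_fun this y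

variable (D) in
/-- The inclusion `a ↦ a ⊗ 1`. -/
def constMap (X : Type x) [AddCommGroup X] [Module K X] : X →ₗ[K] X ⊗[K] R :=
  (TensorProduct.mk K X R).flip D.one

theorem constMap_apply (a : X) : constMap D X a = a ⊗ₜ D.one := rfl

theorem collectWords_const (s : X →ₗ[K] X) (l : List X) :
    collectWords D s (word K (l.map (constMap D X))) = word K l ⊗ₜ D.one := by
  induction l with
  | nil => simp
  | cons a l ih =>
    rw [List.map_cons, word_cons, collectWords_letter_mul, ih, constMap_apply,
      act_of_mem D s a D.one_mem, D.one_mul, word_cons]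
    simp [wmap_id]

/-- All coefficients are the unit, which has degree zero and hence moves past everything without
sign. -/
theorem collect_const (s : X →ₗ[K] X) (y : Schur P X) :
    collect D P s (Schur.map P (constMap D X) y) = y ⊗ₜ D.one := by
  have : collect D P s ∘ₗ Schur.map P (constMap D X) = constMap D (Schur P X) := by
    refine schur_hom_ext' fun n p a => ?_
    have h : (List.ofFn fun j => constMap D X (a j)) = (List.ofFn a).map (constMap D X) := by
      rw [List.map_ofFn]; rfl
    rw [LinearMap.comp_apply, schur_map_of, collect_of, h, collectWords_const, ofTensorR_tmul,
      constMap_apply, ← sch, sch_ofFn]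
  exact LinearMap.congr_fun this y

/-- A map `X ⊗ R → X` induced by a linear form on `R`. -/
def contract (X : Type x) [AddCommGroup X] [Module K X] (χ : R →ₗ[K] K) : X ⊗[K] R →ₗ[K] X :=
  (TensorProduct.rid K X).toLinearMap ∘ₗ TensorProduct.map LinearMap.id χ

@[simp] theorem contract_tmul (χ : R →ₗ[K] K) (a : X) (ν : R) : contract X χ (a ⊗ₜ ν) = χ ν • a := by
  simp [contract]

/-- A character of `R` is a map to the ground field, and with coefficients in the ground field
collecting is trivial. So evaluation at a vertex respects the operations. -/
theorem collect_contract {χ : R →ₗ[K] K} (h : D.IsHom K (groundAlg K) χ) (s : X →ₗ[K] X)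
    (y : Schur P (X ⊗[K] R)) :
    contract (Schur P X) χ (collect D P s y) = Schur.map P (contract X χ) y := by
  have h1 := collect_map_right h s y
  have h2 : Schur.map P (TensorProduct.map LinearMap.id χ) y =
      Schur.map P (constMap (groundAlg K) X) (Schur.map P (contract X χ) y) := by
    rw [← LinearMap.comp_apply (Schur.map P _), ← schur_map_comp]
    congr 2
    refine TensorProduct.ext' fun a ν => ?_
    simp only [TensorProduct.map_tmul, LinearMap.id_apply, LinearMap.comp_apply, contract_tmul,
      constMap_apply, groundAlg]
    rw [TensorProduct.smul_tmul, smul_eq_mul, mul_one]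
  rw [h2, collect_const] at h1
  rw [contract, LinearMap.comp_apply, ← h1]
  simp [groundAlg]

end CollectHom

/-! ### Algebra maps and their effect on curvature -/

section AlgMap

variable {K : Type u} [Field K] {C : NSCooperad.{u, v} K} {P : NSOperad.{u, w} K}
variable (α : TwistingMorphism C P)

/-- A linear map of degree zero that commutes with the differentials and the structure maps. -/
structure IsAlgMap (B : NSAlgData.{u, w, y} P) (B' : NSAlgData.{u, w, z} P)
    (f : B.carrier →ₗ[K] B'.carrier) : Prop where
  degree : ∀ i, ∀ a ∈ B.gr i, f a ∈ B'.gr i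
  comm_d : ∀ a, f (B.d a) = B'.d (f a)
  comm_γ : ∀ a, f (B.γ a) = B'.γ (Schur.map P.obj f a)

variable {α}

theorem curv_apply (W : NSCoalgData.{u, v, x} C) (B : NSAlgData.{u, w, y} P)
    (ψ : W.carrier →ₗ[K] B.carrier) (a : W.carrier) :
    curv α W B ψ a = B.d (ψ a) - ψ (W.d a) +
      B.γ (α.app B.carrier (Schur.map C.obj ψ (W.Δ a))) := rfl

/-- Curvature is built from the structure of the target, so it is natural in algebra maps. It
follows that vertices, faces and constant extensions of twisting maps are twisting. -/
theorem IsAlgMap.curv_comp {B : NSAlgData.{u, w, y} P} {B' : NSAlgData.{u, w, z} P}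
    {f : B.carrier →ₗ[K] B'.carrier} (hf : IsAlgMap B B' f) (W : NSCoalgData.{u, v, x} C)
    (ψ : W.carrier →ₗ[K] B.carrier) : curv α W B' (f ∘ₗ ψ) = f ∘ₗ curv α W B ψ := by
  refine LinearMap.ext fun a => ?_
  rw [LinearMap.comp_apply, curv_apply, curv_apply, map_add, map_sub, hf.comm_d, hf.comm_γ,
    schur_map_comp_apply]
  have := LinearMap.congr_fun (app_natural α f) (Schur.map C.obj ψ (W.Δ a))
  simp only [LinearMap.comp_apply] at this ⊢
  rw [this]

theorem IsAlgMap.isTwisting {B : NSAlgData.{u, w, y} P} {B' : NSAlgData.{u, w, z} P}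
    {f : B.carrier →ₗ[K] B'.carrier} (hf : IsAlgMap B B' f) {W : NSCoalgData.{u, v, x} C}
    {ψ : W.carrier →ₗ[K] B.carrier} (h : IsTwisting α W B ψ) : IsTwisting α W B' (f ∘ₗ ψ) :=
  ⟨fun i a ha => hf.degree i _ (h.degree i a ha), by
    rw [hf.curv_comp, h.curv_eq_zero, LinearMap.comp_zero]⟩

variable {B : NSAlgData.{u, w, x} P} {s : B.carrier →ₗ[K] B.carrier}
variable {R : Type y} [AddCommGroup R] [Module K R] {D : DGAlg K R}
variable {R' : Type z} [AddCommGroup R'] [Module K R'] {D' : DGAlg K R'}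

theorem DGAlg.IsHom.isAlgMap {r : R →ₗ[K] R'} (h : D.IsHom K D' r) :
    IsAlgMap (tensorAlg D B s) (tensorAlg D' B s) (TensorProduct.map LinearMap.id r) where
  degree i a ha := tensorGr_induction ha (tensorGr B.gr D'.gr i) (TensorProduct.map LinearMap.id r)
    fun p q a ν hi ha hν => tmul_mem_tensorGr ha (h.map_mem q ν hν) hi
  comm_d := by
    change ∀ a : B.carrier ⊗[K] R, TensorProduct.map LinearMap.id r (tensorD D s B.d a) =
      tensorD D' s B.d (TensorProduct.map LinearMap.id r a)
    intro a
    induction a with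
    | zero => simp
    | add a b h h' => simp only [map_add, h, h']
    | tmul a ν => simp [tensorD, h.map_d]
  comm_γ := by
    change ∀ a : Schur P.obj (B.carrier ⊗[K] R), TensorProduct.map LinearMap.id r (TensorProduct.map B.γ LinearMap.id
      (collect D P.obj s a)) = TensorProduct.map B.γ LinearMap.id (collect D' P.obj s
        (Schur.map P.obj (TensorProduct.map LinearMap.id r) a))
    intro a
    rw [collect_map_right h]
    induction collect D P.obj s a with
    | zero => simp
    | add a b h h' => simp only [map_add, h, h']
    | tmul a ν => simp

theorem isAlgMap_contract {χ : R →ₗ[K] K} (h : D.IsHom K (groundAlg K) χ) :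
    IsAlgMap (tensorAlg D B s) B (contract B.carrier χ) where
  degree i a ha := tensorGr_induction ha (B.gr i) (contract B.carrier χ)
    fun p q b ν hi hb hν => by
      rw [contract_tmul]
      have := h.map_mem q ν hν
      by_cases hq : q = 0
      · subst hq
        rw [add_zero] at hi
        subst hi
        exact Submodule.smul_mem _ _ hb
      · have : χ ν = 0 := by simpa [groundAlg, hq] using this
        rw [this, zero_smul]
        exact Submodule.zero_mem _
  comm_d := by
    change ∀ a : B.carrier ⊗[K] R, contract B.carrier χ (tensorD D s B.d a) =
      B.d (contract B.carrier χ a)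
    intro a
    induction a with
    | zero => simp
    | add a b h h' => simp only [map_add, h, h']
    | tmul a ν =>
      have : χ (D.d ν) = 0 := h.map_d ν
      simp [tensorD, this]
  comm_γ := by
    change ∀ a : Schur P.obj (B.carrier ⊗[K] R), contract B.carrier χ (TensorProduct.map B.γ LinearMap.id (collect D P.obj s a)) =
      B.γ (Schur.map P.obj (contract B.carrier χ) a)
    intro a
    rw [← collect_contract h s]
    induction collect D P.obj s a with
    | zero => simp
    | add a b h h' => simp only [map_add, h, h']
    | tmul a ν => simp

theorem isAlgMap_constMap : IsAlgMap B (tensorAlg D B s) (constMap D B.carrier) where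
  degree i a ha := tmul_mem_tensorGr ha D.one_mem (add_zero i)
  comm_d a := by
    change B.d a ⊗ₜ D.one = tensorD D s B.d (a ⊗ₜ D.one)
    simp [tensorD, D.d_one]
  comm_γ a := by
    change B.γ a ⊗ₜ D.one = TensorProduct.map B.γ LinearMap.id (collect D P.obj s
        (Schur.map P.obj (constMap D B.carrier) a))
    rw [collect_const]
    simp

end AlgMap

/-! ## The coradical filtration -/

section Coradical

variable {K : Type u} [Field K] {C : NSCooperad.{u, v} K}

/-- The arity `n` part of the structure map of a coalgebra. -/
def NSCoalgData.comul (W : NSCoalgData.{u, v, x} C) (n : ℕ) :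
    W.carrier →ₗ[K] ((C.obj n).carrier ⊗[K] (⨂[K]^n W.carrier)) :=
  DirectSum.component K ℕ (fun n => (C.obj n).carrier ⊗[K] (⨂[K]^n W.carrier)) n ∘ₗ W.Δ

/-- The coradical filtration. -/
def NSCoalgData.coradical (W : NSCoalgData.{u, v, x} C) (k : ℕ) : Submodule K W.carrier :=
  ⨅ n : ℕ, ⨅ _ : k < n, LinearMap.ker (W.comul n)

variable {W : NSCoalgData.{u, v, x} C} {s : W.carrier →ₗ[K] W.carrier}

theorem NSCoalgData.mem_coradical {k : ℕ} {a : W.carrier} :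
    a ∈ W.coradical k ↔ ∀ n, k < n → W.comul n a = 0 := by
  simp [NSCoalgData.coradical, Submodule.mem_iInf]

theorem NSCoalgData.coradical_mono {k l : ℕ} (h : k ≤ l) : W.coradical k ≤ W.coradical l := by
  intro a ha
  rw [NSCoalgData.mem_coradical] at ha ⊢
  exact fun n hn => ha n (by omega)

/-- Conilpotence: `Δ a` lies in a direct sum, so the largest arity in its support bounds the
filtration degree. -/
theorem NSCoalgData.exists_mem_coradical (a : W.carrier) : ∃ k, a ∈ W.coradical k := by
  classical
  refine ⟨(DFinsupp.support (W.Δ a)).sup id, NSCoalgData.mem_coradical.mpr fun n hn => ?_⟩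
  by_contra h
  have : n ∈ DFinsupp.support (W.Δ a) := DFinsupp.mem_support_iff.mpr h
  exact absurd (Finset.le_sup (f := id) this) (by simpa using hn)

/-- The counit recovers `a` from the arity one part of `Δ a`, and this part vanishes on `F_0`. -/
theorem NSCoalgData.IsCoalg.eq_zero_of_mem_coradical_zero (hW : W.IsCoalg s) {a : W.carrier}
    (ha : a ∈ W.coradical 0) : a = 0 := by
  have h := LinearMap.congr_fun hW.counit a
  have h1 : DirectSum.component K ℕ (fun n => (C.obj n).carrier ⊗[K] (⨂[K]^n W.carrier)) 1 (W.Δ a) =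
      0 := NSCoalgData.mem_coradical.mp ha 1 one_pos
  rw [LinearMap.comp_apply, counitProj, LinearMap.comp_apply, LinearMap.comp_apply, h1, map_zero,
    map_zero] at h
  exact h.symm

/-- A linear map vanishes if it vanishes on `x ∈ F_{k+1}` whenever it vanishes on `F_k`. -/
theorem NSCoalgData.IsCoalg.eq_zero_of_coradical (hW : W.IsCoalg s) {Y : Type*} [AddCommGroup Y]
    [Module K Y] {g : W.carrier →ₗ[K] Y}
    (h : ∀ k, (∀ a ∈ W.coradical k, g a = 0) → ∀ a ∈ W.coradical (k + 1), g a = 0) : g = 0 := by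
  have key : ∀ k, ∀ a ∈ W.coradical k, g a = 0 := by
    intro k
    induction k with
    | zero =>
      intro a ha
      rw [hW.eq_zero_of_mem_coradical_zero ha, map_zero]
    | succ k ih => exact h k ih
  refine LinearMap.ext fun a => ?_
  obtain ⟨k, hk⟩ := NSCoalgData.exists_mem_coradical a
  exact key k a hk

theorem directSum_eq_zero {M : ℕ → Type*} [∀ n, AddCommGroup (M n)] [∀ n, Module K (M n)] {Z : Type*}
    [AddCommGroup Z] [Module K Z] (F : (⨁ n, M n) →ₗ[K] Z) (N : ℕ) (y : ⨁ n, M n)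
    (hy : ∀ n, N < n → DirectSum.component K ℕ M n y = 0)
    (hF : ∀ n, n ≤ N → ∀ t, F (DirectSum.lof K ℕ M n t) = 0) : F y = 0 := by
  classical
  rw [← DirectSum.sum_support_of y, map_sum]
  refine Finset.sum_eq_zero fun n _ => ?_
  by_cases h : n ≤ N
  · exact hF n h _
  · have : y n = 0 := hy n (by omega)
    rw [this, map_zero, map_zero]

variable {P : ℕ → DGMod.{u, w} K} {Y : Type y} [AddCommGroup Y] [Module K Y]

/-- The part of arity `> k` of an element of `P ∘ X`. -/
def truncate (P : ℕ → DGMod.{u, v} K) (X : Type x) [AddCommGroup X] [Module K X] (k : ℕ) :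
    Schur P X →ₗ[K] Schur P X :=
  DirectSum.lmap fun n => if k < n then LinearMap.id else 0

theorem truncate_sch {P : ℕ → DGMod.{u, v} K} {X : Type x} [AddCommGroup X] [Module K X] {k n : ℕ}
    (h : n ≤ k) (q : P n) (l : List X) : truncate P X k (sch P (Tot.of P n q) l) = 0 := by
  rw [sch, ofTensor_of_tmul, Schur.of, truncate, DirectSum.lmap_lof, if_neg (by omega)]
  simp

theorem NSCoalgData.coradical_eq_ker (k : ℕ) :
    W.coradical k = LinearMap.ker (truncate C.obj W.carrier k ∘ₗ W.Δ) := by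
  ext a
  rw [NSCoalgData.mem_coradical, LinearMap.mem_ker, LinearMap.comp_apply]
  constructor
  · intro h
    refine DFinsupp.ext fun n => ?_
    rw [truncate, DirectSum.lmap_apply]
    by_cases hn : k < n
    · rw [if_pos hn]; exact h n hn
    · rw [if_neg hn]; rfl
  · intro h n hn
    have := DFunLike.congr_fun h n
    rw [truncate, DirectSum.lmap_apply, if_pos hn] at this
    exact this

/-- `φ ⊗ (∑ᵢ f ⊗ ⋯ ⊗ g ⊗ ⋯ ⊗ h)` on `C ∘ X`. -/
def phiIns {C : ℕ → DGMod.{u, v} K} (φ : ∀ n, C n →ₗ[K] P n) {X : Type x} [AddCommGroup X]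
    [Module K X] (f g h : X →ₗ[K] Y) : Schur C X →ₗ[K] Schur P Y :=
  DirectSum.lmap fun n => TensorProduct.map (φ n) (insertEach n f g h)

theorem phiIns_comp_map {C : ℕ → DGMod.{u, v} K} (φ : ∀ n, C n →ₗ[K] P n) {X : Type x}
    [AddCommGroup X] [Module K X] {Z : Type*} [AddCommGroup Z] [Module K Z] (u : X →ₗ[K] Z)
    (f g h : Z →ₗ[K] Y) :
    phiIns φ f g h ∘ₗ Schur.map C u = phiIns φ (f ∘ₗ u) (g ∘ₗ u) (h ∘ₗ u) := by
  simp only [Schur.map, phiIns, ← DirectSum.lmap_comp, ← TensorProduct.map_comp, insertEach_comp_map]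
  rfl

theorem phiIns_of {C : ℕ → DGMod.{u, v} K} (φ : ∀ n, C n →ₗ[K] P n) {X : Type x} [AddCommGroup X]
    [Module K X] (f g h : X →ₗ[K] Y) (n : ℕ) (c : C n) (a : Fin n → X) :
    phiIns φ f g h (Schur.of C n (c ⊗ₜ PiTensorProduct.tprod K a)) =
      ∑ i : Fin n, Schur.of P n (φ n c ⊗ₜ PiTensorProduct.tprod K fun j =>
        if j < i then f (a j) else if j = i then g (a j) else h (a j)) := by
  rw [phiIns, Schur.of, DirectSum.lmap_lof, TensorProduct.map_tmul, insertEach_tprod,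
    TensorProduct.tmul_sum, map_sum]

theorem exists_comp_eq_of_ker_le {X Y Z : Type*} [AddCommGroup X] [Module K X] [AddCommGroup Y]
    [Module K Y] [AddCommGroup Z] [Module K Z] {u : X →ₗ[K] Z} {g : X →ₗ[K] Y}
    (h : LinearMap.ker u ≤ LinearMap.ker g) : ∃ g' : Z →ₗ[K] Y, g' ∘ₗ u = g := by
  obtain ⟨g', hg'⟩ := LinearMap.exists_extend
    ((LinearMap.ker u).liftQ g h ∘ₗ u.quotKerEquivRange.symm.toLinearMap)
  refine ⟨g', LinearMap.ext fun a => ?_⟩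
  have := LinearMap.congr_fun hg' ⟨u a, a, rfl⟩
  simp only [LinearMap.comp_apply, Submodule.subtype_apply] at this ⊢
  rw [this]
  have h2 : u.quotKerEquivRange.symm ⟨u a, a, rfl⟩ = (LinearMap.ker u).mkQ a := by
    rw [LinearEquiv.symm_apply_eq]; rfl
  exact (congrArg _ h2).trans ((LinearMap.ker u).liftQ_apply g a)

/-- A summand of the decomposition has upper arities `m j` with sum `n ≤ k + 1`. A single upper
factor is excluded by `φ 1 = 0`. With at least two, either the factor carrying `g` has arity at most
`k` and is truncated away, or some other factor has arity zero, and `C(0) = 0`. -/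
theorem phiIns_cut_eq_zero {s : W.carrier →ₗ[K] W.carrier} (hs : s ∘ₗ s = LinearMap.id)
    (φ : ∀ n, C.obj n →ₗ[K] P n) (hφ : φ 1 = 0)
    (f : W.carrier →ₗ[K] Y) {g : Schur C.obj W.carrier →ₗ[K] Y} (h : W.carrier →ₗ[K] Y) {k n : ℕ}
    (hn : n ≤ k + 1) (c : C.obj n) (a : Fin n → W.carrier) :
    phiIns φ (f ∘ₗ counitProj C.obj C.ε) (g ∘ₗ truncate C.obj W.carrier k)
      (h ∘ₗ counitProj C.obj C.ε) (cofreeComul C.obj C.Δ s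
        (Schur.of C.obj n (c ⊗ₜ PiTensorProduct.tprod K a))) = 0 := by
  rw [cofreeComul_of]
  refine arity_word_eq (F := phiIns φ (f ∘ₗ counitProj C.obj C.ε) (g ∘ₗ truncate C.obj W.carrier k)
      (h ∘ₗ counitProj C.obj C.ε) ∘ₗ cut C.obj s) (G := 0) (S := Set.univ)
      (fun r p m e q l hm hq hl _ => ?_) (C.Δ_arity n c) (a := a) (by simp)
  rw [LinearMap.comp_apply, cut_of hs p hq hl, phiIns_of, LinearMap.zero_apply]
  refine Finset.sum_eq_zero fun i _ => ?_
  by_cases hr : r = 1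
  · subst hr
    rw [hφ, LinearMap.zero_apply, TensorProduct.zero_tmul, map_zero]
  rw [← map_zero (Schur.of P r), ← TensorProduct.tmul_zero _ (φ r p)]
  congr 2
  by_cases hi : m i ≤ k
  · refine (PiTensorProduct.tprod K).map_coord_zero i ?_
    rw [if_neg (lt_irrefl i), if_pos rfl, LinearMap.comp_apply, truncate_sch hi, map_zero]
  -- Here `m i` uses up the whole arity `k + 1`, so any second factor has arity zero.
  · obtain ⟨j, hj⟩ : ∃ j : Fin r, j ≠ i := by
      have : 1 < Fintype.card (Fin r) := by
        rw [Fintype.card_fin]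
        have := i.pos
        omega
      exact Fintype.exists_ne_of_one_lt_card this i
    have hmj : m j = 0 := by
      have h1 : m i + m j ≤ ∑ j, m j := by
        rw [← Finset.sum_pair hj.symm]
        exact Finset.sum_le_sum_of_subset (Finset.subset_univ _)
      omega
    refine (PiTensorProduct.tprod K).map_coord_zero j ?_
    have hz (l : List W.carrier) : sch C.obj (Tot.of C.obj (m j) (q j)) l = 0 := by
      have : q j = 0 := by
        generalize q j = q'
        revert q'
        rw [hmj]
        exact C.reduced_zero
      rw [this, map_zero, sch, TensorProduct.zero_tmul, map_zero]
    rw [hz, map_zero, map_zero, map_zero]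
    split_ifs <;> rfl

/-- Coassociativity lets the vanishing of `g` on `F_k` be tested inside the second iteration of `Δ`,
where arities add up. This drives all inductions over the coradical filtration. -/
theorem phiIns_eq_zero (hW : W.IsCoalg s) (φ : ∀ n, C.obj n →ₗ[K] P n) (hφ : φ 1 = 0)
    (f : W.carrier →ₗ[K] Y) {g : W.carrier →ₗ[K] Y} (h : W.carrier →ₗ[K] Y) {k : ℕ}
    (hg : ∀ a ∈ W.coradical k, g a = 0) {a : W.carrier} (ha : a ∈ W.coradical (k + 1)) :
    phiIns φ f g h (W.Δ a) = 0 := by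
  -- `F_k` is the kernel of the part of `Δ` of arity greater than `k`, so over a field `g` factors
  -- through that part. The maps `f` and `h` factor through `Δ` by the counit.
  obtain ⟨g', hg'⟩ : ∃ g' : Schur C.obj W.carrier →ₗ[K] Y,
      g' ∘ₗ truncate C.obj W.carrier k ∘ₗ W.Δ = g := by
    refine exists_comp_eq_of_ker_le ?_
    rw [← NSCoalgData.coradical_eq_ker]
    exact hg
  have h1 := LinearMap.congr_fun (phiIns_comp_map φ W.Δ (f ∘ₗ counitProj C.obj C.ε)
    (g' ∘ₗ truncate C.obj W.carrier k) (h ∘ₗ counitProj C.obj C.ε)) (W.Δ a)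
  have h2 := LinearMap.congr_fun hW.coassoc a
  rw [LinearMap.comp_apply, LinearMap.comp_apply] at h2
  rw [LinearMap.comp_assoc, LinearMap.comp_assoc, LinearMap.comp_assoc, hW.counit, hg',
    LinearMap.comp_id, LinearMap.comp_id, LinearMap.comp_apply, h2] at h1
  rw [← h1, ← LinearMap.comp_apply]
  refine directSum_eq_zero _ (k + 1) _ (fun n hn => NSCoalgData.mem_coradical.mp ha n hn) ?_
  intro n hn t
  have : (phiIns φ (f ∘ₗ counitProj C.obj C.ε) (g' ∘ₗ truncate C.obj W.carrier k)
      (h ∘ₗ counitProj C.obj C.ε) ∘ₗ cofreeComul C.obj C.Δ s) ∘ₗ Schur.of C.obj n = 0 := by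
    refine TensorProduct.ext (LinearMap.ext fun c => PiTensorProduct.ext
      (MultilinearMap.ext fun b => ?_))
    exact phiIns_cut_eq_zero hW.graded.involutive φ hφ f h hn c b
  exact LinearMap.congr_fun this t

end Coradical

/-! ## The Bianchi identity -/

section Bianchi

variable {K : Type u} [Field K] {C : NSCooperad.{u, v} K} {P : NSOperad.{u, w} K}
variable (α : TwistingMorphism C P)

/-- `C(1)` and `P(1)` are concentrated in degree zero, while `α` has degree one. -/
theorem TwistingMorphism.toFun_one : α.toFun 1 = 0 := by
  refine LinearMap.ext fun c => ?_
  have h1 := α.degree 1 0 c (by rw [C.reduced_one_degree]; trivial)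
  have h0 : α.toFun 1 c ∈ (P.obj 1).gr 0 := by
    obtain ⟨t, ht⟩ := P.reduced_one (α.toFun 1 c)
    rw [ht]
    exact Submodule.smul_mem _ _ P.one_degree
  have hd := (P.obj 1).internal.submodule_iSupIndep.pairwiseDisjoint (show (0 : ℤ) ≠ 0 + 1 by simp)
  exact (Submodule.disjoint_def.mp hd) _ h0 h1

variable {X : Type x} [AddCommGroup X] [Module K X] {Y : Type y} [AddCommGroup Y] [Module K Y]

theorem app_sch (q : Tot C.obj) (l : List X) :
    α.app X (sch C.obj q l) = sch P.obj (DirectSum.lmap α.toFun q) l := by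
  rw [sch, TwistingMorphism.app]
  refine (lmap_ofTensor α.toFun (fun _ => LinearMap.id) _).trans ?_
  rw [DirectSum.lmap_id]
  rfl

/-- The component `C(n) → K → P(n)` of `unitCounit`. -/
def unitCounitAt (C : NSCooperad.{u, v} K) (P : NSOperad.{u, w} K) (n : ℕ) :
    C.obj n →ₗ[K] P.obj n :=
  DirectSum.component K ℕ (fun n => (P.obj n).carrier) n ∘ₗ unitCounit C P ∘ₗ Tot.of C.obj n

theorem unitCounit_of_one (c : C.obj 1) :
    unitCounit C P (Tot.of C.obj 1 c) = Tot.of P.obj 1 (C.ε c • P.one) := by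
  simp [unitCounit, counitTot]

theorem unitCounit_of_ne {n : ℕ} (h : n ≠ 1) (c : C.obj n) :
    unitCounit C P (Tot.of C.obj n c) = 0 := by
  simp [unitCounit, counitTot, DirectSum.component.of, h]

theorem of_unitCounitAt (n : ℕ) (c : C.obj n) :
    Tot.of P.obj n (unitCounitAt C P n c) = unitCounit C P (Tot.of C.obj n c) := by
  by_cases h : n = 1
  · subst h
    rw [unitCounitAt, LinearMap.comp_apply, LinearMap.comp_apply, unitCounit_of_one,
      DirectSum.component.lof_self]
  · rw [unitCounitAt, LinearMap.comp_apply, LinearMap.comp_apply, unitCounit_of_ne h, map_zero,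
      map_zero]

theorem unitCounitAt_mem (n : ℕ) (c : C.obj n) : unitCounitAt C P n c ∈ (P.obj n).gr 0 := by
  rw [unitCounitAt, LinearMap.comp_apply, LinearMap.comp_apply]
  by_cases h : n = 1
  · subst h
    rw [unitCounit_of_one, DirectSum.component.lof_self]
    exact Submodule.smul_mem _ _ P.one_degree
  · rw [unitCounit_of_ne h, map_zero]
    exact Submodule.zero_mem _

variable {B : NSAlgData.{u, w, y} P} {s : B.carrier →ₗ[K] B.carrier}

theorem NSAlgData.IsAlg.γ_sch_unitCounit (hB : B.IsAlg s) {n : ℕ} (q : C.obj n)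
    (l : List B.carrier) :
    B.γ (sch P.obj (unitCounit C P (Tot.of C.obj n q)) l) =
      counitProj C.obj C.ε (sch C.obj (Tot.of C.obj n q) l) := by
  by_cases h : n = 1
  · subst h
    rw [unitCounit_of_one]
    by_cases hl : l.length = 1
    · obtain ⟨b, rfl⟩ := List.length_eq_one_iff.mp hl
      have hu := LinearMap.congr_fun hB.unit b
      rw [LinearMap.comp_apply, generator_eq] at hu
      rw [counitProj_sch_one, sch, map_smul, ← TensorProduct.smul_tmul', map_smul, map_smul, ← sch, hu]
      rfl
    · rw [sch_of_length_ne _ hl, sch_of_length_ne _ hl, map_zero, map_zero]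
  · rw [unitCounit_of_ne h, counitProj_sch_of_ne h, sch, TensorProduct.zero_tmul, map_zero, map_zero]

theorem counitProj_sch_eq_zero {n : ℕ} {e : ℤ} {q : C.obj n} (hq : q ∈ (C.obj n).gr e) (he : e ≠ 0)
    (l : List X) : counitProj C.obj C.ε (sch C.obj (Tot.of C.obj n q) l) = 0 := by
  by_cases h : n = 1
  · subst h
    have hd := (C.obj 1).internal.submodule_iSupIndep.pairwiseDisjoint he
    have : q = 0 := (Submodule.disjoint_def.mp hd) q hq (by rw [C.reduced_one_degree]; trivial)
    rw [this, map_zero, sch, TensorProduct.zero_tmul, map_zero, map_zero]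
  · exact counitProj_sch_of_ne h q l

theorem after_of_support {k : ℕ} {e : Fin k → ZMod 2} {i : Fin k} (h : ∀ j, j ≠ i → e j = 0)
    (j : Fin k) : after e j = if j < i then e i else 0 := by
  rw [after, Finset.sum_eq_single i]
  · intro b _ hb
    rw [h b hb, ite_self]
  · simp

theorem counitProj_map (t : X →ₗ[K] X) (q : Tot C.obj) (l : List X) :
    t (counitProj C.obj C.ε (sch C.obj q l)) = counitProj C.obj C.ε (sch C.obj q (l.map t)) := by
  rw [← schur_map_sch]
  exact (LinearMap.congr_fun (counitProj_natural C t) (sch C.obj q l)).symm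

/-- Both sides of the identity below, on one summand. -/
theorem star_summand (hB : B.IsAlg s) {k : ℕ} (p : P.obj k) {m : Fin k → ℕ} {e : Fin k → ℤ}
    {q : ∀ j, C.obj (m j)} (hq : ∀ j, q j ∈ (C.obj (m j)).gr (e j)) {l : Fin k → List B.carrier}
    (hl : ∀ j, (l j).length = m j) (i : Fin k) :
    B.γ (Schur.of P.obj k (p ⊗ₜ PiTensorProduct.tprod K fun j =>
      if j < i then s (counitProj C.obj C.ε (sch C.obj (Tot.of C.obj (m j) (q j))
          ((l j).map (tw s (after (fun j => (e j : ZMod 2)) j)))))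
      else if j = i then B.γ (α.app B.carrier (sch C.obj (Tot.of C.obj (m j) (q j))
          ((l j).map (tw s (after (fun j => (e j : ZMod 2)) j)))))
      else counitProj C.obj C.ε (sch C.obj (Tot.of C.obj (m j) (q j))
          ((l j).map (tw s (after (fun j => (e j : ZMod 2)) j)))))) =
    B.γ (sch P.obj (P.γ (Schur.of P.obj k (p ⊗ₜ PiTensorProduct.tprod K fun j =>
      if j < i then unitCounit C P (Tot.of C.obj (m j) (q j))
      else if j = i then DirectSum.lmap α.toFun (Tot.of C.obj (m j) (q j))
      else unitCounit C P (Tot.of C.obj (m j) (q j))))) (List.ofFn l).flatten) := by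
  have hs := hB.graded.involutive
  -- The images of the `q j` in the operad: `α` at the place `i`, the unit through the counit
  -- elsewhere. Their degrees `e'` are those needed for the Koszul signs of the free multiplication.
  let q' : ∀ j, P.obj (m j) := fun j => if j = i then α.toFun (m j) (q j) else
    unitCounitAt C P (m j) (q j)
  let e' : Fin k → ℤ := fun j => if j = i then e j + 1 else 0
  have hq' : ∀ j, q' j ∈ (P.obj (m j)).gr (e' j) := by
    intro j
    by_cases h : j = i
    · simp only [q', e', if_pos h]
      exact α.degree _ _ _ (hq j)
    · simp only [q', e', if_neg h]
      exact unitCounitAt_mem _ _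
  have hα (j : Fin k) : DirectSum.lmap α.toFun (Tot.of C.obj (m j) (q j)) =
      Tot.of P.obj (m j) (α.toFun (m j) (q j)) := DirectSum.lmap_lof _ _ _
  have hR : (fun j => if j < i then unitCounit C P (Tot.of C.obj (m j) (q j))
      else if j = i then DirectSum.lmap α.toFun (Tot.of C.obj (m j) (q j))
      else unitCounit C P (Tot.of C.obj (m j) (q j))) = fun j => Tot.of P.obj (m j) (q' j) := by
    funext j
    by_cases h : j = i
    · simp only [q', if_pos h, if_neg (h ▸ lt_irrefl i : ¬ j < i), hα]
    · simp only [q', if_neg h, of_unitCounitAt, ite_self]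
  -- The words are twisted in advance, so that the twists of the free multiplication undo each other
  -- and leave `l`.
  let l' : Fin k → List B.carrier := fun j => (l j).map (tw s (after (fun j => (e' j : ZMod 2)) j))
  have hll : (fun j => (l' j).map (tw s (after (fun j => (e' j : ZMod 2)) j))) = l := by
    funext j
    simp only [l', List.map_map]
    rw [← LinearMap.coe_comp, ← tw_add hs, CharTwo.add_self_eq_zero, tw_zero]
    simp
  have h1 := freeMul_of P.γ hs p hq' (l := l') fun j => by simp only [l', List.length_map, hl]
  rw [hll] at h1
  have h2 := LinearMap.congr_fun hB.assoc (Schur.of P.obj k (p ⊗ₜ PiTensorProduct.tprod K fun j =>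
        sch P.obj (Tot.of P.obj (m j) (q' j)) (l' j)))
  rw [LinearMap.comp_apply, LinearMap.comp_apply, h1, schur_map_of] at h2
  rw [hR, ← h2]
  -- If every other `q j` has degree zero, the two systems of twists differ only because `α` raises
  -- the degree at `i` by one; this is the `s` on the factors in front of `i`. Otherwise some counit
  -- factor is zero, and so are both sides.
  by_cases H : ∀ j, j ≠ i → e j = 0
  · congr 4
    funext j
    have hE := after_of_support (e := fun j => (e j : ZMod 2)) (i := i)
      (fun j hj => by simp [H j hj]) j
    have hE' := after_of_support (e := fun j => (e' j : ZMod 2)) (i := i)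
      (fun j hj => by simp [e', hj]) j
    simp only [l', hE, hE']
    by_cases hj : j = i
    · subst hj
      simp [q', app_sch, hα]
    · have hγ (l : List B.carrier) : B.γ (sch P.obj (Tot.of P.obj (m j) (q' j)) l) =
          counitProj C.obj C.ε (sch C.obj (Tot.of C.obj (m j) (q j)) l) := by
        simp only [q', if_neg hj, of_unitCounitAt, hB.γ_sch_unitCounit]
      rw [hγ]
      by_cases hji : j < i
      · simp only [if_pos hji, e', if_true, Int.cast_add, Int.cast_one]
        rw [counitProj_map, List.map_map, ← LinearMap.coe_comp, add_comm, tw_add hs, tw_one]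
      · simp only [if_neg hji, if_neg hj]
  · push Not at H
    obtain ⟨j, hj, hej⟩ := H
    have hz (l : List B.carrier) : counitProj C.obj C.ε (sch C.obj (Tot.of C.obj (m j) (q j)) l) = 0 :=
      counitProj_sch_eq_zero (hq j) hej l
    have hγ (l : List B.carrier) : B.γ (sch P.obj (Tot.of P.obj (m j) (q' j)) l) = 0 := by
      simp only [q', if_neg hj, of_unitCounitAt, hB.γ_sch_unitCounit, hz]
    congr 3
    refine Eq.trans ((PiTensorProduct.tprod K).map_coord_zero j ?_)
      ((PiTensorProduct.tprod K).map_coord_zero j (hγ _)).symm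
    simp only [hz, if_neg hj, map_zero, ite_self]

end Bianchi

/-! ### Insertions after `α`, and the identity for the curvature -/

section Bianchi

variable {K : Type u} [Field K] {C : NSCooperad.{u, v} K} {P : NSOperad.{u, w} K}
variable (α : TwistingMorphism C P)
variable {X : Type x} [AddCommGroup X] [Module K X] {Y : Type y} [AddCommGroup Y] [Module K Y]

/-- `α ∘ (-1)^{|·|}`. -/
def TwistingMorphism.signed (n : ℕ) : C.obj n →ₗ[K] P.obj n := α.toFun n ∘ₗ (C.obj n).sgn

theorem TwistingMorphism.signed_one : α.signed 1 = 0 := by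
  rw [TwistingMorphism.signed, α.toFun_one, LinearMap.zero_comp]

theorem app_ins (f g h : X →ₗ[K] Y) (y : Schur C.obj X) :
    α.app Y (ins C.obj f g h y) = phiIns α.signed f g h y := by
  have : α.app Y ∘ₗ ins C.obj f g h = phiIns α.signed f g h := by
    refine schur_hom_ext' fun n c a => ?_
    rw [LinearMap.comp_apply, phiIns_of, ins, Schur.of, DirectSum.lmap_lof, TensorProduct.map_tmul,
      insertEach_tprod, TensorProduct.tmul_sum, map_sum, map_sum]
    refine Finset.sum_congr rfl fun i _ => ?_
    rw [TwistingMorphism.app, DirectSum.lmap_lof]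
    rfl
  exact LinearMap.congr_fun this y

/-- The sign operator of `P(n)` after `α` is minus `α` after that of `C(n)`, because `α` is odd. -/
theorem ins_app (f g h : X →ₗ[K] Y) (y : Schur C.obj X) :
    ins P.obj f g h (α.app X y) = -phiIns α.signed f g h y := by
  have : ins P.obj f g h ∘ₗ α.app X = -phiIns α.signed f g h := by
    refine schur_hom_ext (S := Set.univ) Submodule.span_univ fun n i c a hc _ => ?_
    rw [LinearMap.comp_apply, LinearMap.neg_apply, phiIns_of, TwistingMorphism.app, Schur.of,
      DirectSum.lmap_lof, TensorProduct.map_tmul, ins, DirectSum.lmap_lof, TensorProduct.map_tmul,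
      LinearMap.id_apply, insertEach_tprod, TensorProduct.tmul_sum, map_sum, ← Finset.sum_neg_distrib]
    refine Finset.sum_congr rfl fun j _ => ?_
    rw [(P.obj n).sgn_of_mem _ _ (α.degree n i c hc), TwistingMorphism.signed, LinearMap.comp_apply,
      (C.obj n).sgn_of_mem _ _ hc, map_smul, Int.cast_add, zsign_add, Int.cast_one, zsign_one,
      mul_neg_one, neg_smul, TensorProduct.neg_tmul, map_neg]
  exact LinearMap.congr_fun this y

/-- The Maurer-Cartan equation of `α`, tensored with words. -/
theorem opD_app (y : Schur C.obj X) :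
    opD P.obj X (α.app X y) + α.app X (opD C.obj X y) =
      -Schur.ofTensor P.obj (TensorProduct.map (preLie C P α.toFun α.toFun) LinearMap.id
        (Schur.toTensor C.obj y)) := by
  have : opD P.obj X ∘ₗ α.app X + α.app X ∘ₗ opD C.obj X =
      -(Schur.ofTensor P.obj ∘ₗ TensorProduct.map (preLie C P α.toFun α.toFun) LinearMap.id ∘ₗ
        Schur.toTensor C.obj) := by
    refine schur_hom_ext' fun n c a => ?_
    have h := LinearMap.congr_fun α.maurerCartan (Tot.of C.obj n c)
    rw [LinearMap.add_apply, LinearMap.zero_apply] at h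
    simp only [LinearMap.add_apply, LinearMap.neg_apply, LinearMap.comp_apply]
    rw [toTensor_of, TensorProduct.map_tmul, eq_neg_of_add_eq_zero_right h, TensorProduct.neg_tmul, map_neg, neg_neg,
      LinearMap.add_apply, TensorProduct.add_tmul, map_add]
    simp only [LinearMap.comp_apply, Tot.d, Tot.of, Schur.of, DirectSum.lmap_lof, opD,
      TwistingMorphism.app, TensorProduct.map_tmul, LinearMap.id_apply]
    exact congrArg₂ (· + ·) (sch_ofFn _ _ _).symm (sch_ofFn _ _ _).symm
  exact LinearMap.congr_fun this y

variable {α}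
variable {B : NSAlgData.{u, w, y} P} {s : B.carrier →ₗ[K] B.carrier}

/-- Associativity of the action: letting `α` act twice, once inside, equals the action of `α ⋆ α`.
The two sides agree summand by summand in `Δ c`, by `star_summand`. -/
theorem NSAlgData.IsAlg.γ_phiIns_cofreeComul (hB : B.IsAlg s) (y : Schur C.obj B.carrier) :
    B.γ (phiIns α.signed (s ∘ₗ counitProj C.obj C.ε) (B.γ ∘ₗ α.app B.carrier)
      (counitProj C.obj C.ε) (cofreeComul C.obj C.Δ s y)) =
    B.γ (Schur.ofTensor P.obj (TensorProduct.map (preLie C P α.toFun α.toFun) LinearMap.id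
        (Schur.toTensor C.obj y))) := by
  have hs := hB.graded.involutive
  have : B.γ ∘ₗ phiIns α.signed (s ∘ₗ counitProj C.obj C.ε) (B.γ ∘ₗ α.app B.carrier)
      (counitProj C.obj C.ε) ∘ₗ cofreeComul C.obj C.Δ s =
      B.γ ∘ₗ Schur.ofTensor P.obj ∘ₗ TensorProduct.map (preLie C P α.toFun α.toFun) LinearMap.id ∘ₗ
        Schur.toTensor C.obj := by
    refine schur_hom_ext' fun n c a => ?_
    rw [LinearMap.comp_apply, LinearMap.comp_apply, cofreeComul_of, LinearMap.comp_apply,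
      LinearMap.comp_apply, LinearMap.comp_apply, toTensor_of]
    refine arity_word_eq
      (F := B.γ ∘ₗ phiIns α.signed (s ∘ₗ counitProj C.obj C.ε) (B.γ ∘ₗ α.app B.carrier)
        (counitProj C.obj C.ε) ∘ₗ cut C.obj s)
      (G := B.γ ∘ₗ Schur.ofTensor P.obj ∘ₗ TensorProduct.map (P.γ ∘ₗ phiIns α.signed
        (unitCounit C P) (DirectSum.lmap α.toFun) (unitCounit C P)) LinearMap.id) (S := Set.univ)
      (fun k p m e q l hm hq hl _ => ?_) (C.Δ_arity n c) (by simp)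
    simp only [LinearMap.comp_apply, TensorProduct.map_tmul, LinearMap.id_apply]
    rw [cut_of hs p hq hl, phiIns_of, phiIns_of, map_sum, map_sum, TensorProduct.sum_tmul, map_sum,
      map_sum]
    exact Finset.sum_congr rfl fun i _ => star_summand α hB (α.signed k p) hq hl i
  exact LinearMap.congr_fun this y

variable {W : NSCoalgData.{u, v, x} C} {t : W.carrier →ₗ[K] W.carrier}

/-- The Bianchi identity. -/
theorem bianchi (hW : W.IsCoalg t) (hB : B.IsAlg s) {ξ : W.carrier →ₗ[K] B.carrier}
    (hξ : ξ ∘ₗ t = s ∘ₗ ξ) (a : W.carrier) :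
    B.d (curv α W B ξ a) + curv α W B ξ (W.d a) +
      B.γ (phiIns α.signed (s ∘ₗ ξ) (curv α W B ξ) ξ (W.Δ a)) = 0 := by
  set y := Schur.map C.obj ξ (W.Δ a) with hy
  set Γ : W.carrier →ₗ[K] B.carrier := B.γ ∘ₗ α.app B.carrier ∘ₗ Schur.map C.obj ξ ∘ₗ W.Δ with hΓ
  have h1 : B.d (Γ a) = B.γ (opD P.obj B.carrier (α.app B.carrier y)) -
      B.γ (phiIns α.signed (s ∘ₗ ξ) (B.d ∘ₗ ξ) ξ (W.Δ a)) := by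
    have := LinearMap.congr_fun hB.γ_d (α.app B.carrier y)
    rw [LinearMap.comp_apply, schur_d_eq, LinearMap.add_apply, ins_app, hy] at this
    have h2 := LinearMap.congr_fun (phiIns_comp_map α.signed ξ s B.d LinearMap.id) (W.Δ a)
    rw [LinearMap.comp_apply, LinearMap.id_comp] at h2
    rw [h2, map_add, map_neg, ← sub_eq_add_neg] at this
    exact this.symm
  have h2 : Γ (W.d a) = B.γ (α.app B.carrier (opD C.obj B.carrier y)) +
      B.γ (phiIns α.signed (s ∘ₗ ξ) (ξ ∘ₗ W.d) ξ (W.Δ a)) := by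
    have h3 := LinearMap.congr_fun hW.Δ_d a
    rw [LinearMap.comp_apply, schur_d_eq, LinearMap.add_apply, LinearMap.comp_apply] at h3
    have h4 := LinearMap.congr_fun (opD_natural (P := C.obj) ξ) (W.Δ a)
    have h5 := LinearMap.congr_fun (map_comp_ins (P := C.obj) ξ t W.d LinearMap.id) (W.Δ a)
    rw [LinearMap.comp_apply, LinearMap.comp_apply] at h4
    rw [LinearMap.comp_apply, hξ, LinearMap.comp_id] at h5
    change B.γ (α.app B.carrier (Schur.map C.obj ξ (W.Δ (W.d a)))) = _
    rw [← h3, map_add (Schur.map C.obj ξ), h4, h5, map_add, app_ins, map_add]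
  -- Inserting the nonlinear term `Γ` into itself produces the action of `α ⋆ α`, which the equation
  -- for `α` trades for the differentials of `P` and `C`. These cancel the operadic parts of `h1`
  -- and `h2`.
  have h3 : B.γ (phiIns α.signed (s ∘ₗ ξ) Γ ξ (W.Δ a)) =
      -(B.γ (opD P.obj B.carrier (α.app B.carrier y)) +
        B.γ (α.app B.carrier (opD C.obj B.carrier y))) := by
    rw [← map_add, opD_app, map_neg, neg_neg, ← hB.γ_phiIns_cofreeComul]
    have h4 := LinearMap.congr_fun (map_comp_Δ hW hB.graded.involutive hξ) a
    simp only [LinearMap.comp_apply] at h4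
    rw [hy, ← h4]
    have h5 := LinearMap.congr_fun (phiIns_comp_map α.signed (Schur.map C.obj ξ ∘ₗ W.Δ)
      (s ∘ₗ counitProj C.obj C.ε) (B.γ ∘ₗ α.app B.carrier) (counitProj C.obj C.ε)) (W.Δ a)
    rw [LinearMap.comp_assoc, counitProj_map_Δ hW, LinearMap.comp_assoc, ← hΓ] at h5
    exact congrArg B.γ h5.symm
  have h4 : phiIns α.signed (s ∘ₗ ξ) (curv α W B ξ) ξ (W.Δ a) =
      phiIns α.signed (s ∘ₗ ξ) (B.d ∘ₗ ξ) ξ (W.Δ a) - phiIns α.signed (s ∘ₗ ξ) (ξ ∘ₗ W.d) ξ (W.Δ a) +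
        phiIns α.signed (s ∘ₗ ξ) Γ ξ (W.Δ a) := by
    simp only [← app_ins]
    rw [← map_sub, ← map_add]
    congr 1
    rw [← LinearMap.sub_apply, ← LinearMap.add_apply, ← ins_sub, ← ins_add]
    rfl
  have h5 : curv α W B ξ a = B.d (ξ a) - ξ (W.d a) + Γ a := rfl
  have h6 : curv α W B ξ (W.d a) = B.d (ξ (W.d a)) - ξ (W.d (W.d a)) + Γ (W.d a) := rfl
  have h7 : B.d (B.d (ξ a)) = 0 := LinearMap.congr_fun hB.d_d (ξ a)
  have h8 : W.d (W.d a) = 0 := LinearMap.congr_fun hW.d_d a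
  rw [h4, h5, h6, map_add, map_sub, h7, h8, map_zero, h1, h2, map_add, map_sub, h3]
  abel

end Bianchi

/-! ## Homotopies of twisting maps -/

section FixedPoint

variable {K : Type u} [Field K] {C : NSCooperad.{u, v} K} {P : NSOperad.{u, w} K}
variable {W : NSCoalgData.{u, v, x} C} {t : W.carrier →ₗ[K] W.carrier}
variable {Y : Type y} [AddCommGroup Y] [Module K Y]

/-- A map that contracts the coradical filtration has a fixed point. -/
theorem NSCoalgData.IsCoalg.exists_fixedPoint (hW : W.IsCoalg t)
    (T : (W.carrier →ₗ[K] Y) → (W.carrier →ₗ[K] Y))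
    (hT : ∀ k f g, (∀ a ∈ W.coradical k, f a = g a) → ∀ a ∈ W.coradical (k + 1), T f a = T g a)
    (Q : W.carrier → Y → Prop) (h0 : ∀ a, Q a 0)
    (hQ : ∀ f : W.carrier →ₗ[K] Y, (∀ a, Q a (f a)) → ∀ a, Q a (T f a)) :
    ∃ f, T f = f ∧ ∀ a, Q a (f a) := by
  -- On `F_n` the iterates are constant from the `n`-th one on, starting from `F_0 = 0`.
  let f (n : ℕ) : W.carrier →ₗ[K] Y := T^[n] 0
  have hf (n : ℕ) : f (n + 1) = T (f n) := Function.iterate_succ_apply' T n 0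
  have hfQ (n : ℕ) : ∀ a, Q a (f n a) := by
    induction n with
    | zero => exact h0
    | succ n ih => rw [hf]; exact hQ _ ih
  have h1 (n : ℕ) : ∀ a ∈ W.coradical n, f (n + 1) a = f n a := by
    induction n with
    | zero =>
      intro a ha
      rw [hW.eq_zero_of_mem_coradical_zero ha, map_zero, map_zero]
    | succ n ih =>
      intro a ha
      have := hT n (f (n + 1)) (f n) ih a ha
      rwa [← hf, ← hf] at this
  have h2 (n m : ℕ) (hnm : n ≤ m) : ∀ a ∈ W.coradical n, f m a = f n a := by
    induction m, hnm using Nat.le_induction with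
    | base => exact fun _ _ => rfl
    | succ m hm ih =>
      exact fun a ha => (h1 m a (NSCoalgData.coradical_mono hm ha)).trans (ih a ha)
  -- The limit is taken at `a` after finitely many steps, so every property `Q` of the iterates is
  -- inherited without any continuity.
  choose k hk using fun a : W.carrier => NSCoalgData.exists_mem_coradical a
  have h3 (a : W.carrier) (n : ℕ) (h : a ∈ W.coradical n) : f (k a) a = f n a := by
    rcases le_total (k a) n with h' | h'
    · exact (h2 _ _ h' a (hk a)).symm
    · exact h2 _ _ h' a h
  let g : W.carrier →ₗ[K] Y :=
    { toFun := fun a => f (k a) a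
      map_add' := fun a b => by
        have ha := NSCoalgData.coradical_mono (le_max_left (k a) (k b)) (hk a)
        have hb := NSCoalgData.coradical_mono (le_max_right (k a) (k b)) (hk b)
        rw [h3 a _ ha, h3 b _ hb, h3 (a + b) _ (Submodule.add_mem _ ha hb), map_add]
      map_smul' := fun c a => by
        rw [h3 (c • a) _ (Submodule.smul_mem _ c (hk a)), map_smul]; rfl }
  have h4 (n : ℕ) : ∀ a ∈ W.coradical n, g a = f n a := fun a ha => h3 a n ha
  refine ⟨g, LinearMap.ext fun a => ?_, fun a => hfQ (k a) a⟩
  have ha := NSCoalgData.coradical_mono (Nat.le_succ (k a)) (hk a)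
  rw [hT _ _ _ (h4 (k a)) a ha, ← hf, h4 _ a ha]

variable {X : Type z} [AddCommGroup X] [Module K X]

/-- The telescoping sum for `f ⊗ ⋯ ⊗ f - g ⊗ ⋯ ⊗ g`. -/
theorem lmap_tensorMap_sub {C : ℕ → DGMod.{u, v} K} {P : ℕ → DGMod.{u, w} K}
    (φ : ∀ n, C n →ₗ[K] P n) (f g : X →ₗ[K] Y) (y : Schur C X) :
    DirectSum.lmap (fun n => TensorProduct.map (φ n) LinearMap.id) (Schur.map C f y) -
      DirectSum.lmap (fun n => TensorProduct.map (φ n) LinearMap.id) (Schur.map C g y) =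
      phiIns φ f (f - g) g y := by
  have : (DirectSum.lmap fun n => TensorProduct.map (φ n) LinearMap.id : Schur C Y →ₗ[K] Schur P Y) ∘ₗ Schur.map C f -
      DirectSum.lmap (fun n => TensorProduct.map (φ n) LinearMap.id) ∘ₗ Schur.map C g =
      phiIns φ f (f - g) g := by
    refine schur_hom_ext' fun n c a => ?_
    rw [LinearMap.sub_apply, LinearMap.comp_apply, LinearMap.comp_apply, schur_map_of, schur_map_of,
      phiIns_of, Schur.of, Schur.of, DirectSum.lmap_lof, DirectSum.lmap_lof, TensorProduct.map_tmul,
      TensorProduct.map_tmul, ← map_sum, ← TensorProduct.tmul_sum, ← map_sub, LinearMap.id_apply,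
      LinearMap.id_apply, ← TensorProduct.tmul_sub]
    have h := MultilinearMap.map_piecewise_sub_map_piecewise
      (PiTensorProduct.tprod K (s := fun _ : Fin n => Y)) (fun j => f (a j)) (fun j => g (a j)) 0
      Finset.univ
    simp only [Finset.piecewise_univ, Finset.mem_univ, if_true] at h
    rw [h]
    rfl
  exact LinearMap.congr_fun this y

/-- On `F_{k+1}` the nonlinear term of the curvature depends only on the values on `F_k`: the
difference is a telescoping sum to which `phiIns_eq_zero` applies. This makes the horn equation
contracting. -/
theorem app_map_congr (α : TwistingMorphism C P) (hW : W.IsCoalg t) {f g : W.carrier →ₗ[K] Y} {k : ℕ}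
    (h : ∀ a ∈ W.coradical k, f a = g a) {a : W.carrier} (ha : a ∈ W.coradical (k + 1)) :
    α.app Y (Schur.map C.obj f (W.Δ a)) = α.app Y (Schur.map C.obj g (W.Δ a)) := by
  rw [← sub_eq_zero]
  refine (lmap_tensorMap_sub α.toFun f g (W.Δ a)).trans ?_
  refine phiIns_eq_zero hW α.toFun α.toFun_one f g (fun a ha => ?_) ha
  rw [LinearMap.sub_apply, h a ha, sub_self]

end FixedPoint

/-! ### Components with respect to a basis of simplices -/

section Components

variable {K : Type u} [Field K] {X : Type x} [AddCommGroup X] [Module K X]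
variable {ι : Type} [Fintype ι] [DecidableEq ι]

/-- The component of an element of `X ⊗ K^ι` at `σ`. -/
abbrev coord (X : Type x) [AddCommGroup X] [Module K X] {ι : Type} (σ : ι) : X ⊗[K] (ι → K) →ₗ[K] X :=
  contract X (LinearMap.proj σ : (ι → K) →ₗ[K] K)

theorem sum_coord (z : X ⊗[K] (ι → K)) : ∑ σ, coord X σ z ⊗ₜ[K] Pi.single σ (1 : K) = z := by
  induction z with
  | zero => simp
  | add y z hy hz =>
    simp only [map_add, TensorProduct.add_tmul, Finset.sum_add_distrib, hy, hz]
  | tmul a ν =>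
    simp only [contract_tmul, LinearMap.proj_apply, TensorProduct.smul_tmul]
    rw [← TensorProduct.tmul_sum]
    congr 1
    funext σ
    simp [Finset.sum_apply, Pi.single_apply]

theorem ext_coord {y z : X ⊗[K] (ι → K)} (h : ∀ σ, coord X σ y = coord X σ z) : y = z := by
  rw [← sum_coord y, ← sum_coord z]
  simp only [h]

variable {Y : Type y} [AddCommGroup Y] [Module K Y]

/-- The map to `X ⊗ K^ι` with components `f σ`. -/
def ofCoords (f : ι → Y →ₗ[K] X) : Y →ₗ[K] X ⊗[K] (ι → K) :=
  ∑ σ, (TensorProduct.mk K X (ι → K)).flip (Pi.single σ 1) ∘ₗ f σ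

theorem coord_ofCoords (f : ι → Y →ₗ[K] X) (σ : ι) (a : Y) : coord X σ (ofCoords f a) = f σ a := by
  simp [ofCoords, LinearMap.sum_apply, Pi.single_apply]

theorem coord_tensorD {D : DGAlg K (ι → K)} (s d : X →ₗ[K] X) (σ : ι) (z : X ⊗[K] (ι → K)) :
    coord X σ (tensorD D s d z) = d (coord X σ z) + s (contract X (LinearMap.proj σ ∘ₗ D.d) z) := by
  induction z with
  | zero => simp
  | add y z hy hz => simp only [map_add, hy, hz]; abel
  | tmul a ν => simp [tensorD]

theorem coord_mem {g : ℤ → Submodule K X} {h : ℤ → Submodule K (ι → K)} (dim : ι → ℤ)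
    (hh : ∀ i ν, ν ∈ h i ↔ ∀ s, dim s ≠ i → ν s = 0) {i : ℤ} {z : X ⊗[K] (ι → K)}
    (hz : z ∈ tensorGr g h i) (σ : ι) : coord X σ z ∈ g (i - dim σ) := by
  refine tensorGr_induction hz (g (i - dim σ)) (coord X σ) fun p q a ν hi ha hν => ?_
  rw [contract_tmul, LinearMap.proj_apply]
  by_cases hq : dim σ = q
  · have : i - dim σ = p := by omega
    rw [this]
    exact Submodule.smul_mem _ _ ha
  · rw [(hh q ν).mp hν σ hq, zero_smul]
    exact Submodule.zero_mem _

theorem mem_of_coord {g : ℤ → Submodule K X} {h : ℤ → Submodule K (ι → K)} (dim : ι → ℤ)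
    (hh : ∀ i ν, ν ∈ h i ↔ ∀ s, dim s ≠ i → ν s = 0) {i : ℤ} {z : X ⊗[K] (ι → K)}
    (hz : ∀ σ, coord X σ z ∈ g (i - dim σ)) : z ∈ tensorGr g h i := by
  rw [← sum_coord z]
  refine Submodule.sum_mem _ fun σ _ => tmul_mem_tensorGr (j := dim σ) (hz σ) ?_ (by omega)
  rw [hh]
  intro s hs
  rw [Pi.single_eq_of_ne]
  rintro rfl
  exact hs rfl

end Components

/-! ### Paths of twisting maps and horn filling -/

section PathRel

theorem app_mem_gr {K : Type u} [Field K] {C : NSCooperad.{u, v} K} {P : NSOperad.{u, w} K}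
    (α : TwistingMorphism C P) {X : Type x} [AddCommGroup X] [Module K X] {g : ℤ → Submodule K X}
    {i : ℤ} {z : Schur C.obj X} (hz : z ∈ Schur.gr C.obj g i) :
    α.app X z ∈ Schur.gr P.obj g (i + 1) :=
  schur_gr_induction hz (Schur.gr P.obj g (i + 1)) (α.app X) fun n e f c a hi hc ha => by
    rw [TwistingMorphism.app, Schur.of, DirectSum.lmap_lof, TensorProduct.map_tmul]
    exact schur_of_mem_gr (α.degree n e c hc) ha (by omega)

variable {K : Type u} [Field K] {C : NSCooperad.{u, v} K} {P : NSOperad.{u, w} K}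
variable (α : TwistingMorphism C P)
variable (W : NSCoalgData.{u, v, x} C) {t : W.carrier →ₗ[K] W.carrier}
variable (B : NSAlgData.{u, w, y} P) (s : B.carrier →ₗ[K] B.carrier)

/-- Two linear maps are the vertices of a twisting map to `B ⊗ N^•(Δ¹)`. -/
def PathRel (φ φ' : W.carrier →ₗ[K] B.carrier) : Prop :=
  ∃ ψ : W.carrier →ₗ[K] B.carrier ⊗[K] Interval K,
    IsTwisting α W (tensorAlg (intervalAlg K) B s) ψ ∧
      (∀ a, coord B.carrier Simp.v0 (ψ a) = φ a) ∧ ∀ a, coord B.carrier Simp.v1 (ψ a) = φ' a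

variable {α W B s}

theorem pathRel_refl {φ : W.carrier →ₗ[K] B.carrier} (h : IsTwisting α W B φ) :
    PathRel α W B s φ φ := by
  refine ⟨constMap (intervalAlg K) B.carrier ∘ₗ φ, isAlgMap_constMap.isTwisting h, fun a => ?_,
    fun a => ?_⟩
  · rw [LinearMap.comp_apply, constMap_apply, contract_tmul]; exact one_smul _ _
  · rw [LinearMap.comp_apply, constMap_apply, contract_tmul]; exact one_smul _ _

theorem coord_res (i : Fin 3) (σ : Simp) (z : B.carrier ⊗[K] (Tri → K)) :
    coord B.carrier σ (TensorProduct.map LinearMap.id (Tri.res K i) z) =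
      coord B.carrier (Tri.face i σ) z := by
  induction z with
  | zero => simp
  | add y z hy hz => simp only [map_add, hy, hz]
  | tmul a ν => simp [Tri.res_apply]

theorem contract_triD_top (z : B.carrier ⊗[K] (Tri → K)) :
    contract B.carrier (LinearMap.proj Tri.top ∘ₗ (triAlg K).d) z =
      coord B.carrier Tri.e12 z - coord B.carrier Tri.e02 z + coord B.carrier Tri.e01 z := by
  induction z with
  | zero => simp
  | add y z hy hz => simp only [map_add, hy, hz]; abel
  | tmul a ν => simp [triAlg, add_smul, sub_smul]

/-- The components of a horn. -/
def hornCoords (ψ ψ' : W.carrier →ₗ[K] B.carrier ⊗[K] Interval K) (f : W.carrier →ₗ[K] B.carrier) :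
    Tri → W.carrier →ₗ[K] B.carrier
  | .v0 => coord B.carrier Simp.v0 ∘ₗ ψ
  | .v1 => coord B.carrier Simp.v1 ∘ₗ ψ
  | .v2 => coord B.carrier Simp.v1 ∘ₗ ψ'
  | .e01 => coord B.carrier Simp.edge ∘ₗ ψ
  | .e02 => coord B.carrier Simp.edge ∘ₗ ψ'
  | .e12 => f
  | .top => 0

variable (K) in
theorem triAlg_mem_gr (i : ℤ) (ν : Tri → K) : ν ∈ (triAlg K).gr i ↔ ∀ s, Tri.dim s ≠ i → ν s = 0 :=
  Tri.mem_gr K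

variable (K) in
theorem intervalAlg_mem_gr (i : ℤ) (ν : Interval K) :
    ν ∈ (intervalAlg K).gr i ↔ ∀ s : Simp, (s.dim : ℤ) ≠ i → ν s = 0 :=
  Interval.mem_cochainGr K

/-- With `0` on the 2-simplex, the top component of the curvature is `s (f - ψ'_edge + ψ_edge) + Γ
f`, where `f` is the unknown edge `12` and `Γ` the nonlinear term. Solving for the linear occurrence
of `f` gives a contracting fixed point equation. -/
theorem exists_horn_filler (hW : W.IsCoalg t) (hB : B.IsAlg s)
    {ψ ψ' : W.carrier →ₗ[K] B.carrier ⊗[K] Interval K}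
    (h : ∀ i, ∀ a ∈ W.gr i, ψ a ∈ tensorGr B.gr (intervalAlg K).gr i)
    (h' : ∀ i, ∀ a ∈ W.gr i, ψ' a ∈ tensorGr B.gr (intervalAlg K).gr i) :
    ∃ f : W.carrier →ₗ[K] B.carrier,
      (∀ i, ∀ a ∈ W.gr i, ofCoords (hornCoords ψ ψ' f) a ∈ tensorGr B.gr (triAlg K).gr i) ∧
      ∀ a, coord B.carrier Tri.top (curv α W (tensorAlg (triAlg K) B s)
        (ofCoords (hornCoords ψ ψ' f)) a) = 0 := by
  have hs (b : B.carrier) : s (s b) = b := LinearMap.congr_fun hB.graded.involutive b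
  let Γ (f : W.carrier →ₗ[K] B.carrier) : W.carrier →ₗ[K] B.carrier :=
    coord B.carrier Tri.top ∘ₗ (TensorProduct.map B.γ LinearMap.id ∘ₗ collect (triAlg K) P.obj s) ∘ₗ
      α.app (B.carrier ⊗[K] (Tri → K)) ∘ₗ Schur.map C.obj (ofCoords (hornCoords ψ ψ' f)) ∘ₗ W.Δ
  -- The top equation solved for `f`, using that `s` is an involution.
  let T (f : W.carrier →ₗ[K] B.carrier) : W.carrier →ₗ[K] B.carrier :=
    coord B.carrier Simp.edge ∘ₗ ψ' - coord B.carrier Simp.edge ∘ₗ ψ - s ∘ₗ Γ f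
  have hdeg (f : W.carrier →ₗ[K] B.carrier) (hf : ∀ i, ∀ a ∈ W.gr i, f a ∈ B.gr (i - 1)) :
      ∀ i, ∀ a ∈ W.gr i, ofCoords (hornCoords ψ ψ' f) a ∈ tensorGr B.gr (triAlg K).gr i := by
    intro i a ha
    refine mem_of_coord Tri.dim (triAlg_mem_gr K) fun σ => ?_
    rw [coord_ofCoords]
    have hc := coord_mem (fun s : Simp => (s.dim : ℤ)) (intervalAlg_mem_gr K) (h i a ha)
    have hc' := coord_mem (fun s : Simp => (s.dim : ℤ)) (intervalAlg_mem_gr K) (h' i a ha)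
    cases σ
    · exact hc .v0
    · exact hc .v1
    · exact hc' .v1
    · exact hc .edge
    · exact hc' .edge
    · exact hf i a ha
    · exact Submodule.zero_mem _
  have hT : ∀ k f g, (∀ a ∈ W.coradical k, f a = g a) → ∀ a ∈ W.coradical (k + 1), T f a = T g a := by
    intro k f g hfg a ha
    have h1 := app_map_congr α hW (f := ofCoords (hornCoords ψ ψ' f))
      (g := ofCoords (hornCoords ψ ψ' g)) (k := k) (fun a ha => ext_coord fun σ => ?_) ha
    · simp only [T, Γ, LinearMap.sub_apply, LinearMap.comp_apply, h1]
    · rw [coord_ofCoords, coord_ofCoords]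
      cases σ <;> first | rfl | exact hfg a ha
  have hQ : ∀ f : W.carrier →ₗ[K] B.carrier, (∀ a, ∀ i, a ∈ W.gr i → f a ∈ B.gr (i - 1)) →
      ∀ a, ∀ i, a ∈ W.gr i → T f a ∈ B.gr (i - 1) := by
    intro f hf a i ha
    have h1 := hdeg f (fun i a ha => hf a i ha)
    refine Submodule.sub_mem _ (Submodule.sub_mem _ ?_ ?_) ?_
    · exact coord_mem (fun s : Simp => (s.dim : ℤ)) (intervalAlg_mem_gr K) (h' i a ha) .edge
    · exact coord_mem (fun s : Simp => (s.dim : ℤ)) (intervalAlg_mem_gr K) (h i a ha) .edge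
    · have h2 := tensorAlg_γ_degree (triAlg K) hB _ _ (app_mem_gr α (schur_map_mem_gr h1
        (hW.Δ_degree i a ha)))
      have h3 := coord_mem Tri.dim (triAlg_mem_gr K) h2 .top
      -- `α` raises the degree by one and the 2-simplex lowers it by two; the result is the degree
      -- of an edge component.
      have h4 : i + 1 - Tri.dim .top = i - 1 := by simp only [Tri.dim]; omega
      rw [h4] at h3
      rw [LinearMap.comp_apply, hB.graded.sgn_of_mem (i - 1) (Γ f a) h3]
      exact Submodule.smul_mem _ _ h3
  obtain ⟨f, hf, hfd⟩ := hW.exists_fixedPoint T hT (fun a b => ∀ i, a ∈ W.gr i → b ∈ B.gr (i - 1))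
    (fun _ _ _ => Submodule.zero_mem _) hQ
  refine ⟨f, hdeg f fun i a ha => hfd a i ha, fun a => ?_⟩
  change coord B.carrier Tri.top (tensorD (triAlg K) s B.d (ofCoords (hornCoords ψ ψ' f) a) -
    ofCoords (hornCoords ψ ψ' f) (W.d a) + (TensorProduct.map B.γ LinearMap.id ∘ₗ
      collect (triAlg K) P.obj s) (α.app (B.carrier ⊗[K] (Tri → K))
        (Schur.map C.obj (ofCoords (hornCoords ψ ψ' f)) (W.Δ a)))) = 0
  rw [map_add, map_sub]
  have h1 : coord B.carrier Tri.top (ofCoords (hornCoords ψ ψ' f) (W.d a)) = 0 :=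
    coord_ofCoords _ _ _
  have h2 := coord_tensorD (D := triAlg K) s B.d Tri.top (ofCoords (hornCoords ψ ψ' f) a)
  rw [contract_triD_top, coord_ofCoords, coord_ofCoords, coord_ofCoords, coord_ofCoords] at h2
  refine (congrArg₂ (· + ·) (congrArg₂ (· - ·) h2 h1) rfl).trans ?_
  change B.d 0 + s (f a - coord B.carrier Simp.edge (ψ' a) + coord B.carrier Simp.edge (ψ a)) - 0 +
    Γ f a = 0
  have h3 : f a = coord B.carrier Simp.edge (ψ' a) - coord B.carrier Simp.edge (ψ a) - s (Γ f a) :=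
    (LinearMap.congr_fun hf a).symm
  rw [h3, map_zero]
  have h4 : coord B.carrier Simp.edge (ψ' a) - coord B.carrier Simp.edge (ψ a) - s (Γ f a) -
    coord B.carrier Simp.edge (ψ' a) + coord B.carrier Simp.edge (ψ a) = -s (Γ f a) := by abel
  rw [h4, map_neg, hs]
  abel

theorem eq_zero_of_tri {F : W.carrier →ₗ[K] B.carrier ⊗[K] (Tri → K)}
    (h1 : ∀ a, TensorProduct.map LinearMap.id (Tri.res K 1) (F a) = 0)
    (h2 : ∀ a, TensorProduct.map LinearMap.id (Tri.res K 2) (F a) = 0)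
    (htop : ∀ a, coord B.carrier Tri.top (F a) = 0) {a : W.carrier}
    (h0 : coord B.carrier Tri.e12 (F a) = 0) : F a = 0 := by
  have h1' (σ : Simp) : coord B.carrier (Tri.face 1 σ) (F a) = 0 := by
    rw [← coord_res, h1, map_zero]
  have h2' (σ : Simp) : coord B.carrier (Tri.face 2 σ) (F a) = 0 := by
    rw [← coord_res, h2, map_zero]
  refine ext_coord fun σ => ?_
  rw [map_zero]
  cases σ
  · exact h1' .v0
  · exact h2' .v1
  · exact h1' .v1
  · exact h2' .edge
  · exact h1' .edge
  · exact h0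
  · exact htop a

/-- The two given faces and the top equation annihilate every component of the curvature except that
on `12`. The Bianchi identity handles it, by induction on the coradical filtration. -/
theorem curv_horn_filler (hW : W.IsCoalg t) (hB : B.IsAlg s)
    {ξ : W.carrier →ₗ[K] B.carrier ⊗[K] (Tri → K)}
    (hξ : ∀ i, ∀ a ∈ W.gr i, ξ a ∈ tensorGr B.gr (triAlg K).gr i)
    (htop : ∀ a, coord B.carrier Tri.top (curv α W (tensorAlg (triAlg K) B s) ξ a) = 0)
    (h1 : curv α W (tensorAlg (intervalAlg K) B s) (TensorProduct.map LinearMap.id (Tri.res K 1) ∘ₗ ξ) = 0)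
    (h2 : curv α W (tensorAlg (intervalAlg K) B s) (TensorProduct.map LinearMap.id (Tri.res K 2) ∘ₗ ξ) = 0) :
    curv α W (tensorAlg (triAlg K) B s) ξ = 0 := by
  have hB' := hB.tensor (triAlg K)
  have hs (b : B.carrier) : s (s b) = b := LinearMap.congr_fun hB.graded.involutive b
  let F : W.carrier →ₗ[K] B.carrier ⊗[K] (Tri → K) := curv α W (tensorAlg (triAlg K) B s) ξ
  have h1' (a : W.carrier) : TensorProduct.map LinearMap.id (Tri.res K 1) (F a) = 0 :=
    (LinearMap.congr_fun ((Tri.res_isHom K 1).isAlgMap.curv_comp W ξ) a).symm.trans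
      (LinearMap.congr_fun h1 a)
  have h2' (a : W.carrier) : TensorProduct.map LinearMap.id (Tri.res K 2) (F a) = 0 :=
    (LinearMap.congr_fun ((Tri.res_isHom K 2).isAlgMap.curv_comp W ξ) a).symm.trans
      (LinearMap.congr_fun h2 a)
  have hcomp (a : W.carrier) (i : Fin 3) (σ : Simp) (hi : i = 1 ∨ i = 2) :
      coord B.carrier (Tri.face i σ) (F a) = 0 := by
    rw [← coord_res]
    rcases hi with rfl | rfl
    · rw [h1', map_zero]
    · rw [h2', map_zero]
  refine hW.eq_zero_of_coradical (g := F) fun k hk a ha => eq_zero_of_tri h1' h2' htop ?_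
  -- By the induction hypothesis the quadratic term vanishes on `F_{k+1}`. In the top component the
  -- term `F (d a)` vanishes too, and `d F` reduces to `s` of the component on `12`.
  have hb := bianchi (α := α) hW hB' (hW.graded.comm_zero hB'.graded.sgn_of_mem hξ) a
  have hz : phiIns α.signed (TensorProduct.map s (triAlg K).sgn ∘ₗ ξ) F ξ (W.Δ a) = 0 :=
    phiIns_eq_zero hW α.signed α.signed_one _ _ hk ha
  replace hb : tensorD (triAlg K) s B.d (F a) + F (W.d a) + (TensorProduct.map B.γ LinearMap.id ∘ₗ
      collect (triAlg K) P.obj s) 0 = 0 :=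
    (congrArg (fun z => tensorD (triAlg K) s B.d (F a) + F (W.d a) +
      (TensorProduct.map B.γ LinearMap.id ∘ₗ collect (triAlg K) P.obj s) z) hz).symm.trans hb
  rw [map_zero, add_zero] at hb
  replace hb := congrArg (coord B.carrier Tri.top) hb
  have h3 := coord_tensorD (D := triAlg K) s B.d Tri.top (F a)
  have h02 : coord B.carrier Tri.e02 (F a) = 0 := hcomp a 1 .edge (Or.inl rfl)
  have h01 : coord B.carrier Tri.e01 (F a) = 0 := hcomp a 2 .edge (Or.inr rfl)
  have h00 : coord B.carrier Tri.top (F a) = 0 := htop a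
  rw [contract_triD_top, h02, h01, h00, map_zero, sub_zero, add_zero, zero_add] at h3
  have h4 : coord B.carrier Tri.top (F (W.d a)) = 0 := htop _
  rw [map_add, h4, add_zero, map_zero] at hb
  rw [← hs (coord B.carrier Tri.e12 (F a)), ← h3, hb, map_zero]

theorem coords_eq {ψ : W.carrier →ₗ[K] B.carrier ⊗[K] Interval K}
    {ξ : W.carrier →ₗ[K] B.carrier ⊗[K] (Tri → K)} {i : Fin 3}
    (h : ∀ σ a, coord B.carrier (Tri.face i σ) (ξ a) = coord B.carrier σ (ψ a)) :
    TensorProduct.map LinearMap.id (Tri.res K i) ∘ₗ ξ = ψ :=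
  LinearMap.ext fun a => ext_coord fun σ => by rw [LinearMap.comp_apply, coord_res, h]

/-- The two paths start at the same vertex and form a horn. The third edge of its filler joins their
ends. -/
theorem PathRel.euclidean (hW : W.IsCoalg t) (hB : B.IsAlg s) {φ φ₁ φ₂ : W.carrier →ₗ[K] B.carrier}
    (h₁ : PathRel α W B s φ φ₁) (h₂ : PathRel α W B s φ φ₂) : PathRel α W B s φ₁ φ₂ := by
  obtain ⟨ψ, hψ, hψ0, hψ1⟩ := h₁
  obtain ⟨ψ', hψ', hψ'0, hψ'1⟩ := h₂
  obtain ⟨f, hdeg, htop⟩ := exists_horn_filler (α := α) hW hB hψ.degree hψ'.degree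
  have hr2 : TensorProduct.map LinearMap.id (Tri.res K 2) ∘ₗ ofCoords (hornCoords ψ ψ' f) = ψ :=
    coords_eq fun σ a => by rw [coord_ofCoords]; cases σ <;> rfl
  have hr1 : TensorProduct.map LinearMap.id (Tri.res K 1) ∘ₗ ofCoords (hornCoords ψ ψ' f) = ψ' :=
    coords_eq fun σ a => by
      rw [coord_ofCoords]
      cases σ
      -- The vertex `0` of the horn was taken from `ψ`; it serves for `ψ'` as well because both
      -- paths start at `φ`.
      · exact (hψ0 a).trans (hψ'0 a).symm
      · rfl
      · rfl
  have hc := curv_horn_filler hW hB hdeg htop 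
    ((congrArg (curv α W (tensorAlg (intervalAlg K) B s)) hr1).trans hψ'.curv_eq_zero)
    ((congrArg (curv α W (tensorAlg (intervalAlg K) B s)) hr2).trans hψ.curv_eq_zero)
  refine ⟨_, (Tri.res_isHom K 0).isAlgMap.isTwisting ⟨hdeg, hc⟩, fun a => ?_, fun a => ?_⟩
  · exact (coord_res 0 .v0 _).trans ((coord_ofCoords _ _ _).trans (hψ1 a))
  · exact (coord_res 0 .v1 _).trans ((coord_ofCoords _ _ _).trans (hψ'1 a))

/-- A horn whose second edge is the constant path. -/
theorem PathRel.symm (hW : W.IsCoalg t) (hB : B.IsAlg s) {φ φ' : W.carrier →ₗ[K] B.carrier}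
    (hφ : IsTwisting α W B φ) (h : PathRel α W B s φ φ') : PathRel α W B s φ' φ :=
  h.euclidean hW hB (pathRel_refl hφ)

theorem PathRel.trans (hW : W.IsCoalg t) (hB : B.IsAlg s) {φ φ' φ'' : W.carrier →ₗ[K] B.carrier}
    (hφ : IsTwisting α W B φ) (h : PathRel α W B s φ φ') (h' : PathRel α W B s φ' φ'') :
    PathRel α W B s φ φ'' :=
  (h.symm hW hB hφ).euclidean hW hB h'

end PathRel

/-! ## The path object -/

section PathObject

variable {K : Type u} [Field K]

theorem Interval.cup_tprod_apply (n : ℕ) (b : Fin n → Interval K) (s : Simp) :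
    Interval.cup K n (PiTensorProduct.tprod K b) s = match s with
      | .v0 => ∏ j, b j .v0
      | .v1 => ∏ j, b j .v1
      | .edge => ∑ i : Fin n, ∏ j, b j (Simp.factor i j) := by
  cases s <;> simp [Interval.cup, List.prod_ofFn, LinearMap.sum_apply]

theorem Interval.cup_zero (b : Fin 0 → Interval K) :
    Interval.cup K 0 (PiTensorProduct.tprod K b) = (intervalAlg K).one := by
  funext s
  rw [Interval.cup_tprod_apply]
  cases s <;> simp [intervalAlg]

/-- On the edge, either the first cochain is evaluated on the edge and all others at the end vertex,
or the first is evaluated at the initial vertex and the edge occurs later. -/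
theorem Interval.cup_succ (n : ℕ) (b : Fin (n + 1) → Interval K) :
    Interval.cup K (n + 1) (PiTensorProduct.tprod K b) =
      (intervalAlg K).mul (b 0) (Interval.cup K n (PiTensorProduct.tprod K fun j => b j.succ)) := by
  funext s
  change _ = Interval.mul K (b 0) (Interval.cup K n (PiTensorProduct.tprod K fun j => b j.succ)) s
  rw [Interval.cup_tprod_apply]
  cases s
  · simp only [Interval.mul_v0, Interval.cup_tprod_apply, Fin.prod_univ_succ]
  · simp only [Interval.mul_v1, Interval.cup_tprod_apply, Fin.prod_univ_succ]
  · simp only [Interval.mul_edge, Interval.cup_tprod_apply]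
    rw [Fin.sum_univ_succ, add_comm]
    congr 1
    · rw [Finset.mul_sum]
      refine Finset.sum_congr rfl fun i _ => ?_
      rw [Fin.prod_univ_succ]
      simp [Simp.factor, Fin.succ_pos]
    · rw [Fin.prod_univ_succ]
      simp [Simp.factor, Fin.succ_ne_zero]

theorem Interval.cup_tw {X : Type x} [AddCommGroup X] [Module K X] (n : ℕ) (e : Fin n → ZMod 2)
    (a : Fin n → X) (ν : Fin n → Interval K) :
    Interval.cup K n (PiTensorProduct.tprod K fun j => tw (Interval.sgn K) (after e j) (ν j)) =
      nuProd (intervalAlg K) (List.ofFn fun j => (e j, a j, ν j)) := by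
  induction n with
  | zero => rw [Interval.cup_zero]; simp [nuProd]
  | succ n ih =>
    rw [Interval.cup_succ, List.ofFn_succ, nuProd, psum_ofFn, ← ih (fun j => e j.succ), after_zero]
    simp only [after_succ]
    rfl

variable {P : NSOperad.{u, v} K}

/-- Identifies the explicit path object with the tensor product algebra over the cochains of the
interval; all algebra laws come from there. -/
theorem pathObject_γ (A : NSAlg.{u, v, w} P) (y : Schur P.obj (A.carrier ⊗[K] Interval K)) :
    (pathObject A).γ y =
      TensorProduct.map A.γ LinearMap.id (collect (intervalAlg K) P.obj A.sgn y) := by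
  let F : Schur P.obj (A.carrier ⊗[K] Interval K) →ₗ[K] A.carrier ⊗[K] Interval K :=
    DirectSum.toModule K ℕ _ fun n =>
    TensorProduct.map (A.γ ∘ₗ Schur.of P.obj n) (Interval.cup K n) ∘ₗ
    (TensorProduct.assoc K (P.obj n).carrier (⨂[K]^n A.carrier)
      (⨂[K]^n (Interval K))).symm.toLinearMap ∘ₗ
    TensorProduct.map LinearMap.id (kunzip A.par (Interval.sgn K) n)
  have h : F = TensorProduct.map A.γ LinearMap.id ∘ₗ collect (intervalAlg K) P.obj A.sgn := by
    refine schur_hom_ext (IsGraded.span_tensSet (R := Interval K) A.isGraded) fun n _ p z _ hz => ?_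
    choose i a ν ha hz using hz
    obtain rfl : z = fun j => a j ⊗ₜ ν j := funext hz
    have h1 := collect_sch (intervalAlg K) (P := P.obj) (s := A.sgn)
      (T := List.ofFn fun j => ((i j : ZMod 2), a j, ν j))
      (fun t ht => by
        obtain ⟨j, rfl⟩ := (List.mem_ofFn' _ _).mp ht
        exact A.sgn_of_mem _ _ (ha j)) (Tot.of P.obj n p)
    rw [tens_ofFn, letters_ofFn, sch_ofFn, sch_ofFn] at h1
    rw [LinearMap.comp_apply, h1, TensorProduct.map_tmul, LinearMap.id_apply, ← Interval.cup_tw]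
    simp only [F, Schur.of, DirectSum.toModule_lof, LinearMap.comp_apply, TensorProduct.map_tmul,
      LinearMap.id_apply]
    rw [kunzip_tprod A.par (Interval.cochain_graded K).involutive n (fun j => (i j : ZMod 2)) a ν
      fun j ε => A.par_of_mem ε (ha j)]
    simp
  exact LinearMap.congr_fun h y

theorem pathObject_isAlg (A : NSAlg.{u, v, w} P) :
    (pathObject A).IsAlg (TensorProduct.map A.sgn (Interval.sgn K)) := by
  have h := A.isAlg.tensor (intervalAlg K)
  have hγ : (pathObject A).γ = (tensorAlg (intervalAlg K) A.toData A.sgn).γ :=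
    LinearMap.ext fun y => pathObject_γ A y
  exact
  { graded := h.graded
    d_mem := h.d_mem
    d_d := h.d_d
    γ_degree := fun i z hz => by rw [hγ]; exact h.γ_degree i z hz
    γ_d := by rw [hγ]; exact h.γ_d
    assoc := by rw [hγ]; exact h.assoc
    unit := by rw [hγ]; exact h.unit }

variable {C : NSCooperad.{u, x} K} {α : TwistingMorphism C P} {W : NSCoalgData.{u, x, y} C}

theorem isTwisting_pathObject {A : NSAlg.{u, v, w} P} {ψ : W.carrier →ₗ[K] A.carrier ⊗[K] Interval K} :
    IsTwisting α W (pathObject A) ψ ↔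
      IsTwisting α W (tensorAlg (intervalAlg K) A.toData A.sgn) ψ := by
  have : curv α W (pathObject A) ψ = curv α W (tensorAlg (intervalAlg K) A.toData A.sgn) ψ := by
    refine LinearMap.ext fun a => ?_
    exact congrArg (fun z : A.carrier ⊗[K] Interval K => tensorD (intervalAlg K) A.sgn A.d (ψ a) -
      ψ (W.d a) + z) (pathObject_γ A _)
  constructor
  · exact fun h => ⟨h.degree, this.symm.trans h.curv_eq_zero⟩
  · exact fun h => ⟨h.degree, this.trans h.curv_eq_zero⟩

end PathObject

/-! ## Coactions of a cochain algebra -/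

section Coaction

variable {K : Type u} [Field K] {C : NSCooperad.{u, v} K} {P : NSOperad.{u, w} K}
variable {R : Type z} [AddCommGroup R] [Module K R] (D : DGAlg K R)

/-- A map `W → W' ⊗ R` of coalgebras over the dg algebra `R`. -/
structure IsCoaction (W : NSCoalgData.{u, v, x} C) (W' : NSCoalgData.{u, v, y} C)
    (t' : W'.carrier →ₗ[K] W'.carrier) (ξ : W.carrier →ₗ[K] W'.carrier ⊗[K] R) : Prop where
  degree : ∀ i, ∀ a ∈ W.gr i, ξ a ∈ tensorGr W'.gr D.gr i
  comm_d : ∀ a, tensorD D t' W'.d (ξ a) = ξ (W.d a)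
  comm_Δ : ∀ a, TensorProduct.map W'.Δ LinearMap.id (ξ a) =
    collect D C.obj t' (Schur.map C.obj ξ (W.Δ a))
  span : Submodule.span K {b | ∃ (χ : R →ₗ[K] K) (a : W.carrier), b = contract W'.carrier χ (ξ a)} = ⊤

variable {D}
variable {W : NSCoalgData.{u, v, x} C} {t : W.carrier →ₗ[K] W.carrier}
variable {W' : NSCoalgData.{u, v, y} C} {t' : W'.carrier →ₗ[K] W'.carrier}
variable {ξ : W.carrier →ₗ[K] W'.carrier ⊗[K] R}

theorem contract_map {X Y : Type*} [AddCommGroup X] [Module K X] [AddCommGroup Y] [Module K Y]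
    (f : X →ₗ[K] Y) (χ : R →ₗ[K] K) (z : X ⊗[K] R) :
    contract Y χ (TensorProduct.map f LinearMap.id z) = f (contract X χ z) := by
  induction z with
  | zero => simp
  | add y z hy hz => simp only [map_add, hy, hz]
  | tmul a ν => simp

/-- The components of `ξ` span `W'`, so identities on `W'` may be tested after `ξ`, where they
follow from those of `W`. -/
theorem IsCoaction.hom_ext (h : IsCoaction D W W' t' ξ) {Y : Type*} [AddCommGroup Y] [Module K Y]
    {f g : W'.carrier →ₗ[K] Y}
    (hfg : ∀ a, TensorProduct.map f LinearMap.id (ξ a) = TensorProduct.map g LinearMap.id (ξ a)) :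
    f = g := by
  refine LinearMap.ext_on h.span ?_
  rintro _ ⟨χ, a, rfl⟩
  rw [← contract_map, hfg, contract_map]

theorem tensorMap_comp_apply {X Y Z : Type*} [AddCommGroup X] [Module K X] [AddCommGroup Y] [Module K Y]
    [AddCommGroup Z] [Module K Z] (g : Y →ₗ[K] Z) (f : X →ₗ[K] Y) (z : X ⊗[K] R) :
    TensorProduct.map (g ∘ₗ f) (LinearMap.id : R →ₗ[K] R) z =
      TensorProduct.map g LinearMap.id (TensorProduct.map f LinearMap.id z) := by
  rw [← LinearMap.comp_apply, ← TensorProduct.map_comp, LinearMap.id_comp]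

theorem collect_counitProj {X : Type x} [AddCommGroup X] [Module K X] {g : ℤ → Submodule K X}
    {s : X →ₗ[K] X} (hX : IsGraded g s) (y : Schur C.obj (X ⊗[K] R)) :
    TensorProduct.map (counitProj C.obj C.ε) LinearMap.id (collect D C.obj s y) =
      counitProj C.obj C.ε y := by
  have : TensorProduct.map (counitProj C.obj C.ε) LinearMap.id ∘ₗ collect D C.obj s =
      counitProj C.obj C.ε := by
    refine schur_hom_ext hX.span_tensSet fun n _ c z _ hz => ?_
    choose i a ν ha hz using hz
    obtain rfl : z = fun j => a j ⊗ₜ ν j := funext hz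
    have h1 := collect_sch D (P := C.obj) (s := s)
      (T := List.ofFn fun j => ((i j : ZMod 2), a j, ν j))
      (fun t ht => by
        obtain ⟨j, rfl⟩ := (List.mem_ofFn' _ _).mp ht
        exact hX.sgn_of_mem _ _ (ha j)) (Tot.of C.obj n c)
    rw [tens_ofFn, letters_ofFn, sch_ofFn, sch_ofFn] at h1
    rw [LinearMap.comp_apply, h1, TensorProduct.map_tmul, LinearMap.id_apply]
    by_cases hn : n = 1
    · subst hn
      rw [← sch_ofFn, ← sch_ofFn]
      simp only [List.ofFn_succ, List.ofFn_zero, counitProj_sch_one, nuProd, psum, List.map_nil,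
        List.sum_nil, tw_zero, LinearMap.id_apply, D.mul_one]
      rw [TensorProduct.smul_tmul']
    · rw [counitProj_of_ne hn, counitProj_of_ne hn, TensorProduct.zero_tmul]
  exact LinearMap.congr_fun this y

theorem IsCoaction.comm_sgn (h : IsCoaction D W W' t' ξ) (hW : W.IsCoalg t)
    (hg : IsGraded W'.gr t') : ξ ∘ₗ t = TensorProduct.map t' D.sgn ∘ₗ ξ :=
  hW.graded.comm_zero (hg.tensor D.graded).sgn_of_mem h.degree

theorem IsCoaction.counit (h : IsCoaction D W W' t' ξ) (hW : W.IsCoalg t)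
    (hg : IsGraded W'.gr t') : counitProj C.obj C.ε ∘ₗ W'.Δ = LinearMap.id := by
  refine h.hom_ext fun a => ?_
  rw [tensorMap_comp_apply, h.comm_Δ, collect_counitProj hg, TensorProduct.map_id]
  exact LinearMap.congr_fun (counitProj_map_Δ hW ξ) a

/-- Tested along `ξ`, both sides are coefficients collected in two stages, and the claim becomes
coassociativity of `W` for maps to `W' ⊗ R`. -/
theorem IsCoaction.coassoc (h : IsCoaction D W W' t' ξ) (hW : W.IsCoalg t)
    (hg : IsGraded W'.gr t') (hΔ : ∀ i, ∀ a ∈ W'.gr i, W'.Δ a ∈ Schur.gr C.obj W'.gr i) :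
    Schur.map C.obj W'.Δ ∘ₗ W'.Δ = cofreeComul C.obj C.Δ t' ∘ₗ W'.Δ := by
  refine h.hom_ext fun a => ?_
  have hs : W'.Δ ∘ₗ t' = schSgn C.obj t' ∘ₗ W'.Δ := hg.comm_zero hg.schur.sgn_of_mem hΔ
  rw [tensorMap_comp_apply, tensorMap_comp_apply, h.comm_Δ]
  have h1 := LinearMap.congr_fun (collect_natural D (P := C.obj) hs) (Schur.map C.obj ξ (W.Δ a))
  have h2 := LinearMap.congr_fun (collect_cofreeComul D hg C.Δ_arity) (Schur.map C.obj ξ (W.Δ a))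
  have h3 := LinearMap.congr_fun (map_comp_Δ hW (hg.tensor D.graded).involutive
    (h.comm_sgn hW hg)) a
  simp only [LinearMap.comp_apply] at h1 h2 h3
  rw [← h1, ← h2, ← h3]
  congr 1
  rw [← schur_map_comp_apply, ← schur_map_comp_apply]
  congr 2
  exact LinearMap.ext fun a => h.comm_Δ a

/-- The scalar `-1` supplies negatives, so cancellation holds where only a monoid structure is at
hand. -/
theorem add_right_cancel_of_module (K : Type*) [Ring K] {M : Type*} [AddCommMonoid M] [Module K M]
    {a b c : M} (h : a + c = b + c) : a = b := by
  let _ := Module.addCommMonoidToAddCommGroup K (M := M)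
  exact add_right_cancel h

theorem schur_map_d {P : ℕ → DGMod.{u, v} K} {X : Type x} [AddCommGroup X] [Module K X]
    {Y : Type y} [AddCommGroup Y] [Module K Y] {f : X →ₗ[K] Y} {s d : X →ₗ[K] X} {s' d' : Y →ₗ[K] Y}
    (hs : f ∘ₗ s = s' ∘ₗ f) (hd : f ∘ₗ d = d' ∘ₗ f) :
    Schur.map P f ∘ₗ Schur.d P s d = Schur.d P s' d' ∘ₗ Schur.map P f := by
  rw [schur_d_eq, schur_d_eq, LinearMap.comp_add, LinearMap.add_comp, opD_natural, map_comp_ins,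
    ins_comp_map, hs, hd, LinearMap.id_comp, LinearMap.comp_id]

theorem IsCoaction.Δ_d (h : IsCoaction D W W' t' ξ) (hW : W.IsCoalg t)
    (hg : IsGraded W'.gr t') (hd : ∀ i, ∀ a ∈ W'.gr i, W'.d a ∈ W'.gr (i + 1))
    (hΔ : ∀ i, ∀ a ∈ W'.gr i, W'.Δ a ∈ Schur.gr C.obj W'.gr i) :
    Schur.d C.obj t' W'.d ∘ₗ W'.Δ = W'.Δ ∘ₗ W'.d := by
  refine h.hom_ext fun a => ?_
  have hs : W'.Δ ∘ₗ t' = schSgn C.obj t' ∘ₗ W'.Δ := hg.comm_zero hg.schur.sgn_of_mem hΔ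
  have hdt : t' ∘ₗ W'.d = -(W'.d ∘ₗ t') := hg.anticomm hg.sgn_of_mem hd
  have h1 := LinearMap.congr_fun (collect_leibniz D (P := C.obj) hg.involutive hdt)
    (Schur.map C.obj ξ (W.Δ a))
  have h2 : Schur.d C.obj (TensorProduct.map t' D.sgn) (tensorD D t' W'.d) (Schur.map C.obj ξ (W.Δ a)) =
      Schur.map C.obj ξ (W.Δ (W.d a)) := by
    have h3 := LinearMap.congr_fun (schur_map_d (P := C.obj) (h.comm_sgn hW hg)
      (d := W.d) (d' := tensorD D t' W'.d) (LinearMap.ext fun a => (h.comm_d a).symm)) (W.Δ a)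
    have h4 := LinearMap.congr_fun hW.Δ_d a
    rw [LinearMap.comp_apply, LinearMap.comp_apply] at h3 h4
    rw [← h3, h4]
  rw [LinearMap.comp_apply, LinearMap.comp_apply, h2, ← h.comm_Δ, ← h.comm_d, ← h.comm_Δ, tensorD,
    tensorD, LinearMap.add_apply, LinearMap.add_apply, map_add, ← tensorMap_comp_apply,
    ← tensorMap_comp_apply, ← LinearMap.comp_apply (TensorProduct.map W'.Δ _),
    ← LinearMap.comp_apply (TensorProduct.map (schSgn C.obj t') _), ← TensorProduct.map_comp,
    ← TensorProduct.map_comp, hs, LinearMap.id_comp, LinearMap.comp_id] at h1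
  -- Both sides contain the same term with the differential of `R`; cancelling it leaves the claim.
  exact (add_right_cancel_of_module K h1).symm

theorem collect_app (α : TwistingMorphism C P) {X : Type x} [AddCommGroup X] [Module K X]
    {g : ℤ → Submodule K X} {s : X →ₗ[K] X} (hX : IsGraded g s) (y : Schur C.obj (X ⊗[K] R)) :
    collect D P.obj s (α.app (X ⊗[K] R) y) =
      TensorProduct.map (α.app X) LinearMap.id (collect D C.obj s y) := by
  have : collect D P.obj s ∘ₗ α.app (X ⊗[K] R) =
      TensorProduct.map (α.app X) LinearMap.id ∘ₗ collect D C.obj s := by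
    refine schur_hom_ext hX.span_tensSet fun n _ c z _ hz => ?_
    obtain ⟨T, hT, hTz⟩ := hX.exists_triples (List.ofFn z) fun a ha => by
      obtain ⟨j, rfl⟩ := (List.mem_ofFn' _ _).mp ha
      exact hz j
    rw [← sch_ofFn, ← hTz, LinearMap.comp_apply, LinearMap.comp_apply, app_sch, collect_sch D hT,
      collect_sch D hT, TensorProduct.map_tmul, app_sch, LinearMap.id_apply]
  exact LinearMap.congr_fun this y

variable {α : TwistingMorphism C P} {B : NSAlgData.{u, w, x'} P} {s : B.carrier →ₗ[K] B.carrier}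

/-- The terms with the differential of `R` cancel, and the nonlinear term passes through `ξ` because
`ξ` respects comultiplications. Hence twisting maps on `W'` are detected as twisting maps from `W`
with coefficients. -/
theorem IsCoaction.curv_comp (h : IsCoaction D W W' t' ξ) (hg : IsGraded W'.gr t') (hB : IsGraded B.gr s)
    {ψ : W'.carrier →ₗ[K] B.carrier} (hψ : ∀ i, ∀ a ∈ W'.gr i, ψ a ∈ B.gr i) (a : W.carrier) :
    curv α W (tensorAlg D B s) (TensorProduct.map ψ LinearMap.id ∘ₗ ξ) a =
      TensorProduct.map (curv α W' B ψ) LinearMap.id (ξ a) := by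
  have hs : ψ ∘ₗ t' = s ∘ₗ ψ := hg.comm_zero hB.sgn_of_mem hψ
  have h1 : tensorD D s B.d (TensorProduct.map ψ LinearMap.id (ξ a)) -
      TensorProduct.map ψ LinearMap.id (ξ (W.d a)) =
      TensorProduct.map (B.d ∘ₗ ψ) LinearMap.id (ξ a) -
        TensorProduct.map (ψ ∘ₗ W'.d) LinearMap.id (ξ a) := by
    rw [← h.comm_d, tensorD, tensorD, LinearMap.add_apply, LinearMap.add_apply, map_add,
      ← tensorMap_comp_apply, ← tensorMap_comp_apply,
      ← LinearMap.comp_apply (TensorProduct.map s D.d),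
      ← LinearMap.comp_apply (TensorProduct.map ψ _), ← TensorProduct.map_comp,
      ← TensorProduct.map_comp, hs, LinearMap.id_comp, LinearMap.comp_id]
    abel
  have h2 : TensorProduct.map B.γ LinearMap.id (collect D P.obj s (α.app (B.carrier ⊗[K] R)
      (Schur.map C.obj (TensorProduct.map ψ LinearMap.id ∘ₗ ξ) (W.Δ a)))) =
      TensorProduct.map (B.γ ∘ₗ α.app B.carrier ∘ₗ Schur.map C.obj ψ ∘ₗ W'.Δ) LinearMap.id (ξ a) := by
    rw [collect_app α hB, schur_map_comp_apply]
    have h3 := LinearMap.congr_fun (collect_natural D (P := C.obj) hs) (Schur.map C.obj ξ (W.Δ a))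
    rw [LinearMap.comp_apply, LinearMap.comp_apply] at h3
    rw [h3, ← h.comm_Δ, ← tensorMap_comp_apply, ← tensorMap_comp_apply, ← tensorMap_comp_apply]
    rfl
  refine (congrArg₂ (· + ·) h1 h2).trans ?_
  have h3 : TensorProduct.map (B.d ∘ₗ ψ) (LinearMap.id : R →ₗ[K] R) =
      TensorProduct.map (B.d ∘ₗ ψ - ψ ∘ₗ W'.d) LinearMap.id +
        TensorProduct.map (ψ ∘ₗ W'.d) LinearMap.id := by
    rw [← TensorProduct.map_add_left, sub_add_cancel]
  rw [curv, TensorProduct.map_add_left, h3, LinearMap.add_apply, add_sub_cancel_right]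
  rfl

theorem IsCoaction.curv_eq_zero_iff (h : IsCoaction D W W' t' ξ) (hg : IsGraded W'.gr t')
    (hB : IsGraded B.gr s) {ψ : W'.carrier →ₗ[K] B.carrier} (hψ : ∀ i, ∀ a ∈ W'.gr i, ψ a ∈ B.gr i) :
    curv α W (tensorAlg D B s) (TensorProduct.map ψ LinearMap.id ∘ₗ ξ) = 0 ↔ curv α W' B ψ = 0 := by
  constructor
  · intro h0
    refine h.hom_ext fun a => ?_
    rw [← h.curv_comp hg hB hψ, TensorProduct.map_zero_left]
    exact LinearMap.congr_fun h0 a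
  · intro h0
    refine LinearMap.ext fun a => (h.curv_comp hg hB hψ a).trans ?_
    rw [h0, TensorProduct.map_zero_left]
    rfl

end Coaction

/-! ## The cylinder -/

section Cylinder

variable {K : Type u} [Field K]

variable (K) in
theorem Interval.mem_chainGr (i : ℤ) (ν : Interval K) :
    ν ∈ Interval.chainGr K i ↔ ∀ s : Simp, -(s.dim : ℤ) ≠ i → ν s = 0 :=
  mem_pi_gr K fun s : Simp => -(s.dim : ℤ)

theorem Interval.chain_graded : IsGraded (Interval.chainGr K) (Interval.sgn K) := by
  have h := pi_graded K fun s : Simp => -(s.dim : ℤ)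
  have : Interval.sgn K = LinearMap.pi fun s : Simp => zsign K ((-(s.dim : ℤ) : ℤ) : ZMod 2) •
      (LinearMap.proj s : (Simp → K) →ₗ[K] K) := by
    rw [Interval.sgn_eq]
    simp only [Int.cast_neg, ZMod.neg_eq_self_mod_two]
  rw [this]
  exact h

variable {X : Type x} [AddCommGroup X] [Module K X]

/-- The inclusion `a ↦ a ⊗ σ`. -/
def incl (X : Type x) [AddCommGroup X] [Module K X] (σ : Simp) : X →ₗ[K] X ⊗[K] Interval K :=
  (TensorProduct.mk K X (Interval K)).flip (Pi.single σ 1)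

theorem incl_apply (σ : Simp) (a : X) : incl X σ a = a ⊗ₜ[K] (Pi.single σ 1 : Interval K) := rfl

/-- The sign of `σ ⊗ σ*` in the canonical element of `N_•(Δ¹) ⊗ N^•(Δ¹)`. -/
def Simp.coeff (K : Type u) [Field K] : Simp → K
  | .edge => -1
  | _ => 1

variable {Y : Type y} [AddCommGroup Y] [Module K Y]

/-- The map `a ↦ ∑ ± σ a ⊗ σ*`. -/
def coactionOf (i : Simp → X →ₗ[K] Y) : X →ₗ[K] Y ⊗[K] Interval K :=
  ofCoords fun σ => Simp.coeff K σ • i σ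

theorem coord_comp_coactionOf (i : Simp → X →ₗ[K] Y) (σ : Simp) :
    coord Y σ ∘ₗ coactionOf i = Simp.coeff K σ • i σ :=
  LinearMap.ext fun a => by rw [LinearMap.comp_apply, coactionOf, coord_ofCoords]

theorem coord_coactionOf (i : Simp → X →ₗ[K] Y) (σ : Simp) (a : X) :
    coord Y σ (coactionOf i a) = Simp.coeff K σ • i σ a :=
  coord_ofCoords _ _ _

/-- The map `a ↦ ∑ ± a ⊗ σ ⊗ σ*`. -/
def cylCoaction (X : Type x) [AddCommGroup X] [Module K X] :
    X →ₗ[K] (X ⊗[K] Interval K) ⊗[K] Interval K :=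
  coactionOf (incl X)

theorem coord_cylCoaction (σ : Simp) (a : X) :
    coord (X ⊗[K] Interval K) σ (cylCoaction X a) = Simp.coeff K σ • incl X σ a := by
  rw [cylCoaction, coord_coactionOf]

theorem tprod_signs_after (n : ℕ) (i : Fin n) (e : Fin n → ZMod 2) (a : Fin n → X) :
    (PiTensorProduct.tprod K fun j => if i < j then zsign K (e j) • a j else a j) =
      zsign K (after e i) • PiTensorProduct.tprod K a := by
  have : (fun j => if i < j then zsign K (e j) • a j else a j) =
      fun j => zsign K (if i < j then e j else 0) • a j := by
    funext j
    split_ifs <;> simp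
  rw [this, MultilinearMap.map_smul_univ, after, zsign_sum]

theorem Interval.tw_sgn_apply (e : ZMod 2) (ν : Interval K) (s : Simp) :
    tw (Interval.sgn K) e ν s = (if s = .edge then zsign K e else 1) * ν s := by
  rcases zmod_two_cases e with rfl | rfl <;> cases s <;> simp

theorem Interval.tw_sgn_single (e : ZMod 2) (s : Simp) :
    tw (Interval.sgn K) e (Pi.single s 1) =
      (if s = .edge then zsign K e else 1) • (Pi.single s 1 : Interval K) := by
  funext s'
  rw [Interval.tw_sgn_apply, Pi.smul_apply, smul_eq_mul]
  by_cases h : s' = s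
  · subst h; rfl
  · rw [Pi.single_eq_of_ne h, mul_zero, mul_zero]

theorem Simp.factor_eq_edge {n : ℕ} {i j : Fin n} : Simp.factor i j = .edge ↔ j = i := by
  rw [Simp.factor]
  by_cases h1 : j < i
  · simp [h1, h1.ne]
  · by_cases h2 : j = i <;> simp [h1, h2]

theorem prod_edge_factor {n : ℕ} (i : Fin n) (e : Fin n → ZMod 2) :
    ∏ j, (if Simp.factor i j = .edge then zsign K (after e j) else 1) = zsign K (after e i) := by
  simp only [Simp.factor_eq_edge]
  rw [Finset.prod_ite_eq' Finset.univ i]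
  simp

variable {P : ℕ → DGMod.{u, v} K} {g : ℤ → Submodule K X} {s : X →ₗ[K] X}

theorem coord_vertex_collect {σ : Simp} (hσ : σ ≠ .edge) (y : Schur P (X ⊗[K] Interval K)) :
    coord (Schur P X) σ (collect (intervalAlg K) P s y) = Schur.map P (coord X σ) y :=
  collect_contract (Interval.proj_isHom K hσ) s y

theorem coord_vertex_collect_map {Y : Type y} [AddCommGroup Y] [Module K Y] {σ : Simp} (hσ : σ ≠ .edge)
    (f : Y →ₗ[K] X ⊗[K] Interval K) {f' : Y →ₗ[K] X} (hf : coord X σ ∘ₗ f = f') (y : Schur P Y) :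
    coord (Schur P X) σ (collect (intervalAlg K) P s (Schur.map P f y)) = Schur.map P f' y := by
  rw [coord_vertex_collect hσ, ← hf, schur_map_comp_apply]

/-- The cup product on the edge evaluates at `[0]` before the distinguished place and at `[1]`
behind it. The odd edge cochain moves past the later elements of `X`, whence the `s`. -/
theorem coord_edge_collect (hX : IsGraded g s) (y : Schur P (X ⊗[K] Interval K)) :
    coord (Schur P X) .edge (collect (intervalAlg K) P s y) =
      phiIns (fun _ => LinearMap.id) (coord X .v0) (coord X .edge) (s ∘ₗ coord X .v1) y := by
  have : coord (Schur P X) Simp.edge ∘ₗ collect (intervalAlg K) P s =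
      phiIns (fun _ => LinearMap.id) (coord X .v0) (coord X .edge) (s ∘ₗ coord X .v1) := by
    refine schur_hom_ext hX.span_tensSet fun n _ c z _ hz => ?_
    choose i a ν ha hz using hz
    obtain rfl : z = fun j => a j ⊗ₜ ν j := funext hz
    have h1 := collect_sch (intervalAlg K) (P := P) (s := s)
      (T := List.ofFn fun j => ((i j : ZMod 2), a j, ν j))
      (fun t ht => by
        obtain ⟨j, rfl⟩ := (List.mem_ofFn' _ _).mp ht
        exact hX.sgn_of_mem _ _ (ha j)) (Tot.of P n c)
    rw [tens_ofFn, letters_ofFn, sch_ofFn, sch_ofFn, ← Interval.cup_tw] at h1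
    rw [LinearMap.comp_apply, h1, contract_tmul, LinearMap.proj_apply, Interval.cup_tprod_apply,
      phiIns_of, Finset.sum_smul]
    refine Finset.sum_congr rfl fun k _ => ?_
    simp only [Interval.tw_sgn_apply, Finset.prod_mul_distrib, prod_edge_factor]
    rw [← map_smul, ← TensorProduct.tmul_smul, LinearMap.id_apply]
    congr 2
    rw [mul_smul, ← MultilinearMap.map_smul_univ, ← tprod_signs_after]
    congr 1
    funext j
    rcases lt_trichotomy j k with h | h | h
    · simp [h, h.not_gt, Simp.factor]
    · subst h; simp [Simp.factor]
    · simp only [h, h.not_gt, h.ne', Simp.factor, if_true, if_false, LinearMap.comp_apply,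
        contract_tmul, LinearMap.proj_apply, map_smul, hX.sgn_of_mem _ _ (ha j)]
      exact smul_comm _ _ _
  exact LinearMap.congr_fun this y

theorem phiIns_smul {Q : ℕ → DGMod.{u, w} K} {Y : Type y} [AddCommGroup Y] [Module K Y]
    (φ : ∀ n, P n →ₗ[K] Q n) (c : K) (f h k : X →ₗ[K] Y) :
    phiIns φ f (c • h) k = c • phiIns φ f h k := by
  refine DirectSum.linearMap_ext _ fun n => LinearMap.ext fun z => ?_
  simp [phiIns, DirectSum.lmap_lof, insertEach_smul, TensorProduct.map_smul_right]

variable {g' : ℤ → Submodule K Y} {s' : Y →ₗ[K] Y}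

theorem map_coactionOf (hY : IsGraded g' s') {i : Simp → X →ₗ[K] Y} (hi : s' ∘ₗ i .v1 = i .v1 ∘ₗ s)
    (Δ : X →ₗ[K] Schur P X) (Δ' : Y →ₗ[K] Schur P Y)
    (h0 : ∀ a, Δ' (i .v0 a) = Schur.map P (i .v0) (Δ a))
    (h1 : ∀ a, Δ' (i .v1 a) = Schur.map P (i .v1) (Δ a))
    (he : ∀ a, Δ' (i .edge a) = phiIns (fun _ => LinearMap.id) (i .v0) (i .edge) (i .v1 ∘ₗ s) (Δ a))
    (a : X) :
    TensorProduct.map Δ' LinearMap.id (coactionOf i a) =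
      collect (intervalAlg K) P s' (Schur.map P (coactionOf i) (Δ a)) := by
  refine ext_coord fun σ => (contract_map Δ' _ _).trans ?_
  rw [coord_coactionOf, map_smul]
  cases σ
  · rw [coord_vertex_collect_map (by simp) (coactionOf i) (coord_comp_coactionOf i _), h0]
    simp only [Simp.coeff, one_smul]
  · rw [coord_vertex_collect_map (by simp) (coactionOf i) (coord_comp_coactionOf i _), h1]
    simp only [Simp.coeff, one_smul]
  · refine Eq.trans ?_ (coord_edge_collect hY _).symm
    refine Eq.trans ?_ (LinearMap.congr_fun (phiIns_comp_map _ (coactionOf i) _ _ _) (Δ a)).symm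
    rw [LinearMap.comp_assoc, coord_comp_coactionOf, coord_comp_coactionOf, coord_comp_coactionOf, he]
    simp only [Simp.coeff, one_smul]
    rw [hi, phiIns_smul]
    rfl

/-- The map `(C ∘ X) ⊗ N_•(Δ¹) → C ∘ (X ⊗ N_•(Δ¹))`. -/
def cylSplit (P : ℕ → DGMod.{u, v} K) (par : ZMod 2 → X →ₗ[K] X) :
    Schur P X ⊗[K] Interval K →ₗ[K] Schur P (X ⊗[K] Interval K) :=
  TensorProduct.lift (DirectSum.toModule K ℕ _ fun n => TensorProduct.curry
      (Schur.of P n ∘ₗ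
      TensorProduct.map LinearMap.id (kzip par (Interval.sgn K) n) ∘ₗ
      (TensorProduct.assoc K (P n).carrier (⨂[K]^n X)
        (⨂[K]^n (Interval K))).toLinearMap ∘ₗ
      TensorProduct.map LinearMap.id (Interval.coproduct K n)))

theorem cylSplit_of (par : ZMod 2 → X →ₗ[K] X) (n : ℕ) (c : P n) (a : Fin n → X) (ν : Interval K) :
    cylSplit P par (Schur.of P n (c ⊗ₜ PiTensorProduct.tprod K a) ⊗ₜ ν) =
      Schur.of P n (c ⊗ₜ kzip par (Interval.sgn K) n
        (PiTensorProduct.tprod K a ⊗ₜ Interval.coproduct K n ν)) := by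
  simp [cylSplit]

theorem Interval.coproduct_vertex (n : ℕ) {σ : Simp} (hσ : σ ≠ .edge) :
    Interval.coproduct K n (Pi.single σ 1) = PiTensorProduct.tprod K fun _ => Pi.single σ 1 := by
  rw [Interval.coproduct, Fintype.linearCombination_apply_single, one_smul]
  cases σ
  · rfl
  · rfl
  · exact absurd rfl hσ

theorem Interval.coproduct_edge (n : ℕ) : Interval.coproduct K n (Pi.single .edge 1) =
    ∑ i : Fin n, PiTensorProduct.tprod K fun j => Pi.single (Simp.factor i j) 1 := by
  rw [Interval.coproduct, Fintype.linearCombination_apply_single, one_smul]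

variable {par : ZMod 2 → X →ₗ[K] X}

theorem cylSplit_vertex (hX : IsGraded g s)
    (hpar : ∀ (ε : ZMod 2) (i : ℤ) (a : X), a ∈ g i → par ε a = if (i : ZMod 2) = ε then a else 0)
    {σ : Simp} (hσ : σ ≠ .edge) (y : Schur P X) :
    cylSplit P par (y ⊗ₜ Pi.single σ 1) = Schur.map P (incl X σ) y := by
  have : cylSplit P par ∘ₗ (TensorProduct.mk K (Schur P X) (Interval K)).flip (Pi.single σ 1) =
      Schur.map P (incl X σ) := by
    refine schur_hom_ext hX.span fun n _ c a _ ha => ?_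
    choose i ha using ha
    rw [LinearMap.comp_apply, LinearMap.flip_apply, TensorProduct.mk_apply, cylSplit_of,
      Interval.coproduct_vertex n hσ, kzip_tprod par (Interval.cochain_graded K).involutive n
      (fun j => (i j : ZMod 2)) a _ (fun j ε => hpar ε (i j) _ (ha j)), schur_map_of]
    simp only [Interval.tw_sgn_single, if_neg hσ, one_smul, incl_apply]
  exact LinearMap.congr_fun this y

/-- In the coproduct of `[0,1]` the odd factor moves past the elements of `X` behind it. This is the
sign found in `coord_edge_collect`, so chains and cochains match. -/
theorem cylSplit_edge (hX : IsGraded g s)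
    (hpar : ∀ (ε : ZMod 2) (i : ℤ) (a : X), a ∈ g i → par ε a = if (i : ZMod 2) = ε then a else 0)
    (y : Schur P X) : cylSplit P par (y ⊗ₜ Pi.single .edge 1) =
      phiIns (fun _ => LinearMap.id) (incl X .v0) (incl X .edge) (incl X .v1 ∘ₗ s) y := by
  have : cylSplit P par ∘ₗ (TensorProduct.mk K (Schur P X) (Interval K)).flip (Pi.single .edge 1) =
      phiIns (fun _ => LinearMap.id) (incl X .v0) (incl X .edge) (incl X .v1 ∘ₗ s) := by
    refine schur_hom_ext hX.span fun n _ c a _ ha => ?_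
    choose i ha using ha
    rw [LinearMap.comp_apply, LinearMap.flip_apply, TensorProduct.mk_apply, cylSplit_of,
      Interval.coproduct_edge, TensorProduct.tmul_sum, map_sum, TensorProduct.tmul_sum, map_sum,
      phiIns_of]
    refine Finset.sum_congr rfl fun k _ => ?_
    rw [kzip_tprod par (Interval.cochain_graded K).involutive n
      (fun j => (i j : ZMod 2)) a _ (fun j ε => hpar ε (i j) _ (ha j)), LinearMap.id_apply]
    congr 2
    simp only [Interval.tw_sgn_single, TensorProduct.tmul_smul]
    rw [MultilinearMap.map_smul_univ, prod_edge_factor, ← tprod_signs_after]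
    congr 1
    funext j
    rcases lt_trichotomy j k with h | h | h
    · simp [h, h.not_gt, Simp.factor, incl_apply]
    · subst h; simp [Simp.factor, incl_apply]
    · simp [h, h.not_gt, h.ne', Simp.factor, incl_apply, hX.sgn_of_mem _ _ (ha j),
        TensorProduct.smul_tmul']
  exact LinearMap.congr_fun this y

theorem coord_comp_cylCoaction (σ : Simp) :
    coord (X ⊗[K] Interval K) σ ∘ₗ cylCoaction X = Simp.coeff K σ • incl X σ :=
  LinearMap.ext fun a => coord_cylCoaction σ a

theorem coord_vertex_collect_cylCoaction (hX : IsGraded g s)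
    (hpar : ∀ (ε : ZMod 2) (i : ℤ) (a : X), a ∈ g i → par ε a = if (i : ZMod 2) = ε then a else 0)
    {σ : Simp} (hσ : σ ≠ .edge) (y : Schur P X) :
    coord (Schur P (X ⊗[K] Interval K)) σ (collect (intervalAlg K) P
      (TensorProduct.map s (Interval.sgn K)) (Schur.map P (cylCoaction X) y)) =
    cylSplit P par (y ⊗ₜ Pi.single σ 1) := by
  have h : Simp.coeff K σ = 1 := by cases σ <;> first | rfl | exact absurd rfl hσ
  have h2 : coord (X ⊗[K] Interval K) σ ∘ₗ cylCoaction X = incl X σ := by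
    rw [coord_comp_cylCoaction, h, one_smul]
  exact (coord_vertex_collect_map hσ (cylCoaction X) h2 y).trans (cylSplit_vertex hX hpar hσ y).symm

theorem coord_edge_collect_cylCoaction (hX : IsGraded g s)
    (hpar : ∀ (ε : ZMod 2) (i : ℤ) (a : X), a ∈ g i → par ε a = if (i : ZMod 2) = ε then a else 0)
    (y : Schur P X) :
    coord (Schur P (X ⊗[K] Interval K)) .edge (collect (intervalAlg K) P
      (TensorProduct.map s (Interval.sgn K)) (Schur.map P (cylCoaction X) y)) =
    (-1 : K) • cylSplit P par (y ⊗ₜ Pi.single .edge 1) := by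
  refine (coord_edge_collect (hX.tensor Interval.chain_graded) _).trans ?_
  have h1 : TensorProduct.map s (Interval.sgn K) ∘ₗ incl X .v1 = incl X .v1 ∘ₗ s := by
    refine LinearMap.ext fun a => ?_
    simp only [LinearMap.comp_apply, incl_apply, TensorProduct.map_tmul]
    congr 1
    funext τ
    cases τ <;> simp
  refine (LinearMap.congr_fun (phiIns_comp_map _ (cylCoaction X) _ _ _) y).trans ?_
  rw [LinearMap.comp_assoc, coord_comp_cylCoaction, coord_comp_cylCoaction, coord_comp_cylCoaction,
    cylSplit_edge hX hpar]
  simp only [Simp.coeff, one_smul]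
  rw [h1, phiIns_smul]
  rfl

theorem coord_collect_cylCoaction (hX : IsGraded g s)
    (hpar : ∀ (ε : ZMod 2) (i : ℤ) (a : X), a ∈ g i → par ε a = if (i : ZMod 2) = ε then a else 0)
    (σ : Simp) (y : Schur P X) :
    coord (Schur P (X ⊗[K] Interval K)) σ (collect (intervalAlg K) P
      (TensorProduct.map s (Interval.sgn K)) (Schur.map P (cylCoaction X) y)) =
    Simp.coeff K σ • cylSplit P par (y ⊗ₜ Pi.single σ 1) := by
  cases σ
  · exact (coord_vertex_collect_cylCoaction hX hpar (by simp) y).trans (one_smul K _).symm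
  · exact (coord_vertex_collect_cylCoaction hX hpar (by simp) y).trans (one_smul K _).symm
  · exact coord_edge_collect_cylCoaction hX hpar y

variable {C : NSCooperad.{u, v} K} (V : NSCoalg.{u, v, w} C)

theorem Interval.chainD_single (σ : Simp) : Interval.chainD K (Pi.single σ 1) =
    if σ = .edge then Pi.single .v1 1 - Pi.single .v0 1 else 0 := by
  funext τ
  cases σ <;> cases τ <;> simp [Interval.chainD]

theorem contract_intervalD {Y : Type y} [AddCommGroup Y] [Module K Y] (σ : Simp) (z : Y ⊗[K] Interval K) :
    contract Y (LinearMap.proj σ ∘ₗ (intervalAlg K).d) z =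
      if σ = .edge then coord Y .v1 z - coord Y .v0 z else 0 := by
  induction z with
  | zero => simp
  | add y z hy hz =>
    rw [map_add, hy, hz, map_add, map_add]
    split_ifs
    · abel
    · rw [add_zero]
  | tmul a ν => cases σ <;> simp [intervalAlg, sub_smul]

theorem cylCoaction_mem {i : ℤ} {a : X} (ha : a ∈ g i) :
    cylCoaction X a ∈ tensorGr (tensorGr g (Interval.chainGr K)) (intervalAlg K).gr i := by
  refine mem_of_coord (fun s : Simp => (s.dim : ℤ)) (intervalAlg_mem_gr K) fun σ => ?_
  rw [coord_cylCoaction]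
  refine Submodule.smul_mem _ _ (tmul_mem_tensorGr (j := -(σ.dim : ℤ)) ha ?_ (by ring))
  rw [Interval.mem_chainGr]
  intro τ hτ
  rw [Pi.single_eq_of_ne]
  rintro rfl
  exact hτ rfl

/-- The canonical element of chains tensor cochains is closed. The coefficient `-1` on the edge is
what makes the boundary of `[0,1]` cancel the coboundary of the vertices. -/
theorem cylCoaction_d (s d : X →ₗ[K] X) (a : X) :
    tensorD (intervalAlg K) (TensorProduct.map s (Interval.sgn K))
      (TensorProduct.map d LinearMap.id + TensorProduct.map s (Interval.chainD K)) (cylCoaction X a) =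
      cylCoaction X (d a) := by
  refine ext_coord fun σ => ?_
  rw [coord_tensorD, contract_intervalD, coord_cylCoaction, coord_cylCoaction, coord_cylCoaction,
    coord_cylCoaction, map_smul, LinearMap.add_apply, incl_apply, incl_apply, incl_apply, incl_apply,
    TensorProduct.map_tmul, TensorProduct.map_tmul, Interval.chainD_single, LinearMap.id_apply]
  have h0 : Interval.sgn K (Pi.single .v0 1) = Pi.single .v0 1 := by
    funext τ; cases τ <;> simp
  have h1 : Interval.sgn K (Pi.single .v1 1) = Pi.single .v1 1 := by
    funext τ; cases τ <;> simp
  by_cases h : σ = .edge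
  · subst h
    rw [if_pos rfl, if_pos rfl]
    simp only [Simp.coeff, one_smul, map_sub, TensorProduct.map_tmul, h0, h1, TensorProduct.tmul_sub,
      neg_one_smul]
    abel
  · rw [if_neg h, if_neg h, map_zero, TensorProduct.tmul_zero, add_zero, add_zero]

theorem span_contract_cylCoaction : Submodule.span K {b | ∃ (χ : Interval K →ₗ[K] K) (a : X),
    b = contract (X ⊗[K] Interval K) χ (cylCoaction X a)} = ⊤ := by
  rw [eq_top_iff]
  intro y _
  rw [← sum_coord y]
  refine Submodule.sum_mem _ fun σ _ => ?_
  have h := Submodule.smul_mem _ (Simp.coeff K σ)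
    (Submodule.subset_span (R := K) (s := {b | ∃ (χ : Interval K →ₗ[K] K) (a : X),
      b = contract (X ⊗[K] Interval K) χ (cylCoaction X a)})
      ⟨LinearMap.proj σ, coord X σ y, rfl⟩)
  rw [coord_cylCoaction, smul_smul] at h
  have h1 : Simp.coeff K σ * Simp.coeff K σ = 1 := by cases σ <;> simp [Simp.coeff]
  rwa [h1, one_smul] at h

/-- Up to the self-inverse coefficients, the values of `cylSplit` are components of the collecting
map, which preserves degrees. -/
theorem cylSplit_mem (hX : IsGraded g s)
    (hpar : ∀ (ε : ZMod 2) (i : ℤ) (a : X), a ∈ g i → par ε a = if (i : ZMod 2) = ε then a else 0)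
    {Δ : X →ₗ[K] Schur P X} (hdeg : ∀ i, ∀ a ∈ g i, Δ a ∈ Schur.gr P g i)
    {i : ℤ} {y : X ⊗[K] Interval K} (hy : y ∈ tensorGr g (Interval.chainGr K) i) :
    cylSplit P par (TensorProduct.map Δ LinearMap.id y) ∈
      Schur.gr P (tensorGr g (Interval.chainGr K)) i := by
  rw [← sum_coord y, map_sum, map_sum]
  refine Submodule.sum_mem _ fun σ _ => ?_
  rw [TensorProduct.map_tmul, LinearMap.id_apply]
  have h1 := coord_mem (fun s : Simp => -(s.dim : ℤ)) (Interval.mem_chainGr K) hy σ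
  have h2 := collect_mem_gr (D := intervalAlg K) (hX.tensor Interval.chain_graded)
    (schur_map_mem_gr (f := cylCoaction X) (fun i a ha => cylCoaction_mem ha) (hdeg _ _ h1))
  have h3 := coord_mem (fun s : Simp => (s.dim : ℤ)) (intervalAlg_mem_gr K) h2 σ
  rw [coord_collect_cylCoaction hX hpar] at h3
  have h4 := Submodule.smul_mem _ (Simp.coeff K σ) h3
  have h5 : Simp.coeff K σ * Simp.coeff K σ = 1 := by cases σ <;> simp [Simp.coeff]
  rw [smul_smul, h5, one_smul] at h4
  have h6 : i - -(σ.dim : ℤ) - (σ.dim : ℤ) = i := by ring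
  rwa [h6] at h4

theorem Interval.chainD_mem {i : ℤ} {ν : Interval K} (hν : ν ∈ Interval.chainGr K i) :
    Interval.chainD K ν ∈ Interval.chainGr K (i + 1) := by
  rw [Interval.mem_chainGr] at hν ⊢
  intro s hs
  have h : Interval.chainD K ν s = (match s with | .v0 => -ν .edge | .v1 => ν .edge | .edge => 0) := by
    cases s <;> rfl
  rw [h]
  cases s
  · simp only [Simp.dim] at hs ⊢
    rw [hν .edge (by simp only [Simp.dim]; push_cast at *; omega), neg_zero]
  · simp only [Simp.dim] at hs ⊢
    rw [hν .edge (by simp only [Simp.dim]; push_cast at *; omega)]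
  · rfl

theorem Interval.chainD_chainD (ν : Interval K) : Interval.chainD K (Interval.chainD K ν) = 0 := by
  funext s
  cases s <;> simp [Interval.chainD]

theorem cylinder_Δ_vertex {σ : Simp} (hσ : σ ≠ .edge) (a : V.toData.carrier) :
    (cylinder V).Δ (incl V.carrier σ a) =
      Schur.map C.obj (W := (cylinder V).carrier) (incl V.carrier σ) (V.toData.Δ a) :=
  cylSplit_vertex V.isGraded (fun ε _ _ ha => V.par_of_mem ε ha) hσ (V.Δ a)

theorem cylinder_Δ_edge (a : V.toData.carrier) :
    (cylinder V).Δ (incl V.carrier .edge a) =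
      phiIns (Y := (cylinder V).carrier) (fun _ => LinearMap.id) (incl V.carrier .v0)
        (incl V.carrier .edge) (incl V.carrier .v1 ∘ₗ V.sgn) (V.toData.Δ a) :=
  cylSplit_edge V.isGraded (fun ε _ _ ha => V.par_of_mem ε ha) (V.Δ a)

theorem cylinder_sgn_vertex :
    (TensorProduct.map V.sgn (Interval.sgn K) :
      (cylinder V).carrier →ₗ[K] (cylinder V).carrier) ∘ₗ incl V.carrier .v1 =
    (incl V.carrier .v1 : V.carrier →ₗ[K] (cylinder V).carrier) ∘ₗ V.sgn := by
  refine LinearMap.ext fun a => ?_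
  change TensorProduct.map V.sgn (Interval.sgn K) (incl V.carrier .v1 a) =
    incl V.carrier .v1 (V.sgn a)
  rw [incl_apply, incl_apply, TensorProduct.map_tmul]
  congr 1
  funext τ
  cases τ <;> simp

theorem cylinder_graded : IsGraded (cylinder V).gr (TensorProduct.map V.sgn (Interval.sgn K)) :=
  V.isGraded.tensor Interval.chain_graded

theorem cylinder_isCoaction :
    IsCoaction (intervalAlg K) V.toData (cylinder V) (TensorProduct.map V.sgn (Interval.sgn K))
      (coactionOf (Y := (cylinder V).carrier) (incl V.carrier)) where
  degree _ _ ha := cylCoaction_mem ha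
  comm_d a := cylCoaction_d V.sgn V.d a
  comm_Δ := map_coactionOf (X := V.toData.carrier) (Y := (cylinder V).carrier) (s := V.sgn)
      (g' := (cylinder V).gr) (s' := TensorProduct.map V.sgn (Interval.sgn K)) (cylinder_graded V)
      (i := incl V.carrier) (cylinder_sgn_vertex V) V.toData.Δ (cylinder V).Δ
      (cylinder_Δ_vertex V (by simp)) (cylinder_Δ_vertex V (by simp)) (cylinder_Δ_edge V)
  span := span_contract_cylCoaction

theorem cylinder_d_mem (i : ℤ) (y : V.carrier ⊗[K] Interval K)
    (hy : y ∈ tensorGr V.gr (Interval.chainGr K) i) :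
    (TensorProduct.map V.d LinearMap.id + TensorProduct.map V.sgn (Interval.chainD K) :
      V.carrier ⊗[K] Interval K →ₗ[K] V.carrier ⊗[K] Interval K) y ∈
      tensorGr V.gr (Interval.chainGr K) (i + 1) := by
  refine tensorGr_induction hy (tensorGr V.gr (Interval.chainGr K) (i + 1)) _ fun p q a ν hi ha hν => ?_
  rw [LinearMap.add_apply, TensorProduct.map_tmul, TensorProduct.map_tmul, V.sgn_of_mem p a ha,
    ← TensorProduct.smul_tmul', LinearMap.id_apply]
  exact Submodule.add_mem _ (tmul_mem_tensorGr (V.d_mem p a ha) hν (by omega))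
    (Submodule.smul_mem _ _ (tmul_mem_tensorGr ha (Interval.chainD_mem hν) (by omega)))

theorem cylinder_d_d :
    (TensorProduct.map V.d LinearMap.id + TensorProduct.map V.sgn (Interval.chainD K) :
      V.carrier ⊗[K] Interval K →ₗ[K] V.carrier ⊗[K] Interval K) ∘ₗ
      (TensorProduct.map V.d LinearMap.id + TensorProduct.map V.sgn (Interval.chainD K)) = 0 := by
  refine TensorProduct.ext' fun a ν => ?_
  have h1 : V.sgn (V.d a) = -V.d (V.sgn a) :=
    LinearMap.congr_fun (V.isGraded.anticomm V.isGraded.sgn_of_mem V.d_mem) a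
  simp [h1, V.d_d, Interval.chainD_chainD, TensorProduct.neg_tmul]

/-- The coalgebra identities are inherited from `V` along the coaction; only degrees and `d² = 0`
are checked directly. -/
theorem cylinder_isCoalg : (cylinder V).IsCoalg (TensorProduct.map V.sgn (Interval.sgn K)) where
  graded := cylinder_graded V
  d_mem := cylinder_d_mem V
  d_d := cylinder_d_d V
  Δ_degree _ _ hy := cylSplit_mem V.isGraded (fun ε _ _ ha => V.par_of_mem ε ha) V.Δ_degree hy
  Δ_d := (cylinder_isCoaction V).Δ_d V.isCoalg (cylinder_graded V) (cylinder_d_mem V)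
    fun _ _ hy => cylSplit_mem V.isGraded (fun ε _ _ ha => V.par_of_mem ε ha) V.Δ_degree hy
  coassoc := (cylinder_isCoaction V).coassoc V.isCoalg (cylinder_graded V)
    fun _ _ hy => cylSplit_mem V.isGraded (fun ε _ _ ha => V.par_of_mem ε ha) V.Δ_degree hy
  counit := (cylinder_isCoaction V).counit V.isCoalg (cylinder_graded V)

end Cylinder

/-! ## Homotopies of morphisms and paths of twisting elements -/

section CylinderHomotopy

variable {K : Type u} [Field K] {C : NSCooperad.{u, v} K} {P : NSOperad.{u, w} K}
variable {α : TwistingMorphism C P}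
variable {W : NSCoalgData.{u, v, x} C} {W' : NSCoalgData.{u, v, y} C}
variable {t' : W'.carrier →ₗ[K] W'.carrier} {i : Simp → W.carrier →ₗ[K] W'.carrier}
variable {B : NSAlgData.{u, w, x'} P} {s : B.carrier →ₗ[K] B.carrier}

theorem coord_map_coactionOf (i : Simp → W.carrier →ₗ[K] W'.carrier)
    (φ : W'.carrier →ₗ[K] B.carrier) (σ : Simp) (a : W.carrier) :
    coord B.carrier σ (TensorProduct.map φ LinearMap.id (coactionOf i a)) =
      Simp.coeff K σ • φ (i σ a) := by
  rw [contract_map, coord_coactionOf, map_smul]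

theorem IsTwisting.map_coactionOf
    (h : IsCoaction (intervalAlg K) W W' t' (coactionOf i)) (hg : IsGraded W'.gr t')
    (hB : IsGraded B.gr s) {φ : W'.carrier →ₗ[K] B.carrier} (hφ : IsTwisting α W' B φ) :
    IsTwisting α W (tensorAlg (intervalAlg K) B s)
      (TensorProduct.map φ LinearMap.id ∘ₗ coactionOf i) where
  degree j a ha := by
    refine tensorGr_induction (h.degree j a ha) (tensorGr B.gr (intervalAlg K).gr j)
      (TensorProduct.map φ LinearMap.id) fun p q b ν hj hb hν => ?_
    rw [TensorProduct.map_tmul]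
    exact tmul_mem_tensorGr (hφ.degree p b hb) hν hj
  curv_eq_zero := (h.curv_eq_zero_iff hg hB hφ.degree).mpr hφ.curv_eq_zero

/-- The projections `p` dual to the inclusions `i` reassemble a map on `W'` from the components of
`ψ`. The coefficients are their own inverses. -/
theorem IsTwisting.exists_of_tensor
    (h : IsCoaction (intervalAlg K) W W' t' (coactionOf i)) (hg : IsGraded W'.gr t')
    (hB : IsGraded B.gr s) (p : Simp → W'.carrier →ₗ[K] W.carrier)
    (hp : ∀ σ, ∀ j, ∀ y ∈ W'.gr j, p σ y ∈ W.gr (j + σ.dim))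
    (hpi : ∀ σ τ a, p τ (i σ a) = if τ = σ then a else 0)
    {ψ : W.carrier →ₗ[K] B.carrier ⊗[K] Interval K}
    (hψ : IsTwisting α W (tensorAlg (intervalAlg K) B s) ψ) :
    ∃ φ : W'.carrier →ₗ[K] B.carrier, IsTwisting α W' B φ ∧
      ∀ σ a, φ (i σ a) = Simp.coeff K σ • coord B.carrier σ (ψ a) := by
  let φ : W'.carrier →ₗ[K] B.carrier :=
    ∑ σ, Simp.coeff K σ • (coord B.carrier σ ∘ₗ ψ ∘ₗ p σ)
  have hφ : ∀ y, φ y = ∑ σ, Simp.coeff K σ • coord B.carrier σ (ψ (p σ y)) := fun y => by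
    simp [φ, LinearMap.sum_apply]
  have hφi : ∀ σ a, φ (i σ a) = Simp.coeff K σ • coord B.carrier σ (ψ a) := by
    intro σ a
    rw [hφ, Finset.sum_eq_single σ]
    · rw [hpi, if_pos rfl]
    · intro τ _ hτ
      rw [hpi, if_neg hτ, map_zero, map_zero, smul_zero]
    · exact fun h => absurd (Finset.mem_univ _) h
  have hdeg : ∀ j, ∀ y ∈ W'.gr j, φ y ∈ B.gr j := by
    intro j y hy
    rw [hφ]
    refine Submodule.sum_mem _ fun σ _ => Submodule.smul_mem _ _ ?_
    have h1 := coord_mem (fun s : Simp => (s.dim : ℤ)) (intervalAlg_mem_gr K)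
      (hψ.degree _ _ (hp σ j y hy)) σ
    rwa [add_sub_cancel_right] at h1
  have hψφ : TensorProduct.map φ LinearMap.id ∘ₗ coactionOf i = ψ := by
    refine LinearMap.ext fun a => ext_coord fun σ => ?_
    rw [LinearMap.comp_apply, coord_map_coactionOf, hφi, smul_smul]
    have h1 : Simp.coeff K σ * Simp.coeff K σ = 1 := by cases σ <;> simp [Simp.coeff]
    rw [h1, one_smul]
  refine ⟨φ, ⟨hdeg, (h.curv_eq_zero_iff hg hB hdeg).mp ?_⟩, hφi⟩
  exact (congrArg (curv α W (tensorAlg (intervalAlg K) B s)) hψφ).trans hψ.curv_eq_zero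

theorem coord_incl {X : Type x} [AddCommGroup X] [Module K X] (σ τ : Simp) (a : X) :
    coord (K := K) X τ (incl X σ a) = if τ = σ then a else 0 := by
  rw [incl_apply, contract_tmul, LinearMap.proj_apply, Pi.single_apply]
  split_ifs <;> simp

variable (V : NSCoalg.{u, v, x} C) (A : NSAlg.{u, w, y} P)

theorem coord_cylinder_mem (σ : Simp) (j : ℤ) (y : V.carrier ⊗[K] Interval K)
    (hy : y ∈ tensorGr V.gr (Interval.chainGr K) j) : coord V.carrier σ y ∈ V.gr (j + σ.dim) := by
  have := coord_mem (fun s : Simp => -(s.dim : ℤ)) (Interval.mem_chainGr K) hy σ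
  rwa [sub_neg_eq_add] at this

variable {V A}

/-- A homotopy corestricts to a twisting map on the cylinder, and these correspond to twisting maps
from `V` to `A ⊗ N^•(Δ¹)`. -/
theorem NSCoalgHom.homotopic_iff_pathRel (f g : NSCoalgHom V.toData (bar α A)) :
    f.Homotopic g ↔ PathRel α V.toData A.toData A.sgn
      (barHomEquiv (α := α) V.isCoalg A f).1 (barHomEquiv (α := α) V.isCoalg A g).1 := by
  constructor
  · rintro ⟨H, hH⟩
    have hφ := (barHomEquiv (α := α) (cylinder_isCoalg V) A H).2
    refine ⟨_, hφ.map_coactionOf (cylinder_isCoaction V) (cylinder_graded V) A.isAlg.graded,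
      fun a => ?_, fun a => ?_⟩
    · refine (coord_map_coactionOf (W := V.toData) (W' := cylinder V) (B := A.toData) _ _ _ a).trans
        ((one_smul K _).trans ?_)
      exact congrArg (counitProj C.obj C.ε) (hH a).1
    · refine (coord_map_coactionOf (W := V.toData) (W' := cylinder V) (B := A.toData) _ _ _ a).trans
        ((one_smul K _).trans ?_)
      exact congrArg (counitProj C.obj C.ε) (hH a).2
  · rintro ⟨ψ, hψ, h0, h1⟩
    obtain ⟨φ, hφ, hφi⟩ := hψ.exists_of_tensor (cylinder_isCoaction V) (cylinder_graded V)
      A.isAlg.graded (coord V.carrier) (coord_cylinder_mem V)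
      fun σ τ a => coord_incl (K := K) (X := V.carrier) σ τ a
    -- Maps to the bar construction are determined by their corestrictions, so the ends of the
    -- homotopy are compared there.
    have key : ∀ (f : NSCoalgHom V.toData (bar α A)) (σ : Simp), σ ≠ .edge →
        (∀ a, coord A.carrier σ (ψ a) = (barHomEquiv (α := α) V.isCoalg A f).1 a) → ∀ a,
        ((barHomEquiv (α := α) (cylinder_isCoalg V) A).symm ⟨φ, hφ⟩).toLin
          (incl V.carrier σ a) = f.toLin a := by
      intro f σ hσ hf a
      have e1 : Simp.coeff K σ = 1 := by cases σ <;> first | rfl | exact absurd rfl hσ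
      have e2 : φ ∘ₗ incl V.carrier σ = (barHomEquiv (α := α) V.isCoalg A f).1 :=
        LinearMap.ext fun a => (hφi σ a).trans (((congrArg (· • _) e1).trans (one_smul K _)).trans (hf a))
      refine (congrArg (Schur.map C.obj φ) (cylinder_Δ_vertex V hσ a)).trans ?_
      refine (schur_map_comp_apply _ _ _).symm.trans ?_
      refine (congrArg (fun q => Schur.map C.obj q (V.Δ a)) e2).trans ?_
      exact (LinearMap.congr_fun
        (eq_map_comp_Δ (W := V.toData) A.isAlg.graded.involutive f.comm_Δ) a).symm
    exact ⟨_, fun a => ⟨key f .v0 (by simp) h0 a, key g .v1 (by simp) h1 a⟩⟩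

theorem isAlgMap_evalAt {σ : Simp} (hσ : σ ≠ .edge) :
    IsAlgMap (pathObject A) A.toData (coord A.carrier σ) := by
  have h := isAlgMap_contract (B := A.toData) (s := A.sgn) (Interval.proj_isHom K hσ)
  exact ⟨h.degree, h.comm_d, fun y => (congrArg (coord A.carrier σ) (pathObject_γ A y)).trans
    (h.comm_γ y)⟩

/-- The cobar bijection with the path object as target. Evaluation at a vertex is an algebra map, so
the ends may be compared on generators. -/
theorem NSAlgHom.homotopic_iff_pathRel (f g : NSAlgHom (cobar α V) A.toData) :
    f.Homotopic g ↔ PathRel α V.toData A.toData A.sgn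
      (cobarHomEquiv (α := α) A.isAlg V f).1 (cobarHomEquiv (α := α) A.isAlg V g).1 := by
  constructor
  · rintro ⟨H, hH⟩
    have hψ := (cobarHomEquiv (α := α) (pathObject_isAlg A) V H).2
    exact ⟨_, isTwisting_pathObject.mp hψ, fun a => (hH (generator P a)).1,
      fun a => (hH (generator P a)).2⟩
  · rintro ⟨ψ, hψ, h0, h1⟩
    have hψ' := isTwisting_pathObject.mpr hψ
    have key : ∀ (f : NSAlgHom (cobar α V) A.toData) (σ : Simp), σ ≠ .edge →
        (∀ a, coord A.carrier σ (ψ a) = (cobarHomEquiv (α := α) A.isAlg V f).1 a) → ∀ b,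
        evalAt A.carrier σ (((cobarHomEquiv (α := α) (pathObject_isAlg A) V).symm ⟨ψ, hψ'⟩).toLin b) =
          f.toLin b := by
      intro f σ hσ hf b
      refine ((isAlgMap_evalAt hσ).comm_γ _).trans ?_
      refine (congrArg A.γ (schur_map_comp_apply _ _ _).symm).trans ?_
      have e2 : coord A.toData.carrier σ ∘ₗ ψ = (cobarHomEquiv (α := α) A.isAlg V f).1 := LinearMap.ext hf
      refine (congrArg (fun q => A.γ (Schur.map P.obj q b)) e2).trans ?_
      exact congrArg (fun h : NSAlgHom (cobar α V) A.toData => h.toLin b)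
        ((cobarHomEquiv (α := α) A.isAlg V).symm_apply_apply f)
    exact ⟨_, fun b => ⟨key f .v0 (by simp) h0 b, key g .v1 (by simp) h1 b⟩⟩

end CylinderHomotopy

/-! ## Maurer-Cartan elements of the convolution algebra -/

section SumOfOperations

variable {K : Type u} [Field K] {C : NSCooperad.{u, v} K} {P : NSOperad.{u, w} K}
variable {α : TwistingMorphism C P}

theorem sum_component {M : ℕ → Type*} [∀ n, AddCommGroup (M n)] [∀ n, Module K (M n)] {Z : Type*}
    [AddCommGroup Z] [Module K Z] (F : (⨁ n, M n) →ₗ[K] Z) {N : ℕ} {y : ⨁ n, M n}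
    (hy : ∀ n, N ≤ n → DirectSum.component K ℕ M n y = 0) :
    ∑ l ∈ Finset.range N, F (DirectSum.lof K ℕ M l (DirectSum.component K ℕ M l y)) = F y := by
  cases N with
  | zero =>
    have : y = 0 := DFinsupp.ext fun n => hy n (Nat.zero_le n)
    rw [this, map_zero, Finset.range_zero, Finset.sum_empty]
  | succ N =>
    let G : (⨁ n, M n) →ₗ[K] Z := F - ∑ l ∈ Finset.range (N + 1),
      F ∘ₗ DirectSum.lof K ℕ M l ∘ₗ DirectSum.component K ℕ M l
    have hG : ∀ y, G y = F y - ∑ l ∈ Finset.range (N + 1),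
        F (DirectSum.lof K ℕ M l (DirectSum.component K ℕ M l y)) := fun y => by
      simp only [G, LinearMap.sub_apply, LinearMap.sum_apply, LinearMap.comp_apply]
    have h := directSum_eq_zero G N y (fun n hn => hy n hn) fun n hn t => by
      rw [hG, Finset.sum_eq_single n, DirectSum.component.lof_self, sub_self]
      · intro l _ hl
        rw [DirectSum.component.of, dif_neg hl.symm, map_zero, map_zero]
      · intro h
        exact absurd (Finset.mem_range.mpr (by omega)) h
    rw [hG, sub_eq_zero] at h
    exact h.symm

variable {W : NSCoalgData.{u, v, x} C} {B : NSAlgData.{u, w, y} P}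

theorem TwistingMorphism.toFun_zero (α : TwistingMorphism C P) : α.toFun 0 = 0 :=
  LinearMap.ext fun c => by rw [C.reduced_zero c, map_zero, map_zero]

theorem app_map_of (ψ : W.carrier →ₗ[K] B.carrier) (l : ℕ)
    (y : (C.obj l).carrier ⊗[K] ⨂[K]^l W.carrier) :
    α.app B.carrier (Schur.map C.obj ψ (Schur.of C.obj l y)) =
      Schur.of P.obj l (TensorProduct.map (α.toFun l) (PiTensorProduct.map fun _ => ψ) y) := by
  rw [Schur.map, TwistingMorphism.app, Schur.of, DirectSum.lmap_lof, DirectSum.lmap_lof,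
    ← LinearMap.comp_apply (TensorProduct.map _ _), ← TensorProduct.map_comp, LinearMap.comp_id,
    LinearMap.id_comp]

/-- `α` vanishes in arities 0 and 1, so the nonlinear term of the curvature leaves these places free
for `q 0 = 0` and the differential. The bound `k + 2` includes arity 1 and all arities at most `k`,
beyond which `Δⁿ a = 0`. -/
theorem sum_operations_eq_curv {ψ : W.carrier →ₗ[K] B.carrier} {a : W.carrier} {k n : ℕ}
    (ha : a ∈ W.coradical k) (hn : k + 2 ≤ n) {q : ℕ → B.carrier} (h0 : q 0 = 0)
    (h1 : q 1 = B.d (ψ a) - ψ (W.d a))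
    (h2 : ∀ l, 2 ≤ l → q l = B.γ (Schur.of P.obj l
      (TensorProduct.map (α.toFun l) (PiTensorProduct.map fun _ => ψ) (W.comul l a)))) :
    ∑ l ∈ Finset.range n, q l = curv α W B ψ a := by
  have h := sum_component (B.γ ∘ₗ α.app B.carrier ∘ₗ Schur.map C.obj ψ) (N := n) (y := W.Δ a)
    fun l hl => NSCoalgData.mem_coradical.mp ha l (by omega)
  simp only [LinearMap.comp_apply, app_map_of] at h
  rw [curv_apply, ← h]
  obtain ⟨m, rfl⟩ : ∃ m, n = m + 2 := ⟨n - 2, by omega⟩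
  rw [Finset.sum_range_succ', Finset.sum_range_succ', Finset.sum_range_succ',
    Finset.sum_range_succ']
  rw [h0, h1, α.toFun_zero, α.toFun_one]
  simp only [TensorProduct.map_zero_left, LinearMap.zero_apply, map_zero, add_zero]
  rw [add_comm]
  congr 1
  refine Finset.sum_congr rfl fun l _ => ?_
  exact h2 (l + 1 + 1) (by omega)

end SumOfOperations

/-! ### Maurer-Cartan elements as twisting maps -/

section Convolution

variable {K : Type u} [Field K]

theorem homPar_of_mem (V : DGMod.{u, v} K) (W : DGMod.{u, w} K) {p : ℤ}
    {f : V.carrier →ₗ[K] W.carrier} (hf : f ∈ homGr V W p) (ε : ZMod 2) :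
    homPar V W ε f = if (p : ZMod 2) = ε then f else 0 := by
  refine LinearMap.ext_on V.isGraded.span ?_
  rintro a ⟨j, ha⟩
  rw [homPar, LinearMap.sum_apply, LinearMap.sum_apply, Finset.sum_eq_single (j : ZMod 2)]
  · simp only [LinearMap.comp_apply, LinearMap.lcomp_apply, LinearMap.compRight_apply]
    rw [V.par_of_mem _ ha, if_pos rfl, W.par_of_mem _ (hf j a ha), Int.cast_add]
    by_cases h : (p : ZMod 2) = ε
    · rw [if_pos h, if_pos (by rw [h])]
    · rw [if_neg h, if_neg (fun h' => h (add_left_cancel h'))]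
      rfl
  · intro δ _ hδ
    simp only [LinearMap.comp_apply, LinearMap.lcomp_apply, LinearMap.compRight_apply]
    rw [V.par_of_mem _ ha, if_neg hδ.symm, map_zero, map_zero]
  · exact fun h => absurd (Finset.mem_univ _) h

variable {C : NSCooperad.{u, v} K} {P : NSOperad.{u, w} K} {α : TwistingMorphism C P}
variable {V : NSCoalg.{u, v, x} C} {A : NSAlg.{u, w, y} P}

theorem convTensor_tprod {n : ℕ} {p : Fin n → ℤ} {f : Fin n → V.carrier →ₗ[K] A.carrier}
    (hf : ∀ i, f i ∈ homGr V.toDGMod A.toDGMod (p i)) :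
    convTensor α V A n (PiTensorProduct.tprod K f) =
      TensorProduct.map (α.toFun n ∘ₗ tw (C.obj n).sgn (∑ j, (p j : ZMod 2)))
        (PiTensorProduct.map fun i => f i ∘ₗ tw V.sgn (after (fun j => (p j : ZMod 2)) i)) := by
  rw [convTensor, LinearMap.sum_apply, Finset.sum_eq_single fun j => (p j : ZMod 2)]
  · rw [LinearMap.comp_apply, LinearMap.comp_apply, PiTensorProduct.map_tprod,
      PiTensorProduct.piTensorHomMap_tprod_eq_map, TensorProduct.mapBilinear_apply,
      pow_sum_val (C.obj n).isGraded.involutive]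
    congr 2
    funext i
    rw [LinearMap.comp_apply, homPar_of_mem _ _ (hf i), if_pos rfl, LinearMap.lcomp_apply']
    congr 1
    rw [after, ← tw_natCast V.isGraded.involutive]
    push_cast
    congr 1
    simp
  · intro ε _ hε
    obtain ⟨i, hi⟩ := Function.ne_iff.mp hε
    rw [LinearMap.comp_apply, LinearMap.comp_apply, PiTensorProduct.map_tprod,
      MultilinearMap.map_coord_zero (i := i), map_zero, map_zero]
    rw [LinearMap.comp_apply, homPar_of_mem _ _ (hf i), if_neg hi.symm, map_zero]
  · exact fun h => absurd (Finset.mem_univ _) h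

theorem convQ_apply (n : ℕ) (hn : 2 ≤ n) (z : ⨂[K]^n (V.carrier →ₗ[K] A.carrier)) (a : V.carrier) :
    convQ α V A n z a = A.γ (Schur.of P.obj n (convTensor α V A n z (V.comul n a))) := by
  obtain ⟨m, rfl⟩ : ∃ m, n = m + 2 := ⟨n - 2, by omega⟩
  rfl

theorem homPar_sub {p : ℤ} {f : V.carrier →ₗ[K] A.carrier}
    (hf : f ∈ homGr V.toDGMod A.toDGMod p) :
    homPar V.toDGMod A.toDGMod 0 f - homPar V.toDGMod A.toDGMod 1 f = zsign K (p : ZMod 2) • f := by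
  rw [homPar_of_mem _ _ hf, homPar_of_mem _ _ hf]
  rcases zmod_two_cases (p : ZMod 2) with h | h <;> simp [h]

theorem convD_apply {p : ℤ} {f : V.carrier →ₗ[K] A.carrier}
    (hf : f ∈ homGr V.toDGMod A.toDGMod p) (a : V.carrier) :
    convD V A f a = A.d (f a) - zsign K (p : ZMod 2) • f (V.d a) := by
  rw [convD, LinearMap.sub_apply, LinearMap.comp_apply, LinearMap.sub_apply (homPar _ _ 0),
    homPar_sub hf, LinearMap.sub_apply]
  rfl

theorem mem_homGr_zero {f : V.carrier →ₗ[K] A.carrier} :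
    f ∈ homGr V.toDGMod A.toDGMod 0 ↔ ∀ i, ∀ a ∈ V.gr i, f a ∈ A.gr i := by
  change (∀ i, ∀ a ∈ V.gr i, f a ∈ A.gr (i + 0)) ↔ _
  simp only [add_zero]

/-- On `F_k` the partial sums are eventually equal to `c`, and the filtration is exhaustive; so
convergence to zero means `c = 0`. The map `θ` lets the argument serve with and without
coefficients. -/
theorem forall_filtration_iff {L : Type*} [AddCommGroup L] [Module K L] {Z : Type*} [AddCommGroup Z]
    [Module K Z]
    {W : NSCoalgData.{u, v, x} C} {F : ℕ → Submodule K L}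
    {θ : L → W.carrier → Z} (h0 : F 0 = ⊤)
    (hF : ∀ k z, z ∈ F (k + 1) ↔ ∀ a ∈ W.coradical k, θ z a = 0) {S : ℕ → L} {c : W.carrier →ₗ[K] Z}
    (hS : ∀ k n a, a ∈ W.coradical k → k + 2 ≤ n → θ (S n) a = c a) :
    (∀ k, ∃ N, ∀ n ≥ N, S n ∈ F k) ↔ c = 0 := by
  constructor
  · intro h
    refine LinearMap.ext fun a => ?_
    obtain ⟨k, hk⟩ := NSCoalgData.exists_mem_coradical a
    obtain ⟨N, hN⟩ := h (k + 1)
    rw [← hS k (max N (k + 2)) a hk (le_max_right _ _)]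
    exact (hF k _).mp (hN _ (le_max_left _ _)) a hk
  · rintro rfl k
    cases k with
    | zero => exact ⟨0, fun n _ => by rw [h0]; trivial⟩
    | succ k => exact ⟨k + 2, fun n hn => (hF k _).mpr fun a ha => hS k n a ha hn⟩

theorem mem_convF_succ (k : ℕ) (f : V.carrier →ₗ[K] A.carrier) :
    f ∈ convF V A (k + 1) ↔ ∀ a ∈ V.toData.coradical k, f a = 0 := by
  rw [convF, LinearMap.mem_ker]
  constructor
  · exact fun h a ha => LinearMap.congr_fun h ⟨a, ha⟩
  · exact fun h => LinearMap.ext fun a => h a.1 a.2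

theorem convQ_one_of_degree_zero {φ : V.carrier →ₗ[K] A.carrier}
    (hφ : φ ∈ homGr V.toDGMod A.toDGMod 0) (a : V.carrier) :
    convQ α V A 1 (PiTensorProduct.tprod K fun _ => φ) a = A.d (φ a) - φ (V.d a) := by
  rw [convQ, LinearMap.comp_apply, LinearEquiv.coe_coe,
    PiTensorProduct.subsingletonEquiv_apply_tprod, convD_apply hφ, Int.cast_zero, zsign_zero, one_smul]

theorem convQ_of_degree_zero {φ : V.carrier →ₗ[K] A.carrier}
    (hφ : φ ∈ homGr V.toDGMod A.toDGMod 0) {n : ℕ} (hn : 2 ≤ n) (a : V.carrier) :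
    convQ α V A n (PiTensorProduct.tprod K fun _ => φ) a = A.γ (Schur.of P.obj n
      (TensorProduct.map (α.toFun n) (PiTensorProduct.map fun _ => φ) (V.comul n a))) := by
  rw [convQ_apply n hn, convTensor_tprod (p := fun _ => 0) fun _ => hφ]
  simp only [Int.cast_zero, Finset.sum_const_zero, after, ite_self, tw_zero, LinearMap.comp_id]

theorem isMC_conv_iff {φ : V.carrier →ₗ[K] A.carrier} :
    (conv α V A).IsMC φ ↔ IsTwisting α V.toData A.toData φ := by
  have key : φ ∈ homGr V.toDGMod A.toDGMod 0 →
      ((∀ k : ℕ, ∃ N : ℕ, ∀ n ≥ N, ∑ l ∈ Finset.range n,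
        convQ α V A l (PiTensorProduct.tprod K fun _ => φ) ∈ convF V A k) ↔
        curv α V.toData A.toData φ = 0) := by
    intro hφ
    refine forall_filtration_iff (W := V.toData) (θ := fun f a => f a) rfl mem_convF_succ ?_
    intro k n a ha hn
    have h : (∑ l ∈ Finset.range n, convQ α V A l (PiTensorProduct.tprod K fun _ => φ)) a =
        ∑ l ∈ Finset.range n, convQ α V A l (PiTensorProduct.tprod K fun _ => φ) a :=
      LinearMap.sum_apply _ _ _
    exact h.trans (sum_operations_eq_curv (α := α) (B := A.toData) (ψ := φ)
      (q := fun l => convQ α V A l (PiTensorProduct.tprod K fun _ => φ) a) ha hn rfl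
      (convQ_one_of_degree_zero hφ a)
      fun l hl => convQ_of_degree_zero hφ hl a)
  constructor
  · exact fun h => ⟨mem_homGr_zero.mp h.1, (key h.1).mp h.2⟩
  · exact fun h => ⟨mem_homGr_zero.mpr h.degree, (key (mem_homGr_zero.mpr h.degree)).mpr h.curv_eq_zero⟩

end Convolution

/-! ## Extension of scalars of the convolution algebra -/

section HomTensor

variable {K : Type u} [Field K] {X : Type x} [AddCommGroup X] [Module K X]
variable {Y : Type y} [AddCommGroup Y] [Module K Y] {g : ℤ → Submodule K X} {s : X →ₗ[K] X}

/-- The map `f ⊗ ν ↦ (a ↦ (-1)^{|ν| |a|} f a ⊗ ν)`. -/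
def homTensor (s : X →ₗ[K] X) : (X →ₗ[K] Y) ⊗[K] Interval K →ₗ[K] X →ₗ[K] Y ⊗[K] Interval K :=
  ∑ σ : Simp, (incl Y σ).compRight K ∘ₗ (tw s (σ.dim : ZMod 2)).lcomp K Y ∘ₗ coord (X →ₗ[K] Y) σ

theorem coord_homTensor (z : (X →ₗ[K] Y) ⊗[K] Interval K) (a : X) (σ : Simp) :
    coord Y σ (homTensor s z a) = coord (X →ₗ[K] Y) σ z (tw s (σ.dim : ZMod 2) a) := by
  rw [homTensor, LinearMap.sum_apply, LinearMap.sum_apply, map_sum, Finset.sum_eq_single σ]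
  · simp only [LinearMap.comp_apply, LinearMap.compRight_apply, LinearMap.lcomp_apply, incl_apply,
      contract_tmul, LinearMap.proj_apply, Pi.single_eq_same, one_smul]
  · intro τ _ hτ
    simp only [LinearMap.comp_apply, LinearMap.compRight_apply, incl_apply, contract_tmul,
      LinearMap.proj_apply, Pi.single_eq_of_ne hτ.symm, zero_smul]
  · exact fun h => absurd (Finset.mem_univ _) h

theorem homTensor_tmul {i : ℤ} (f : X →ₗ[K] Y) {ν : Interval K} (hν : ν ∈ Interval.cochainGr K i)
    (a : X) : homTensor s (f ⊗ₜ ν) a = f (tw s (i : ZMod 2) a) ⊗ₜ ν := by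
  refine ext_coord fun σ => ?_
  rw [coord_homTensor, contract_tmul, contract_tmul, LinearMap.proj_apply, LinearMap.smul_apply]
  by_cases h : (σ.dim : ℤ) = i
  · rw [← h, Int.cast_natCast]
  · rw [(intervalAlg_mem_gr K i ν).mp hν σ h, zero_smul, zero_smul]

/-- On components the map is a twist by an involution, which is undone by twisting again. -/
theorem homTensor_surjective (hs : s ∘ₗ s = LinearMap.id) :
    Function.Surjective (homTensor s : (X →ₗ[K] Y) ⊗[K] Interval K →ₗ[K] X →ₗ[K] Y ⊗[K] Interval K) := by
  intro ψ
  refine ⟨∑ σ, (coord Y σ ∘ₗ ψ ∘ₗ tw s (σ.dim : ZMod 2)) ⊗ₜ[K] Pi.single σ (1 : K),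
    LinearMap.ext fun a => ext_coord fun σ => ?_⟩
  rw [coord_homTensor, map_sum, Finset.sum_eq_single σ]
  · rw [contract_tmul, LinearMap.proj_apply, Pi.single_eq_same, one_smul, LinearMap.comp_apply,
      LinearMap.comp_apply, ← LinearMap.comp_apply (tw s _), ← tw_add hs,
      CharTwo.add_self_eq_zero, tw_zero, LinearMap.id_apply]
  · intro τ _ hτ
    rw [contract_tmul, LinearMap.proj_apply, Pi.single_eq_of_ne hτ.symm, zero_smul]
  · exact fun h => absurd (Finset.mem_univ _) h

theorem tw_tw (hs : s ∘ₗ s = LinearMap.id) (e : ZMod 2) (a : X) : tw s e (tw s e a) = a := by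
  rw [← LinearMap.comp_apply, ← tw_add hs, CharTwo.add_self_eq_zero, tw_zero, LinearMap.id_apply]

theorem tw_of_mem (h : IsGraded g s) (e : ZMod 2) {i : ℤ} {a : X} (ha : a ∈ g i) :
    tw s e a = zsign K (e * i) • a := by
  rcases zmod_two_cases e with rfl | rfl
  · simp
  · rw [tw_one, h.sgn_of_mem i a ha, one_mul]

theorem mem_range_map_subtype (F : Submodule K X) (z : X ⊗[K] Interval K) :
    z ∈ LinearMap.range (TensorProduct.map F.subtype (LinearMap.id : Interval K →ₗ[K] Interval K)) ↔
      ∀ σ, coord X σ z ∈ F := by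
  constructor
  · rintro ⟨y, rfl⟩ σ
    induction y with
    | zero => rw [map_zero, map_zero]; exact F.zero_mem
    | add y z hy hz => rw [map_add, map_add]; exact F.add_mem hy hz
    | tmul a ν => rw [TensorProduct.map_tmul, contract_tmul]; exact F.smul_mem _ a.2
  · intro h
    refine ⟨∑ σ, (⟨coord X σ z, h σ⟩ : F) ⊗ₜ[K] Pi.single σ (1 : K), ?_⟩
    rw [map_sum]
    exact sum_coord z

theorem Interval.cup_mem {n : ℕ} {r : Fin n → ℤ} {ν : Fin n → Interval K}
    (hν : ∀ i, ν i ∈ Interval.cochainGr K (r i)) :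
    Interval.cup K n (PiTensorProduct.tprod K ν) ∈ Interval.cochainGr K (∑ i, r i) := by
  have h := Interval.cup_tw n (fun _ => 0) ν ν
  simp only [after, ite_self, Finset.sum_const_zero, tw_zero, LinearMap.id_apply] at h
  rw [h]
  exact nuProd_mem (D := intervalAlg K) _ r hν

/-- Signs modulo two for maps and cochains of parities `e i` and elements of parities `q i`. On the
left all cochains are moved out of the tensor product of maps before evaluation, on the right after
it. -/
theorem koszul_exponents {n : ℕ} (e q : Fin n → ZMod 2) :
    ∑ i, (after e i + ∑ j, e j) * q i + ∑ i, after e i * e i =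
      ∑ i, e i * q i + ∑ i, after (fun j => q j + e j) i * e i := by
  have h1 : ∑ i, after q i * e i = ∑ j, (∑ i, if i < j then e i else 0) * q j := by
    simp only [after, Finset.sum_mul]
    rw [Finset.sum_comm]
    refine Finset.sum_congr rfl fun j _ => Finset.sum_congr rfl fun i _ => ?_
    split_ifs <;> ring
  have h2 : ∀ i, after (fun j => q j + e j) i = after q i + after e i := fun i => by
    simp only [after, ← Finset.sum_add_distrib]
    refine Finset.sum_congr rfl fun j _ => ?_
    split_ifs <;> simp
  have h3 : ∀ i, ∑ j, e j = after e i + e i + ∑ j, if j < i then e j else 0 := fun i => by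
    have hi : ∑ j, (if j = i then e j else 0) = e i := by simp
    rw [after, ← hi, ← Finset.sum_add_distrib, ← Finset.sum_add_distrib]
    refine Finset.sum_congr rfl fun j _ => ?_
    rcases lt_trichotomy i j with h | h | h
    · simp [h, h.not_gt, h.ne']
    · simp [h]
    · simp [h, h.not_gt, h.ne]
  simp only [h2, add_mul, Finset.sum_add_distrib, h1]
  -- The total parity is the part behind `i`, the part at `i` and the part before `i`; the first
  -- occurs twice and cancels.
  have h4 : ∑ i, after e i * q i + ∑ i, (∑ j, e j) * q i =
      ∑ i, e i * q i + ∑ j, (∑ i, if i < j then e i else 0) * q j := by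
    rw [← Finset.sum_add_distrib, ← Finset.sum_add_distrib]
    refine Finset.sum_congr rfl fun i _ => ?_
    rw [h3 i, add_mul, add_mul, ← add_assoc, ← add_assoc, CharTwo.add_self_eq_zero, zero_add]
  linear_combination h4

end HomTensor

/-! ### `Hom(V, A) ⊗ N^•(Δ¹)` and `Hom(V, A ⊗ N^•(Δ¹))` have the same operations -/

section IntervalOperations

variable {K : Type u} [Field K] {C : NSCooperad.{u, v} K} {P : NSOperad.{u, w} K}
variable {α : TwistingMorphism C P} {V : NSCoalg.{u, v, x} C} {A : NSAlg.{u, w, y} P}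

theorem homTensor_mem_iff {z : (V.carrier →ₗ[K] A.carrier) ⊗[K] Interval K} :
    z ∈ tensorGr (homGr V.toDGMod A.toDGMod) (Interval.cochainGr K) 0 ↔
      ∀ j, ∀ a ∈ V.gr j, homTensor V.sgn z a ∈ tensorGr A.gr (Interval.cochainGr K) j := by
  constructor
  · intro hz j a ha
    refine mem_of_coord (fun s : Simp => (s.dim : ℤ)) (intervalAlg_mem_gr K) fun σ => ?_
    rw [coord_homTensor, sub_eq_add_neg, ← zero_sub]
    exact coord_mem (fun s : Simp => (s.dim : ℤ)) (intervalAlg_mem_gr K) hz σ j _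
      (V.isGraded.tw_mem ha _)
  · intro h
    refine mem_of_coord (fun s : Simp => (s.dim : ℤ)) (intervalAlg_mem_gr K) fun σ => ?_
    intro j a ha
    have h1 := coord_mem (fun s : Simp => (s.dim : ℤ)) (intervalAlg_mem_gr K)
      (h j _ (V.isGraded.tw_mem ha (σ.dim : ZMod 2))) σ
    rwa [coord_homTensor, tw_tw V.isGraded.involutive, sub_eq_add_neg, ← zero_sub] at h1

theorem comul_sgn (n : ℕ) (a : V.carrier) : V.comul n (V.sgn a) =
    TensorProduct.map (C.obj n).sgn (PiTensorProduct.map fun _ => V.sgn) (V.comul n a) := by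
  have h := LinearMap.congr_fun (V.isGraded.comm_zero V.isGraded.schur.sgn_of_mem V.Δ_degree) a
  rw [NSCoalg.comul, LinearMap.comp_apply, LinearMap.comp_apply]
  refine (congrArg _ h).trans ?_
  exact DirectSum.lmap_apply (fun n => TensorProduct.map (C.obj n).sgn
    (PiTensorProduct.map fun _ : Fin n => V.sgn)) (V.Δ a) n

theorem comul_tw (n : ℕ) (e : ZMod 2) (a : V.carrier) : V.comul n (tw V.sgn e a) =
    TensorProduct.map (tw (C.obj n).sgn e) (PiTensorProduct.map fun _ => tw V.sgn e) (V.comul n a) := by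
  rcases zmod_two_cases e with rfl | rfl
  · simp only [tw_zero, PiTensorProduct.map_id, TensorProduct.map_id, LinearMap.id_apply]
  · simp only [tw_one, comul_sgn]

theorem tw_mem_coradical {k : ℕ} {a : V.carrier} (ha : a ∈ V.toData.coradical k) (e : ZMod 2) :
    tw V.sgn e a ∈ V.toData.coradical k :=
  NSCoalgData.mem_coradical.mpr fun n hn => (comul_tw n e a).trans
    ((congrArg _ (NSCoalgData.mem_coradical.mp ha n hn)).trans (map_zero _))

theorem homTensor_filtration (k : ℕ) (z : (V.carrier →ₗ[K] A.carrier) ⊗[K] Interval K) :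
    z ∈ LinearMap.range (TensorProduct.map (convF V A (k + 1)).subtype
      (LinearMap.id : Interval K →ₗ[K] Interval K)) ↔
      ∀ a ∈ V.toData.coradical k, homTensor V.sgn z a = 0 := by
  rw [mem_range_map_subtype]
  constructor
  · intro h a ha
    refine ext_coord fun σ => ?_
    rw [map_zero]
    exact (coord_homTensor z a σ).trans ((mem_convF_succ k _).mp (h σ) _ (tw_mem_coradical ha _))
  · intro h σ
    refine (mem_convF_succ k _).mpr fun a ha => ?_
    have h1 := (coord_homTensor z (tw V.sgn (σ.dim : ZMod 2) a) σ).symm.trans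
      ((congrArg (coord A.carrier σ) (h _ (tw_mem_coradical ha _))).trans (map_zero _))
    exact (congrArg (coord (V.carrier →ₗ[K] A.carrier) σ z)
      (tw_tw V.isGraded.involutive _ a)).symm.trans h1

variable (A) in
/-- The operation of arity `n` of the path object. -/
def pathOperation (n : ℕ) : (P.obj n).carrier ⊗[K] (⨂[K]^n (A.carrier ⊗[K] Interval K)) →ₗ[K]
    A.carrier ⊗[K] Interval K :=
  TensorProduct.map (A.γ ∘ₗ Schur.of P.obj n) (Interval.cup K n) ∘ₗ
    (TensorProduct.assoc K (P.obj n).carrier (⨂[K]^n A.carrier)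
      (⨂[K]^n (Interval K))).symm.toLinearMap ∘ₗ
    TensorProduct.map LinearMap.id (kunzip A.par (Interval.sgn K) n)

theorem pathObject_γ_of (n : ℕ) (y : (P.obj n).carrier ⊗[K] (⨂[K]^n (A.carrier ⊗[K] Interval K))) :
    (pathObject A).γ (Schur.of P.obj n y) = pathOperation A n y := by
  have h := DirectSum.toModule_lof (R := K) (φ := fun n => pathOperation A n) n y
  exact h

theorem pathOperation_tmul (n : ℕ) (c : P.obj n) (T : ⨂[K]^n (A.carrier ⊗[K] Interval K)) :
    pathOperation A n (c ⊗ₜ T) = TensorProduct.map (A.γ ∘ₗ Schur.of P.obj n) (Interval.cup K n)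
      ((TensorProduct.assoc K (P.obj n).carrier (⨂[K]^n A.carrier) (⨂[K]^n (Interval K))).symm
        (c ⊗ₜ kunzip A.par (Interval.sgn K) n T)) := by
  rw [pathOperation, LinearMap.comp_apply, LinearMap.comp_apply, TensorProduct.map_tmul,
    LinearMap.id_apply, LinearEquiv.coe_coe]

/-- Total degree zero forces `f i` and `ν i` to have equal parity, so all signs are expressed by the
`p i` and `q i` and compared by `koszul_exponents`. -/
theorem homTensor_operation_of {n : ℕ} {p r : Fin n → ℤ} (hpr : ∀ i, p i + r i = 0)
    {f : Fin n → V.carrier →ₗ[K] A.carrier} (hf : ∀ i, f i ∈ homGr V.toDGMod A.toDGMod (p i))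
    {ν : Fin n → Interval K} (hν : ∀ i, ν i ∈ Interval.cochainGr K (r i))
    (c : P.obj n) {q : Fin n → ℤ} {a : Fin n → V.carrier} (ha : ∀ i, a i ∈ V.gr (q i)) :
    A.γ (Schur.of P.obj n (c ⊗ₜ PiTensorProduct.tprod K fun i =>
        f i (tw V.sgn (after (fun j => (p j : ZMod 2)) i) (tw V.sgn (∑ j, (p j : ZMod 2)) (a i))))) ⊗ₜ
      Interval.cup K n (PiTensorProduct.tprod K fun i =>
        tw (Interval.sgn K) (after (fun j => (p j : ZMod 2)) i) (ν i)) =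
    TensorProduct.map (A.γ ∘ₗ Schur.of P.obj n) (Interval.cup K n)
      ((TensorProduct.assoc K (P.obj n).carrier (⨂[K]^n A.carrier) (⨂[K]^n (Interval K))).symm
        (c ⊗ₜ kunzip A.par (Interval.sgn K) n (PiTensorProduct.tprod K fun i =>
          f i (tw V.sgn (r i : ZMod 2) (a i)) ⊗ₜ ν i))) := by
  have hr : ∀ i, (r i : ZMod 2) = p i := fun i => by
    have : r i = - p i := by linarith [hpr i]
    rw [this, Int.cast_neg, ZMod.neg_eq_self_mod_two]
  rw [kunzip_tprod A.par (Interval.cochain_graded K).involutive n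
    (fun i => ((q i + p i : ℤ) : ZMod 2)) _ ν fun i ε =>
      A.par_of_mem ε (hf i _ _ (V.isGraded.tw_mem (ha i) _)),
    TensorProduct.assoc_symm_tmul, TensorProduct.map_tmul, LinearMap.comp_apply]
  simp only [tw_of_mem V.isGraded _ (ha _), tw_of_mem (Interval.cochain_graded K) _ (hν _), map_smul,
    MultilinearMap.map_smul_univ, TensorProduct.tmul_smul, ← TensorProduct.smul_tmul', smul_smul,
    ← zsign_sum, ← zsign_add, hr]
  congr 2
  have h := koszul_exponents (fun i => (p i : ZMod 2)) fun i => (q i : ZMod 2)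
  simp only [Int.cast_add, add_mul, Finset.sum_add_distrib] at h ⊢
  linear_combination h

theorem homTensor_operation_tmul {n : ℕ} (hn : 2 ≤ n) {p r : Fin n → ℤ} (hpr : ∀ i, p i + r i = 0)
    {f : Fin n → V.carrier →ₗ[K] A.carrier} (hf : ∀ i, f i ∈ homGr V.toDGMod A.toDGMod (p i))
    {ν : Fin n → Interval K} (hν : ∀ i, ν i ∈ Interval.cochainGr K (r i)) (a : V.carrier) :
    homTensor V.sgn (TensorProduct.map (convQ α V A n) (Interval.cup K n)
      (kunzip (homPar V.toDGMod A.toDGMod) (Interval.sgn K) n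
        (PiTensorProduct.tprod K fun i => f i ⊗ₜ ν i))) a =
    pathOperation A n (TensorProduct.map (α.toFun n)
      (PiTensorProduct.map fun i => homTensor V.sgn (f i ⊗ₜ ν i)) (V.comul n a)) := by
  have hE : ((∑ i, r i : ℤ) : ZMod 2) = ∑ i, (p i : ZMod 2) := by
    rw [Int.cast_sum]
    refine Finset.sum_congr rfl fun i _ => ?_
    have : r i = - p i := by linarith [hpr i]
    rw [this, Int.cast_neg, ZMod.neg_eq_self_mod_two]
  rw [kunzip_tprod _ (Interval.cochain_graded K).involutive n (fun i => (p i : ZMod 2)) f ν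
      fun i ε => homPar_of_mem _ _ (hf i) ε, TensorProduct.map_tmul,
    homTensor_tmul _ (Interval.cup_mem fun i => (Interval.cochain_graded K).tw_mem (hν i) _),
    convQ_apply n hn, convTensor_tprod hf, comul_tw, hE]
  have h : (TensorProduct.mk K A.carrier (Interval K)).flip (Interval.cup K n
      (PiTensorProduct.tprod K fun i =>
        tw (Interval.sgn K) (after (fun j => (p j : ZMod 2)) i) (ν i))) ∘ₗ A.γ ∘ₗ
      Schur.of P.obj n ∘ₗ
      TensorProduct.map (α.toFun n ∘ₗ tw (C.obj n).sgn (∑ j, (p j : ZMod 2)))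
        (PiTensorProduct.map fun i => f i ∘ₗ tw V.sgn (after (fun j => (p j : ZMod 2)) i)) ∘ₗ
      TensorProduct.map (tw (C.obj n).sgn (∑ j, (p j : ZMod 2)))
        (PiTensorProduct.map fun _ => tw V.sgn (∑ j, (p j : ZMod 2))) =
      pathOperation A n ∘ₗ TensorProduct.map (α.toFun n)
        (PiTensorProduct.map fun i => homTensor V.sgn (f i ⊗ₜ ν i)) := by
    refine TensorProduct.ext (LinearMap.ext fun c => PiTensorProduct.ext
      (MultilinearMap.ext_of_span (S := fun _ => {a | ∃ i, a ∈ V.gr i}) (fun _ => V.isGraded.span)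
        fun b hb => ?_))
    choose q hq using hb
    simp only [LinearMap.compMultilinearMap_apply, LinearMap.compr₂ₛₗ_apply,
      TensorProduct.mk_apply, LinearMap.comp_apply, TensorProduct.map_tmul,
      PiTensorProduct.map_tprod, LinearMap.flip_apply, tw_tw (C.obj n).isGraded.involutive,
      homTensor_tmul _ (hν _)]
    rw [pathOperation_tmul]
    exact homTensor_operation_of hpr hf hν _ hq
  exact LinearMap.congr_fun h (V.comul n a)

theorem homTensor_operation {n : ℕ} (hn : 2 ≤ n)
    {z : Fin n → (V.carrier →ₗ[K] A.carrier) ⊗[K] Interval K}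
    (hz : ∀ i, z i ∈ tensorGr (homGr V.toDGMod A.toDGMod) (Interval.cochainGr K) 0) (a : V.carrier) :
    homTensor V.sgn (TensorProduct.map (convQ α V A n) (Interval.cup K n)
      (kunzip (homPar V.toDGMod A.toDGMod) (Interval.sgn K) n (PiTensorProduct.tprod K z))) a =
    pathOperation A n (TensorProduct.map (α.toFun n)
      (PiTensorProduct.map fun i => homTensor V.sgn (z i)) (V.comul n a)) := by
  -- Both sides are multilinear in `z`. Their difference is checked on pure tensors of total degree
  -- zero, which span the degree zero part.
  let M₁ : MultilinearMap K (fun _ : Fin n => (V.carrier →ₗ[K] A.carrier) ⊗[K] Interval K)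
      (A.carrier ⊗[K] Interval K) :=
    (LinearMap.applyₗ a ∘ₗ homTensor V.sgn ∘ₗ
      TensorProduct.map (convQ α V A n) (Interval.cup K n) ∘ₗ
      kunzip (homPar V.toDGMod A.toDGMod) (Interval.sgn K) n).compMultilinearMap
        (PiTensorProduct.tprod K)
  let M₂ : MultilinearMap K (fun _ : Fin n => (V.carrier →ₗ[K] A.carrier) ⊗[K] Interval K)
      (A.carrier ⊗[K] Interval K) :=
    ((pathOperation A n ∘ₗ LinearMap.applyₗ (V.comul n a) ∘ₗ
      TensorProduct.mapBilinear (.id K) (C.obj n).carrier (⨂[K]^n V.carrier) (P.obj n).carrier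
        (⨂[K]^n (A.carrier ⊗[K] Interval K)) (α.toFun n)).compMultilinearMap
        (PiTensorProduct.mapMultilinear K (fun _ : Fin n => V.carrier)
          (fun _ : Fin n => A.carrier ⊗[K] Interval K))).compLinearMap fun _ => homTensor V.sgn
  have h := MultilinearMap.mem_of_span (M₁ - M₂) (W := ⊥) (fun b hb => ?_) z hz
  · exact sub_eq_zero.mp ((Submodule.mem_bot K).mp h)
  · choose p r f ν hpr hf hν hb using hb
    obtain rfl : b = fun i => f i ⊗ₜ ν i := funext hb
    exact (Submodule.mem_bot K).mpr (sub_eq_zero.mpr (homTensor_operation_tmul hn hpr hf hν a))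

/-- The cochain differential changes the parity of `ν`, hence the twist of `a` by one `s`; this is
the `s` needed to pass `A.sgn` through `f`. -/
theorem homTensor_differential
    {z : (V.carrier →ₗ[K] A.carrier) ⊗[K] Interval K}
    (hz : z ∈ tensorGr (homGr V.toDGMod A.toDGMod) (Interval.cochainGr K) 0) (a : V.carrier) :
    homTensor V.sgn (TensorProduct.map (convD V A) LinearMap.id z +
      TensorProduct.map (homPar V.toDGMod A.toDGMod 0 - homPar V.toDGMod A.toDGMod 1)
        (Interval.cochainD K) z) a =
    tensorD (intervalAlg K) A.sgn A.d (homTensor V.sgn z a) - homTensor V.sgn z (V.d a) := by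
  have h := tensorGr_induction hz ⊥
    (LinearMap.applyₗ a ∘ₗ homTensor V.sgn ∘ₗ (TensorProduct.map (convD V A) LinearMap.id +
      TensorProduct.map (homPar V.toDGMod A.toDGMod 0 - homPar V.toDGMod A.toDGMod 1)
        (Interval.cochainD K)) -
      (tensorD (intervalAlg K) A.sgn A.d ∘ₗ LinearMap.applyₗ a ∘ₗ homTensor V.sgn -
        LinearMap.applyₗ (V.d a) ∘ₗ homTensor V.sgn)) fun p r f ν hpr hf hν => ?_
  · exact sub_eq_zero.mp ((Submodule.mem_bot K).mp h)
  · refine (Submodule.mem_bot K).mpr ?_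
    rw [LinearMap.sub_apply, sub_eq_zero]
    have hr : (r : ZMod 2) = p := by
      have : r = - p := by linarith
      rw [this, Int.cast_neg, ZMod.neg_eq_self_mod_two]
    have hd : Interval.cochainD K ν ∈ Interval.cochainGr K (r + 1) := (intervalAlg K).d_mem _ _ hν
    have hD : (intervalAlg K).d ν = Interval.cochainD K ν := rfl
    have h3 : ∀ b, A.sgn (f b) = zsign K (p : ZMod 2) • f (V.sgn b) :=
      LinearMap.congr_fun (V.isGraded.comm A.sgn_of_mem hf)
    have h4 : V.sgn ∘ₗ V.d = -(V.d ∘ₗ V.sgn) := V.isGraded.anticomm V.sgn_of_mem V.d_mem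
    have h5 : V.d (tw V.sgn (p : ZMod 2) a) = zsign K (p : ZMod 2) • tw V.sgn (p : ZMod 2) (V.d a) := by
      rcases zmod_two_cases (p : ZMod 2) with h | h
      · simp [h]
      · have := LinearMap.congr_fun h4 a
        rw [LinearMap.comp_apply, LinearMap.neg_apply, LinearMap.comp_apply] at this
        rw [h, tw_one, this, zsign_one, neg_smul, one_smul, neg_neg]
    have h6 : tw V.sgn ((r + 1 : ℤ) : ZMod 2) a = V.sgn (tw V.sgn (p : ZMod 2) a) := by
      rw [Int.cast_add, Int.cast_one, hr, add_comm, tw_add V.isGraded.involutive, tw_one]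
      rfl
    simp only [LinearMap.comp_apply, LinearMap.applyₗ_apply_apply, LinearMap.add_apply,
      LinearMap.sub_apply, TensorProduct.map_tmul, LinearMap.id_apply, map_add]
    rw [homTensor_tmul _ hν, homTensor_tmul _ hν, homTensor_tmul _ hν, homTensor_tmul _ hd, tensorD, LinearMap.add_apply, TensorProduct.map_tmul,
      TensorProduct.map_tmul, LinearMap.id_apply, convD_apply hf, h6, hr, h3,
      homPar_sub hf, h5, hD,
      map_smul, smul_smul, zsign_mul_self, one_smul, LinearMap.smul_apply, TensorProduct.sub_tmul]
    abel

end IntervalOperations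

/-! ### Paths of Maurer-Cartan elements and gauge equivalence -/

section IntervalMC

variable {K : Type u} [Field K] {C : NSCooperad.{u, v} K} {P : NSOperad.{u, w} K}
variable {α : TwistingMorphism C P} {V : NSCoalg.{u, v, x} C} {A : NSAlg.{u, w, y} P}

variable (α V A) in
/-- The operations of `Hom^α(V, A) ⊗ N^•(Δ¹)`. -/
def convIntervalQ (n : ℕ) : (⨂[K]^n ((V.carrier →ₗ[K] A.carrier) ⊗[K] Interval K)) →ₗ[K]
    ((V.carrier →ₗ[K] A.carrier) ⊗[K] Interval K) :=
  (conv α V A).intervalQ n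

theorem convIntervalQ_zero (z : ⨂[K]^0 ((V.carrier →ₗ[K] A.carrier) ⊗[K] Interval K)) :
    convIntervalQ α V A 0 z = 0 := by
  have h : convIntervalQ α V A 0 = TensorProduct.map 0 (Interval.cup K 0) ∘ₗ
      kunzip (homPar V.toDGMod A.toDGMod) (Interval.sgn K) 0 := rfl
  rw [h, TensorProduct.map_zero_left, LinearMap.zero_comp, LinearMap.zero_apply]

theorem convIntervalQ_one (z : (V.carrier →ₗ[K] A.carrier) ⊗[K] Interval K) :
    convIntervalQ α V A 1 (PiTensorProduct.tprod K fun _ => z) =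
      TensorProduct.map (convD V A) LinearMap.id z +
        TensorProduct.map (homPar V.toDGMod A.toDGMod 0 - homPar V.toDGMod A.toDGMod 1)
          (Interval.cochainD K) z := by
  have h : convIntervalQ α V A 1 =
      (TensorProduct.map ((convD V A ∘ₗ (PiTensorProduct.subsingletonEquiv (R := K)
          (s := fun _ : Fin 1 => (V.carrier →ₗ[K] A.carrier)) 0).toLinearMap) ∘ₗ
        (PiTensorProduct.subsingletonEquiv (R := K)
          (s := fun _ : Fin 1 => (V.carrier →ₗ[K] A.carrier)) 0).symm.toLinearMap) LinearMap.id +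
        TensorProduct.map (homPar V.toDGMod A.toDGMod 0 - homPar V.toDGMod A.toDGMod 1)
          (Interval.cochainD K)) ∘ₗ
      (PiTensorProduct.subsingletonEquiv (R := K)
        (s := fun _ : Fin 1 => (V.carrier →ₗ[K] A.carrier) ⊗[K] Interval K) 0).toLinearMap := rfl
  have h' : (convD V A ∘ₗ (PiTensorProduct.subsingletonEquiv (R := K)
          (s := fun _ : Fin 1 => (V.carrier →ₗ[K] A.carrier)) 0).toLinearMap) ∘ₗ
        (PiTensorProduct.subsingletonEquiv (R := K)
          (s := fun _ : Fin 1 => (V.carrier →ₗ[K] A.carrier)) 0).symm.toLinearMap = convD V A :=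
    LinearMap.ext fun f => congrArg (convD V A) (LinearEquiv.apply_symm_apply _ f)
  rw [h, h', LinearMap.comp_apply, LinearEquiv.coe_coe, PiTensorProduct.subsingletonEquiv_apply_tprod]
  rfl

theorem convIntervalQ_of_two_le {n : ℕ} (hn : 2 ≤ n) :
    convIntervalQ α V A n = TensorProduct.map (convQ α V A n) (Interval.cup K n) ∘ₗ
      kunzip (homPar V.toDGMod A.toDGMod) (Interval.sgn K) n := by
  obtain ⟨m, rfl⟩ : ∃ m, n = m + 2 := ⟨n - 2, by omega⟩
  rfl

theorem homTensor_convIntervalQ_one {z : (V.carrier →ₗ[K] A.carrier) ⊗[K] Interval K}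
    (hz : z ∈ tensorGr (homGr V.toDGMod A.toDGMod) (Interval.cochainGr K) 0) (a : V.carrier) :
    homTensor V.sgn (convIntervalQ α V A 1 (PiTensorProduct.tprod K fun _ => z)) a =
      tensorD (intervalAlg K) A.sgn A.d (homTensor V.sgn z a) - homTensor V.sgn z (V.d a) := by
  rw [convIntervalQ_one, homTensor_differential hz]

theorem homTensor_convIntervalQ {z : (V.carrier →ₗ[K] A.carrier) ⊗[K] Interval K}
    (hz : z ∈ tensorGr (homGr V.toDGMod A.toDGMod) (Interval.cochainGr K) 0) {n : ℕ} (hn : 2 ≤ n)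
    (a : V.carrier) :
    homTensor V.sgn (convIntervalQ α V A n (PiTensorProduct.tprod K fun _ => z)) a =
      pathOperation A n (TensorProduct.map (α.toFun n)
        (PiTensorProduct.map fun _ => homTensor V.sgn z) (V.comul n a)) := by
  rw [convIntervalQ_of_two_le hn, LinearMap.comp_apply, homTensor_operation hn fun _ => hz]

theorem sum_convIntervalQ {z : (V.carrier →ₗ[K] A.carrier) ⊗[K] Interval K}
    (hz : z ∈ tensorGr (homGr V.toDGMod A.toDGMod) (Interval.cochainGr K) 0) {k n : ℕ}
    {a : V.carrier} (ha : a ∈ V.toData.coradical k) (hn : k + 2 ≤ n) :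
    ∑ l ∈ Finset.range n, homTensor V.sgn
      (convIntervalQ α V A l (PiTensorProduct.tprod K fun _ => z)) a =
      curv α V.toData (pathObject A) (homTensor V.sgn z) a :=
  sum_operations_eq_curv (α := α) (B := pathObject A) (ψ := homTensor V.sgn z)
    (q := fun l => homTensor V.sgn (convIntervalQ α V A l (PiTensorProduct.tprod K fun _ => z)) a)
    ha hn
    (by
      have h : homTensor V.sgn (convIntervalQ α V A 0 (PiTensorProduct.tprod K fun _ => z)) a = 0 := by
        rw [convIntervalQ_zero, map_zero, LinearMap.zero_apply]
      exact h)
    (homTensor_convIntervalQ_one hz a)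
    fun l hl => (homTensor_convIntervalQ hz hl a).trans (pathObject_γ_of l _).symm

/-- The argument for `isMC_conv_iff`, with the path object as target and values read through
`homTensor`. -/
theorem isMC_interval_iff {z : (V.carrier →ₗ[K] A.carrier) ⊗[K] Interval K} :
    (conv α V A).interval.IsMC z ↔ IsTwisting α V.toData (pathObject A) (homTensor V.sgn z) := by
  have h0 : LinearMap.range (TensorProduct.map (convF V A 0).subtype
      (LinearMap.id : Interval K →ₗ[K] Interval K)) = ⊤ :=
    eq_top_iff.mpr fun y _ => (mem_range_map_subtype (convF V A 0) y).mpr fun _ => Submodule.mem_top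
  have key : z ∈ tensorGr (homGr V.toDGMod A.toDGMod) (Interval.cochainGr K) 0 →
      ((∀ k : ℕ, ∃ N : ℕ, ∀ n ≥ N, ∑ l ∈ Finset.range n,
        convIntervalQ α V A l (PiTensorProduct.tprod K fun _ => z) ∈
          LinearMap.range (TensorProduct.map (convF V A k).subtype
            (LinearMap.id : Interval K →ₗ[K] Interval K))) ↔
        curv α V.toData (pathObject A) (homTensor V.sgn z) = 0) := by
    intro hz
    refine forall_filtration_iff (W := V.toData) (θ := fun y a => homTensor V.sgn y a) h0
      homTensor_filtration ?_
    intro k n a ha hn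
    have h : homTensor V.sgn (∑ l ∈ Finset.range n,
        convIntervalQ α V A l (PiTensorProduct.tprod K fun _ => z)) a =
        ∑ l ∈ Finset.range n, homTensor V.sgn
          (convIntervalQ α V A l (PiTensorProduct.tprod K fun _ => z)) a := by
      rw [map_sum]
      exact LinearMap.sum_apply _ _ _
    exact h.trans (sum_convIntervalQ hz ha hn)
  constructor
  · exact fun h => ⟨homTensor_mem_iff.mp h.1, (key h.1).mp h.2⟩
  · exact fun h => ⟨homTensor_mem_iff.mpr h.degree, (key (homTensor_mem_iff.mpr h.degree)).mpr
      h.curv_eq_zero⟩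

theorem exists_interval_MC_iff_pathRel (φ φ' : V.carrier →ₗ[K] A.carrier) :
    (∃ c : (conv α V A).interval.MC, evalAt (V.carrier →ₗ[K] A.carrier) Simp.v0 c.1 = φ ∧
      evalAt (V.carrier →ₗ[K] A.carrier) Simp.v1 c.1 = φ') ↔
      PathRel α V.toData A.toData A.sgn φ φ' := by
  have hev : ∀ (z : (V.carrier →ₗ[K] A.carrier) ⊗[K] Interval K) (σ : Simp), σ ≠ .edge → ∀ a,
      coord A.carrier σ (homTensor V.sgn z a) = coord (V.carrier →ₗ[K] A.carrier) σ z a := by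
    intro z σ hσ a
    rw [coord_homTensor]
    cases σ
    · simp [Simp.dim]
    · simp [Simp.dim]
    · exact absurd rfl hσ
  constructor
  · rintro ⟨⟨z, hz⟩, rfl, rfl⟩
    exact ⟨homTensor V.sgn z, isTwisting_pathObject.mp (isMC_interval_iff.mp hz),
      hev z .v0 (by simp), hev z .v1 (by simp)⟩
  · rintro ⟨ψ, hψ, h0, h1⟩
    -- Any preimage will do, since the Maurer-Cartan condition and the vertices of `z` are expressed
    -- through its image.
    obtain ⟨z, hz⟩ := homTensor_surjective (Y := A.carrier) V.isGraded.involutive ψ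
    refine ⟨⟨z, isMC_interval_iff.mpr (isTwisting_pathObject.mpr (hz.symm ▸ hψ))⟩,
      LinearMap.ext fun a => ?_, LinearMap.ext fun a => ?_⟩
    · exact (hev z .v0 (by simp) a).symm.trans
        ((congrArg (fun f => coord A.carrier Simp.v0 (f a)) hz).trans (h0 a))
    · exact (hev z .v1 (by simp) a).symm.trans
        ((congrArg (fun f => coord A.carrier Simp.v1 (f a)) hz).trans (h1 a))

/-- The generated equivalence relation collapses to a single step because horn filling makes
`PathRel` an equivalence relation on twisting maps. -/
theorem gaugeEquiv_iff_pathRel (φ φ' : (conv α V A).MC) :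
    (conv α V A).GaugeEquiv φ φ' ↔ PathRel α V.toData A.toData A.sgn φ.1 φ'.1 := by
  constructor
  · intro h
    induction h with
    | rel φ φ' h => exact (exists_interval_MC_iff_pathRel _ _).mp h
    | refl φ => exact pathRel_refl (isMC_conv_iff.mp φ.2)
    | symm φ φ' _ h => exact h.symm V.isCoalg A.isAlg (isMC_conv_iff.mp φ.2)
    | trans φ φ' φ'' _ _ h h' => exact h.trans V.isCoalg A.isAlg (isMC_conv_iff.mp φ.2) h'
  · exact fun h => Relation.EqvGen.rel _ _ ((exists_interval_MC_iff_pathRel _ _).mpr h)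

variable (α V A) in
/-- Maurer-Cartan elements of the convolution algebra are twisting elements. -/
def mcEquiv : (conv α V A).MC ≃ {φ : V.carrier →ₗ[K] A.carrier // IsTwisting α V.toData A.toData φ} :=
  Equiv.subtypeEquivRight fun _ => isMC_conv_iff

end IntervalMC

end NSConv

end

theorem mainTheorem5 {K : Type*} [Field K] {C : NSCooperad K} {P : NSOperad K}
    (α : TwistingMorphism C P) (V : NSCoalg C) (A : NSAlg P) :
    ∃ (Φ : NSCoalgHom V.toData (bar α A) ≃ (conv α V A).MC)
      (Ψ : (conv α V A).MC ≃ NSAlgHom (cobar α V) A.toData),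
      (∀ f : NSCoalgHom V.toData (bar α A), (Φ f).1 = counitProj C.obj C.ε ∘ₗ f.toLin) ∧
      (∀ g : NSAlgHom (cobar α V) A.toData, (Ψ.symm g).1 = g.toLin ∘ₗ generator P) ∧
      (∀ f g : NSCoalgHom V.toData (bar α A),
        f.Homotopic g ↔ (conv α V A).GaugeEquiv (Φ f) (Φ g)) ∧
      (∀ f g : NSAlgHom (cobar α V) A.toData,
        f.Homotopic g ↔ (conv α V A).GaugeEquiv (Ψ.symm f) (Ψ.symm g)) := by
  refine ⟨(barHomEquiv (α := α) V.isCoalg A).trans (mcEquiv α V A).symm,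
    (mcEquiv α V A).trans (cobarHomEquiv (α := α) A.isAlg V).symm, fun _ => rfl, fun _ => rfl,
    fun f g => ?_, fun f g => ?_⟩
  · exact (NSCoalgHom.homotopic_iff_pathRel f g).trans
      (gaugeEquiv_iff_pathRel (α := α) (V := V) (A := A)
        ((mcEquiv α V A).symm (barHomEquiv (α := α) V.isCoalg A f))
        ((mcEquiv α V A).symm (barHomEquiv (α := α) V.isCoalg A g))).symm
  · exact (NSAlgHom.homotopic_iff_pathRel f g).trans
      (gaugeEquiv_iff_pathRel (α := α) (V := V) (A := A)
        ((mcEquiv α V A).symm (cobarHomEquiv (α := α) A.isAlg V f))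
        ((mcEquiv α V A).symm (cobarHomEquiv (α := α) A.isAlg V g))).symm
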